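/- **Setting.** A labelled pushdown system (PDS) $\mathcal P=(P,\Gamma,\Delta,\sharp)$ has a finite set $P$ of control locations, a finite stack alphabet $\Gamma$, a bottom symbol $\sharp\notin\Gamma$ that occurs in no rule, and a finite set $\Delta$ of rules $\langle p,\gamma\rangle\xrightarrow{call}\langle q,\gamma_1\gamma_2\rangle$, $\langle p,\gamma\rangle\xrightarrow{ret}\langle q,\varepsilon\rangle$, $\langle p,\gamma\rangle\xrightarrow{int}\langle q,w\rangle$ with $w\in\Gamma^*$. A configuration is a pair $\langle p,\omega\rangle\in P\times\Gamma^*$; a rule $\langle p,\gamma\rangle\xrightarrow{t}\langle q,w\rangle$ gives the transitions $\langle p,\gamma\omega'\rangle\Rightarrow\langle q,w\omega'\rangle$. A run is an infinite sequence of configurations $c_0c_1c_2\dots$ with $c_i\Rightarrow c_{i+1}$, together with the kinds ($call$, $ret$, $int$) of the rules applied. On a run, the global-successor of $c_i$ is $c_{i+1}$. The abstract-successor of $c_i$ is $c_{i+1}$ if step $i$ is an $int$; it is $\bot$ if step $i$ is a $ret$; and if step $i$ is a $call$, from stack $\gamma\omega'$ to $\gamma_1\gamma_2\omega'$, it is the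 corresponding return-point, i.e. the first later configuration whose stack is again $\gamma_2\omega'$, provided that it exists and is reached by a $ret$ step, and $\bot$ otherwise. The global- and abstract-successors of a configuration $c$ are those of $c$ on the runs that start from $c$. A global-path (abstract-path) from $c$ is an infinite sequence that starts with $c$ in which each element is a global-successor (abstract-successor) of the one before it, where $\bot$ is followed by $\bot$ only. BCARET formulas over a finite set $AP$ are $$\varphi::=true\mid false\mid e\mid\neg e\mid\varphi\vee\varphi\mid\varphi\wedge\varphi\mid EX^b\varphi\mid AX^b\varphi\mid E[\varphi U^b\varphi]\mid A[\varphi U^b\varphi]\mid E[\varphi R^b\varphi]\mid A[\varphi R^b\varphi]$$ with $e\in AP$, $b\in\{g,a\}$. For $\lambda:AP\to2^{P\times\Gamma^*}$, the relation $c\vDash_\lambda\varphi$ is the usual CTL semantics, with $c\vDash_\lambda e$ iff $c\in\lambda(e)$, with $EX^b,AX^b$ ranging over global-successors ($b=g$) or abstract-successors ($b=a$), and with the quantifiers before $U^b$ and $R^b$ ranging over global-paths or abstract-paths from $c$; $\bot$ satisfies no formula. Here $\pi_0\pi_1\dots$ satisfies $\varphi_1U\varphi_2$ iff some $\pi_i\vDash_\lambda\varphi_2$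 with $\pi_j\vDash_\lambda\varphi_1$ for all $j<i$, and $\varphi_1R\varphi_2$ iff for every $i$ with $\pi_i\nvDash_\lambda\varphi_2$ there is $j<i$ with $\pi_j\vDash_\lambda\varphi_1$. A multi-automaton has a finite state set $Q\supseteq P$, a transition set $\delta\subseteq Q\times\Gamma\times Q$ and final states $F\subseteq Q$; it recognizes $\langle p,\omega\rangle$ iff some path from $p$ labelled $\omega$ ends in $F$. A set of configurations is regular iff it is the set of configurations recognized by a multi-automaton, and $\lambda$ is regular iff every $\lambda(e)$ is. For regular $\lambda$ there are multi-automata $M_e$ recognizing $\lambda(e)$ and $M_{\neg e}$ recognizing $(P\times\Gamma^*)\setminus\lambda(e)$. **Theorem.** There is an algorithm that, given a PDS $\mathcal P$, a regular labelling function $\lambda$, a BCARET formula $\varphi$ and a configuration $\langle p,\omega\rangle$, decides whether $\langle p,\omega\rangle\vDash_\lambda\varphi$ in time $$O\Big((|P||\varphi|+k)^2\,|\Gamma|\,|\varphi|\,\big((|P||\Gamma||\Delta||\varphi|+d)\cdot2^{5(|P||\varphi|+k)}+2^{|P||\varphi|+k}\,|\omega|\big)\Big),$$ with an absolute constant. Here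 $\lambda$ is given by arbitrary such automata $M_e=(Q_e,\delta_e,F_e)$ for the $e$ that occur as subformulas of $\varphi$ ($e\in AP^+$) and $M_{\neg e}=(Q_{\neg e},\delta_{\neg e},F_{\neg e})$ for the $e$ such that $\neg e$ is a subformula of $\varphi$ ($e\in AP^-$), and $$k=\sum_{e\in AP^+}|Q_e|+\sum_{e\in AP^-}|Q_{\neg e}|,\qquad d=\sum_{e\in AP^+}|\delta_e|+\sum_{e\in AP^-}|\delta_{\neg e}|.$$ Further, $|\varphi|$ is the number of operators, constants and literals in $\varphi$, $|\omega|$ is the length of $\omega$, and $|\Delta|$ is the size of $\Delta$: each rule with right-hand side $\langle q,w\rangle$ counts $1+|w|$. (If all $|w|\le2$, this is at most three times the number of rules.) In the bound, $|\Gamma|$ and $|\Delta|$ are replaced by $1$ if they are $0$. Time is the number of steps of a random access machine with addition and subtraction, under the unit-cost measure, on a list of natural numbers that writes out the input in the standard way. -/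

import Mathlib

namespace BCARET

/-! ### Labelled pushdown systems -/

/-- Rules of a labelled pushdown system with control locations `P` and stack alphabet `Γ`:
`⟨p, γ⟩ -call→ ⟨q, γ₁ γ₂⟩`, `⟨p, γ⟩ -ret→ ⟨q, ε⟩` and `⟨p, γ⟩ -int→ ⟨q, w⟩`. -/
inductive Rule (P Γ : Type) where
  | call (p : P) (γ : Γ) (q : P) (γ₁ γ₂ : Γ) : Rule P Γ
  | ret (p : P) (γ : Γ) (q : P) : Rule P Γ
  | int (p : P) (γ : Γ) (q : P) (w : List Γ) : Rule P Γ

/-- The size of a rule: one plus the length of the word that it writes on the stack. -/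
def Rule.size {P Γ : Type} : Rule P Γ → ℕ
  | .call _ _ _ _ _ => 3
  | .ret _ _ _ => 1
  | .int _ _ _ w => 1 + w.length

/-- A labelled pushdown system. The bottom symbol `♯ ∉ Γ` lies under every stack content and
occurs in no rule; so it is not written, and a configuration with stack content `ε` has no
successor. -/
structure PDS (P Γ : Type) where
  Δ : Finset (Rule P Γ)

/-- The size of the set of rules. -/
def PDS.size {P Γ : Type} (S : PDS P Γ) : ℕ := ∑ r ∈ S.Δ, r.size

/-- Configurations: a control location and a stack content, top of the stack first. -/
abbrev Conf (P Γ : Type) : Type := P × List Γ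

/-- The three kinds of statements. -/
inductive Act where
  | call
  | ret
  | int

/-- The transition relation, labelled with the kind of the rule that is applied. -/
inductive PDS.Step {P Γ : Type} (S : PDS P Γ) : Act → Conf P Γ → Conf P Γ → Prop
  | call {p γ q γ₁ γ₂} (w : List Γ) (h : Rule.call p γ q γ₁ γ₂ ∈ S.Δ) :
      S.Step .call (p, γ :: w) (q, γ₁ :: γ₂ :: w)
  | ret {p γ q} (w : List Γ) (h : Rule.ret p γ q ∈ S.Δ) :
      S.Step .ret (p, γ :: w) (q, w)
  | int {p γ q u} (w : List Γ) (h : Rule.int p γ q u ∈ S.Δ) :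
      S.Step .int (p, γ :: w) (q, u ++ w)

/-- A run: an infinite sequence of configurations, each an immediate successor of the one
before it, together with the kinds of the rules that are applied. -/
structure PDS.Run {P Γ : Type} (S : PDS P Γ) where
  conf : ℕ → Conf P Γ
  act : ℕ → Act
  step : ∀ i, S.Step (act i) (conf i) (conf (i + 1))

/-- The runs that start from `c`. -/
def PDS.Traces {P Γ : Type} (S : PDS P Γ) (c : Conf P Γ) : Set S.Run :=
  {π | π.conf 0 = c}

/-- Position `k` of the run is the corresponding return-point of the call made at position `i`.
The call replaces a stack content `γ w` by `γ₁ γ₂ w`; position `k` is the first one after it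
at which the stack content is `γ₂ w` again (that is, the first one at which the stack is as high
as at position `i`), and it is reached by a return statement. -/
def PDS.Run.IsReturnPoint {P Γ : Type} {S : PDS P Γ} (π : S.Run) (i k : ℕ) : Prop :=
  ∃ j, k = j + 1 ∧ i < j ∧ π.act j = .ret ∧
    (π.conf k).2.length = (π.conf i).2.length ∧
    ∀ l, i < l → l ≤ j → (π.conf i).2.length < (π.conf l).2.length

/-- The abstract-successor of position `i` on a run; `none` stands for `⊥`. -/
inductive PDS.Run.AbsSucc {P Γ : Type} {S : PDS P Γ} (π : S.Run) (i : ℕ) :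
    Option (Conf P Γ) → Prop
  | returns {k : ℕ} (h : π.act i = .call) (hk : π.IsReturnPoint i k) :
      π.AbsSucc i (some (π.conf k))
  | never (h : π.act i = .call) (hk : ¬ ∃ k, π.IsReturnPoint i k) : π.AbsSucc i none
  | int (h : π.act i = .int) : π.AbsSucc i (some (π.conf (i + 1)))
  | ret (h : π.act i = .ret) : π.AbsSucc i none

/-- The two modes of the temporal operators: global `g` and abstract `a`. -/
inductive Mode where
  | g
  | a

/-- Global and abstract successors of a configuration: those over some run that starts from
it. -/
def PDS.Succ {P Γ : Type} (S : PDS P Γ) : Mode → Conf P Γ → Option (Conf P Γ) → Prop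
  | .g, c, o => ∃ π ∈ S.Traces c, o = some (π.conf 1)
  | .a, c, o => ∃ π ∈ S.Traces c, π.AbsSucc 0 o

/-- Global-paths and abstract-paths from a configuration. An abstract-path that reaches `⊥`
stays there. -/
def PDS.IsPath {P Γ : Type} (S : PDS P Γ) (b : Mode) (c : Conf P Γ)
    (π : ℕ → Option (Conf P Γ)) : Prop :=
  π 0 = some c ∧
    ∀ i, (∃ d, π i = some d ∧ S.Succ b d (π (i + 1))) ∨ (π i = none ∧ π (i + 1) = none)

/-! ### The logic -/

/-- Formulas, in positive normal form. -/
inductive Formula (AP : Type) where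
  | tt : Formula AP
  | ff : Formula AP
  | atom (e : AP) : Formula AP
  | natom (e : AP) : Formula AP
  | or (φ ψ : Formula AP) : Formula AP
  | and (φ ψ : Formula AP) : Formula AP
  | EX (b : Mode) (φ : Formula AP) : Formula AP
  | AX (b : Mode) (φ : Formula AP) : Formula AP
  | EU (b : Mode) (φ ψ : Formula AP) : Formula AP
  | AU (b : Mode) (φ ψ : Formula AP) : Formula AP
  | ER (b : Mode) (φ ψ : Formula AP) : Formula AP
  | AR (b : Mode) (φ ψ : Formula AP) : Formula AP

namespace Formula

variable {AP : Type}

/-- The size of a formula: the number of operators, constants and literals in it. -/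
def size : Formula AP → ℕ
  | tt | ff | atom _ | natom _ => 1
  | EX _ φ | AX _ φ => φ.size + 1
  | or φ ψ | and φ ψ | EU _ φ ψ | AU _ φ ψ | ER _ φ ψ | AR _ φ ψ => φ.size + ψ.size + 1

/-- The closure: the set of all subformulas. -/
def cl : Formula AP → Set (Formula AP)
  | tt => {tt}
  | ff => {ff}
  | atom e => {atom e}
  | natom e => {natom e}
  | or φ ψ => insert (or φ ψ) (φ.cl ∪ ψ.cl)
  | and φ ψ => insert (and φ ψ) (φ.cl ∪ ψ.cl)
  | EX b φ => insert (EX b φ) φ.cl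
  | AX b φ => insert (AX b φ) φ.cl
  | EU b φ ψ => insert (EU b φ ψ) (φ.cl ∪ ψ.cl)
  | AU b φ ψ => insert (AU b φ ψ) (φ.cl ∪ ψ.cl)
  | ER b φ ψ => insert (ER b φ ψ) (φ.cl ∪ ψ.cl)
  | AR b φ ψ => insert (AR b φ ψ) (φ.cl ∪ ψ.cl)

open Classical in
/-- The atomic propositions that occur positively. -/
noncomputable def posAtoms [Fintype AP] (φ : Formula AP) : Finset AP :=
  Finset.univ.filter fun e => atom e ∈ φ.cl

open Classical in
/-- The atomic propositions that occur negated. -/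
noncomputable def negAtoms [Fintype AP] (φ : Formula AP) : Finset AP :=
  Finset.univ.filter fun e => natom e ∈ φ.cl

end Formula

/-- Extends a property of configurations to `⊥`, where no property holds. -/
def Holds {P Γ : Type} (A : Conf P Γ → Prop) : Option (Conf P Γ) → Prop
  | none => False
  | some c => A c

/-- `A₁ U A₂` along a path. -/
def UntilOn {P Γ : Type} (A₁ A₂ : Conf P Γ → Prop) (π : ℕ → Option (Conf P Γ)) : Prop :=
  ∃ i, Holds A₂ (π i) ∧ ∀ j < i, Holds A₁ (π j)

/-- `A₁ R A₂` along a path. -/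
def ReleaseOn {P Γ : Type} (A₁ A₂ : Conf P Γ → Prop) (π : ℕ → Option (Conf P Γ)) : Prop :=
  ∀ i, ¬ Holds A₂ (π i) → ∃ j < i, Holds A₁ (π j)

/-- `S.Sat lab φ c`: the configuration `c` satisfies `φ` with respect to the labelling function
`lab`. -/
def PDS.Sat {P Γ AP : Type} (S : PDS P Γ) (lab : AP → Set (Conf P Γ)) :
    Formula AP → Conf P Γ → Prop
  | .tt, _ => True
  | .ff, _ => False
  | .atom e, c => c ∈ lab e
  | .natom e, c => c ∉ lab e
  | .or φ ψ, c => S.Sat lab φ c ∨ S.Sat lab ψ c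
  | .and φ ψ, c => S.Sat lab φ c ∧ S.Sat lab ψ c
  | .EX b φ, c => ∃ o, S.Succ b c o ∧ Holds (S.Sat lab φ) o
  | .AX b φ, c => ∀ o, S.Succ b c o → Holds (S.Sat lab φ) o
  | .EU b φ ψ, c => ∃ π, S.IsPath b c π ∧ UntilOn (S.Sat lab φ) (S.Sat lab ψ) π
  | .AU b φ ψ, c => ∀ π, S.IsPath b c π → UntilOn (S.Sat lab φ) (S.Sat lab ψ) π
  | .ER b φ ψ, c => ∃ π, S.IsPath b c π ∧ ReleaseOn (S.Sat lab φ) (S.Sat lab ψ) π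
  | .AR b φ ψ, c => ∀ π, S.IsPath b c π → ReleaseOn (S.Sat lab φ) (S.Sat lab ψ) π

/-! ### Multi-automata and regular sets of configurations -/

/-- A multi-automaton, with state set `{0, …, states - 1}`. The control locations are its
initial states; `init` is the inclusion of `P` into the state set. -/
structure MultiAutomaton (P Γ : Type) where
  states : ℕ
  δ : Finset (Fin states × Γ × Fin states)
  init : P ↪ Fin states
  final : Finset (Fin states)

/-- The transition relation extended to words. -/
inductive MultiAutomaton.Reach {P Γ : Type} (A : MultiAutomaton P Γ) :
    Fin A.states → List Γ → Fin A.states → Prop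
  | nil (q) : A.Reach q [] q
  | cons {q q' q'' γ w} (h : (q, γ, q') ∈ A.δ) (h' : A.Reach q' w q'') : A.Reach q (γ :: w) q''

/-- The set of configurations that a multi-automaton recognizes. -/
def MultiAutomaton.language {P Γ : Type} (A : MultiAutomaton P Γ) : Set (Conf P Γ) :=
  {c | ∃ q ∈ A.final, A.Reach (A.init c.1) c.2 q}

/-- Regular sets of configurations. -/
def IsRegularSet {P Γ : Type} (L : Set (Conf P Γ)) : Prop :=
  ∃ A : MultiAutomaton P Γ, A.language = L

/-! ### Random access machines

The machine has registers and a memory, whose cells hold natural numbers. Its programs are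
finite, built from the usual instructions of a random access machine with addition and
subtraction by sequencing, branching and loops. Every instruction and every test takes one
unit of time. -/

/-- Programs; `i`, `j`, `k` are names of registers and `n` is a constant. -/
inductive Prog where
  | const (i n : ℕ) : Prog
  | add (i j k : ℕ) : Prog
  | sub (i j k : ℕ) : Prog
  | load (i j : ℕ) : Prog
  | store (i j : ℕ) : Prog
  | seq (p q : Prog) : Prog
  | branch (i : ℕ) (p q : Prog) : Prog
  | loop (i : ℕ) (p : Prog) : Prog

/-- The contents of the registers and of the memory. -/
structure State where
  reg : ℕ → ℕ
  mem : ℕ → ℕ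

/-- Write `v` into register `i`. -/
def State.set (s : State) (i v : ℕ) : State := ⟨Function.update s.reg i v, s.mem⟩

/-- `Exec p s t s'`: the program `p`, started in `s`, halts in `s'` after `t` units of time. -/
inductive Exec : Prog → State → ℕ → State → Prop
  | const (s i n) : Exec (.const i n) s 1 (s.set i n)
  | add (s i j k) : Exec (.add i j k) s 1 (s.set i (s.reg j + s.reg k))
  | sub (s i j k) : Exec (.sub i j k) s 1 (s.set i (s.reg j - s.reg k))
  | load (s i j) : Exec (.load i j) s 1 (s.set i (s.mem (s.reg j)))
  | store (s i j) :
      Exec (.store i j) s 1 ⟨s.reg, Function.update s.mem (s.reg i) (s.reg j)⟩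
  | seq {p q s s' s'' t t'} (h : Exec p s t s') (h' : Exec q s' t' s'') :
      Exec (.seq p q) s (t + t') s''
  | branchTrue {i p q s s' t} (hi : s.reg i ≠ 0) (h : Exec p s t s') :
      Exec (.branch i p q) s (t + 1) s'
  | branchFalse {i p q s s' t} (hi : s.reg i = 0) (h : Exec q s t s') :
      Exec (.branch i p q) s (t + 1) s'
  | loopTrue {i p s s' s'' t t'} (hi : s.reg i ≠ 0) (h : Exec p s t s')
      (h' : Exec (.loop i p) s' t' s'') : Exec (.loop i p) s (t + t' + 1) s''
  | loopFalse {i p s} (hi : s.reg i = 0) : Exec (.loop i p) s 1 s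

/-- The state at the start: the input is in the memory cells `0, 1, 2, …`, its length is in
register `0`, and everything else is `0`. -/
def State.start (x : List ℕ) : State :=
  ⟨fun i => if i = 0 then x.length else 0, fun i => x.getD i 0⟩

/-- On input `x` the program `p` halts within time `T`, and register `0` then holds `1` if `A`
is true and `0` if `A` is false. -/
def Prog.AnswersWithin (p : Prog) (x : List ℕ) (A : Prop) (T : ℕ) : Prop :=
  ∃ t s, Exec p (State.start x) t s ∧ t ≤ T ∧
    (A → s.reg 0 = 1) ∧ (¬ A → s.reg 0 = 0)

/-! ### Inputs

A finite set is written as the list of its elements, in any order, with its length in front. -/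

/-- The list `l` lists the elements of `s`, each of them once. -/
def Enumerates {α : Type} (l : List α) (s : Finset α) : Prop :=
  l.Nodup ∧ ∀ a, a ∈ l ↔ a ∈ s

section Encoding

variable {nP nΓ nA : ℕ}

/-- A word, after its length. -/
def encodeWord (w : List (Fin nΓ)) : List ℕ := w.length :: w.map Fin.val

def encodeRule : Rule (Fin nP) (Fin nΓ) → List ℕ
  | .call p γ q γ₁ γ₂ => [0, p, γ, q, γ₁, γ₂]
  | .ret p γ q => [1, p, γ, q]
  | .int p γ q w => [2, (p : ℕ), (γ : ℕ), (q : ℕ)] ++ encodeWord w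

def encodeMode : Mode → ℕ
  | .g => 0
  | .a => 1

/-- Formulas are written in prefix notation. -/
def encodeFormula : Formula (Fin nA) → List ℕ
  | .tt => [0]
  | .ff => [1]
  | .atom e => [2, e]
  | .natom e => [3, e]
  | .or φ ψ => [4] ++ encodeFormula φ ++ encodeFormula ψ
  | .and φ ψ => [5] ++ encodeFormula φ ++ encodeFormula ψ
  | .EX b φ => [6, encodeMode b] ++ encodeFormula φ
  | .AX b φ => [7, encodeMode b] ++ encodeFormula φ
  | .EU b φ ψ => [8, encodeMode b] ++ encodeFormula φ ++ encodeFormula ψ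
  | .AU b φ ψ => [9, encodeMode b] ++ encodeFormula φ ++ encodeFormula ψ
  | .ER b φ ψ => [10, encodeMode b] ++ encodeFormula φ ++ encodeFormula ψ
  | .AR b φ ψ => [11, encodeMode b] ++ encodeFormula φ ++ encodeFormula ψ

/-- A multi-automaton whose transitions are listed by `l`: the number of states, the initial
state of each control location, for each state whether it is final, and the transitions. -/
def encodeAutomaton (A : MultiAutomaton (Fin nP) (Fin nΓ))
    (l : List (Fin A.states × Fin nΓ × Fin A.states)) : List ℕ :=
  [A.states] ++ List.ofFn (fun p => (A.init p : ℕ)) ++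
    List.ofFn (fun q => if q ∈ A.final then 1 else 0) ++
    [l.length] ++ l.flatMap (fun τ => [(τ.1 : ℕ), (τ.2.1 : ℕ), (τ.2.2 : ℕ)])

/-- `x` is an input that presents the pushdown system `S`, the formula `φ`, the automata `M e`
for the propositions `e` that occur positively in `φ`, the automata `M' e` for those that occur
negated, and the configuration `c`. -/
def IsInput (S : PDS (Fin nP) (Fin nΓ)) (φ : Formula (Fin nA))
    (M M' : Fin nA → MultiAutomaton (Fin nP) (Fin nΓ)) (c : Conf (Fin nP) (Fin nΓ))
    (x : List ℕ) : Prop :=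
  ∃ (rules : List (Rule (Fin nP) (Fin nΓ))) (pos neg : List (Fin nA))
    (l : ∀ e, List (Fin (M e).states × Fin nΓ × Fin (M e).states))
    (l' : ∀ e, List (Fin (M' e).states × Fin nΓ × Fin (M' e).states)),
    Enumerates rules S.Δ ∧ Enumerates pos φ.posAtoms ∧ Enumerates neg φ.negAtoms ∧
    (∀ e, Enumerates (l e) (M e).δ) ∧ (∀ e, Enumerates (l' e) (M' e).δ) ∧
    x = [nP, nΓ] ++
      [rules.length] ++ rules.flatMap encodeRule ++
      encodeFormula φ ++
      [pos.length] ++ pos.flatMap (fun e => [e.val] ++ encodeAutomaton (M e) (l e)) ++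
      [neg.length] ++ neg.flatMap (fun e => [e.val] ++ encodeAutomaton (M' e) (l' e)) ++
      [(c.1 : ℕ)] ++ encodeWord c.2

end Encoding

/-! ### The time bound -/

/-- The total number of states of the automata that are used for `φ`. -/
noncomputable def totalStates {P Γ AP : Type} [Fintype AP] (φ : Formula AP)
    (M M' : AP → MultiAutomaton P Γ) : ℕ :=
  ∑ e ∈ φ.posAtoms, (M e).states + ∑ e ∈ φ.negAtoms, (M' e).states

/-- The total number of transitions of the automata that are used for `φ`. -/
noncomputable def totalTransitions {P Γ AP : Type} [Fintype AP] (φ : Formula AP)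
    (M M' : AP → MultiAutomaton P Γ) : ℕ :=
  ∑ e ∈ φ.posAtoms, (M e).δ.card + ∑ e ∈ φ.negAtoms, (M' e).δ.card

/-- `(p f + k)² g f ((p g r f + d) 2 ^ (5 (p f + k)) + 2 ^ (p f + k) m)`, where `p`, `g`, `r`,
`f`, `m` are the sizes of the set of control locations, the stack alphabet, the set of rules, the
formula and the stack content, and `k` and `d` are the numbers of states and of transitions. -/
def timeBound (p g r f k d m : ℕ) : ℕ :=
  (p * f + k) ^ 2 * g * f *
    ((p * g * r * f + d) * 2 ^ (5 * (p * f + k)) + 2 ^ (p * f + k) * m)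

end BCARET

open BCARET

namespace BCARET

/-! The truth of a formula at ⟨p, γw⟩ depends on w only through finitely many bits. By
`PDS.succ_iff`, a successor of ⟨p, γw⟩ is ⊥ or has the form ⟨q, uw⟩, where q and u come from a
single rule and, for a call, from the relation that tells at which locations the called symbol can
be popped. Which candidates count depends only on whether a run starts there, and a call that never
comes down amounts to a run from ⟨q, γ₁⟩ over the empty stack. Let the type of w consist of the
pairs (subformula, location) that hold over w, of the locations from which a run starts over w, and
of the automaton states that accept w. Then the type of γw is a function of γ and of the type of w.
The algorithm computes this function as a table with 2^N columns, N = (|φ| + 1)|P| + k, with one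
more row for the type of the empty stack. The answer is found by folding the table over ω.

Every property is a least or a greatest fixed point of the one-step operator `PDS.Phi`
(`PDS.sem_step`, `PDS.sem_least`). Paths are infinite, so the expansion laws mention the existence
of a run; this is itself a greatest fixed point and is computed first. Then the subformulas follow,
operands before operators. For a greatest fixed point a digit that is set means failure, so every
stage only sets digits. Soundness (`StageInv.upd`) is kept by each digit that is set. Completeness
(`StageInv.done`) uses extremality: fix w with its correct type, interpret the configurations ⟨q,
uw⟩ by the stable table and all others by their true meaning; this interpretation (`Approx`) is
closed under the operator, and so it lies on the correct side of the truth. Many columns are the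
type of no stack content; nothing is claimed about them.

The popping relation is computed beforehand by the same kind of saturation (`PopSound.pop_iff`), as
a predicate transformer: a set of final locations, each with a mark telling whether a return came
last, is mapped to the locations from which γ can be consumed so as to end in it. Such transformers
compose along words, so right-hand sides of any length are evaluated by folding.

Every sweep over an unstable table sets a new digit (`Tab.count_setBit`, `Carries.fix`), so O(|Γ| N
2^N) sweeps suffice. A sweep visits O(|Γ| 2^N |P|) entries and spends O(|P||Δ|) on each, and this
happens for |φ| + 1 properties. With n = |P||φ| + k one has N ≤ 2n, so the work is exponential in 4n
only, within the allowed 5n (`totalCost_le`).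

The machine is programmed in a small command language with explicit state and cost functions, whose
compilation is exact in both respects (`Cmd.exec_compile`). Multiplication and operations on digits
are not available; powers of two, digits and row addresses are therefore tabulated in advance. That
regular labellings have automata for the complements is the subset construction
(`MultiAutomaton.language_compl`). -/

/-! ### A language of expressions and bounded loops -/

/-- Expressions over registers and memory. -/
inductive Expr where
  | reg (i : ℕ)
  | num (n : ℕ)
  | add (a b : Expr)
  | sub (a b : Expr)
  | mem (a : Expr)

namespace Expr

instance : Add Expr := ⟨add⟩
instance : Sub Expr := ⟨sub⟩
instance (n : ℕ) : OfNat Expr n := ⟨num n⟩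

/-- The value of an expression. -/
def eval (s : State) : Expr → ℕ
  | reg i => s.reg i
  | num n => n
  | add a b => a.eval s + b.eval s
  | sub a b => a.eval s - b.eval s
  | mem a => s.mem (a.eval s)

/-- The number of instructions that evaluate an expression. -/
def cost : Expr → ℕ
  | reg _ => 2
  | num _ => 1
  | add a b | sub a b => a.cost + (b.cost + 1)
  | mem a => a.cost + 1

/-- Evaluation into the hidden register `2 d + 1`; the register `i` is register `2 i` of the
machine. -/
def compile : Expr → ℕ → Prog
  -- There is no instruction that copies a register; a copy is an addition to zero.
  | reg i, d => .seq (.const (2 * d + 1) 0) (.add (2 * d + 1) (2 * i) (2 * d + 1))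
  | num n, d => .const (2 * d + 1) n
  | add a b, d => .seq (a.compile d)
      (.seq (b.compile (d + 1)) (.add (2 * d + 1) (2 * d + 1) (2 * (d + 1) + 1)))
  | sub a b, d => .seq (a.compile d)
      (.seq (b.compile (d + 1)) (.sub (2 * d + 1) (2 * d + 1) (2 * (d + 1) + 1)))
  | mem a, d => .seq (a.compile d) (.load (2 * d + 1) (2 * d + 1))

@[simp] theorem eval_reg (s : State) (i) : (reg i).eval s = s.reg i := rfl
@[simp] theorem eval_num (s : State) (n) : (num n).eval s = n := rfl
@[simp] theorem eval_ofNat (s : State) (n : ℕ) :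
    (no_index (OfNat.ofNat n : Expr)).eval s = OfNat.ofNat n := rfl
@[simp] theorem eval_zero (s : State) : (0 : Expr).eval s = 0 := rfl
@[simp] theorem eval_one (s : State) : (1 : Expr).eval s = 1 := rfl
@[simp] theorem eval_add (s : State) (a b : Expr) : (a + b).eval s = a.eval s + b.eval s := rfl
@[simp] theorem eval_sub (s : State) (a b : Expr) : (a - b).eval s = a.eval s - b.eval s := rfl
@[simp] theorem eval_mem (s : State) (a : Expr) : (mem a).eval s = s.mem (a.eval s) := rfl

end Expr

/-- The hidden registers below the `d`-th, the visible registers and the memory agree. -/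
structure Agree (d : ℕ) (σ σ' : State) : Prop where
  mem : σ'.mem = σ.mem
  vis : ∀ i, σ'.reg (2 * i) = σ.reg (2 * i)
  hid : ∀ j < d, σ'.reg (2 * j + 1) = σ.reg (2 * j + 1)

/-- A state of the machine shows the state `s` in its visible part. -/
structure Shows (σ s : State) : Prop where
  mem : σ.mem = s.mem
  reg : ∀ i, σ.reg (2 * i) = s.reg i

@[simp] theorem State.set_mem (s : State) (i v : ℕ) : (s.set i v).mem = s.mem := rfl

theorem State.set_reg (s : State) (i v j : ℕ) :
    (s.set i v).reg j = if j = i then v else s.reg j := by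
  simp [State.set, Function.update_apply]

/-- The value of the left operand waits in the hidden register of level `d` while the right operand
is evaluated at level `d + 1`. This is safe because an evaluation changes no hidden register of a
lower level. -/
theorem Expr.exec_compile (e : Expr) : ∀ (d : ℕ) (σ s : State), Shows σ s →
    ∃ σ', Exec (e.compile d) σ e.cost σ' ∧ Agree d σ σ' ∧ σ'.reg (2 * d + 1) = e.eval s := by
  induction e with
  | reg i =>
    intro d σ s h
    refine ⟨_, .seq (.const _ _ _) (.add _ _ _ _), ⟨rfl, fun j => ?_, fun j hj => ?_⟩, ?_⟩
    · simp only [State.set_reg]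
      rw [if_neg (by omega), if_neg (by omega)]
    · simp only [State.set_reg]
      rw [if_neg (by omega), if_neg (by omega)]
    · simp only [State.set_reg, if_true]
      rw [if_neg (by omega), h.reg]
      rfl
  | num n =>
    intro d σ s h
    refine ⟨_, .const _ _ _, ⟨rfl, fun j => ?_, fun j hj => ?_⟩, ?_⟩
    · simp only [State.set_reg]
      rw [if_neg (by omega)]
    · simp only [State.set_reg]
      rw [if_neg (by omega)]
    · simp [State.set_reg]
  | add a b iha ihb =>
    intro d σ s h
    obtain ⟨σ₁, h₁, g₁, v₁⟩ := iha d σ s h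
    obtain ⟨σ₂, h₂, g₂, v₂⟩ := ihb (d + 1) σ₁ s
      ⟨g₁.mem.trans h.mem, fun i => (g₁.vis i).trans (h.reg i)⟩
    refine ⟨_, .seq h₁ (.seq h₂ (.add _ _ _ _)), ⟨?_, fun j => ?_, fun j hj => ?_⟩, ?_⟩
    · rw [State.set_mem, g₂.mem, g₁.mem]
    · rw [State.set_reg, if_neg (by omega), g₂.vis, g₁.vis]
    · rw [State.set_reg, if_neg (by omega), g₂.hid j (by omega), g₁.hid j hj]
    · rw [State.set_reg, if_pos rfl, g₂.hid d (by omega), v₁, v₂]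
      rfl
  | sub a b iha ihb =>
    intro d σ s h
    obtain ⟨σ₁, h₁, g₁, v₁⟩ := iha d σ s h
    obtain ⟨σ₂, h₂, g₂, v₂⟩ := ihb (d + 1) σ₁ s
      ⟨g₁.mem.trans h.mem, fun i => (g₁.vis i).trans (h.reg i)⟩
    refine ⟨_, .seq h₁ (.seq h₂ (.sub _ _ _ _)), ⟨?_, fun j => ?_, fun j hj => ?_⟩, ?_⟩
    · rw [State.set_mem, g₂.mem, g₁.mem]
    · rw [State.set_reg, if_neg (by omega), g₂.vis, g₁.vis]
    · rw [State.set_reg, if_neg (by omega), g₂.hid j (by omega), g₁.hid j hj]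
    · rw [State.set_reg, if_pos rfl, g₂.hid d (by omega), v₁, v₂]
      rfl
  | mem a iha =>
    intro d σ s h
    obtain ⟨σ₁, h₁, g₁, v₁⟩ := iha d σ s h
    refine ⟨_, .seq h₁ (.load _ _ _), ⟨?_, fun j => ?_, fun j hj => ?_⟩, ?_⟩
    · rw [State.set_mem, g₁.mem]
    · rw [State.set_reg, if_neg (by omega), g₁.vis]
    · rw [State.set_reg, if_neg (by omega), g₁.hid j hj]
    · rw [State.set_reg, if_pos rfl, v₁, g₁.mem, h.mem]
      rfl

/-- Commands. The loop `for_ i e c` runs `c` with `n - 1, …, 1, 0` in register `i`, where `n` is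
the value of `e` at the start. -/
inductive Cmd where
  | skip
  | asg (i : ℕ) (e : Expr)
  | sto (a e : Expr)
  | seq (c c' : Cmd)
  | ite (e : Expr) (c c' : Cmd)
  | for_ (i : ℕ) (e : Expr) (c : Cmd)

infixr:60 " ;; " => Cmd.seq

/-- The state after the iterations `n - 1, …, 0` of a loop. -/
def iterDen (f : State → State) (i : ℕ) : ℕ → State → State
  | 0, s => s
  | n + 1, s => iterDen f i n (f (s.set i n))

/-- The time that the iterations `n - 1, …, 0` of a loop take. -/
def iterCost (f : State → State) (g : State → ℕ) (i : ℕ) : ℕ → State → ℕ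
  | 0, _ => 1
  | n + 1, s => g (s.set i n) + 5 + iterCost f g i n (f (s.set i n))

namespace Cmd

/-- The state in which a command ends. -/
def den : Cmd → State → State
  | skip, s => s
  | asg i e, s => s.set i (e.eval s)
  | sto a e, s => ⟨s.reg, Function.update s.mem (a.eval s) (e.eval s)⟩
  | seq c c', s => c'.den (c.den s)
  | ite e c c', s => if e.eval s ≠ 0 then c.den s else c'.den s
  | for_ i e c, s => iterDen c.den i (e.eval s) s

/-- The time that a command takes. -/
def cost : Cmd → State → ℕ
  | skip, _ => 1
  | asg _ e, _ => e.cost + 2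
  | sto a e, _ => a.cost + (e.cost + 1)
  | seq c c', s => c.cost s + c'.cost (c.den s)
  | ite e c c', s => e.cost + ((if e.eval s ≠ 0 then c.cost s else c'.cost s) + 1)
  | for_ i e c, s => e.cost + iterCost c.den c.cost i (e.eval s) s

/-- Compilation; the hidden registers from the `d`-th on may be used. -/
def compile : Cmd → ℕ → Prog
  | skip, d => .const (2 * d + 1) 0
  | asg i e, d => .seq (e.compile d)
      (.seq (.const (2 * i) 0) (.add (2 * i) (2 * i) (2 * d + 1)))
  | sto a e, d => .seq (a.compile d)
      (.seq (e.compile (d + 1)) (.store (2 * d + 1) (2 * (d + 1) + 1)))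
  | seq c c', d => .seq (c.compile d) (c'.compile d)
  | ite e c c', d => .seq (e.compile d) (.branch (2 * d + 1) (c.compile d) (c'.compile d))
  | for_ i e c, d => .seq (e.compile d) (.loop (2 * d + 1)
      (.seq (.seq (.const (2 * i) 1) (.seq (.sub (2 * d + 1) (2 * d + 1) (2 * i))
        (.seq (.const (2 * i) 0) (.add (2 * i) (2 * i) (2 * d + 1)))))
        (c.compile (d + 1))))

/-- The true counter sits in the hidden register of level `d` and only a copy of it is visible in
register `i`. As the body is compiled at level `d + 1`, the number of iterations is fixed at the
start, even if the body overwrites `i`. -/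
theorem exec_loop (c : Cmd) (i d : ℕ)
    (ih : ∀ (σ s : State), Shows σ s → ∃ σ', Exec (c.compile (d + 1)) σ (c.cost s) σ' ∧
      Shows σ' (c.den s) ∧ ∀ j < d + 1, σ'.reg (2 * j + 1) = σ.reg (2 * j + 1)) (n : ℕ) :
    ∀ (σ s : State), Shows σ s → σ.reg (2 * d + 1) = n →
      ∃ σ', Exec (.loop (2 * d + 1)
        (.seq (.seq (.const (2 * i) 1) (.seq (.sub (2 * d + 1) (2 * d + 1) (2 * i))
          (.seq (.const (2 * i) 0) (.add (2 * i) (2 * i) (2 * d + 1)))))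
          (c.compile (d + 1)))) σ (iterCost c.den c.cost i n s) σ' ∧
        Shows σ' (iterDen c.den i n s) ∧ ∀ j < d, σ'.reg (2 * j + 1) = σ.reg (2 * j + 1) := by
  induction n with
  | zero =>
    intro σ s h h0
    exact ⟨σ, .loopFalse h0, h, fun _ _ => rfl⟩
  | succ n ihn =>
    intro σ s h h0
    -- Register `2 * i` serves first as scratch space for the constant 1 that is subtracted from the
    -- counter, and then receives the copy of the counter.
    let σ₁ := (((σ.set (2 * i) 1).set (2 * d + 1) n).set (2 * i) 0).set (2 * i) n
    have hσ : Exec (.seq (.const (2 * i) 1) (.seq (.sub (2 * d + 1) (2 * d + 1) (2 * i))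
        (.seq (.const (2 * i) 0) (.add (2 * i) (2 * i) (2 * d + 1))))) σ 4 σ₁ := by
      refine .seq (t' := 3) (.const _ _ _) (.seq (t' := 2) (t := 1)
        (s' := (σ.set (2 * i) 1).set (2 * d + 1) n) ?_ (.seq (t' := 1) (.const _ _ _) ?_))
      · convert Exec.sub _ _ _ _ using 2
        rw [State.set_reg, State.set_reg, if_pos rfl, if_neg (by omega), h0]
        rfl
      · convert Exec.add _ _ _ _ using 2
        rw [State.set_reg, if_pos rfl, State.set_reg, if_neg (by omega), State.set_reg, if_pos rfl]
        omega
    have hs : Shows σ₁ (s.set i n) := by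
      refine ⟨h.mem, fun j => ?_⟩
      simp only [σ₁, State.set_reg]
      rcases eq_or_ne j i with rfl | hj
      · simp
      · rw [if_neg (by omega), if_neg (by omega), if_neg (by omega), if_neg (by omega), if_neg hj,
          h.reg]
    obtain ⟨σ₂, h₂, g₂, k₂⟩ := ih σ₁ _ hs
    have hk : ∀ j < d + 1, σ₁.reg (2 * j + 1) = if j = d then n else σ.reg (2 * j + 1) := by
      intro j hj
      simp only [σ₁, State.set_reg]
      rcases eq_or_ne j d with rfl | hj
      · rw [if_neg (by omega), if_neg (by omega), if_pos rfl, if_pos rfl]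
      · rw [if_neg (by omega), if_neg (by omega), if_neg (by omega), if_neg (by omega), if_neg hj]
    obtain ⟨σ₃, h₃, g₃, k₃⟩ := ihn σ₂ _ g₂ (by rw [k₂ d (by omega), hk d (by omega), if_pos rfl])
    refine ⟨σ₃, ?_, g₃, fun j hj => ?_⟩
    · have := Exec.loopTrue (by omega) (.seq hσ h₂) h₃
      convert this using 1
      simp only [iterCost]
      omega
    · rw [k₃ j hj, k₂ j (by omega), hk j (by omega), if_neg (by omega)]

/-- The clause about the hidden registers below level `d` belongs to the induction: it protects the
counters of the enclosing loops and the operands that are waiting. -/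
theorem exec_compile (c : Cmd) : ∀ (d : ℕ) (σ s : State), Shows σ s →
    ∃ σ', Exec (c.compile d) σ (c.cost s) σ' ∧ Shows σ' (c.den s) ∧
      ∀ j < d, σ'.reg (2 * j + 1) = σ.reg (2 * j + 1) := by
  induction c with
  | skip =>
    intro d σ s h
    refine ⟨_, .const _ _ _, ⟨h.mem, fun j => ?_⟩, fun j hj => ?_⟩
    · rw [State.set_reg, if_neg (by omega), h.reg]
      rfl
    · rw [State.set_reg, if_neg (by omega)]
  | asg i e =>
    intro d σ s h
    obtain ⟨σ₁, h₁, g₁, v₁⟩ := e.exec_compile d σ s h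
    refine ⟨_, .seq h₁ (.seq (.const _ _ _) (.add _ _ _ _)), ⟨g₁.mem.trans h.mem, fun j => ?_⟩,
      fun j hj => ?_⟩
    · simp only [den, State.set_reg, if_true]
      rcases eq_or_ne j i with rfl | hj
      · rw [if_pos rfl, if_pos rfl, if_neg (by omega), v₁, Nat.zero_add]
      · rw [if_neg (by omega), if_neg (by omega), if_neg hj, g₁.vis, h.reg]
    · rw [State.set_reg, if_neg (by omega), State.set_reg, if_neg (by omega), g₁.hid j hj]
  | sto a e =>
    intro d σ s h
    obtain ⟨σ₁, h₁, g₁, v₁⟩ := a.exec_compile d σ s h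
    obtain ⟨σ₂, h₂, g₂, v₂⟩ := e.exec_compile (d + 1) σ₁ s
      ⟨g₁.mem.trans h.mem, fun i => (g₁.vis i).trans (h.reg i)⟩
    refine ⟨_, .seq h₁ (.seq h₂ (.store _ _ _)), ⟨?_, fun j => ?_⟩, fun j hj => ?_⟩
    · simp only [den]
      rw [v₂, g₂.hid d (by omega), v₁, g₂.mem, g₁.mem, h.mem]
    · simp only [den]
      rw [g₂.vis, g₁.vis, h.reg]
    · simp only
      rw [g₂.hid j (by omega), g₁.hid j hj]
  | seq c c' ih ih' =>
    intro d σ s h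
    obtain ⟨σ₁, h₁, g₁, v₁⟩ := ih d σ s h
    obtain ⟨σ₂, h₂, g₂, v₂⟩ := ih' d σ₁ _ g₁
    exact ⟨σ₂, .seq h₁ h₂, g₂, fun j hj => (v₂ j hj).trans (v₁ j hj)⟩
  | ite e c c' ih ih' =>
    intro d σ s h
    obtain ⟨σ₁, h₁, g₁, v₁⟩ := e.exec_compile d σ s h
    have hs : Shows σ₁ s := ⟨g₁.mem.trans h.mem, fun i => (g₁.vis i).trans (h.reg i)⟩
    simp only [compile, cost, den]
    by_cases h0 : e.eval s ≠ 0
    · obtain ⟨σ₂, h₂, g₂, v₂⟩ := ih d σ₁ _ hs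
      rw [if_pos h0, if_pos h0]
      exact ⟨σ₂, .seq h₁ (.branchTrue (by rwa [v₁]) h₂), g₂,
        fun j hj => (v₂ j hj).trans (g₁.hid j hj)⟩
    · obtain ⟨σ₂, h₂, g₂, v₂⟩ := ih' d σ₁ _ hs
      rw [if_neg h0, if_neg h0]
      exact ⟨σ₂, .seq h₁ (.branchFalse (by rw [v₁]; exact not_not.1 h0) h₂), g₂,
        fun j hj => (v₂ j hj).trans (g₁.hid j hj)⟩
  | for_ i e c ih =>
    intro d σ s h
    obtain ⟨σ₁, h₁, g₁, v₁⟩ := e.exec_compile d σ s h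
    have hs : Shows σ₁ s := ⟨g₁.mem.trans h.mem, fun i => (g₁.vis i).trans (h.reg i)⟩
    obtain ⟨σ₂, h₂, g₂, v₂⟩ := exec_loop c i d (ih (d + 1)) _ σ₁ s hs v₁
    exact ⟨σ₂, .seq h₁ h₂, g₂, fun j hj => (v₂ j hj).trans (g₁.hid j hj)⟩

/-- The command writes no register below `K`. -/
def above (K : ℕ) : Cmd → Bool
  | skip => true
  | asg i _ => K ≤ i
  | sto _ _ => true
  | seq c c' => c.above K && c'.above K
  | ite _ c c' => c.above K && c'.above K
  | for_ i _ c => K ≤ i && c.above K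

/-- The command does not write to the memory. -/
def quiet : Cmd → Bool
  | skip => true
  | asg _ _ => true
  | sto _ _ => false
  | seq c c' => c.quiet && c'.quiet
  | ite _ c c' => c.quiet && c'.quiet
  | for_ _ _ c => c.quiet

theorem reg_den {K : ℕ} {c : Cmd} (h : c.above K = true) (s : State) {r : ℕ} (hr : r < K) :
    (c.den s).reg r = s.reg r := by
  induction c generalizing s with
  | skip => rfl
  | asg i e =>
    simp only [above, decide_eq_true_eq] at h
    rw [den, State.set_reg, if_neg (by omega)]
  | sto a e => rfl
  | seq c c' ih ih' =>
    simp only [above, Bool.and_eq_true] at h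
    rw [den, ih' h.2, ih h.1]
  | ite e c c' ih ih' =>
    simp only [above, Bool.and_eq_true] at h
    rw [den]
    split_ifs
    exacts [ih h.1 s, ih' h.2 s]
  | for_ i e c ih =>
    simp only [above, Bool.and_eq_true, decide_eq_true_eq] at h
    rw [den]
    generalize e.eval s = n
    induction n generalizing s with
    | zero => rfl
    | succ n ihn => rw [iterDen, ihn, ih h.2, State.set_reg, if_neg (by omega)]

theorem mem_den {c : Cmd} (h : c.quiet = true) (s : State) : (c.den s).mem = s.mem := by
  induction c generalizing s with
  | skip => rfl
  | asg i e => rfl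
  | sto a e => simp [quiet] at h
  | seq c c' ih ih' =>
    simp only [quiet, Bool.and_eq_true] at h
    rw [den, ih' h.2, ih h.1]
  | ite e c c' ih ih' =>
    simp only [quiet, Bool.and_eq_true] at h
    rw [den]
    split_ifs
    exacts [ih h.1 s, ih' h.2 s]
  | for_ i e c ih =>
    rw [den]
    generalize e.eval s = n
    induction n generalizing s with
    | zero => rfl
    | succ n ihn => rw [iterDen, ihn, ih h, State.set_mem]

/-- The command does not write register `r`. -/
def keeps (r : ℕ) : Cmd → Bool
  | skip => true
  | asg i _ => i ≠ r
  | sto _ _ => true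
  | seq c c' => c.keeps r && c'.keeps r
  | ite _ c c' => c.keeps r && c'.keeps r
  | for_ i _ c => i ≠ r && c.keeps r

theorem reg_den_of_keeps {r : ℕ} {c : Cmd} (h : c.keeps r = true) (s : State) :
    (c.den s).reg r = s.reg r := by
  induction c generalizing s with
  | skip => rfl
  | asg i e =>
    simp only [keeps, decide_eq_true_eq] at h
    rw [den, State.set_reg, if_neg (Ne.symm h)]
  | sto a e => rfl
  | seq c c' ih ih' =>
    simp only [keeps, Bool.and_eq_true] at h
    rw [den, ih' h.2, ih h.1]
  | ite e c c' ih ih' =>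
    simp only [keeps, Bool.and_eq_true] at h
    rw [den]
    split_ifs
    exacts [ih h.1 s, ih' h.2 s]
  | for_ i e c ih =>
    simp only [keeps, Bool.and_eq_true, decide_eq_true_eq] at h
    rw [den]
    generalize e.eval s = n
    induction n generalizing s with
    | zero => rfl
    | succ n ihn => rw [iterDen, ihn, ih h.2, State.set_reg, if_neg (Ne.symm h.1)]

/-- Loops with an invariant; the registers below `K` are not changed. -/
theorem loop_rule {i : ℕ} {e : Expr} {c : Cmd} {s : State} (K : ℕ)
    (hK : (for_ i e c).above K = true) (I : ℕ → State → Prop) (T : ℕ → ℕ)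
    (h0 : I (e.eval s) s)
    (step : ∀ k s', k < e.eval s → (∀ r < K, s'.reg r = s.reg r) → I (k + 1) s' →
      I k (c.den (s'.set i k)) ∧ c.cost (s'.set i k) ≤ T k) :
    I 0 ((for_ i e c).den s) ∧
      (for_ i e c).cost s ≤ e.cost + 1 + ∑ k ∈ Finset.range (e.eval s), (T k + 5) := by
  simp only [den, cost]
  simp only [above, Bool.and_eq_true, decide_eq_true_eq] at hK
  -- The invariant is indexed by the number of iterations still to come; with index `n + 1` it holds
  -- just before the iteration whose counter value is `n`.
  have key : ∀ n s', n ≤ e.eval s → (∀ r < K, s'.reg r = s.reg r) → I n s' →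
      I 0 (iterDen c.den i n s') ∧
        iterCost c.den c.cost i n s' ≤ 1 + ∑ k ∈ Finset.range n, (T k + 5) := by
    intro n
    induction n with
    | zero =>
      intro s' _ _ h
      exact ⟨h, by simp [iterCost]⟩
    | succ n ih =>
      intro s' hn hr h
      obtain ⟨h₁, h₂⟩ := step n s' hn hr h
      obtain ⟨h₃, h₄⟩ := ih _ (by omega)
        (fun r hr' => by
          rw [reg_den hK.2 _ hr', State.set_reg, if_neg (by omega), hr r hr']) h₁
      refine ⟨h₃, ?_⟩
      simp only [iterCost]
      rw [Finset.sum_range_succ]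
      omega
  obtain ⟨h₁, h₂⟩ := key _ s le_rfl (fun _ _ => rfl) h0
  exact ⟨h₁, by omega⟩

/-- Loops with an invariant in which every iteration takes time at most `T`. -/
theorem loop_rule' {i : ℕ} {e : Expr} {c : Cmd} {s : State} (K : ℕ)
    (hK : (for_ i e c).above K = true) (I : ℕ → State → Prop) (T : ℕ)
    (h0 : I (e.eval s) s)
    (step : ∀ k s', k < e.eval s → (∀ r < K, s'.reg r = s.reg r) → I (k + 1) s' →
      I k (c.den (s'.set i k)) ∧ c.cost (s'.set i k) ≤ T) :
    I 0 ((for_ i e c).den s) ∧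
      (for_ i e c).cost s ≤ e.cost + 1 + e.eval s * (T + 5) := by
  have := loop_rule K hK I (fun _ => T) h0 step
  simpa using this

/-- The command has no loops. -/
def simple : Cmd → Bool
  | skip => true
  | asg _ _ => true
  | sto _ _ => true
  | seq c c' => c.simple && c'.simple
  | ite _ c c' => c.simple && c'.simple
  | for_ _ _ _ => false

/-- A bound for the time that a command without loops takes. -/
def worst : Cmd → ℕ
  | skip => 1
  | asg _ e => e.cost + 2
  | sto a e => a.cost + (e.cost + 1)
  | seq c c' => c.worst + c'.worst
  | ite e c c' => e.cost + (max c.worst c'.worst + 1)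
  | for_ _ _ _ => 0

theorem cost_le_worst {c : Cmd} (h : c.simple = true) (s : State) : c.cost s ≤ c.worst := by
  induction c generalizing s with
  | skip => exact le_rfl
  | asg i e => exact le_rfl
  | sto a e => exact le_rfl
  | seq c c' ih ih' =>
    simp only [simple, Bool.and_eq_true] at h
    exact Nat.add_le_add (ih h.1 s) (ih' h.2 _)
  | ite e c c' ih ih' =>
    simp only [simple, Bool.and_eq_true] at h
    have := ih h.1 s
    have := ih' h.2 s
    simp only [cost, worst]
    split_ifs <;> omega
  | for_ i e c ih => simp [simple] at h

/-- The start state shows itself: doubling the names of registers fixes register `0`, and all other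
registers hold `0`. For the same reason the visible answer in register `0` is the one that the
machine gives. -/
theorem answers {c : Cmd} {x : List ℕ} {A : Prop} {T : ℕ} (hT : c.cost (State.start x) ≤ T)
    (h : A → (c.den (State.start x)).reg 0 = 1) (h' : ¬ A → (c.den (State.start x)).reg 0 = 0) :
    (c.compile 0).AnswersWithin x A T := by
  obtain ⟨σ, hσ, hs, -⟩ := c.exec_compile 0 (State.start x) (State.start x)
    ⟨rfl, fun i => by
      simp only [State.start]
      rcases eq_or_ne i 0 with rfl | hi
      · rfl
      · rw [if_neg (by omega), if_neg hi]⟩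
  have h0 := hs.reg 0
  rw [Nat.mul_zero] at h0
  exact ⟨_, σ, hσ, hT, fun hA => h0.trans (h hA), fun hA => h0.trans (h' hA)⟩

end Cmd

/-- The memory holds the list `l` from address `a` on. -/
def MemAt (m : ℕ → ℕ) : ℕ → List ℕ → Prop
  | _, [] => True
  | a, x :: l => m a = x ∧ MemAt m (a + 1) l

@[simp] theorem memAt_nil (m a) : MemAt m a [] := trivial

@[simp] theorem memAt_cons (m a x l) : MemAt m a (x :: l) ↔ m a = x ∧ MemAt m (a + 1) l := Iff.rfl

theorem memAt_append (m : ℕ → ℕ) (l l' : List ℕ) : ∀ a,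
    MemAt m a (l ++ l') ↔ MemAt m a l ∧ MemAt m (a + l.length) l' := by
  induction l with
  | nil => simp
  | cons x l ih =>
    intro a
    simp only [List.cons_append, memAt_cons, ih, List.length_cons, and_assoc]
    rw [show a + 1 + l.length = a + (l.length + 1) by omega]

theorem MemAt.congr {m m' : ℕ → ℕ} {l : List ℕ} : ∀ {a : ℕ}, MemAt m a l →
    (∀ b, a ≤ b → b < a + l.length → m' b = m b) → MemAt m' a l := by
  induction l with
  | nil => intros; trivial
  | cons x l ih =>
    intro a h hm
    refine ⟨(hm a le_rfl (by simp)).trans h.1, ih h.2 fun b hb hb' => hm b (by omega) ?_⟩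
    simp only [List.length_cons]
    omega

theorem MemAt.get {m : ℕ → ℕ} {l : List ℕ} : ∀ {a : ℕ}, MemAt m a l →
    ∀ {i : ℕ} (hi : i < l.length), m (a + i) = l[i] := by
  induction l with
  | nil => intro a _ i hi; simp at hi
  | cons x l ih =>
    intro a h i hi
    cases i with
    | zero => exact h.1
    | succ i =>
      rw [show a + (i + 1) = a + 1 + i by omega, ih h.2 (by simpa using hi)]
      rfl

theorem memAt_getD (x : List ℕ) : MemAt (fun a => x.getD a 0) 0 x := by
  suffices ∀ (l : List ℕ) (a : ℕ), x.drop a = l → MemAt (fun a => x.getD a 0) a l from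
    this x 0 rfl
  intro l
  induction l with
  | nil => intros; trivial
  | cons y l ih =>
    intro a h
    refine ⟨?_, ih _ ?_⟩
    · have := congrArg (fun l => l.getD 0 0) h
      simpa using this
    · rw [← List.drop_drop, h]
      rfl

/-! ### Infinite paths of a relation -/

section Paths

variable {O : Type} {R : O → O → Prop}

/-- The point `o` is the start of an infinite path. -/
def Alive (R : O → O → Prop) (o : O) : Prop := ∃ π : ℕ → O, π 0 = o ∧ ∀ i, R (π i) (π (i + 1))

/-- Dependent choice, by iterating a choice function on the points of `G`. -/
theorem exists_path (G : O → Prop) (h : ∀ o, G o → ∃ o', R o o' ∧ G o') {o : O} (ho : G o) :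
    ∃ π : ℕ → O, π 0 = o ∧ (∀ i, R (π i) (π (i + 1))) ∧ ∀ i, G (π i) := by
  choose f hf using h
  let g : {o // G o} → {o // G o} := fun x => ⟨f x.1 x.2, (hf x.1 x.2).2⟩
  refine ⟨fun i => (g^[i] ⟨o, ho⟩).1, rfl, fun i => ?_, fun i => (g^[i] ⟨o, ho⟩).2⟩
  simp only [Function.iterate_succ_apply']
  exact (hf _ _).1

theorem Alive.step {o : O} (h : Alive R o) : ∃ o', R o o' ∧ Alive R o' := by
  obtain ⟨π, rfl, h⟩ := h
  exact ⟨π 1, h 0, fun i => π (i + 1), rfl, fun i => h (i + 1)⟩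

theorem alive_of_post (G : O → Prop) (h : ∀ o, G o → ∃ o', R o o' ∧ G o') {o : O} (ho : G o) :
    Alive R o := by
  obtain ⟨π, h0, hπ, -⟩ := exists_path G h ho
  exact ⟨π, h0, hπ⟩

/-- Some infinite path from `o` satisfies `A₁` until `A₂`. -/
def SomeUntil (R : O → O → Prop) (A₁ A₂ : O → Prop) (o : O) : Prop :=
  ∃ π : ℕ → O, π 0 = o ∧ (∀ i, R (π i) (π (i + 1))) ∧ ∃ i, A₂ (π i) ∧ ∀ j < i, A₁ (π j)

/-- Every infinite path from `o` satisfies `A₁` until `A₂`. -/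
def AllUntil (R : O → O → Prop) (A₁ A₂ : O → Prop) (o : O) : Prop :=
  ∀ π : ℕ → O, π 0 = o → (∀ i, R (π i) (π (i + 1))) → ∃ i, A₂ (π i) ∧ ∀ j < i, A₁ (π j)

variable {A₁ A₂ : O → Prop}

theorem SomeUntil.of_step {o : O} (h : Alive R o)
    (h' : A₂ o ∨ (A₁ o ∧ ∃ o', R o o' ∧ SomeUntil R A₁ A₂ o')) : SomeUntil R A₁ A₂ o := by
  rcases h' with h' | ⟨h₁, o', hr, π, rfl, hπ, i, hi, hj⟩
  · obtain ⟨π, rfl, hπ⟩ := h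
    exact ⟨π, rfl, hπ, 0, h', by simp⟩
  · refine ⟨fun i => Nat.casesOn i o π, rfl, fun i => by cases i <;> simp_all, i + 1, hi, ?_⟩
    intro j hj'
    cases j with
    | zero => exact h₁
    | succ j => exact hj j (by omega)

/-- Induction on the position at which `A₂` holds, from the end of the path prefix back to its
start. Only points on infinite paths matter, so closure of `X` is asked for at these only. -/
theorem SomeUntil.least (X : O → Prop)
    (hX : ∀ o, Alive R o → (A₂ o ∨ (A₁ o ∧ ∃ o', R o o' ∧ X o')) → X o) {o : O}
    (h : SomeUntil R A₁ A₂ o) : X o := by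
  obtain ⟨π, rfl, hπ, i, hi, hj⟩ := h
  induction i generalizing π with
  | zero => exact hX _ ⟨π, rfl, hπ⟩ (.inl hi)
  | succ i ih =>
    exact hX _ ⟨π, rfl, hπ⟩ (.inr ⟨hj 0 (by omega), _, hπ 0,
      ih (fun i => π (i + 1)) (fun i => hπ (i + 1)) hi fun j hj' => hj (j + 1) (by omega)⟩)

theorem AllUntil.of_step {o : O}
    (h : ¬ Alive R o ∨ A₂ o ∨ (A₁ o ∧ ∀ o', R o o' → AllUntil R A₁ A₂ o')) :
    AllUntil R A₁ A₂ o := by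
  rintro π rfl hπ
  rcases h with h | h | ⟨h₁, h₂⟩
  · exact absurd ⟨π, rfl, hπ⟩ h
  · exact ⟨0, h, by simp⟩
  · obtain ⟨i, hi, hj⟩ := h₂ _ (hπ 0) (fun i => π (i + 1)) rfl fun i => hπ (i + 1)
    refine ⟨i + 1, hi, fun j hj' => ?_⟩
    cases j with
    | zero => exact h₁
    | succ j => exact hj j (by omega)

/-- From a point outside `X` one builds an infinite path that refutes the until. Points outside `X`
are alive and falsify `A₂`; as long as `A₁` holds there is a successor that is again outside `X`;
once `A₁` fails, any infinite continuation will do. -/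
theorem AllUntil.least (X : O → Prop)
    (hX : ∀ o, (¬ Alive R o ∨ A₂ o ∨ (A₁ o ∧ ∀ o', R o o' → X o')) → X o) {o : O}
    (h : AllUntil R A₁ A₂ o) : X o := by
  by_contra ho
  -- The relation with the strategy built in: leave the complement of `X` only where `A₁` fails.
  let R' : O → O → Prop := fun o o' => R o o' ∧ (¬ X o → A₁ o → ¬ X o')
  have hal : ∀ o, ¬ X o → Alive R o := fun o h => by
    by_contra hn
    exact h (hX o (.inl hn))
  obtain ⟨π, rfl, hπ, -⟩ := exists_path (R := R') (Alive R) (by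
    intro o ha
    by_cases hb : ¬ X o ∧ A₁ o
    · have : ¬ (¬ Alive R o ∨ A₂ o ∨ (A₁ o ∧ ∀ o', R o o' → X o')) := fun h => hb.1 (hX o h)
      simp only [not_or, not_and, not_forall] at this
      obtain ⟨o', hr, ho'⟩ := this.2.2 hb.2
      exact ⟨o', ⟨hr, fun _ _ => ho'⟩, hal o' ho'⟩
    · obtain ⟨o', hr, ho'⟩ := ha.step
      exact ⟨o', ⟨hr, fun h h' => absurd ⟨h, h'⟩ hb⟩, ho'⟩) (hal o ho)
  obtain ⟨i, hi, hj⟩ := h π rfl fun i => (hπ i).1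
  have : ∀ j ≤ i, ¬ X (π j) := by
    intro j
    induction j with
    | zero => exact fun _ => ho
    | succ j ih => exact fun hji => (hπ j).2 (ih (by omega)) (hj j (by omega))
  exact this i le_rfl (hX _ (.inr (.inl hi)))

end Paths

/-! ### Rules and runs -/

section Runs

variable {P Γ : Type}

namespace Rule

def srcP : Rule P Γ → P
  | call p _ _ _ _ | ret p _ _ | int p _ _ _ => p

def srcΓ : Rule P Γ → Γ
  | call _ γ _ _ _ | ret _ γ _ | int _ γ _ _ => γ

def tgt : Rule P Γ → P
  | call _ _ q _ _ | ret _ _ q | int _ _ q _ => q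

def word : Rule P Γ → List Γ
  | call _ _ _ γ₁ γ₂ => [γ₁, γ₂]
  | ret _ _ _ => []
  | int _ _ _ w => w

def act : Rule P Γ → Act
  | call _ _ _ _ _ => .call
  | ret _ _ _ => .ret
  | int _ _ _ _ => .int

end Rule

namespace PDS

variable (S : PDS P Γ)

/-- The unlabelled transition relation. -/
def Tr (c d : Conf P Γ) : Prop := ∃ a, S.Step a c d

/-- The configurations from which a run starts. -/
def Inf (c : Conf P Γ) : Prop := Alive S.Tr c

variable {S}

theorem step_iff {a : Act} {c d : Conf P Γ} : S.Step a c d ↔ ∃ r ∈ S.Δ, ∃ w, a = r.act ∧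
    c = (r.srcP, r.srcΓ :: w) ∧ d = (r.tgt, r.word ++ w) := by
  constructor
  · rintro (⟨w, h⟩ | ⟨w, h⟩ | ⟨w, h⟩) <;> exact ⟨_, h, w, rfl, rfl, rfl⟩
  · rintro ⟨r, hr, w, ha, rfl, rfl⟩
    subst ha
    cases r
    exacts [.call w hr, .ret w hr, .int w hr]

theorem inf_iff {c : Conf P Γ} : (S.Traces c).Nonempty ↔ S.Inf c := by
  constructor
  · rintro ⟨π, rfl⟩
    exact ⟨π.conf, rfl, fun i => ⟨_, π.step i⟩⟩
  · rintro ⟨π, rfl, hπ⟩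
    choose a ha using hπ
    exact ⟨⟨π, a, ha⟩, rfl⟩

theorem Run.inf (π : S.Run) (i : ℕ) : S.Inf (π.conf i) :=
  ⟨fun j => π.conf (i + j), rfl, fun j => ⟨_, π.step (i + j)⟩⟩

/-- Put a step in front of a run. -/
def Run.cons (π : S.Run) {a : Act} {c : Conf P Γ} (h : S.Step a c (π.conf 0)) : S.Run where
  conf i := Nat.casesOn i c π.conf
  act i := Nat.casesOn i a π.act
  step i := by
    cases i with
    | zero => exact h
    | succ i => exact π.step i

theorem not_inf_nil (p : P) : ¬ S.Inf (p, []) := by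
  rintro h
  obtain ⟨d, ⟨a, h⟩, -⟩ := Alive.step h
  obtain ⟨r, -, w, -, h, -⟩ := step_iff.1 h
  simp at h

theorem Step.lift {a : Act} {c d : Conf P Γ} (h : S.Step a c d) (w : List Γ) :
    S.Step a (c.1, c.2 ++ w) (d.1, d.2 ++ w) := by
  obtain ⟨r, hr, v, rfl, rfl, rfl⟩ := step_iff.1 h
  exact step_iff.2 ⟨r, hr, v ++ w, rfl, rfl, by simp⟩

/-- A rule inspects the topmost symbol only, so as long as something lies above `w` the step does
not notice `w`. -/
theorem Step.lower {a : Act} {q : P} {u w : List Γ} {d : Conf P Γ}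
    (h : S.Step a (q, u ++ w) d) (hu : u ≠ []) :
    ∃ u', d = (d.1, u' ++ w) ∧ S.Step a (q, u) (d.1, u') := by
  obtain ⟨r, hr, v, ha, h1, rfl⟩ := step_iff.1 h
  subst ha
  cases u with
  | nil => exact absurd rfl hu
  | cons γ u =>
    rw [List.cons_append, Prod.mk.injEq, List.cons.injEq] at h1
    obtain ⟨rfl, rfl, rfl⟩ := h1
    exact ⟨r.word ++ u, by simp, step_iff.2 ⟨r, hr, u, rfl, rfl, rfl⟩⟩

variable (S) in
/-- Starting with the single symbol `γ` on the stack, the location `q'` is reached when the symbol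
is popped; the flag tells whether a return statement pops it. -/
def Pop (ret : Prop) (q : P) (γ : Γ) (q' : P) : Prop :=
  ∃ d a, Relation.ReflTransGen S.Tr (q, [γ]) d ∧ S.Step a d (q', []) ∧ (a = .ret ↔ ret)

variable (S) in
/-- The successors of configurations `⟨p, γ w⟩`, up to the part `w` of the stack. The predicate
`J` describes from which configurations there is a run. -/
inductive LSucc (J : P × List Γ → Prop) (p : P) (γ : Γ) : Mode → Option (P × List Γ) → Prop
  | glob {r} (hr : r ∈ S.Δ) (hp : r.srcP = p) (hγ : r.srcΓ = γ) (h : J (r.tgt, r.word)) :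
      LSucc J p γ .g (some (r.tgt, r.word))
  | int {q u} (hr : Rule.int p γ q u ∈ S.Δ) (h : J (q, u)) : LSucc J p γ .a (some (q, u))
  | ret {q} (hr : Rule.ret p γ q ∈ S.Δ) (h : J (q, [])) : LSucc J p γ .a none
  | callRet {q γ₁ γ₂ q'} (hr : Rule.call p γ q γ₁ γ₂ ∈ S.Δ) (hp : S.Pop True q γ₁ q')
      (h : J (q', [γ₂])) : LSucc J p γ .a (some (q', [γ₂]))
  | callInt {q γ₁ γ₂ q'} (hr : Rule.call p γ q γ₁ γ₂ ∈ S.Δ) (hp : S.Pop False q γ₁ q')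
      (h : J (q', [γ₂])) : LSucc J p γ .a none
  | callNever {q γ₁ γ₂} (hr : Rule.call p γ q γ₁ γ₂ ∈ S.Δ) (h : S.Inf (q, [γ₁])) :
      LSucc J p γ .a none

/-- As long as the stack is higher than `w`, a run does not touch `w`. -/
theorem Run.above (π : S.Run) {q : P} {γ : Γ} {w : List Γ} (h1 : π.conf 1 = (q, γ :: w)) (j : ℕ)
    (hj : ∀ l, 1 ≤ l → l ≤ j + 1 → w.length < (π.conf l).2.length) :
    ∃ u, π.conf (j + 1) = ((π.conf (j + 1)).1, u ++ w) ∧ u ≠ [] ∧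
      Relation.ReflTransGen S.Tr (q, [γ]) ((π.conf (j + 1)).1, u) := by
  induction j with
  | zero =>
    refine ⟨[γ], ?_, by simp, ?_⟩ <;> rw [Nat.zero_add, h1]
    rfl
  | succ j ih =>
    obtain ⟨u, hu, hu0, hr⟩ := ih fun l h h' => hj l h (by omega)
    have hs := π.step (j + 1)
    rw [hu] at hs
    obtain ⟨u', hu', hs'⟩ := hs.lower hu0
    refine ⟨u', hu', ?_, hr.tail ⟨_, hs'⟩⟩
    rintro rfl
    have := hj (j + 2) (by omega) le_rfl
    rw [hu'] at this
    simp at this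

/-- Where a run first reaches the height of `w`, the symbol above `w` is popped. -/
theorem Run.pop_of_first (π : S.Run) {q : P} {γ : Γ} {w : List Γ} (h1 : π.conf 1 = (q, γ :: w))
    (j : ℕ) (hj : ∀ l, 1 ≤ l → l ≤ j + 1 → w.length < (π.conf l).2.length)
    (hl : (π.conf (j + 2)).2.length ≤ w.length) :
    π.conf (j + 2) = ((π.conf (j + 2)).1, w) ∧
      S.Pop (π.act (j + 1) = .ret) q γ (π.conf (j + 2)).1 := by
  obtain ⟨u, hu, hu0, hr⟩ := π.above h1 j hj
  have hs := π.step (j + 1)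
  rw [hu] at hs
  obtain ⟨u', hu', hs'⟩ := hs.lower hu0
  rw [hu'] at hl
  simp only [List.length_append, add_le_iff_nonpos_left, Nat.le_zero, List.length_eq_zero_iff] at hl
  subst hl
  exact ⟨hu', _, _, hr, hs', Iff.rfl⟩

/-- A popping computation on top of `w`, followed by a run. -/
theorem Pop.run {ret : Prop} {q q' : P} {γ : Γ} {w : List Γ} (h : S.Pop ret q γ q')
    (hi : S.Inf (q', w)) : ∃ (π : S.Run) (j : ℕ), π.conf 0 = (q, γ :: w) ∧
      π.conf (j + 1) = (q', w) ∧ (π.act j = .ret ↔ ret) ∧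
      ∀ l ≤ j, w.length < (π.conf l).2.length := by
  obtain ⟨d, a, hr, hs, ha⟩ := h
  -- Generalized to every configuration on the way, so that the computation can be prepended step by
  -- step to a run that starts after the pop.
  suffices ∀ e, Relation.ReflTransGen S.Tr e d → ∃ (π : S.Run) (j : ℕ),
      π.conf 0 = (e.1, e.2 ++ w) ∧ π.conf (j + 1) = (q', w) ∧ (π.act j = .ret ↔ ret) ∧
      ∀ l ≤ j, w.length < (π.conf l).2.length from this _ hr
  intro e he
  have hne : ∀ {a} {c d : Conf P Γ}, S.Step a c d → w.length < (c.2 ++ w).length := by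
    intro a c d h
    obtain ⟨r, -, v, -, rfl, -⟩ := step_iff.1 h
    simp
  induction he using Relation.ReflTransGen.head_induction_on with
  | refl =>
    obtain ⟨π, hπ⟩ := inf_iff.2 hi
    change π.conf 0 = _ at hπ
    refine ⟨π.cons (a := a) (c := (d.1, d.2 ++ w)) ?_, 0, rfl, hπ, ha, ?_⟩
    · rw [hπ]
      exact hs.lift w
    · intro l hl
      obtain rfl : l = 0 := by omega
      exact hne hs
  | head h _ ih =>
    obtain ⟨π, j, h0, hj, ha, hl⟩ := ih
    obtain ⟨b, hb⟩ := h
    refine ⟨π.cons (a := b) (c := (_, _ ++ w)) ?_, j + 1, rfl, hj, ha, ?_⟩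
    · rw [h0]
      exact hb.lift w
    · intro l hlj
      cases l with
      | zero => exact hne hb
      | succ l => exact hl l (by omega)

theorem succ_nil (b : Mode) (p : P) (o : Option (Conf P Γ)) : ¬ S.Succ b (p, []) o := by
  intro h
  refine not_inf_nil (S := S) p (inf_iff.1 ?_)
  cases b <;> obtain ⟨π, hπ, -⟩ := h <;> exact ⟨π, hπ⟩

/-- Any step can be put in front of a run, and the rest of a run is a run. Hence the only trace that
the quantification over runs leaves is that the successor itself must start one. -/
theorem succ_g_iff {c : Conf P Γ} {o : Option (Conf P Γ)} :
    S.Succ .g c o ↔ ∃ d, o = some d ∧ S.Tr c d ∧ S.Inf d := by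
  constructor
  · rintro ⟨π, rfl, rfl⟩
    exact ⟨_, rfl, ⟨_, π.step 0⟩, π.inf 1⟩
  · rintro ⟨d, rfl, ⟨a, ha⟩, hd⟩
    obtain ⟨π, rfl⟩ := inf_iff.2 hd
    exact ⟨π.cons ha, rfl, rfl⟩

theorem succ_alive {b : Mode} {c d : Conf P Γ} (h : S.Succ b c (some d)) : S.Inf d := by
  cases b with
  | g =>
    obtain ⟨d, h, -, hd⟩ := succ_g_iff.1 h
    cases h
    exact hd
  | a =>
    obtain ⟨π, -, h⟩ := h
    cases h <;> exact π.inf _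

/-- The successors of a configuration, in terms of the rules. -/
theorem succ_iff {b : Mode} {p : P} {γ : Γ} {w : List Γ} {o : Option (Conf P Γ)} :
    S.Succ b (p, γ :: w) o ↔ ∃ o', S.LSucc (fun x => S.Inf (x.1, x.2 ++ w)) p γ b o' ∧
      o = o'.map fun x => (x.1, x.2 ++ w) := by
  cases b with
  | g =>
    rw [succ_g_iff]
    constructor
    · rintro ⟨d, rfl, ⟨a, ha⟩, hd⟩
      obtain ⟨r, hr, v, -, h, rfl⟩ := step_iff.1 ha
      simp only [Prod.mk.injEq, List.cons.injEq] at h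
      obtain ⟨rfl, rfl, rfl⟩ := h
      exact ⟨_, .glob hr rfl rfl hd, rfl⟩
    · rintro ⟨o', ⟨hr, rfl, rfl, h⟩, rfl⟩
      exact ⟨_, rfl, ⟨_, step_iff.2 ⟨_, hr, w, rfl, rfl, rfl⟩⟩, h⟩
  | a =>
    constructor
    · rintro ⟨π, hπ, h⟩
      change π.conf 0 = _ at hπ
      have hs := π.step 0
      have hi := π.inf 1
      rw [hπ] at hs
      have hcall : π.act 0 = .call → ∃ q γ₁ γ₂, Rule.call p γ q γ₁ γ₂ ∈ S.Δ ∧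
          π.conf 1 = (q, γ₁ :: γ₂ :: w) := by
        intro ha
        rw [ha] at hs
        rw [Nat.zero_add] at hs
        generalize π.conf 1 = e at hs
        cases hs with | call _ h => exact ⟨_, _, _, h, rfl⟩
      cases h with
      | @returns k ha hk =>
        obtain ⟨q, γ₁, γ₂, hr, h1⟩ := hcall ha
        obtain ⟨j, rfl, hj, hret, hlen, hl⟩ := hk
        obtain ⟨j, rfl⟩ : ∃ i, j = i + 1 := ⟨j - 1, by omega⟩
        rw [hπ] at hlen hl
        obtain ⟨hc, hp⟩ := π.pop_of_first h1 j (fun l h h' => hl l h h') (by simpa using hlen.le)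
        simp only [hret] at hp
        have := π.inf (j + 2)
        rw [hc] at this
        exact ⟨_, .callRet hr (by simpa using hp) this, by simpa using hc⟩
      | never ha hk =>
        obtain ⟨q, γ₁, γ₂, hr, h1⟩ := hcall ha
        -- A call without return-point: either the stack does come down to γ₂w, but the first time
        -- by a step that is no return, or it stays above γ₂w for ever.
        by_cases hlow : ∃ l, 1 ≤ l ∧ (π.conf l).2.length ≤ (γ₂ :: w).length
        · classical
          obtain ⟨hl1, hl2⟩ := Nat.find_spec hlow
          have hmin := fun l h => Nat.find_min hlow (m := l) h
          generalize Nat.find hlow = k at hl1 hl2 hmin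
          have hk1 : k ≠ 1 := by
            rintro rfl
            rw [h1] at hl2
            simp at hl2
          obtain ⟨j, rfl⟩ : ∃ i, k = i + 2 := ⟨k - 2, by omega⟩
          have hl : ∀ l, 1 ≤ l → l ≤ j + 1 → (γ₂ :: w).length < (π.conf l).2.length := by
            intro l h h'
            have := hmin l (by omega)
            push Not at this
            exact this h
          obtain ⟨hc, hp⟩ := π.pop_of_first h1 j hl hl2
          have hret : π.act (j + 1) ≠ .ret := by
            intro hret
            refine hk ⟨j + 2, j + 1, rfl, by omega, hret, ?_, ?_⟩
            · rw [hc, hπ]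
              rfl
            · intro l h h'
              rw [hπ]
              exact hl l h h'
          simp only [hret] at hp
          have := π.inf (j + 2)
          rw [hc] at this
          exact ⟨_, .callInt hr hp this, rfl⟩
        -- What lies above γ₂w is never used up, so with γ₂w removed the run remains a run; it
        -- starts with the single symbol γ₁.
        · push Not at hlow
          refine ⟨_, .callNever hr ?_, rfl⟩
          refine alive_of_post (fun e => ∃ l, π.conf (l + 1) = (e.1, e.2 ++ γ₂ :: w)) ?_
            ⟨0, h1⟩
          rintro ⟨e, u⟩ ⟨l, hl⟩
          have hu : u ≠ [] := by
            rintro rfl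
            have := hlow (l + 1) (by omega)
            rw [hl] at this
            simp at this
          have hs := π.step (l + 1)
          rw [hl] at hs
          obtain ⟨u', hu', hs'⟩ := hs.lower hu
          exact ⟨_, ⟨_, hs'⟩, l + 1, hu'⟩
      | int ha =>
        rw [ha] at hs
        generalize he : π.conf (0 + 1) = e at hs
        rw [Nat.zero_add] at he
        cases hs with
        | int _ h =>
          rw [he] at hi
          exact ⟨_, .int h hi, by simp⟩
      | ret ha =>
        rw [ha] at hs
        generalize he : π.conf (0 + 1) = e at hs
        cases hs with
        | ret _ h =>
          rw [← Nat.zero_add 1, he] at hi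
          exact ⟨_, .ret h hi, rfl⟩
    · rintro ⟨o', h, rfl⟩
      cases h with
      | int hr h =>
        obtain ⟨π, hπ⟩ := inf_iff.2 h
        refine ⟨π.cons (a := .int) (c := (p, γ :: w)) ?_, rfl, ?_⟩
        · rw [hπ]
          exact .int w hr
        · rw [show Option.map _ _ = some (π.conf 0) by rw [hπ]; rfl]
          exact Run.AbsSucc.int (π := π.cons _) rfl
      | ret hr h =>
        obtain ⟨π, hπ⟩ := inf_iff.2 h
        refine ⟨π.cons (a := .ret) (c := (p, γ :: w)) ?_, rfl, .ret rfl⟩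
        rw [hπ]
        exact .ret w hr
      | callRet hr hp h =>
        obtain ⟨π, j, h0, hj, ha, hl⟩ := hp.run h
        refine ⟨π.cons (a := .call) (c := (p, γ :: w)) ?_, rfl, ?_⟩
        · rw [h0]
          exact .call w hr
        · rw [show Option.map _ _ = some (π.conf (j + 1)) by rw [hj]; rfl]
          refine Run.AbsSucc.returns (π := π.cons _) (k := j + 2) rfl
            ⟨j + 1, rfl, by omega, ha.2 trivial, ?_, ?_⟩
          · change (π.conf (j + 1)).2.length = _
            rw [hj]
            rfl
          · intro l h0 hlj
            obtain ⟨l, rfl⟩ : ∃ i, l = i + 1 := ⟨l - 1, by omega⟩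
            exact hl l (by omega)
      | callInt hr hp h =>
        obtain ⟨π, j, h0, hj, ha, hl⟩ := hp.run h
        refine ⟨π.cons (a := .call) (c := (p, γ :: w)) ?_, rfl, .never rfl ?_⟩
        · rw [h0]
          exact .call w hr
        · rintro ⟨_, i, rfl, hi, hret, hlen, hli⟩
          obtain ⟨i, rfl⟩ : ∃ l, i = l + 1 := ⟨i - 1, by omega⟩
          change (π.conf (i + 1)).2.length = w.length + 1 at hlen
          -- The stack first reaches the height of γ₂w where the popping computation ends. A
          -- return-point cannot come before (the stack is too high), nor there (the step is no
          -- return), nor after (the stack has already been that low).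
          rcases lt_trichotomy i j with hij | rfl | hij
          · have := hl (i + 1) (by omega)
            simp only [List.singleton_append, List.length_cons] at this
            omega
          · exact ha.1 hret
          · have := hli (j + 2) (by omega) (by omega)
            change w.length + 1 < (π.conf (j + 1)).2.length at this
            rw [hj] at this
            simp at this
      | @callNever q γ₁ γ₂ hr h =>
        obtain ⟨π', h0, hπ'⟩ := h
        choose a ha using hπ'
        -- The run over the single symbol, lifted on top of γ₂w. It has no configuration with empty
        -- stack, so the lifted run never comes down to γ₂w.
        let ρ : S.Run := ⟨fun i => ((π' i).1, (π' i).2 ++ γ₂ :: w), a, fun i => (ha i).lift _⟩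
        refine ⟨ρ.cons (a := .call) (c := (p, γ :: w)) ?_, rfl, .never rfl ?_⟩
        · simp only [ρ, h0]
          exact .call w hr
        · rintro ⟨_, i, rfl, hi, hret, hlen, hli⟩
          change (ρ.conf i).2.length = w.length + 1 at hlen
          obtain ⟨r, -, v, -, hv, -⟩ := step_iff.1 (ha i)
          simp [ρ, hv] at hlen
          omega

end PDS

end Runs

/-! ### Fixed points -/

namespace Formula

variable {AP : Type}

/-- The number of the operator of a formula. -/
def tag : Formula AP → ℕ
  | tt => 0 | ff => 1 | atom _ => 2 | natom _ => 3 | or _ _ => 4 | and _ _ => 5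
  | EX _ _ => 6 | AX _ _ => 7 | EU _ _ _ => 8 | AU _ _ _ => 9 | ER _ _ _ => 10 | AR _ _ _ => 11

def mode : Formula AP → Mode
  | EX b _ | AX b _ | EU b _ _ | AU b _ _ | ER b _ _ | AR b _ _ => b
  | _ => .g

/-- The first operand. -/
def left : Formula AP → Formula AP
  | EX _ φ | AX _ φ | EU _ φ _ | AU _ φ _ | ER _ φ _ | AR _ φ _ | or φ _ | and φ _ => φ
  | φ => φ

/-- The second operand. -/
def right : Formula AP → Formula AP
  | EU _ _ φ | AU _ _ φ | ER _ _ φ | AR _ _ φ | or _ φ | and _ φ => φ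
  | φ => φ

end Formula

/-- One step of the evaluation of the operator number `tag`; `x₁` and `x₂` tell whether the
operands hold, `inf` whether there is a run, `e` and `al` whether some successor or all successors
satisfy what they have to. Number `12` stands for the existence of a run. -/
def cond (tag : ℕ) (x₁ x₂ inf e al : Prop) : Prop :=
  match tag with
  | 0 => True
  | 4 => x₁ ∨ x₂
  | 5 => x₁ ∧ x₂
  | 6 => e
  | 7 => al
  | 8 => inf ∧ (x₂ ∨ (x₁ ∧ e))
  | 9 => ¬ inf ∨ x₂ ∨ (x₁ ∧ al)
  | 10 => inf ∧ x₂ ∧ (x₁ ∨ e)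
  | 11 => ¬ inf ∨ (x₂ ∧ (x₁ ∨ al))
  | 12 => e
  | _ => False

/-- The remaining arguments are settled before the property is evaluated; in particular the negated
occurrence of `inf` does no harm to monotonicity. -/
theorem cond_mono {tag : ℕ} {x₁ x₂ inf e al e' al' : Prop} (he : e → e') (hal : al → al') :
    cond tag x₁ x₂ inf e al → cond tag x₁ x₂ inf e' al' := by
  unfold cond
  split <;> tauto

/-- Implication, from the right to the left if `pol` holds. -/
def Imp (pol a b : Prop) : Prop := (pol → b → a) ∧ (¬ pol → a → b)

section Fix

variable {P Γ AP : Type} {S : PDS P Γ} {lab : AP → Set (Conf P Γ)}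

namespace PDS

variable (S lab) in
/-- The properties that are evaluated: a formula, or the existence of a run. -/
def Sem : Option (Formula AP) → Conf P Γ → Prop
  | none => S.Inf
  | some φ => S.Sat lab φ

def ctag : Option (Formula AP) → ℕ
  | none => 12
  | some φ => φ.tag

def cmode : Option (Formula AP) → Mode
  | none => .g
  | some φ => φ.mode

variable (S) in
/-- The successors of a configuration, where `J` describes from which configurations there is a
run. -/
def Next (J : Conf P Γ → Prop) (b : Mode) (c : Conf P Γ) (o : Option (Conf P Γ)) : Prop :=
  ∃ γ w o', c.2 = γ :: w ∧ S.LSucc (fun x => J (x.1, x.2 ++ w)) c.1 γ b o' ∧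
    o = o'.map fun x => (x.1, x.2 ++ w)

theorem next_iff {b : Mode} {c : Conf P Γ} {o : Option (Conf P Γ)} :
    S.Next S.Inf b c o ↔ S.Succ b c o := by
  obtain ⟨p, v⟩ := c
  cases v with
  | nil =>
    refine ⟨?_, fun h => absurd h (succ_nil _ _ _)⟩
    rintro ⟨γ, w, o', hc, -⟩
    simp at hc
  | cons γ w =>
    rw [succ_iff]
    constructor
    · rintro ⟨γ, w, o', hc, h⟩
      cases hc
      exact ⟨o', h⟩
    · rintro ⟨o', h⟩
      exact ⟨γ, w, o', rfl, h⟩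

variable (S lab) in
/-- One step of the evaluation of a property; `X` approximates the property. -/
def Phi (C : Option (Formula AP)) (X : Conf P Γ → Prop) (c : Conf P Γ) : Prop :=
  -- Numbers from 8 on are recursive operators, which ask their own approximation at the successors;
  -- the nexttime operators ask their operand.
  let Y : Conf P Γ → Prop := fun d => if 8 ≤ ctag C then X d else ∃ φ ∈ C, S.Sat lab φ.left d
  -- For the property that a run exists, the restriction to successors from which a run starts is
  -- itself what is being approximated.
  let J : Conf P Γ → Prop := fun d => if C = none then X d else S.Inf d
  cond (ctag C) (∃ φ ∈ C, S.Sat lab φ.left c) (∃ φ ∈ C, S.Sat lab φ.right c) (S.Inf c)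
    (∃ o, S.Next J (cmode C) c o ∧ Holds Y o) (∀ o, S.Next J (cmode C) c o → Holds Y o)

variable (S) in
/-- The steps of global-paths and abstract-paths. -/
def PathStep (b : Mode) (o o' : Option (Conf P Γ)) : Prop :=
  (∃ d, o = some d ∧ S.Succ b d o') ∨ (o = none ∧ o' = none)

theorem alive_none (b : Mode) : Alive (S.PathStep b) none :=
  ⟨fun _ => none, rfl, fun _ => .inr ⟨rfl, rfl⟩⟩

theorem exists_succ {c : Conf P Γ} (h : S.Inf c) (b : Mode) : ∃ o, S.Succ b c o := by
  obtain ⟨π, hπ⟩ := inf_iff.2 h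
  cases b with
  | g => exact ⟨_, π, hπ, rfl⟩
  | a =>
    cases ha : π.act 0 with
    | call =>
      by_cases hk : ∃ k, π.IsReturnPoint 0 k
      · obtain ⟨k, hk⟩ := hk
        exact ⟨_, π, hπ, .returns ha hk⟩
      · exact ⟨_, π, hπ, .never ha hk⟩
    | ret => exact ⟨_, π, hπ, .ret ha⟩
    | int => exact ⟨_, π, hπ, .int ha⟩

/-- Paths never get stuck where a run starts: there is a successor in either mode, every successor
other than ⊥ again starts a run, and ⊥ repeats for ever. Conversely the very first step of a path is
taken over a run. -/
theorem alive_some {b : Mode} {c : Conf P Γ} : Alive (S.PathStep b) (some c) ↔ S.Inf c := by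
  constructor
  · rintro h
    obtain ⟨o', ⟨d, hd, h⟩ | ⟨h, -⟩, -⟩ := h.step
    · cases hd
      refine inf_iff.1 ?_
      cases b <;> obtain ⟨π, hπ, -⟩ := h <;> exact ⟨π, hπ⟩
    · simp at h
  · intro h
    refine alive_of_post (fun o => ∀ d, o = some d → S.Inf d) ?_ (by rintro d ⟨⟩; exact h)
    rintro (_ | d) hd
    · exact ⟨none, .inr ⟨rfl, rfl⟩, by simp⟩
    · obtain ⟨o', ho'⟩ := exists_succ (hd d rfl) b
      refine ⟨o', .inl ⟨d, rfl, ho'⟩, ?_⟩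
      rintro e rfl
      exact succ_alive ho'

theorem sat_EU {b : Mode} {φ ψ : Formula AP} {c : Conf P Γ} : S.Sat lab (.EU b φ ψ) c ↔
    SomeUntil (S.PathStep b) (Holds (S.Sat lab φ)) (Holds (S.Sat lab ψ)) (some c) :=
  ⟨fun ⟨π, h, h'⟩ => ⟨π, h.1, h.2, h'⟩, fun ⟨π, h, h', h''⟩ => ⟨π, ⟨h, h'⟩, h''⟩⟩

theorem sat_AU {b : Mode} {φ ψ : Formula AP} {c : Conf P Γ} : S.Sat lab (.AU b φ ψ) c ↔
    AllUntil (S.PathStep b) (Holds (S.Sat lab φ)) (Holds (S.Sat lab ψ)) (some c) :=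
  ⟨fun h π h0 hπ => h π ⟨h0, hπ⟩, fun h π hπ => h π hπ.1 hπ.2⟩

theorem releaseOn_iff {A₁ A₂ : Conf P Γ → Prop} {π : ℕ → Option (Conf P Γ)} :
    ReleaseOn A₁ A₂ π ↔ ¬ ∃ i, ¬ Holds A₂ (π i) ∧ ∀ j < i, ¬ Holds A₁ (π j) := by
  simp only [ReleaseOn, not_exists, not_and, not_forall, not_not, exists_prop]

/-- Release is dual to until for the complements. The complements are taken over configurations
together with ⊥, so that both hold at ⊥; this is why the until operators were studied for relations
on optional configurations. -/
theorem sat_ER {b : Mode} {φ ψ : Formula AP} {c : Conf P Γ} : S.Sat lab (.ER b φ ψ) c ↔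
    ¬ AllUntil (S.PathStep b) (fun o => ¬ Holds (S.Sat lab φ) o)
      (fun o => ¬ Holds (S.Sat lab ψ) o) (some c) := by
  simp only [Sat, releaseOn_iff, AllUntil, not_forall, IsPath, PathStep]
  exact ⟨fun ⟨π, h, h'⟩ => ⟨π, h.1, h.2, h'⟩, fun ⟨π, h, h', h''⟩ => ⟨π, ⟨h, h'⟩, h''⟩⟩

theorem sat_AR {b : Mode} {φ ψ : Formula AP} {c : Conf P Γ} : S.Sat lab (.AR b φ ψ) c ↔
    ¬ SomeUntil (S.PathStep b) (fun o => ¬ Holds (S.Sat lab φ) o)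
      (fun o => ¬ Holds (S.Sat lab ψ) o) (some c) := by
  constructor
  · rintro h ⟨π, h0, hπ, hi⟩
    exact releaseOn_iff.1 (h π ⟨h0, hπ⟩) hi
  · intro h π hπ
    exact releaseOn_iff.2 fun hi => h ⟨π, hπ.1, hπ.2, hi⟩

theorem next_g_iff {J X : Conf P Γ → Prop} {c : Conf P Γ} :
    (∃ o, S.Next J .g c o ∧ Holds X o) ↔ ∃ d, S.Tr c d ∧ J d ∧ X d := by
  constructor
  · rintro ⟨o, ⟨γ, w, o', hc, ⟨hr, hp, hγ, hJ⟩, rfl⟩, hX⟩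
    refine ⟨_, ⟨_, step_iff.2 ⟨_, hr, w, rfl, ?_, rfl⟩⟩, hJ, hX⟩
    rw [hp, hγ, ← hc]
  · rintro ⟨d, ⟨a, ha⟩, hJ, hX⟩
    obtain ⟨r, hr, w, -, rfl, rfl⟩ := step_iff.1 ha
    exact ⟨_, ⟨_, _, _, rfl, .glob hr rfl rfl hJ, rfl⟩, hX⟩

/-- The properties are closed under their evaluation steps. -/
theorem sem_step {C : Option (Formula AP)} (hC : ctag C ≠ 2 ∧ ctag C ≠ 3) (c : Conf P Γ) :
    Imp (10 ≤ ctag C) (S.Phi lab C (S.Sem lab C) c) (S.Sem lab C c) := by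
  rcases C with _ | φ
  · refine ⟨fun _ h => ?_, fun h => absurd (by simp [ctag]) h⟩
    simp only [Phi, cond, ctag, cmode, next_g_iff]
    obtain ⟨d, hd, hd'⟩ := Alive.step h
    exact ⟨d, hd, hd', hd'⟩
  · cases φ with
    | atom e => simp [ctag, Formula.tag] at hC
    | natom e => simp [ctag, Formula.tag] at hC
    | EU b φ ψ =>
      refine ⟨fun h => absurd h (by simp [ctag, Formula.tag]), fun _ h => ?_⟩
      simp [Phi, cond, ctag, cmode, Formula.tag, Formula.mode, Formula.left, Formula.right,
        next_iff, Sem] at h ⊢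
      rw [sat_EU]
      refine .of_step (alive_some.2 h.1) ?_
      rcases h.2 with h | ⟨h, o, ho, ho'⟩
      · exact .inl h
      · refine .inr ⟨h, o, .inl ⟨_, rfl, ho⟩, ?_⟩
        cases o with
        | none => exact ho'.elim
        | some d => exact sat_EU.1 ho'
    | AU b φ ψ =>
      refine ⟨fun h => absurd h (by simp [ctag, Formula.tag]), fun _ h => ?_⟩
      simp [Phi, cond, ctag, cmode, Formula.tag, Formula.mode, Formula.left, Formula.right,
        next_iff, Sem] at h ⊢
      rw [sat_AU]
      refine .of_step ?_
      rcases h with h | h | ⟨h, h'⟩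
      · exact .inl (mt alive_some.1 h)
      · exact .inr (.inl h)
      · refine .inr (.inr ⟨h, ?_⟩)
        rintro o (⟨d, hd, ho⟩ | ⟨h, -⟩)
        · cases hd
          have := h' o ho
          cases o with
          | none => exact this.elim
          | some d => exact sat_AU.1 this
        · simp at h
    | ER b φ ψ =>
      refine ⟨fun _ => ?_, fun h => absurd (by simp [ctag, Formula.tag]) h⟩
      simp [Phi, cond, ctag, cmode, Formula.tag, Formula.mode, Formula.left, Formula.right,
        next_iff, Sem]
      rw [sat_ER]
      intro h
      by_contra hn
      refine h (.of_step ?_)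
      by_cases h1 : S.Inf c
      · by_cases h2 : S.Sat lab ψ c
        · refine .inr (.inr ⟨fun h3 => hn ⟨h1, h2, .inl h3⟩, ?_⟩)
          rintro o (⟨d, hd, ho⟩ | ⟨h, -⟩)
          · cases hd
            cases o with
            -- At ⊥ the second operand fails, so the dual until is fulfilled at once.
            | none => exact .of_step (.inr (.inl id))
            | some d =>
              by_contra hd
              exact hn ⟨h1, h2, .inr ⟨_, ho, sat_ER.2 hd⟩⟩
          · simp at h
        · exact .inr (.inl h2)
      · exact .inl (mt alive_some.1 h1)
    | AR b φ ψ =>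
      refine ⟨fun _ => ?_, fun h => absurd (by simp [ctag, Formula.tag]) h⟩
      simp [Phi, cond, ctag, cmode, Formula.tag, Formula.mode, Formula.left, Formula.right,
        next_iff, Sem]
      rw [sat_AR]
      intro h
      by_cases h1 : S.Inf c
      · right
        refine ⟨?_, ?_⟩
        · by_contra h2
          exact h (.of_step (alive_some.2 h1) (.inl h2))
        · by_contra h2
          push Not at h2
          obtain ⟨h2, o, ho, ho'⟩ := h2
          refine h (.of_step (alive_some.2 h1) (.inr ⟨h2, o, .inl ⟨_, rfl, ho⟩, ?_⟩))
          cases o with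
          | none => exact .of_step (alive_none b) (.inl id)
          | some d =>
            by_contra hd
            exact ho' (sat_AR.2 hd)
      · exact .inl h1
    | _ =>
      refine ⟨fun h => absurd h (by simp [ctag, Formula.tag]), fun _ h => ?_⟩
      simp [Phi, cond, ctag, cmode, Formula.tag, Formula.mode, Formula.left, Formula.right,
        next_iff, Sem, Sat] at h ⊢ <;> exact h

/-- The properties are extremal among those that are closed under the evaluation steps. -/
theorem sem_least {C : Option (Formula AP)} (hC : ctag C ≠ 2 ∧ ctag C ≠ 3) {X : Conf P Γ → Prop}
    (hX : ∀ c, Imp (10 ≤ ctag C) (S.Phi lab C X c) (X c)) (c : Conf P Γ) :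
    Imp (10 ≤ ctag C) (S.Sem lab C c) (X c) := by
  rcases C with _ | φ
  · refine ⟨fun _ h => ?_, fun h => absurd (by simp [ctag]) h⟩
    refine alive_of_post X (fun d hd => ?_) h
    have := (hX d).1 (by simp [ctag]) hd
    simp only [Phi, cond, ctag, cmode, next_g_iff] at this
    obtain ⟨e, he, he', -⟩ := this
    exact ⟨e, he, by simpa using he'⟩
  · cases φ with
    | atom e => simp [ctag, Formula.tag] at hC
    | natom e => simp [ctag, Formula.tag] at hC
    | EU b φ ψ =>
      refine ⟨fun h => absurd h (by simp [ctag, Formula.tag]), fun hp h => ?_⟩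
      have hX := fun c => (hX c).2 hp
      simp [Phi, cond, ctag, cmode, Formula.tag, Formula.mode, Formula.left, Formula.right,
        next_iff, Sem] at h hX
      rw [sat_EU] at h
      refine SomeUntil.least (Holds X) ?_ h
      rintro (_ | d) ha h
      · rcases h with h | h
        exacts [h.elim, h.1.elim]
      · refine hX d.1 d.2 (alive_some.1 ha) ?_
        rcases h with h | ⟨h, o, (⟨e, he, ho⟩ | ⟨h', -⟩), ho'⟩
        · exact .inl h
        · cases he
          exact .inr ⟨h, o, ho, ho'⟩
        · simp at h'
    | AU b φ ψ =>
      refine ⟨fun h => absurd h (by simp [ctag, Formula.tag]), fun hp h => ?_⟩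
      have hX := fun c => (hX c).2 hp
      simp [Phi, cond, ctag, cmode, Formula.tag, Formula.mode, Formula.left, Formula.right,
        next_iff, Sem] at h hX
      rw [sat_AU] at h
      refine AllUntil.least (Holds X) ?_ h
      rintro (_ | d) h
      -- No clause can put ⊥ into the until: it has an infinite path and satisfies neither operand.
      · rcases h with h | h | h
        exacts [(h (alive_none b)).elim, h.elim, h.1.elim]
      · refine hX d.1 d.2 ?_
        rcases h with h | h | ⟨h, h'⟩
        · exact .inl (mt alive_some.2 h)
        · exact .inr (.inl h)
        · exact .inr (.inr ⟨h, fun o ho => h' o (.inl ⟨d, rfl, ho⟩)⟩)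
    | ER b φ ψ =>
      refine ⟨fun hp h => ?_, fun h => absurd (by simp [ctag, Formula.tag]) h⟩
      have hX := fun c => (hX c).1 hp
      simp [Phi, cond, ctag, cmode, Formula.tag, Formula.mode, Formula.left, Formula.right,
        next_iff, Sem] at hX ⊢
      rw [sat_ER]
      intro hn
      refine AllUntil.least (fun o => ¬ Holds X o) ?_ hn h
      rintro (_ | d) h hd
      · exact hd
      · obtain ⟨h1, h2, h3⟩ := hX d.1 d.2 hd
        rcases h with h | h | ⟨h, h'⟩
        · exact h (alive_some.2 h1)
        · exact h h2
        · rcases h3 with h3 | ⟨o, ho, ho'⟩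
          · exact h h3
          · exact h' o (.inl ⟨d, rfl, ho⟩) ho'
    | AR b φ ψ =>
      refine ⟨fun hp h => ?_, fun h => absurd (by simp [ctag, Formula.tag]) h⟩
      have hX := fun c => (hX c).1 hp
      simp [Phi, cond, ctag, cmode, Formula.tag, Formula.mode, Formula.left, Formula.right,
        next_iff, Sem] at hX ⊢
      rw [sat_AR]
      intro hn
      refine SomeUntil.least (fun o => ¬ Holds X o) ?_ hn h
      rintro (_ | d) ha h hd
      · exact hd
      · rcases hX d.1 d.2 hd with h1 | ⟨h2, h3⟩
        · exact h1 (alive_some.1 ha)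
        · rcases h with h | ⟨h, o, (⟨e, he, ho⟩ | ⟨h', -⟩), ho'⟩
          · exact h h2
          · cases he
            rcases h3 with h3 | h3
            · exact h h3
            · exact ho' (h3 o ho)
          · simp at h'
    | _ =>
      refine ⟨fun h => absurd h (by simp [ctag, Formula.tag]), fun hp h => ?_⟩
      have hX := (hX c).2 hp
      simp [Phi, cond, ctag, cmode, Formula.tag, Formula.mode, Formula.left, Formula.right,
        next_iff, Sem, Sat] at h hX <;> first
        | exact hX h
        | exact hX
        | exact hX h.1 h.2
        | exact h.elim fun o ho => hX o ho.1 ho.2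

/-- The evaluation steps are monotone. -/
theorem phi_mono {C : Option (Formula AP)} {X X' : Conf P Γ → Prop} {pol : Prop}
    (h : ∀ c, Imp pol (X c) (X' c)) (c : Conf P Γ) :
    Imp pol (S.Phi lab C X c) (S.Phi lab C X' c) := by
  have key : ∀ {X X' : Conf P Γ → Prop}, (∀ c, X c → X' c) →
      S.Phi lab C X c → S.Phi lab C X' c := by
    intro X X' h
    rcases C with _ | φ
    -- Here the approximation also enters through `J`. The mode is global and only the existential
    -- part is used, in which `J` occurs positively.
    · simp only [Phi, cond, ctag, cmode, next_g_iff]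
      simp
      exact fun p w hd hX => ⟨p, w, hd, h _ hX⟩
    · simp only [Phi, reduceCtorEq, if_false]
      refine cond_mono ?_ ?_
      · rintro ⟨o, ho, h'⟩
        refine ⟨o, ho, ?_⟩
        cases o with
        | none => exact h'
        | some d =>
          simp only [Holds] at h' ⊢
          split_ifs at h' ⊢
          exacts [h d h', h']
      · intro h' o ho
        have := h' o ho
        cases o with
        | none => exact this
        | some d =>
          simp only [Holds] at this ⊢
          split_ifs at this ⊢
          exacts [h d this, this]
  exact ⟨fun hp => key fun c => (h c).1 hp, fun hp => key fun c => (h c).2 hp⟩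

end PDS

end Fix

/-! ### Tables

The type of a stack content is a number whose binary digits tell which properties hold for it.
A table maps a letter `γ` and the type of `w` to the type of `γ w`. -/

/-- Tables. -/
abbrev Tab : Type := ℕ → ℕ → ℕ

/-- The type of `u w`, where `T` is the type of `w`. -/
def ev {g : ℕ} (t : Tab) (u : List (Fin g)) (T : ℕ) : ℕ := u.foldr (fun γ U => t γ U) T

@[simp] theorem ev_nil {g : ℕ} (t : Tab) (T : ℕ) : ev t ([] : List (Fin g)) T = T := rfl

@[simp] theorem ev_cons {g : ℕ} (t : Tab) (γ : Fin g) (u : List (Fin g)) (T : ℕ) :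
    ev t (γ :: u) T = t γ (ev t u T) := rfl

theorem ev_append {g : ℕ} (t : Tab) (u v : List (Fin g)) (T : ℕ) :
    ev t (u ++ v) T = ev t u (ev t v T) := by
  simp [ev, List.foldr_append]

/-- Set the digit `b` of an entry. -/
def Tab.setBit (t : Tab) (γ T b : ℕ) : Tab :=
  fun γ' T' => if γ' = γ ∧ T' = T then t γ T ||| 2 ^ b else t γ' T'

theorem Tab.testBit_setBit (t : Tab) (γ T b γ' T' b' : ℕ) :
    (t.setBit γ T b γ' T').testBit b' =
      (decide (γ' = γ ∧ T' = T ∧ b' = b) || (t γ' T').testBit b') := by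
  unfold Tab.setBit
  split_ifs with h
  · obtain ⟨rfl, rfl⟩ := h
    rw [Nat.testBit_or, Nat.testBit_two_pow, Bool.or_comm]
    simp [eq_comm]
  · have : ¬ (γ' = γ ∧ T' = T ∧ b' = b) := fun h' => h ⟨h'.1, h'.2.1⟩
    rw [decide_eq_false this, Bool.false_or]

theorem Tab.setBit_eq {t : Tab} {γ T b : ℕ} (h : t.setBit γ T b = t) :
    (t γ T).testBit b = true := by
  have := t.testBit_setBit γ T b γ T b
  rw [h] at this
  simpa using this

/-- All entries of the first `g` rows have at most `N` digits. -/
def Tab.Bdd (t : Tab) (g N : ℕ) : Prop := ∀ γ < g, ∀ T < 2 ^ N, t γ T < 2 ^ N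

theorem Tab.Bdd.setBit {t : Tab} {g N γ T b : ℕ} (h : t.Bdd g N) (hb : b < N) :
    (t.setBit γ T b).Bdd g N := by
  intro γ' hγ T' hT
  unfold Tab.setBit
  split_ifs with h'
  · obtain ⟨rfl, rfl⟩ := h'
    exact Nat.or_lt_two_pow (h _ hγ _ hT) (Nat.pow_lt_pow_right (by norm_num) hb)
  · exact h _ hγ _ hT

theorem Tab.Bdd.ev_lt {t : Tab} {g g' N T : ℕ} (h : t.Bdd g' N) (hg : g ≤ g') (u : List (Fin g))
    (hT : T < 2 ^ N) : ev t u T < 2 ^ N := by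
  induction u with
  | nil => exact hT
  | cons γ u ih => exact h _ (by omega) _ ih

/-! ### Popping -/

section Pop

variable {nP nΓ : ℕ} {S : PDS (Fin nP) (Fin nΓ)}

/-- The digit for the location `q` reached by a step of kind `a`. -/
def lastBit (nP : ℕ) (a : Act) (q : ℕ) : ℕ :=
  match a with
  | .ret => nP + q
  | _ => q

theorem lastBit_inj {a a' : Act} {q q' : ℕ} (hq : q < nP) (hq' : q' < nP)
    (h : lastBit nP a q = lastBit nP a' q') : q = q' ∧ (a = .ret ↔ a' = .ret) := by
  cases a <;> cases a' <;> simp [lastBit] at h ⊢ <;> omega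

variable (S) in
/-- From a configuration reached by a step of kind `a`, the empty stack can be reached with a
location in `Y`. -/
inductive Rch (Y : ℕ → Prop) : Act → Conf (Fin nP) (Fin nΓ) → Prop
  | base {a} {q : Fin nP} (h : Y (lastBit nP a q)) : Rch Y a (q, [])
  | step {a b c d} (h : S.Step b c d) (h' : Rch Y b d) : Rch Y a c

/-- A computation that consumes the part above `w` continues with `w`. The kind of the last step is
handed over, because it is still the last step when `w` is empty. -/
theorem Rch.append {Y Y' : ℕ → Prop} {w : List (Fin nΓ)}
    (hY : ∀ a (q : Fin nP), Y (lastBit nP a q) → Rch S Y' a (q, w)) {a : Act}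
    {c : Conf (Fin nP) (Fin nΓ)} (h : Rch S Y a c) : Rch S Y' a (c.1, c.2 ++ w) := by
  induction h with
  | base h => exact hY _ _ h
  | step h _ ih => exact .step (h.lift w) ih

/-- The kind `a` with which the search begins is irrelevant: the stack is not empty, so at least one
further step is taken and it overrides `a`. -/
theorem pop_iff {ret : Prop} {b : Act} (hb : b = .ret ↔ ret) {a : Act} {q q' : Fin nP}
    {γ : Fin nΓ} :
    S.Pop ret q γ q' ↔ Rch S (fun j => j = lastBit nP b q') a (q, [γ]) := by
  constructor
  · rintro ⟨d, a', hr, hs, ha⟩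
    suffices ∀ e, Relation.ReflTransGen S.Tr e d → ∀ a,
      Rch S (fun j => j = lastBit nP b q') a e from this _ hr a
    intro e he
    induction he using Relation.ReflTransGen.head_induction_on with
    | refl =>
      refine fun a => .step hs (.base ?_)
      cases a' <;> cases b <;> simp_all [lastBit]
    | head h _ ih =>
      obtain ⟨a'', h⟩ := h
      exact fun a => .step h (ih a'')
  · have key : ∀ {a} {c : Conf (Fin nP) (Fin nΓ)}, Rch S (fun j => j = lastBit nP b q') a c →
        (c = (q', []) ∧ (a = .ret ↔ ret)) ∨ ∃ d a', Relation.ReflTransGen S.Tr c d ∧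
          S.Step a' d (q', []) ∧ (a' = .ret ↔ ret) := by
      intro a c h
      induction h with
      | base h =>
        obtain ⟨h, h'⟩ := lastBit_inj (Fin.is_lt _) (Fin.is_lt _) h
        exact .inl ⟨by rw [Fin.ext h], h'.trans hb⟩
      | @step a a' c d h _ ih =>
        rcases ih with ⟨rfl, ih⟩ | ⟨e, a'', h1, h2, h3⟩
        · exact .inr ⟨_, _, .refl, h, ih⟩
        · exact .inr ⟨_, _, .head ⟨_, h⟩ h1, h2, h3⟩
    intro h
    rcases key h with ⟨h, -⟩ | h
    · simp at h
    · exact h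

/-- The rows of a table after the first `g + 1`. -/
def Tab.low (t : Tab) (g : ℕ) : Tab := fun γ => t (g + 1 + γ)

/-- What is true of the second half of a table during the computation of the popping relation. -/
structure PopSound (S : PDS (Fin nP) (Fin nΓ)) (N : ℕ) (t : Tab) : Prop where
  sound : ∀ (γ : Fin nΓ) (T : ℕ), T < 2 ^ N → ∀ (q : Fin nP),
    (t.low nΓ γ T).testBit q = true → Rch S (fun j => T.testBit j = true) .int (q, [γ])
  eq : ∀ (γ T : ℕ) (q : Fin nP),
    (t.low nΓ γ T).testBit (nP + q) = (t.low nΓ γ T).testBit q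

/-- Some rule for `⟨p, γ⟩` leads to a configuration from which the empty stack is reached. -/
def popCond (S : PDS (Fin nP) (Fin nΓ)) (t : Tab) (γ T p : ℕ) : Prop :=
  ∃ r ∈ S.Δ, (r.srcP : ℕ) = p ∧ (r.srcΓ : ℕ) = γ ∧
    (ev (t.low nΓ) r.word T).testBit (lastBit nP r.act r.tgt) = true

open Classical in
/-- The elementary step of the computation of the popping relation. -/
noncomputable def popUpd (S : PDS (Fin nP) (Fin nΓ)) (t : Tab) (γ T p : ℕ) : Tab :=
  if popCond S t γ T p then (t.setBit (nΓ + 1 + γ) T p).setBit (nΓ + 1 + γ) T (nP + p) else t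

/-- Folding the table over a word composes predicate transformers: the set obtained for the lower
part of the word serves as the set of admissible final digits for the symbol above it. -/
theorem PopSound.rch {t : Tab} {N : ℕ} (h : PopSound S N t) (hb : t.Bdd (2 * nΓ + 2) N) {T : ℕ}
    (hT : T < 2 ^ N) (u : List (Fin nΓ)) : ∀ (a : Act) (q : Fin nP),
    (ev (t.low nΓ) u T).testBit (lastBit nP a q) = true →
      Rch S (fun j => T.testBit j = true) a (q, u) := by
  induction u with
  | nil => exact fun a q hq => .base hq
  | cons γ u ih =>
    intro a q hq
    have hlt : ev (t.low nΓ) u T < 2 ^ N := by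
      clear ih hq
      induction u with
      | nil => exact hT
      | cons γ u ih => exact hb _ (by omega) _ ih
    -- While a symbol is left, the kind of the previous step does not matter; so the two digits of a
    -- location agree in every entry, and they need to be told apart only in the target set.
    have hq' : (t.low nΓ γ (ev (t.low nΓ) u T)).testBit q = true := by
      cases a <;> simp only [lastBit, ev_cons] at hq
      · exact hq
      · rwa [h.eq] at hq
      · exact hq
    have := (h.sound γ _ hlt q hq').append (w := u) ih
    cases this with | step h h' => exact .step h h'

theorem PopSound.upd {t : Tab} {N γ T p : ℕ} (h : PopSound S N t) (hb : t.Bdd (2 * nΓ + 2) N)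
    (hT : T < 2 ^ N) (hp : p < nP) : PopSound S N (popUpd S t γ T p) := by
  unfold popUpd
  split_ifs with hc
  · refine ⟨fun γ' T' hT' q hq => ?_, fun γ' T' q => ?_⟩
    · simp only [Tab.low, Tab.testBit_setBit, Bool.or_eq_true, decide_eq_true_eq] at hq
      rcases hq with hq | hq | hq
      -- The second digit `nP + p` that was set is not the digit of a location `q < nP`.
      · omega
      · obtain ⟨hγ, rfl, rfl⟩ := hq
        obtain ⟨r, hr, hrp, hrγ, hbit⟩ := hc
        refine .step (PDS.step_iff.2 ⟨r, hr, [], rfl, ?_, rfl⟩) ?_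
        · rw [Prod.mk.injEq, List.cons.injEq]
          exact ⟨Fin.ext hrp.symm, Fin.ext (by omega), rfl⟩
        · rw [List.append_nil]
          exact h.rch hb hT _ _ _ hbit
      · exact h.sound γ' T' hT' q hq
    · have := h.eq γ' T' q
      simp only [Tab.low] at this
      simp only [Tab.low, Tab.testBit_setBit, this]
      have hq := q.2
      rw [Bool.eq_iff_iff]
      simp only [Bool.or_eq_true, decide_eq_true_eq]
      constructor <;> rintro (h | h | h) <;> first | exact .inr (.inr h) | skip
      · exact .inr (.inl (by omega))
      · omega
      · omega
      · exact .inl (by omega)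
  · exact h

/-- Induction from the end of the computation: the rule of the first step witnesses `popCond` for
its left-hand side, and stability of the table means that the digits demanded by it are set. -/
theorem PopSound.complete {t : Tab} {N : ℕ} (h : PopSound S N t) (hb : t.Bdd (2 * nΓ + 2) N)
    (hc : ∀ γ T p, γ ≤ nΓ → T < 2 ^ N → p < nP → popUpd S t γ T p = t) {T : ℕ} (hT : T < 2 ^ N)
    {a : Act} {c : Conf (Fin nP) (Fin nΓ)} (hr : Rch S (fun j => T.testBit j = true) a c) :
    (ev (t.low nΓ) c.2 T).testBit (lastBit nP a c.1) = true := by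
  have hlt : ∀ u : List (Fin nΓ), ev (t.low nΓ) u T < 2 ^ N := by
    intro u
    induction u with
    | nil => exact hT
    | cons γ u ih => exact hb _ (by omega) _ ih
  induction hr with
  | base h => exact h
  | step hs _ ih =>
    rename_i a b c d _
    obtain ⟨r, hr, w, rfl, rfl, rfl⟩ := PDS.step_iff.1 hs
    rw [ev_append] at ih
    have hcond : popCond S t r.srcΓ (ev (t.low nΓ) w T) r.srcP := ⟨r, hr, rfl, rfl, ih⟩
    have hu := hc r.srcΓ (ev (t.low nΓ) w T) r.srcP (by omega) (hlt w) (by omega)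
    -- Setting both digits gives the table back unchanged, so reading the first of them tells that
    -- it was already there.
    have h1 := Tab.testBit_setBit (t.setBit (nΓ + 1 + r.srcΓ) (ev (t.low nΓ) w T) r.srcP)
      (nΓ + 1 + r.srcΓ) (ev (t.low nΓ) w T) (nP + r.srcP) (nΓ + 1 + r.srcΓ) (ev (t.low nΓ) w T)
      r.srcP
    rw [popUpd, if_pos hcond] at hu
    rw [hu, Tab.testBit_setBit] at h1
    have h2 : (t.low nΓ r.srcΓ (ev (t.low nΓ) w T)).testBit r.srcP = true := by
      rw [Tab.low, h1]
      simp
    rw [ev_cons]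
    cases a <;> simp only [lastBit]
    · exact h2
    · rwa [h.eq]
    · exact h2

/-- The table decides which symbols are popped. -/
theorem PopSound.pop_iff {t : Tab} {N : ℕ} (h : PopSound S N t) (hb : t.Bdd (2 * nΓ + 2) N)
    (hc : ∀ γ T p, γ ≤ nΓ → T < 2 ^ N → p < nP → popUpd S t γ T p = t) (q q' : Fin nP)
    (γ : Fin nΓ) (b : Act) (hN : lastBit nP b q' < N) :
    (t (nΓ + 1 + γ) (2 ^ lastBit nP b q')).testBit q = true ↔ S.Pop (b = .ret) q γ q' := by
  rw [BCARET.pop_iff (b := b) Iff.rfl (a := .int)]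
  have hT : 2 ^ lastBit nP b q' < 2 ^ N := Nat.pow_lt_pow_right (by norm_num) hN
  -- A single target corresponds to the column whose number is a power of two.
  have hY : (fun j => j = lastBit nP b q') =
      fun j => (2 ^ lastBit nP b (q' : ℕ)).testBit j = true := by
    funext j
    rw [Nat.testBit_two_pow]
    simp [eq_comm]
  rw [hY]
  constructor
  · exact fun hq => h.sound γ _ hT q hq
  · exact fun hr => h.complete hb hc hT hr

end Pop

/-! ### Evaluation of one property -/

open PDS

/-- Each argument has to agree only for the operators that make use of it. Operands of atoms or of
the run property, and right operands of nexttime operators, do not exist and must not be asked for.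
-/
theorem cond_congr {tag : ℕ} {x₁ x₂ inf e al x₁' x₂' inf' e' al' : Prop}
    (h₁ : 4 ≤ tag → tag ≤ 11 → (x₁ ↔ x₁'))
    (h₂ : 4 ≤ tag → tag ≤ 11 → tag ≠ 6 → tag ≠ 7 → (x₂ ↔ x₂'))
    (hi : tag ≤ 11 → (inf ↔ inf'))
    (he : 6 ≤ tag → tag ≤ 12 → (e ↔ e')) (ha : 6 ≤ tag → tag ≤ 11 → (al ↔ al')) :
    cond tag x₁ x₂ inf e al ↔ cond tag x₁' x₂' inf' e' al' := by
  unfold cond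
  split <;> simp_all

section Stage

variable {nP nΓ nA : ℕ}

/-- How properties and automaton states are laid out in the digits of types: property number `i`
is `comp i`, its digit for the location `p` is `pos i p`, the right operand of property number `i`
is property number `rc i`, and `acc b w` tells whether the automaton state with digit `b` accepts
`w`. -/
structure Layout (S : PDS (Fin nP) (Fin nΓ)) (lab : Fin nA → Set (Conf (Fin nP) (Fin nΓ)))
    (F N : ℕ) (comp : ℕ → Option (Formula (Fin nA))) (rc : ℕ → ℕ) (pos : ℕ → ℕ → ℕ)
    (acc : ℕ → List (Fin nΓ) → Prop) : Prop where
  last : comp F = none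
  before : ∀ i < F, ∃ φ, comp i = some φ
  left : ∀ i < F, ∀ φ, comp i = some φ → 4 ≤ φ.tag → i + 1 < F ∧ comp (i + 1) = some φ.left
  right : ∀ i < F, ∀ φ, comp i = some φ → 4 ≤ φ.tag → φ.tag ≠ 6 → φ.tag ≠ 7 →
    i < rc i ∧ rc i < F ∧ comp (rc i) = some φ.right
  pos_eq : ∀ i ≤ F, ctag (comp i) ≠ 2 ∧ ctag (comp i) ≠ 3 → ∀ p < nP, pos i p = i * nP + p
  atom : ∀ i ≤ F, ¬ (ctag (comp i) ≠ 2 ∧ ctag (comp i) ≠ 3) → ∀ p : Fin nP,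
    (F + 1) * nP ≤ pos i p ∧ pos i p < N ∧ ∀ w, acc (pos i p) w ↔ S.Sem lab (comp i) (p, w)
  le : (F + 1) * nP ≤ N

/-- The property number `i` holds at the location `p`, according to the type `T`. -/
def Truth (comp : ℕ → Option (Formula (Fin nA))) (pos : ℕ → ℕ → ℕ) (i p T : ℕ) : Prop :=
  T.testBit (pos i p) = true ↔ ¬ 10 ≤ ctag (comp i)

/-- Extends a property to `⊥`. -/
def HoldsAt {α : Type} (A : α → Prop) : Option α → Prop
  | none => False
  | some x => A x

/-- The property number that a temporal operator asks for at the successors. -/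
def cnt (comp : ℕ → Option (Formula (Fin nA))) (i : ℕ) : ℕ :=
  if 8 ≤ ctag (comp i) then i else i + 1

/-- The successors according to the table. -/
def TSucc (S : PDS (Fin nP) (Fin nΓ)) (comp : ℕ → Option (Formula (Fin nA))) (pos : ℕ → ℕ → ℕ)
    (F i : ℕ) (t : Tab) (γ T p : ℕ) (o : Option (Fin nP × List (Fin nΓ))) : Prop :=
  ∃ (p' : Fin nP) (γ' : Fin nΓ), (p' : ℕ) = p ∧ (γ' : ℕ) = γ ∧
    S.LSucc (fun x => Truth comp pos F x.1 (ev t x.2 T)) p' γ' (cmode (comp i)) o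

/-- The value of the property number `i` in one step of the evaluation with a table. -/
def tval (S : PDS (Fin nP) (Fin nΓ)) (comp : ℕ → Option (Formula (Fin nA))) (rc : ℕ → ℕ)
    (pos : ℕ → ℕ → ℕ) (F i : ℕ) (t : Tab) (γ T p : ℕ) : Prop :=
  cond (ctag (comp i)) (Truth comp pos (i + 1) p (t γ T)) (Truth comp pos (rc i) p (t γ T))
    (Truth comp pos F p (t γ T))
    (∃ o, TSucc S comp pos F i t γ T p o ∧
      HoldsAt (fun x => Truth comp pos (cnt comp i) x.1 (ev t x.2 T)) o)
    (∀ o, TSucc S comp pos F i t γ T p o →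
      HoldsAt (fun x => Truth comp pos (cnt comp i) x.1 (ev t x.2 T)) o)

open Classical in
/-- The elementary step of the evaluation. -/
noncomputable def upd (S : PDS (Fin nP) (Fin nΓ)) (comp : ℕ → Option (Formula (Fin nA)))
    (rc : ℕ → ℕ) (pos : ℕ → ℕ → ℕ) (F i : ℕ) (t : Tab) (γ T p : ℕ) : Tab :=
  if (tval S comp rc pos F i t γ T p ↔ ¬ 10 ≤ ctag (comp i)) then t.setBit γ T (pos i p) else t

/-- The type `T` tells the truth about the stack content `w` and the properties from number `i` on. -/
structure Right (S : PDS (Fin nP) (Fin nΓ)) (lab : Fin nA → Set (Conf (Fin nP) (Fin nΓ)))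
    (F N : ℕ) (comp : ℕ → Option (Formula (Fin nA))) (pos : ℕ → ℕ → ℕ)
    (acc : ℕ → List (Fin nΓ) → Prop) (i T : ℕ) (w : List (Fin nΓ)) : Prop where
  truth : ∀ j, i ≤ j → j ≤ F → ∀ p : Fin nP, Truth comp pos j p T ↔ S.Sem lab (comp j) (p, w)
  acc : ∀ b, (F + 1) * nP ≤ b → b < N → (T.testBit b = true ↔ acc b w)

/-- The table preserves truth of the properties from number `i` on. -/
structure TabOK (S : PDS (Fin nP) (Fin nΓ)) (lab : Fin nA → Set (Conf (Fin nP) (Fin nΓ)))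
    (F N : ℕ) (comp : ℕ → Option (Formula (Fin nA))) (pos : ℕ → ℕ → ℕ)
    (acc : ℕ → List (Fin nΓ) → Prop) (i : ℕ) (t : Tab) : Prop where
  cons : ∀ (γ : Fin nΓ) (T : ℕ) (w : List (Fin nΓ)), T < 2 ^ N →
    Right S lab F N comp pos acc i T w → Right S lab F N comp pos acc i (t γ T) (γ :: w)
  nil : Right S lab F N comp pos acc i (t nΓ 0) []

/-- What is true of the table during the evaluation of property number `i`. -/
structure StageInv (S : PDS (Fin nP) (Fin nΓ)) (lab : Fin nA → Set (Conf (Fin nP) (Fin nΓ)))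
    (F N : ℕ) (comp : ℕ → Option (Formula (Fin nA))) (pos : ℕ → ℕ → ℕ)
    (acc : ℕ → List (Fin nΓ) → Prop) (i : ℕ) (t : Tab) : Prop where
  ok : TabOK S lab F N comp pos acc (i + 1) t
  cons : ∀ (γ : Fin nΓ) (T : ℕ) (w : List (Fin nΓ)), T < 2 ^ N →
    Right S lab F N comp pos acc (i + 1) T w →
    (∀ p : Fin nP, Imp (10 ≤ ctag (comp i)) (Truth comp pos i p T) (S.Sem lab (comp i) (p, w))) →
    ∀ p : Fin nP, Imp (10 ≤ ctag (comp i)) (Truth comp pos i p (t γ T))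
      (S.Sem lab (comp i) (p, γ :: w))
  nil : ∀ p : Fin nP, Imp (10 ≤ ctag (comp i)) (Truth comp pos i p (t nΓ 0))
      (S.Sem lab (comp i) (p, []))

theorem Imp.trans {pol a b c : Prop} (h : Imp pol a b) (h' : Imp pol b c) : Imp pol a c :=
  ⟨fun hp hc => h.1 hp (h'.1 hp hc), fun hp ha => h'.2 hp (h.2 hp ha)⟩

theorem Imp.of_iff {pol a b : Prop} (h : a ↔ b) : Imp pol a b := ⟨fun _ => h.2, fun _ => h.1⟩

theorem Imp.antisymm {pol a b : Prop} (h : Imp pol a b) (h' : Imp pol b a) : a ↔ b := by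
  by_cases hp : pol
  · exact ⟨h'.1 hp, h.1 hp⟩
  · exact ⟨h.2 hp, h'.2 hp⟩

variable {S : PDS (Fin nP) (Fin nΓ)} {lab : Fin nA → Set (Conf (Fin nP) (Fin nΓ))}
  {F N : ℕ} {comp : ℕ → Option (Formula (Fin nA))} {rc : ℕ → ℕ} {pos : ℕ → ℕ → ℕ}
  {acc : ℕ → List (Fin nΓ) → Prop} {i : ℕ} {t : Tab}

theorem next_cons {J : Conf (Fin nP) (Fin nΓ) → Prop} {b : Mode} {p : Fin nP} {γ : Fin nΓ}
    {w : List (Fin nΓ)} {o : Option (Conf (Fin nP) (Fin nΓ))} : S.Next J b (p, γ :: w) o ↔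
      ∃ o', S.LSucc (fun x => J (x.1, x.2 ++ w)) p γ b o' ∧
        o = o'.map fun x => (x.1, x.2 ++ w) := by
  constructor
  · rintro ⟨γ, w, o', hc, h⟩
    cases hc
    exact ⟨o', h⟩
  · rintro ⟨o', h⟩
    exact ⟨γ, w, o', rfl, h⟩

/-- The truth about stack contents over `w` according to the table. -/
def Approx (S : PDS (Fin nP) (Fin nΓ)) (lab : Fin nA → Set (Conf (Fin nP) (Fin nΓ)))
    (comp : ℕ → Option (Formula (Fin nA))) (pos : ℕ → ℕ → ℕ) (i : ℕ) (t : Tab) (T : ℕ)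
    (w : List (Fin nΓ)) (c : Conf (Fin nP) (Fin nΓ)) : Prop :=
  (∃ u, c.2 = u ++ w ∧ Truth comp pos i c.1 (ev t u T)) ∨
    ((¬ ∃ u, c.2 = u ++ w) ∧ S.Sem lab (comp i) c)

theorem approx_append {T : ℕ} {w u : List (Fin nΓ)} {p : Fin nP} :
    Approx S lab comp pos i t T w (p, u ++ w) ↔ Truth comp pos i p (ev t u T) := by
  constructor
  · rintro (⟨u', h, h'⟩ | ⟨h, -⟩)
    · rwa [List.append_cancel_right h]
    · exact absurd ⟨u, rfl⟩ h
  · exact fun h => .inl ⟨u, rfl, h⟩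

theorem TabOK.ev {T : ℕ} {w : List (Fin nΓ)} (h : TabOK S lab F N comp pos acc i t)
    (hb : t.Bdd (2 * nΓ + 2) N) (hT : T < 2 ^ N) (hr : Right S lab F N comp pos acc i T w)
    (u : List (Fin nΓ)) : Right S lab F N comp pos acc i (ev t u T) (u ++ w) := by
  induction u with
  | nil => exact hr
  | cons γ u ih => exact h.cons γ _ _ (hb.ev_lt (by omega) u hT) ih

/-- One step of the evaluation with the table is one step of the evaluation of the property. -/
theorem tval_iff (L : Layout S lab F N comp rc pos acc) (hi : i ≤ F) {T : ℕ} {w : List (Fin nΓ)}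
    (h : TabOK S lab F N comp pos acc (i + 1) t) (hb : t.Bdd (2 * nΓ + 2) N) (hT : T < 2 ^ N)
    (hr : Right S lab F N comp pos acc (i + 1) T w) (γ : Fin nΓ) (u : List (Fin nΓ))
    (p : Fin nP) :
    tval S comp rc pos F i t γ (ev t u T) p ↔
      S.Phi lab (comp i) (Approx S lab comp pos i t T w) (p, γ :: (u ++ w)) := by
  have hru : ∀ v : List (Fin nΓ), Right S lab F N comp pos acc (i + 1) (BCARET.ev t v T) (v ++ w) :=
    h.ev hb hT hr
  have hru' : ∀ v : List (Fin nΓ), Right S lab F N comp pos acc (i + 1)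
      (BCARET.ev t v (BCARET.ev t u T)) (v ++ (u ++ w)) := fun v => by
    rw [← ev_append, ← List.append_assoc]
    exact hru _
  have hF : ctag (comp i) ≤ 11 → i < F := by
    intro h11
    rcases hi.lt_or_eq with h' | rfl
    · exact h'
    · rw [L.last] at h11
      simp [ctag] at h11
  -- the successors
  let J : Conf (Fin nP) (Fin nΓ) → Prop := fun d =>
    if comp i = none then Approx S lab comp pos i t T w d else S.Inf d
  -- For `i < F` the existence of runs, property number `F`, is already settled and the table gives
  -- the truth; for `i = F` it is the approximation that is being computed.
  have hJ : (fun x : Fin nP × List (Fin nΓ) => J (x.1, x.2 ++ (u ++ w))) =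
      fun x => Truth comp pos F x.1 (BCARET.ev t x.2 (BCARET.ev t u T)) := by
    funext x
    simp only [J]
    rcases hi.lt_or_eq with h' | rfl
    · obtain ⟨φ, hφ⟩ := L.before i h'
      rw [hφ, if_neg (by simp), eq_iff_iff, (hru' x.2).truth F h' le_rfl, L.last]
      rfl
    · rw [L.last, if_pos rfl, ← List.append_assoc, approx_append, ev_append]
  have hS : ∀ o, TSucc S comp pos F i t γ (BCARET.ev t u T) p o ↔
      S.LSucc (fun x => J (x.1, x.2 ++ (u ++ w))) p γ (cmode (comp i)) o := by
    intro o
    rw [hJ]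
    constructor
    · rintro ⟨p', γ', hp, hγ, h⟩
      rwa [Fin.ext hp, Fin.ext hγ] at h
    · exact fun h => ⟨p, γ, rfl, rfl, h⟩
  have hY : 6 ≤ ctag (comp i) → ∀ o, HoldsAt (fun x : Fin nP × List (Fin nΓ) =>
      Truth comp pos (cnt comp i) x.1 (BCARET.ev t x.2 (BCARET.ev t u T))) o ↔
      Holds (fun d => if 8 ≤ ctag (comp i) then Approx S lab comp pos i t T w d else
        ∃ φ ∈ comp i, S.Sat lab φ.left d) (o.map fun x => (x.1, x.2 ++ (u ++ w))) := by
    intro h6 o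
    cases o with
    | none => exact Iff.rfl
    | some x =>
      simp only [HoldsAt, Option.map_some, Holds, cnt]
      split_ifs with h8
      · rw [← List.append_assoc, approx_append, ev_append]
      · obtain ⟨φ, hφ⟩ := L.before i (hF (by omega))
        have hl := L.left i (hF (by omega)) φ hφ (by rw [hφ] at h6; exact (by decide : 4 ≤ 6).trans h6)
        rw [(hru' x.2).truth (i + 1) le_rfl hl.1.le, hl.2, hφ]
        simp [Sem]
  have hR := h.cons γ _ _ (hb.ev_lt (by omega) u hT) (hru u)
  refine cond_congr ?_ ?_ ?_ ?_ ?_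
  · intro h4 h11
    obtain ⟨φ, hφ⟩ := L.before i (hF h11)
    have hl := L.left i (hF h11) φ hφ (by rw [hφ] at h4; exact h4)
    rw [hR.truth (i + 1) le_rfl hl.1.le, hl.2, hφ]
    simp [Sem]
  · intro h4 h11 h6 h7
    obtain ⟨φ, hφ⟩ := L.before i (hF h11)
    rw [hφ] at h4 h6 h7
    have hl := L.right i (hF h11) φ hφ h4 h6 h7
    rw [hR.truth (rc i) hl.1 hl.2.1.le, hl.2.2, hφ]
    simp [Sem]
  · intro h11
    rw [hR.truth F (hF h11) le_rfl, L.last]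
    rfl
  · intro h6 _
    constructor
    · rintro ⟨o, ho, ho'⟩
      exact ⟨_, next_cons.2 ⟨o, (hS o).1 ho, rfl⟩, (hY h6 o).1 ho'⟩
    · rintro ⟨_, hn, ho'⟩
      obtain ⟨o, ho, rfl⟩ := next_cons.1 hn
      exact ⟨o, (hS o).2 ho, (hY h6 o).2 ho'⟩
  · intro h6 _
    constructor
    · rintro h _ hn
      obtain ⟨o, ho, rfl⟩ := next_cons.1 hn
      exact (hY h6 o).1 (h o ((hS o).2 ho))
    · intro h o ho
      exact (hY h6 o).2 (h _ (next_cons.2 ⟨o, (hS o).1 ho, rfl⟩))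

/-- The same for the empty stack. -/
theorem tval_nil_iff (L : Layout S lab F N comp rc pos acc) (hi : i ≤ F)
    (h : TabOK S lab F N comp pos acc (i + 1) t) (p : Fin nP) (X : Conf (Fin nP) (Fin nΓ) → Prop) :
    tval S comp rc pos F i t nΓ 0 p ↔ S.Phi lab (comp i) X (p, []) := by
  have hF : ctag (comp i) ≤ 11 → i < F := by
    intro h11
    rcases hi.lt_or_eq with h' | rfl
    · exact h'
    · rw [L.last] at h11
      simp [ctag] at h11
  have hR := h.nil
  -- The row `nΓ` stands for the empty stack; no letter has this number, so no rule applies.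
  have h1 : ∀ o, ¬ TSucc S comp pos F i t nΓ 0 p o := by
    rintro o ⟨p', γ', -, hγ, -⟩
    omega
  have h2 : ∀ J b o, ¬ S.Next J b (p, []) o := by
    rintro J b o ⟨γ, w, o', h, -⟩
    simp at h
  refine cond_congr ?_ ?_ ?_ ?_ ?_
  · intro h4 h11
    obtain ⟨φ, hφ⟩ := L.before i (hF h11)
    have hl := L.left i (hF h11) φ hφ (by rw [hφ] at h4; exact h4)
    rw [hR.truth (i + 1) le_rfl hl.1.le, hl.2, hφ]
    simp [Sem]
  · intro h4 h11 h6 h7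
    obtain ⟨φ, hφ⟩ := L.before i (hF h11)
    rw [hφ] at h4 h6 h7
    have hl := L.right i (hF h11) φ hφ h4 h6 h7
    rw [hR.truth (rc i) hl.1 hl.2.1.le, hl.2.2, hφ]
    simp [Sem]
  · intro h11
    rw [hR.truth F (hF h11) le_rfl, L.last]
    rfl
  · simp [h1, h2]
  · simp [h1, h2]

theorem Layout.pos_lt (L : Layout S lab F N comp rc pos acc) (hi : i ≤ F) {p : ℕ} (hp : p < nP) :
    pos i p < N := by
  by_cases h : ctag (comp i) ≠ 2 ∧ ctag (comp i) ≠ 3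
  · rw [L.pos_eq i hi h p hp]
    have := L.le
    nlinarith
  · exact (L.atom i hi h ⟨p, hp⟩).2.1

/-- The digits of evaluated properties form consecutive blocks of length `nP` below `(F + 1) * nP`,
whereas atoms share the digits of automaton states above. Only two atoms may have a digit in common,
and these are never set during an evaluation. -/
theorem Layout.pos_ne (L : Layout S lab F N comp rc pos acc) (hi : i ≤ F)
    (h : ctag (comp i) ≠ 2 ∧ ctag (comp i) ≠ 3) {p : ℕ} (hp : p < nP) {j q : ℕ} (hj : j ≤ F)
    (hq : q < nP) (hne : j ≠ i ∨ q ≠ p) : pos j q ≠ pos i p := by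
  rw [L.pos_eq i hi h p hp]
  by_cases h' : ctag (comp j) ≠ 2 ∧ ctag (comp j) ≠ 3
  · rw [L.pos_eq j hj h' q hq]
    rcases lt_trichotomy i j with hij | rfl | hij
    · have : (i + 1) * nP ≤ j * nP := Nat.mul_le_mul_right _ hij
      rw [Nat.add_mul] at this
      omega
    · omega
    · have : (j + 1) * nP ≤ i * nP := Nat.mul_le_mul_right _ hij
      rw [Nat.add_mul] at this
      omega
  · have h1 := (L.atom j hj h' ⟨q, hq⟩).1
    have : (i + 1) * nP ≤ (F + 1) * nP := Nat.mul_le_mul_right _ (by omega)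
    rw [Nat.add_mul i] at this
    simp only at h1
    omega

/-- Setting digits of property number `i` does not affect the other properties. -/
theorem right_congr (L : Layout S lab F N comp rc pos acc) (hi : i ≤ F)
    (h : ctag (comp i) ≠ 2 ∧ ctag (comp i) ≠ 3) {T T' : ℕ} {w : List (Fin nΓ)} {p : ℕ} (hp : p < nP)
    (hT : ∀ b, b ≠ pos i p → T'.testBit b = T.testBit b)
    (hr : Right S lab F N comp pos acc (i + 1) T w) :
    Right S lab F N comp pos acc (i + 1) T' w := by
  refine ⟨fun j hij hj q => ?_, fun b hb hb' => ?_⟩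
  · rw [Truth, hT _ (L.pos_ne hi h hp hj q.2 (.inl (by omega)))]
    exact hr.truth j hij hj q
  · rw [hT]
    · exact hr.acc b hb hb'
    · rw [L.pos_eq i hi h p hp]
      have : (i + 1) * nP ≤ (F + 1) * nP := Nat.mul_le_mul_right _ (by omega)
      rw [Nat.add_mul i] at this
      omega

/-- One-sided correctness passes from `w` to everything above `w`, one letter at a time; away from
`w` the approximation is exact by definition. -/
theorem approx_imp {T : ℕ} {w : List (Fin nΓ)} (h : StageInv S lab F N comp pos acc i t)
    (hb : t.Bdd (2 * nΓ + 2) N) (hT : T < 2 ^ N)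
    (hr : Right S lab F N comp pos acc (i + 1) T w)
    (hp : ∀ p : Fin nP, Imp (10 ≤ ctag (comp i)) (Truth comp pos i p T)
      (S.Sem lab (comp i) (p, w))) (c : Conf (Fin nP) (Fin nΓ)) :
    Imp (10 ≤ ctag (comp i)) (Approx S lab comp pos i t T w c) (S.Sem lab (comp i) c) := by
  by_cases hc : ∃ u, c.2 = u ++ w
  · obtain ⟨p, v⟩ := c
    obtain ⟨u, rfl⟩ : ∃ u, v = u ++ w := hc
    refine (Imp.of_iff approx_append).trans ?_
    induction u generalizing p with
    | nil => exact hp p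
    | cons γ u ih =>
      exact h.cons γ _ _ (hb.ev_lt (by omega) u hT) (h.ok.ev hb hT hr u) ih p
  · refine Imp.of_iff ⟨?_, fun h => .inr ⟨hc, h⟩⟩
    rintro (⟨u, h, -⟩ | ⟨-, h⟩)
    · exact absurd ⟨u, h⟩ hc
    · exact h

/-- A digit is set on account of one step of the operator applied to `Approx`. By monotonicity
`Approx` may be replaced by the true property, which is closed under the step. For atoms nothing is
ever set, since `cond` is false for them and they count as least fixed points. -/
theorem StageInv.upd (L : Layout S lab F N comp rc pos acc) (hi : i ≤ F)
    (h : StageInv S lab F N comp pos acc i t) (hb : t.Bdd (2 * nΓ + 2) N) {γ T p : ℕ}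
    (hT : T < 2 ^ N) (hp : p < nP) :
    StageInv S lab F N comp pos acc i (upd S comp rc pos F i t γ T p) := by
  by_cases hC : ctag (comp i) ≠ 2 ∧ ctag (comp i) ≠ 3
  swap
  · rwa [BCARET.upd, if_neg]
    have : ctag (comp i) = 2 ∨ ctag (comp i) = 3 := by omega
    rcases this with h | h <;> simp [tval, h, cond]
  rw [BCARET.upd]
  split_ifs with hv
  swap
  · exact h
  have hbit : ∀ γ' T' b, b ≠ pos i p →
      (t.setBit γ T (pos i p) γ' T').testBit b = (t γ' T').testBit b := by
    intro γ' T' b hb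
    rw [Tab.testBit_setBit, decide_eq_false (fun h => hb h.2.2), Bool.false_or]
  -- the digit that is set
  have hset : ∀ T : ℕ, Truth comp pos i p (t.setBit γ T (pos i p) γ T) ↔ ¬ 10 ≤ ctag (comp i) := by
    intro T
    rw [Truth, Tab.testBit_setBit]
    simp
  refine ⟨⟨fun γ' T' w hT' hr => ?_, ?_⟩, fun γ' T' w hT' hr hi' q => ?_, fun q => ?_⟩
  · exact right_congr L hi hC hp (hbit γ' T') (h.ok.cons γ' T' w hT' hr)
  · exact right_congr L hi hC hp (hbit _ _) h.ok.nil
  · by_cases hq : (γ' : ℕ) = γ ∧ T' = T ∧ (q : ℕ) = p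
    · obtain ⟨rfl, rfl, rfl⟩ := hq
      refine (Imp.of_iff ((hset T').trans hv.symm)).trans ?_
      have := tval_iff L hi h.ok hb hT hr γ' [] q
      rw [ev_nil, List.nil_append] at this
      exact (Imp.of_iff this).trans ((phi_mono (approx_imp h hb hT hr hi') _).trans (sem_step hC _))
    · rw [Truth, Tab.testBit_setBit, decide_eq_false, Bool.false_or]
      · exact h.cons γ' T' w hT' hr hi' q
      · rintro ⟨h1, h2, h3⟩
        exact L.pos_ne hi hC hp hi q.2 (.inr fun h3 => hq ⟨h1, h2, h3⟩) h3
  · by_cases hq : nΓ = γ ∧ 0 = T ∧ (q : ℕ) = p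
    · obtain ⟨rfl, rfl, rfl⟩ := hq
      refine (Imp.of_iff ((hset 0).trans hv.symm)).trans ?_
      exact (Imp.of_iff (tval_nil_iff L hi h.ok q (S.Sem lab (comp i)))).trans (sem_step hC _)
    · rw [Truth, Tab.testBit_setBit, decide_eq_false, Bool.false_or]
      · exact h.nil q
      · rintro ⟨h1, h2, h3⟩
        exact L.pos_ne hi hC hp hi q.2 (.inr fun h3 => hq ⟨h1, h2, h3⟩) h3

/-- When no elementary step changes the table any more, property number `i` is evaluated. -/
theorem StageInv.done (L : Layout S lab F N comp rc pos acc) (hi : i ≤ F)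
    (h : StageInv S lab F N comp pos acc i t) (hb : t.Bdd (2 * nΓ + 2) N)
    (hc : ∀ γ T p, γ ≤ nΓ → T < 2 ^ N → p < nP → BCARET.upd S comp rc pos F i t γ T p = t) :
    TabOK S lab F N comp pos acc i t := by
  suffices key : (∀ (γ : Fin nΓ) (T : ℕ) (w : List (Fin nΓ)), T < 2 ^ N →
      Right S lab F N comp pos acc i T w → ∀ p : Fin nP,
        Truth comp pos i p (t γ T) ↔ S.Sem lab (comp i) (p, γ :: w)) ∧
      ∀ p : Fin nP, Truth comp pos i p (t nΓ 0) ↔ S.Sem lab (comp i) (p, []) by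
    refine ⟨fun γ T w hT hr => ⟨fun j hij hj p => ?_, ?_⟩, ⟨fun j hij hj p => ?_, h.ok.nil.acc⟩⟩
    · rcases hij.lt_or_eq with hij | rfl
      · exact (h.ok.cons γ T w hT ⟨fun j hj => hr.truth j (by omega), hr.acc⟩).truth j hij hj p
      · exact key.1 γ T w hT hr p
    · exact (h.ok.cons γ T w hT ⟨fun j hj => hr.truth j (by omega), hr.acc⟩).acc
    · rcases hij.lt_or_eq with hij | rfl
      · exact h.ok.nil.truth j hij hj p
      · exact key.2 p
  by_cases hC : ctag (comp i) ≠ 2 ∧ ctag (comp i) ≠ 3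
  swap
  · have hpol : ¬ 10 ≤ ctag (comp i) := by omega
    have : ∀ (p : Fin nP) T, Truth comp pos i p T ↔ T.testBit (pos i p) = true := by
      intro p T
      simp [Truth, hpol]
    refine ⟨fun γ T w hT hr p => ?_, fun p => ?_⟩
    · obtain ⟨h1, h2, h3⟩ := L.atom i hi hC p
      rw [this, ← h3]
      exact (h.ok.cons γ T w hT ⟨fun j hj => hr.truth j (by omega), hr.acc⟩).acc _ h1 h2
    · obtain ⟨h1, h2, h3⟩ := L.atom i hi hC p
      rw [this, ← h3]
      exact h.ok.nil.acc _ h1 h2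
  -- If the value differs from the default of its polarity, stability says that the digit is set and
  -- entry and value agree; if it is the default, the implication in question is trivial.
  have hclosed : ∀ γ T (p : Fin nP), γ ≤ nΓ → T < 2 ^ N →
      Imp (10 ≤ ctag (comp i)) (tval S comp rc pos F i t γ T p) (Truth comp pos i p (t γ T)) := by
    intro γ T p hγ hT
    have := hc γ T p hγ hT p.2
    by_cases hv : (tval S comp rc pos F i t γ T p ↔ ¬ 10 ≤ ctag (comp i))
    · rw [BCARET.upd, if_pos hv] at this
      refine Imp.of_iff (hv.trans ?_)
      rw [Truth, Tab.setBit_eq this]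
      simp
    · refine ⟨fun hp _ => ?_, fun hp hv' => absurd (iff_of_true hv' hp) hv⟩
      by_contra hv'
      exact hv (iff_of_false hv' (not_not.2 hp))
  refine ⟨fun γ T w hT hr p => ?_, fun p => ?_⟩
  · have hr' : Right S lab F N comp pos acc (i + 1) T w := ⟨fun j hj => hr.truth j (by omega), hr.acc⟩
    have hi' : ∀ p : Fin nP, Truth comp pos i p T ↔ S.Sem lab (comp i) (p, w) :=
      fun p => hr.truth i le_rfl hi p
    have hA := approx_imp h hb hT hr' fun p => .of_iff (hi' p)
    refine Imp.antisymm (h.cons γ T w hT hr' (fun p => .of_iff (hi' p)) p) ?_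
    refine Imp.trans (sem_least hC (X := Approx S lab comp pos i t T w) ?_ (p, [γ] ++ w))
      (.of_iff approx_append)
    intro c
    -- Strictly above `w` the approximation is read from the table, which is closed under the step.
    -- At `w` itself and away from `w` it is the true property, and the step from the one-sided
    -- approximation stays on the correct side.
    by_cases hcw : ∃ u, c.2 = u ++ w ∧ u ≠ []
    · obtain ⟨q, v⟩ := c
      obtain ⟨u, rfl, hu⟩ : ∃ u, v = u ++ w ∧ u ≠ [] := hcw
      cases u with
      | nil => exact absurd rfl hu
      | cons γ' u =>
        refine (Imp.of_iff (tval_iff L hi h.ok hb hT hr' γ' u q).symm).trans ?_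
        refine (hclosed γ' _ q (by omega) (hb.ev_lt (by omega) u hT)).trans ?_
        exact .of_iff (approx_append (u := γ' :: u)).symm
    · refine ((phi_mono hA c).trans (sem_step hC c)).trans (.of_iff ?_)
      by_cases hcw' : ∃ u, c.2 = u ++ w
      · obtain ⟨q, v⟩ := c
        obtain ⟨u, rfl⟩ : ∃ u, v = u ++ w := hcw'
        have hu : u = [] := by
          by_contra hu
          exact hcw ⟨u, rfl, hu⟩
        subst hu
        rw [approx_append]
        exact (hi' q).symm
      · exact ⟨fun h => .inr ⟨hcw', h⟩, fun h => by
          rcases h with ⟨u, h, -⟩ | ⟨-, h⟩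
          · exact absurd ⟨u, h⟩ hcw'
          · exact h⟩
  · refine Imp.antisymm (h.nil p) ?_
    refine Imp.trans ?_ (hclosed nΓ 0 p le_rfl (by positivity))
    refine Imp.trans ?_ (.of_iff (tval_nil_iff L hi h.ok p (S.Sem lab (comp i))).symm)
    -- At the empty stack the operator does not look at its argument. Modifying the property there
    -- by one step gives a set that is closed, so by extremality the property is an exact fixed
    -- point at the empty stack.
    let X : Conf (Fin nP) (Fin nΓ) → Prop := fun c =>
      if c.2 = [] then S.Phi lab (comp i) (S.Sem lab (comp i)) c else S.Sem lab (comp i) c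
    have hX : ∀ c, Imp (10 ≤ ctag (comp i)) (X c) (S.Sem lab (comp i) c) := by
      intro c
      simp only [X]
      split_ifs
      exacts [sem_step hC c, .of_iff Iff.rfl]
    refine (sem_least hC (X := X) (fun c => ?_) (p, [])).trans (.of_iff (by simp [X]))
    have hm := phi_mono (S := S) (lab := lab) (C := comp i) hX c
    by_cases hc : c.2 = []
    · exact hm.trans (.of_iff (by simp [X, hc]))
    · exact (hm.trans (sem_step hC c)).trans (.of_iff (by simp [X, hc]))

end Stage

open Cmd BCARET.Expr PDS

/-! ### Memory layout -/

section Memory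

variable {nP nΓ nA : ℕ}

/-- The contents `m` of the memory below the table and the contents `ρ` of the lower registers. -/
structure Static (ρ m : ℕ → ℕ) (rules : List (Rule (Fin nP) (Fin nΓ))) (F N : ℕ)
    (comp : ℕ → Option (Formula (Fin nA))) (rc : ℕ → ℕ) (pos : ℕ → ℕ → ℕ) : Prop where
  rP : ρ 1 = nP
  rG : ρ 2 = nΓ
  rR : ρ 3 = rules.length
  rF : ρ 4 = F
  rN : ρ 5 = N
  rD : ρ 6 = 2 ^ N
  rM : ρ 7 = (2 * nΓ + 2) * N * 2 ^ N + 1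
  -- Row pointers of the two halves of the table: register 17 for the types (letters, then the empty
  -- stack), register 18 for the popping relation.
  r17 : ρ 17 = ρ 14 + N
  r18 : ρ 18 = ρ 14 + N + (nΓ + 1)
  rules_at : MemAt m 3 (rules.flatMap encodeRule)
  rules_lt : 3 + (rules.flatMap encodeRule).length ≤ ρ 16
  tag : ∀ i ≤ F, m (ρ 9 + i) = ctag (comp i)
  tag_lt : ρ 9 + F < ρ 16
  mode : ∀ i ≤ F, 6 ≤ ctag (comp i) → m (ρ 10 + i) = encodeMode (cmode (comp i))
  mode_lt : ρ 10 + F < ρ 16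
  rc : ∀ i < F, 4 ≤ ctag (comp i) → ctag (comp i) ≠ 6 → ctag (comp i) ≠ 7 →
    m (ρ 11 + (i + 1)) = rc i
  rc_lt : ρ 11 + F < ρ 16
  ipos_lt : ρ 12 + F < ρ 16
  pos : ∀ i ≤ F, ∀ q < nP, m (ρ 12 + i) + q < ρ 16 ∧ m (m (ρ 12 + i) + q) = pos i q
  -- Pointers to rows take the place of multiplication in address computations. The first `N` rows
  -- are the digits of all numbers below `2 ^ N`; the table comes after them.
  row : ∀ r < N + (2 * nΓ + 2), m (ρ 14 + r) = ρ 16 + r * 2 ^ N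
  row_lt : ρ 14 + (N + (2 * nΓ + 2)) ≤ ρ 16
  pow : ∀ j < N, m (ρ 15 + j) = 2 ^ j
  pow_lt : ρ 15 + N ≤ ρ 16
  bit : ∀ j < N, ∀ T < 2 ^ N, m (ρ 16 + j * 2 ^ N + T) = (T.testBit j).toNat

/-- A state with the given contents of the lower registers and the memory, and with the table. -/
structure Good (g : ℕ) (ρ m : ℕ → ℕ) (N : ℕ) (t : Tab) (s : State) : Prop where
  reg : ∀ r < 32, s.reg r = ρ r
  mem : ∀ a < ρ 16 + N * 2 ^ N, s.mem a = m a
  tab : ∀ γ < 2 * g + 2, ∀ T < 2 ^ N, s.mem (ρ 16 + N * 2 ^ N + γ * 2 ^ N + T) = t γ T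

theorem Good.of_eq {g : ℕ} {ρ m : ℕ → ℕ} {N : ℕ} {t : Tab} {s s' : State}
    (h : Good g ρ m N t s) (hr : ∀ r < 32, s'.reg r = s.reg r) (hm : s'.mem = s.mem) :
    Good g ρ m N t s' :=
  ⟨fun r hr' => (hr r hr').trans (h.reg r hr'), fun a ha => by rw [hm, h.mem a ha],
    fun γ hγ T hT => by rw [hm, h.tab γ hγ T hT]⟩

variable {ρ m : ℕ → ℕ} {rules : List (Rule (Fin nP) (Fin nΓ))} {F N : ℕ}
  {comp : ℕ → Option (Formula (Fin nA))} {rc : ℕ → ℕ} {pos : ℕ → ℕ → ℕ} {t : Tab} {s : State}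

/-- The entry of the table for letter `γ` and type `T`. -/
def lkE (tp : ℕ) (γ T : Expr) : Expr := mem (mem (reg tp + γ) + T)

/-- Digit `b` of the type `T`. -/
def bitE (b T : Expr) : Expr := mem (mem (reg 14 + b) + T)

/-- The address where the digits of property number `i` are found. -/
def posE (i p : Expr) : Expr := mem (mem (reg 12 + i) + p)

/-- Whether two numbers are equal. -/
def eqE (a b : Expr) : Expr := 1 - ((a - b) + (b - a))

/-- Whether property number `i` holds at the location `p` for the type `T`. -/
def truthE (i p T : Expr) : Expr :=
  1 - eqE (bitE (posE i p) T) (1 - (10 - mem (reg 9 + i)))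

theorem eval_eqE (a b : Expr) : (eqE a b).eval s ≠ 0 ↔ a.eval s = b.eval s := by
  simp [eqE]
  omega

theorem Good.eval_lk (h : Good nΓ ρ m N t s) (H : Static ρ m rules F N comp rc pos) {γ T : Expr}
    (hγ : γ.eval s ≤ nΓ) (hT : T.eval s < 2 ^ N) :
    (lkE 17 γ T).eval s = t (γ.eval s) (T.eval s) := by
  have h1 := H.row (N + γ.eval s) (by omega)
  have h2 := H.row_lt
  have h3 := h.tab (γ.eval s) (by omega) _ hT
  simp only [lkE, eval_mem, eval_add, eval_reg]
  rw [h.reg 17 (by norm_num), H.r17, Nat.add_assoc, h.mem (ρ 14 + (N + γ.eval s)) (by omega), h1,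
    Nat.add_mul, ← Nat.add_assoc, h3]

theorem Good.eval_lk_low (h : Good nΓ ρ m N t s) (H : Static ρ m rules F N comp rc pos) {γ T : Expr}
    (hγ : γ.eval s ≤ nΓ) (hT : T.eval s < 2 ^ N) :
    (lkE 18 γ T).eval s = t (nΓ + 1 + γ.eval s) (T.eval s) := by
  have h1 := H.row (N + (nΓ + 1 + γ.eval s)) (by omega)
  have h2 := H.row_lt
  have h3 := h.tab (nΓ + 1 + γ.eval s) (by omega) _ hT
  simp only [lkE, eval_mem, eval_add, eval_reg]
  rw [h.reg 18 (by norm_num), H.r18, Nat.add_assoc, Nat.add_assoc,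
    h.mem (ρ 14 + (N + (nΓ + 1 + γ.eval s))) (by omega), h1, Nat.add_mul, ← Nat.add_assoc, h3]

theorem Good.eval_bit (h : Good nΓ ρ m N t s) (H : Static ρ m rules F N comp rc pos) {b T : Expr}
    (hb : b.eval s < N) (hT : T.eval s < 2 ^ N) :
    (bitE b T).eval s = ((T.eval s).testBit (b.eval s)).toNat := by
  have h1 := H.row (b.eval s) (by omega)
  have h2 := H.row_lt
  have h4 : (b.eval s + 1) * 2 ^ N ≤ N * 2 ^ N := Nat.mul_le_mul_right _ hb
  rw [Nat.add_mul] at h4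
  simp only [bitE, eval_mem, eval_add, eval_reg]
  rw [h.reg 14 (by norm_num), h.mem (ρ 14 + b.eval s) (by omega), h1,
    h.mem _ (by omega), H.bit _ hb _ hT]

theorem Good.eval_pos (h : Good nΓ ρ m N t s) (H : Static ρ m rules F N comp rc pos) {i p : Expr}
    (hi : i.eval s ≤ F) (hp : p.eval s < nP) :
    (posE i p).eval s = pos (i.eval s) (p.eval s) := by
  have h1 := H.pos _ hi _ hp
  have h2 := H.ipos_lt
  simp only [posE, eval_mem, eval_add, eval_reg]
  rw [h.reg 12 (by norm_num), h.mem (ρ 12 + i.eval s) (by omega), h.mem _ (by omega), h1.2]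

/-- With truncated subtraction `1 - (10 - tag)` is 1 exactly for greatest fixed points, where a
digit that is set means failure. A property holds if and only if its digit differs from this number.
-/
theorem Good.eval_truth (h : Good nΓ ρ m N t s) (H : Static ρ m rules F N comp rc pos)
    {i p T : Expr} (hi : i.eval s ≤ F) (hp : p.eval s < nP) (hT : T.eval s < 2 ^ N)
    (hpos : pos (i.eval s) (p.eval s) < N) :
    (truthE i p T).eval s ≠ 0 ↔ Truth comp pos (i.eval s) (p.eval s) (T.eval s) := by
  have h2 := H.tag_lt
  have h3 := H.tag _ hi
  have h4 := h.eval_pos H hi hp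
  have h5 := h.eval_bit H (b := posE i p) (by rw [h4]; exact hpos) hT
  have h6 : (Expr.mem (Expr.reg 9 + i)).eval s = ctag (comp (i.eval s)) := by
    simp only [eval_mem, eval_add, eval_reg]
    rw [h.reg 9 (by norm_num), h.mem _ (by omega), h3]
  have h7 := eval_eqE (s := s) (bitE (posE i p) T) (1 - (10 - Expr.mem (Expr.reg 9 + i)))
  rw [h5, h4] at h7
  have h8 : (1 - (10 - Expr.mem (Expr.reg 9 + i)) : Expr).eval s = 1 - (10 - ctag (comp (i.eval s))) := by
    rw [← h6]
    rfl
  rw [h8] at h7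
  have h9 : ∀ n : ℕ, 1 - n ≠ 0 ↔ ¬ n ≠ 0 := fun n => by omega
  rw [truthE, eval_sub, eval_one, h9, h7, Truth]
  cases ((T.eval s).testBit (pos (i.eval s) (p.eval s)))
  · rw [Bool.toNat_false, iff_false_left Bool.false_ne_true]
    omega
  · rw [Bool.toNat_true, iff_true_left rfl]
    omega

/-- The machine adds but has no bitwise disjunction. If digit `b` is clear, the residue modulo `2 ^
(b + 1)` lies below `2 ^ b`, so adding `2 ^ b` causes no carry and only sets this digit. -/
theorem Tab.setBit_apply (t : Tab) (γ T b : ℕ) :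
    t.setBit γ T b γ T = if (t γ T).testBit b then t γ T else t γ T + 2 ^ b := by
  rw [Tab.setBit, if_pos ⟨rfl, rfl⟩]
  split_ifs with h
  · apply Nat.eq_of_testBit_eq
    intro i
    rw [Nat.testBit_or, Nat.testBit_two_pow]
    rcases eq_or_ne b i with rfl | hi
    · simp [h]
    · simp [hi]
  · have hlo : t γ T % 2 ^ (b + 1) < 2 ^ b := by
      have h1 := Nat.mod_lt (t γ T) (Nat.two_pow_pos (b + 1))
      by_contra hlo
      have h2 : (t γ T % 2 ^ (b + 1)).testBit b = true := by
        rw [Nat.testBit_eq_decide_div_mod_eq, decide_eq_true_eq,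
          Nat.div_eq_of_lt_le (k := 1) (by omega) (by rw [pow_succ] at h1; omega)]
      rw [Nat.testBit_mod_two_pow] at h2
      simp [h] at h2
    have hx := Nat.div_add_mod (t γ T) (2 ^ (b + 1))
    have h3 : t γ T % 2 ^ (b + 1) + 2 ^ b < 2 ^ (b + 1) := by
      have := pow_succ 2 b
      omega
    apply Nat.eq_of_testBit_eq
    intro i
    have h4 : t γ T + 2 ^ b =
        2 ^ (b + 1) * (t γ T / 2 ^ (b + 1)) + (t γ T % 2 ^ (b + 1) + 2 ^ b) := by
      rw [← Nat.add_assoc, hx]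
    rw [h4, Nat.testBit_two_pow_mul_add _ h3, ← Nat.or_two_pow_eq_add_of_lt hlo, Nat.testBit_or,
      Nat.testBit_or]
    conv_lhs => rw [← hx]
    rw [Nat.testBit_two_pow_mul_add _ (Nat.mod_lt _ (Nat.two_pow_pos _)), Nat.testBit_two_pow]
    split_ifs with hi
    · rfl
    · simp
      omega

theorem Tab.setBit_of_testBit {t : Tab} {γ T b : ℕ} (h : (t γ T).testBit b = true) :
    t.setBit γ T b = t := by
  funext γ' T'
  rw [Tab.setBit]
  split_ifs with hc
  · obtain ⟨rfl, rfl⟩ := hc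
    have := t.setBit_apply γ' T' b
    rwa [if_pos h, Tab.setBit, if_pos ⟨rfl, rfl⟩] at this
  · rfl

/-- Set the digit `b` of the entry for the letter in register `40` and the type in register
`41`. -/
def setCmd (tp : ℕ) (b : Expr) : Cmd :=
  ite (bitE b (lkE tp (reg 40) (reg 41))) skip
    (sto (mem (reg tp + reg 40) + reg 41) (lkE tp (reg 40) (reg 41) + mem (reg 15 + b)))

/-- The row of the table that a row pointer register refers to. -/
def rowOf (g tp γ : ℕ) : ℕ := if tp = 17 then γ else g + 1 + γ

theorem Good.eval_row (h : Good nΓ ρ m N t s) (H : Static ρ m rules F N comp rc pos) {tp : ℕ}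
    (htp : tp = 17 ∨ tp = 18) {γ : Expr} (hγ : γ.eval s ≤ nΓ) :
    (Expr.mem (Expr.reg tp + γ)).eval s = ρ 16 + N * 2 ^ N + rowOf nΓ tp (γ.eval s) * 2 ^ N := by
  have h2 := H.row_lt
  rcases htp with rfl | rfl
  · have h1 := H.row (N + γ.eval s) (by omega)
    rw [eval_mem, eval_add, eval_reg, h.reg 17 (by norm_num), H.r17, Nat.add_assoc,
      h.mem _ (by omega), h1, Nat.add_mul, ← Nat.add_assoc]
    rfl
  · have h1 := H.row (N + (nΓ + 1 + γ.eval s)) (by omega)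
    rw [eval_mem, eval_add, eval_reg, h.reg 18 (by norm_num), H.r18, Nat.add_assoc, Nat.add_assoc,
      h.mem _ (by omega), h1, Nat.add_mul, ← Nat.add_assoc]
    rfl

theorem Good.eval_lkE (h : Good nΓ ρ m N t s) (H : Static ρ m rules F N comp rc pos) {tp : ℕ}
    (htp : tp = 17 ∨ tp = 18) {γ T : Expr} (hγ : γ.eval s ≤ nΓ) (hT : T.eval s < 2 ^ N) :
    (lkE tp γ T).eval s = t (rowOf nΓ tp (γ.eval s)) (T.eval s) := by
  rcases htp with rfl | rfl
  · exact h.eval_lk H hγ hT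
  · exact h.eval_lk_low H hγ hT

theorem rowOf_lt {tp g γ : ℕ} (hγ : γ ≤ g) : rowOf g tp γ < 2 * g + 2 := by
  unfold rowOf
  split_ifs <;> omega

/-- Writing an entry of the table. -/
theorem Good.write (h : Good nΓ ρ m N t s) {γ T v : ℕ} (hT : T < 2 ^ N) :
    Good nΓ ρ m N (fun γ' T' => if γ' = γ ∧ T' = T then v else t γ' T')
      ⟨s.reg, Function.update s.mem (ρ 16 + N * 2 ^ N + γ * 2 ^ N + T) v⟩ := by
  refine ⟨h.reg, fun a ha => ?_, fun γ' hγ' T' hT' => ?_⟩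
  · simp only [Function.update_apply]
    rw [if_neg (by rw [Nat.add_assoc]; exact fun h => by subst h; simp at ha)]
    exact h.mem a ha
  · simp only [Function.update_apply]
    by_cases hc : γ' = γ ∧ T' = T
    · obtain ⟨rfl, rfl⟩ := hc
      rw [if_pos rfl, if_pos ⟨rfl, rfl⟩]
    · rw [if_neg, if_neg hc, h.tab γ' hγ' T' hT']
      intro he
      have h1 : γ' * 2 ^ N + T' = γ * 2 ^ N + T := by omega
      -- The quotient by the length of a row recovers the row from the address.
      have h2 : γ' = γ := by
        have := congrArg (· / 2 ^ N) h1
        simpa [Nat.add_comm, Nat.add_mul_div_right, Nat.div_eq_of_lt hT, Nat.div_eq_of_lt hT']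
          using this
      subst h2
      exact hc ⟨rfl, by omega⟩

theorem Good.setCmd (h : Good nΓ ρ m N t s) (H : Static ρ m rules F N comp rc pos)
    (hB : t.Bdd (2 * nΓ + 2) N) {tp : ℕ} (htp : tp = 17 ∨ tp = 18) {b : Expr}
    (hγ : s.reg 40 ≤ nΓ) (hT : s.reg 41 < 2 ^ N) (hb : b.eval s < N) :
    Good nΓ ρ m N (t.setBit (rowOf nΓ tp (s.reg 40)) (s.reg 41) (b.eval s))
      ((setCmd tp b).den s) := by
  have h1 := h.eval_lkE H htp (γ := Expr.reg 40) (T := Expr.reg 41) hγ hT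
  have h2 := h.eval_bit H (b := b) hb (T := lkE tp (Expr.reg 40) (Expr.reg 41))
    (by rw [h1]; exact hB _ (rowOf_lt hγ) _ hT)
  have h3 := h.eval_row H htp (γ := Expr.reg 40) hγ
  simp only [eval_reg] at h1 h3
  have h4 : (Expr.mem (Expr.reg 15 + b)).eval s = 2 ^ b.eval s := by
    have := H.pow_lt
    simp only [eval_mem, eval_add, eval_reg]
    rw [h.reg 15 (by norm_num), h.mem _ (by omega), H.pow _ hb]
  rw [BCARET.setCmd, den, h2, h1]
  by_cases hv : (t (rowOf nΓ tp (s.reg 40)) (s.reg 41)).testBit (b.eval s) = true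
  · rw [if_pos (by simp [hv]), Tab.setBit_of_testBit hv]
    exact h
  · rw [if_neg (by simp [hv]), den, eval_add, eval_add, h1, h3, h4]
    have h5 : (t.setBit (rowOf nΓ tp (s.reg 40)) (s.reg 41) (b.eval s)) =
        fun γ' T' => if γ' = rowOf nΓ tp (s.reg 40) ∧ T' = s.reg 41 then
          t (rowOf nΓ tp (s.reg 40)) (s.reg 41) + 2 ^ b.eval s else t γ' T' := by
      funext γ' T'
      by_cases hc : γ' = rowOf nΓ tp (s.reg 40) ∧ T' = s.reg 41
      · rw [if_pos hc, hc.1, hc.2, Tab.setBit_apply, if_neg hv]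
      · rw [if_neg hc, Tab.setBit, if_neg hc]
    rw [h5]
    exact h.write hT

/-- The number of digits that are set in a table. -/
def Tab.count (t : Tab) (g N : ℕ) : ℕ :=
  ∑ γ ∈ Finset.range g, ∑ T ∈ Finset.range (2 ^ N), ∑ b ∈ Finset.range N, ((t γ T).testBit b).toNat

theorem Tab.count_le (t : Tab) (g N : ℕ) : t.count g N ≤ g * N * 2 ^ N := by
  have h : ∀ (γ T b : ℕ), ((t γ T).testBit b).toNat ≤ 1 := fun γ T b => Bool.toNat_le _
  calc t.count g N ≤ ∑ γ ∈ Finset.range g, ∑ T ∈ Finset.range (2 ^ N), ∑ b ∈ Finset.range N, 1 :=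
        Finset.sum_le_sum fun γ _ => Finset.sum_le_sum fun T _ => Finset.sum_le_sum fun b _ => h _ _ _
    _ = g * N * 2 ^ N := by
        simp
        ring

/-- The progress measure of all saturations: together with `Tab.count_le` it bounds the number of
sweeps in which anything happens. -/
theorem Tab.count_setBit (t : Tab) {g N γ T b : ℕ} (hγ : γ < g) (hT : T < 2 ^ N) (hb : b < N) :
    t.setBit γ T b = t ∨ t.count g N < (t.setBit γ T b).count g N := by
  by_cases h : (t γ T).testBit b = true
  · exact .inl (Tab.setBit_of_testBit h)
  · right
    have hle : ∀ γ' T' b', ((t γ' T').testBit b').toNat ≤ ((t.setBit γ T b γ' T').testBit b').toNat := by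
      intro γ' T' b'
      rw [Tab.testBit_setBit]
      cases (t γ' T').testBit b' <;> simp
    refine Finset.sum_lt_sum (fun γ' _ => Finset.sum_le_sum fun T' _ => Finset.sum_le_sum
      fun b' _ => hle _ _ _) ⟨γ, Finset.mem_range.2 hγ, Finset.sum_lt_sum (fun T' _ =>
      Finset.sum_le_sum fun b' _ => hle _ _ _) ⟨T, Finset.mem_range.2 hT, Finset.sum_lt_sum
      (fun b' _ => hle _ _ _) ⟨b, Finset.mem_range.2 hb, ?_⟩⟩⟩
    rw [Tab.testBit_setBit]
    simp [h]

theorem Tab.count_setBit_le (t : Tab) {g N γ T b : ℕ} :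
    t.count g N ≤ (t.setBit γ T b).count g N := by
  refine Finset.sum_le_sum fun γ' _ => Finset.sum_le_sum fun T' _ => Finset.sum_le_sum
      fun b' _ => ?_
  rw [Tab.testBit_setBit]
  cases (t γ' T').testBit b' <;> simp

end Memory

/-! ### Passing through the list of rules -/

section Rules

variable {nP nΓ nA : ℕ}

/-- The number of the kind of a rule. -/
def actNum : Act → ℕ
  | .call => 0
  | .ret => 1
  | .int => 2

/-- Read the rule at the address in register `44`. -/
def readRule : Cmd :=
  asg 46 (mem (reg 44)) ;; asg 47 (mem (reg 44 + 1)) ;; asg 48 (mem (reg 44 + 2)) ;;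
  asg 49 (mem (reg 44 + 3)) ;;
  ite (reg 46) (ite (reg 46 - 1) (asg 50 (reg 44 + 5) ;; asg 51 (mem (reg 44 + 4)))
    (asg 50 (reg 44 + 4) ;; asg 51 0)) (asg 50 (reg 44 + 4) ;; asg 51 2)

/-- The contents of the registers after the rule `r` has been read. -/
structure ReadOut (r : Rule (Fin nP) (Fin nΓ)) (s : State) : Prop where
  kind : s.reg 46 = actNum r.act
  srcP : s.reg 47 = r.srcP
  srcΓ : s.reg 48 = r.srcΓ
  tgt : s.reg 49 = r.tgt
  word : MemAt s.mem (s.reg 50) (r.word.map Fin.val)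
  len : s.reg 51 = r.word.length

/-- In every encoding the word written on the stack comes last, so the end of the word is the
address of the next rule. -/
theorem readRule_spec {r : Rule (Fin nP) (Fin nΓ)} {s : State}
    (h : MemAt s.mem (s.reg 44) (encodeRule r)) : ReadOut r (readRule.den s) ∧
      (readRule.den s).reg 50 + (readRule.den s).reg 51 = s.reg 44 + (encodeRule r).length := by
  have hm : (readRule.den s).mem = s.mem := mem_den rfl s
  cases r with
  | call p γ q γ₁ γ₂ =>
    simp only [encodeRule, memAt_cons, memAt_nil, and_true, Nat.add_assoc, Nat.reduceAdd] at h
    obtain ⟨h0, h1, h2, h3, h4, h5⟩ := h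
    refine ⟨⟨?_, ?_, ?_, ?_, ?_, ?_⟩, ?_⟩ <;>
      simp [readRule, den, State.set_reg, h0, h1, h2, h3, h4, h5, Rule.act, actNum, Rule.srcP,
        Rule.srcΓ, Rule.tgt, Rule.word, encodeRule]
  | ret p γ q =>
    simp only [encodeRule, memAt_cons, memAt_nil, and_true, Nat.add_assoc, Nat.reduceAdd] at h
    obtain ⟨h0, h1, h2, h3⟩ := h
    refine ⟨⟨?_, ?_, ?_, ?_, ?_, ?_⟩, ?_⟩ <;>
      simp [readRule, den, State.set_reg, h0, h1, h2, h3, Rule.act, actNum, Rule.srcP,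
        Rule.srcΓ, Rule.tgt, Rule.word, encodeRule]
  | int p γ q w =>
    simp only [encodeRule, encodeWord, List.cons_append, List.nil_append, memAt_cons,
      Nat.add_assoc, Nat.reduceAdd] at h
    obtain ⟨h0, h1, h2, h3, h4, h5⟩ := h
    refine ⟨⟨?_, ?_, ?_, ?_, ?_, ?_⟩, ?_⟩ <;>
      simp [readRule, den, State.set_reg, h0, h1, h2, h3, h4, h5, Rule.act, actNum, Rule.srcP,
        Rule.srcΓ, Rule.tgt, Rule.word, encodeRule, encodeWord]
    omega

/-- Run `body` for every rule. -/
def rulesLoop (body : Cmd) : Cmd :=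
  asg 44 3 ;; for_ 45 (reg 3) (readRule ;; body ;; asg 44 (reg 50 + reg 51))

/-- The predicate `J` relates the rules read so far to the two result registers. The body may take
time proportional to the size of the rule, because a word of arbitrary length has to be evaluated;
the total is then governed by the size of the rule set, not by the number of rules. -/
theorem rulesLoop_spec {body : Cmd} (hb : body.above 52 = true) (hq : body.quiet = true)
    {rules : List (Rule (Fin nP) (Fin nΓ))} {s : State}
    (hm : MemAt s.mem 3 (rules.flatMap encodeRule)) (hl : s.reg 3 = rules.length)
    (J : List (Rule (Fin nP) (Fin nΓ)) → ℕ → ℕ → Prop) (K : ℕ)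
    (h0 : J [] (s.reg 52) (s.reg 53))
    (step : ∀ l r s', r ∈ rules → (∀ i < 44, s'.reg i = s.reg i) → s'.mem = s.mem →
      ReadOut r s' → J l (s'.reg 52) (s'.reg 53) →
      J (l ++ [r]) ((body.den s').reg 52) ((body.den s').reg 53) ∧ body.cost s' ≤ K * r.size) :
    J rules (((rulesLoop body).den s).reg 52) (((rulesLoop body).den s).reg 53) ∧
      (rulesLoop body).cost s ≤ 10 + (K + 80) * (rules.map Rule.size).sum ∧
      ((rulesLoop body).den s).reg 44 = 3 + (rules.flatMap encodeRule).length := by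
  set s₁ := s.set 44 3 with hs₁
  have hab : (for_ 45 (reg 3) (readRule ;; body ;; asg 44 (reg 50 + reg 51))).above 44 = true := by
    have : body.above 44 = true := by
      have : ∀ c : Cmd, c.above 52 = true → c.above 44 = true := by
        intro c
        induction c with
        | skip => exact id
        | asg i e =>
          simp only [above, decide_eq_true_eq]
          omega
        | sto => exact id
        | seq c c' ih ih' =>
          simp only [above, Bool.and_eq_true]
          exact fun h => ⟨ih h.1, ih' h.2⟩
        | ite e c c' ih ih' =>
          simp only [above, Bool.and_eq_true]
          exact fun h => ⟨ih h.1, ih' h.2⟩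
        | for_ i e c ih =>
          simp only [above, Bool.and_eq_true, decide_eq_true_eq]
          exact fun h => ⟨by omega, ih h.2⟩
      exact this _ hb
    simp [above, this, readRule]
  have hqq : (readRule ;; body ;; asg 44 (reg 50 + reg 51)).quiet = true := by
    simp [quiet, hq, readRule]
  have hn : (reg 3).eval s₁ = rules.length := hl
  have key := loop_rule (s := s₁) 44 hab
    (fun k s' => s'.mem = s.mem ∧ ∃ l l', rules = l ++ l' ∧ l'.length = k ∧
      MemAt s'.mem (s'.reg 44) (l'.flatMap encodeRule) ∧ J l (s'.reg 52) (s'.reg 53) ∧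
      s'.reg 44 + (l'.flatMap encodeRule).length = 3 + (rules.flatMap encodeRule).length)
    -- The counter runs downwards while the list is read forwards: the counter value `k` belongs to
    -- the rule at position `length - (k + 1)`. The 75 covers reading the rule and moving the
    -- pointer; the loop itself adds 5 more.
    (fun k => (K + 75) * ((rules.map Rule.size).getD (rules.length - (k + 1)) 0))
    ⟨rfl, [], rules, rfl, hn.symm, hm, h0, rfl⟩ (by
      rintro k s' hk hr ⟨hm', l, l', hll, hlen, hat, hJ, hptr⟩
      cases l' with
      | nil => simp at hlen
      | cons r l' =>
        rw [List.flatMap_cons, memAt_append] at hat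
        have hrd := readRule_spec (r := r) (s := s'.set 45 k) hat.1
        set s₂ := readRule.den (s'.set 45 k) with hs₂
        have hm₂ : s₂.mem = s.mem := (mem_den rfl _).trans hm'
        have hr₂ : ∀ i < 44, s₂.reg i = s.reg i := by
          intro i hi
          rw [hs₂, reg_den (K := 44) rfl _ hi, State.set_reg, if_neg (by omega), hr i hi, hs₁,
            State.set_reg, if_neg (by omega)]
        have h52 : s₂.reg 52 = s'.reg 52 := (reg_den_of_keeps rfl _).trans rfl
        have h53 : s₂.reg 53 = s'.reg 53 := (reg_den_of_keeps rfl _).trans rfl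
        obtain ⟨h₁, h₂⟩ := step l r s₂ (by rw [hll]; simp) hr₂ hm₂ hrd.1 (by rwa [h52, h53])
        refine ⟨⟨(mem_den hqq _).trans hm', l ++ [r], l', by rw [hll]; simp, by simpa using hlen,
          ?_, ?_, ?_⟩, ?_⟩
        · rw [mem_den hqq, State.set_mem]
          convert hat.2 using 1
          rw [show s'.reg 44 = (s'.set 45 k).reg 44 from rfl, ← hrd.2]
          change (body.den s₂).reg 50 + (body.den s₂).reg 51 = _
          rw [reg_den hb _ (by norm_num), reg_den hb _ (by norm_num)]
        · exact h₁
        · rw [← hptr, List.flatMap_cons, List.length_append, ← Nat.add_assoc]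
          congr 1
          rw [show s'.reg 44 = (s'.set 45 k).reg 44 from rfl, ← hrd.2]
          change (body.den s₂).reg 50 + (body.den s₂).reg 51 = _
          rw [reg_den hb _ (by norm_num), reg_den hb _ (by norm_num)]
        · change readRule.cost (s'.set 45 k) + (body.cost s₂ + _) ≤ _
          have hc := cost_le_worst (c := readRule) rfl (s'.set 45 k)
          have hw : readRule.worst ≤ 60 := by decide
          have hk : (rules.map Rule.size).getD (rules.length - (k + 1)) 0 = r.size := by
            have h1 : rules.length - (k + 1) = l.length := by
              rw [hll]
              simp only [List.length_append]
              omega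
            rw [h1, hll]
            simp
          have h1 : 1 ≤ r.size := by cases r <;> simp [Rule.size]
          rw [hk]
          have : (K + 75) * r.size = K * r.size + 75 * r.size := Nat.add_mul _ _ _
          change _ + (_ + ((reg 50).cost + ((reg 51).cost + 1) + 2)) ≤ _
          simp only [Expr.cost]
          omega)
  obtain ⟨⟨-, l, l', hll, hlen, -, hJ, hptr⟩, hc⟩ := key
  refine ⟨?_, ?_, ?_⟩
  · rw [List.length_eq_zero_iff] at hlen
    rw [hlen, List.append_nil] at hll
    rw [hll]
    exact hJ
  · change (3 : Expr).cost + 2 + (for_ 45 (reg 3) (readRule ;; body ;;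
      asg 44 (reg 50 + reg 51))).cost s₁ ≤ _
    rw [hn] at hc
    have hsum : ∑ k ∈ Finset.range rules.length,
        ((K + 75) * ((rules.map Rule.size).getD (rules.length - (k + 1)) 0) + 5) ≤
        (K + 80) * (rules.map Rule.size).sum := by
      have : ∀ k ∈ Finset.range rules.length,
          ((K + 75) * ((rules.map Rule.size).getD (rules.length - (k + 1)) 0) + 5) ≤
          (K + 80) * ((rules.map Rule.size).getD (rules.length - 1 - k) 0) := by
        intro k hk
        rw [Finset.mem_range] at hk
        have hlt : rules.length - 1 - k < (rules.map Rule.size).length := by simp; omega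
        rw [Nat.add_comm k 1, ← Nat.sub_sub, List.getD_eq_getElem _ _ hlt, List.getElem_map]
        have h1 : 1 ≤ (rules[rules.length - 1 - k]'(by simpa using hlt)).size := by
          generalize rules[rules.length - 1 - k]'(by simpa using hlt) = r
          cases r <;> simp [Rule.size]
        nlinarith
      refine (Finset.sum_le_sum this).trans ?_
      -- Reversal of the order of summation, since the counter runs downwards.
      rw [Finset.sum_range_reflect
        (fun k => (K + 80) * ((rules.map Rule.size).getD k 0)), ← Finset.mul_sum]
      refine Nat.mul_le_mul_left _ (le_of_eq ?_)
      rw [← Fin.sum_univ_eq_sum_range (fun k => (rules.map Rule.size).getD k 0),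
        ← Fin.sum_univ_getElem]
      refine Fintype.sum_equiv (finCongr (by simp)) _ _ fun k => ?_
      rw [List.getD_eq_getElem _ _ (by simp)]
      rfl
    have h3 : (3 : Expr).cost = 1 := rfl
    have h4 : (reg 3).cost = 2 := rfl
    omega
  · rw [List.length_eq_zero_iff.1 hlen] at hptr
    exact hptr

end Rules

/-! ### Evaluation of words, and saturation of a table -/

section Loops

variable {nP nΓ nA : ℕ} {ρ m : ℕ → ℕ} {rules : List (Rule (Fin nP) (Fin nΓ))} {F N : ℕ}
  {comp : ℕ → Option (Formula (Fin nA))} {rc : ℕ → ℕ} {pos : ℕ → ℕ → ℕ} {t : Tab} {s : State}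

/-- Prefix the word at the address in register `50`, of the length in register `51`, to the type in
register `54`. -/
def evalWord (tp : ℕ) : Cmd :=
  for_ 55 (reg 51) (asg 54 (lkE tp (mem (reg 50 + reg 55)) (reg 54)))

/-- The loop counts down, hence the word is processed from its bottom letter upwards, as the fold
`ev` requires. After the iteration with index `k` the register holds the type of the suffix from
position `k` on. -/
theorem Good.evalWord (h : Good nΓ ρ m N t s) (H : Static ρ m rules F N comp rc pos)
    (hB : t.Bdd (2 * nΓ + 2) N) {tp : ℕ} (htp : tp = 17 ∨ tp = 18) {w : List (Fin nΓ)}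
    (hw : MemAt s.mem (s.reg 50) (w.map Fin.val)) (hl : s.reg 51 = w.length)
    (hT : s.reg 54 < 2 ^ N) :
    ((evalWord tp).den s).reg 54 = ev (fun γ => t (rowOf nΓ tp γ)) w (s.reg 54) ∧
      ev (fun γ => t (rowOf nΓ tp γ)) w (s.reg 54) < 2 ^ N ∧
      (evalWord tp).cost s ≤ 3 + 21 * w.length := by
  have hlt : ∀ u : List (Fin nΓ), ev (fun γ => t (rowOf nΓ tp γ)) u (s.reg 54) < 2 ^ N := by
    intro u
    induction u with
    | nil => exact hT
    | cons γ u ih => exact hB _ (rowOf_lt γ.2.le) _ ih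
  have hn : (Expr.reg 51).eval s = w.length := hl
  have hq : (asg 54 (lkE tp (Expr.mem (Expr.reg 50 + Expr.reg 55)) (Expr.reg 54))).quiet = true :=
    rfl
  have key := loop_rule' (s := s) (i := 55) (e := Expr.reg 51)
    (c := asg 54 (lkE tp (Expr.mem (Expr.reg 50 + Expr.reg 55)) (Expr.reg 54))) 54 rfl
    (fun k s' => s'.mem = s.mem ∧
      s'.reg 54 = ev (fun γ => t (rowOf nΓ tp γ)) (w.drop k) (s.reg 54)) 16
    (by rw [hn]; simp [ev]) (by
      rintro k s' hk hr ⟨hm', h54⟩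
      rw [hn] at hk
      refine ⟨⟨(mem_den hq _).trans hm', ?_⟩, ?_⟩
      · have hg : Good nΓ ρ m N t (s'.set 55 k) := h.of_eq (fun r hr' => by
          rw [State.set_reg, if_neg (by omega), hr r (by omega)]) hm'
        have h1 : (Expr.mem (Expr.reg 50 + Expr.reg 55)).eval (s'.set 55 k) = w[k] := by
          have := hw.get (i := k) (by simpa using hk)
          simp only [eval_mem, eval_add, eval_reg, State.set_reg, State.set_mem, hm']
          simpa [hr 50 (by norm_num)] using this
        have h2 : (Expr.reg 54).eval (s'.set 55 k) = s'.reg 54 := by simp [State.set_reg]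
        rw [den, State.set_reg, if_pos rfl, hg.eval_lkE H htp (by rw [h1]; exact w[k].2.le)
          (by rw [h2, h54]; exact hlt _), h1, h2, h54, List.drop_eq_getElem_cons hk]
        rfl
      · exact le_rfl)
  obtain ⟨⟨-, h1⟩, h2⟩ := key
  refine ⟨h1, hlt w, ?_⟩
  rw [hn] at h2
  have : (Expr.reg 51).cost = 2 := rfl
  unfold BCARET.evalWord
  omega

/-- Run `B` for every letter, every type and every location. -/
def sweep (B : Cmd) : Cmd :=
  for_ 40 (reg 2 + 1) (for_ 41 (reg 6) (for_ 42 (reg 1) B))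

/-- Run `B` for every letter, every type and every location, until nothing changes. -/
def fix (B : Cmd) : Cmd := for_ 39 (reg 7) (sweep B)

/-- The body of a sweep carries out the update `u` in time `K`. -/
def Carries (ρ m : ℕ → ℕ) (nP nΓ N : ℕ) (Inv : Tab → Prop) (u : Tab → ℕ → ℕ → ℕ → Tab) (B : Cmd)
    (s₀ : State) (K : ℕ) : Prop :=
  ∀ t s, (∀ r < 39, s.reg r = s₀.reg r) → Good nΓ ρ m N t s → Inv t → s.reg 40 ≤ nΓ →
    s.reg 41 < 2 ^ N → s.reg 42 < nP →
      Good nΓ ρ m N (u t (s.reg 40) (s.reg 41) (s.reg 42)) (B.den s) ∧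
      Inv (u t (s.reg 40) (s.reg 41) (s.reg 42)) ∧ B.cost s ≤ K

theorem above_mono {K K' : ℕ} (hK : K ≤ K') : ∀ {c : Cmd}, c.above K' = true → c.above K = true
  | skip, h => h
  | asg i e, h => by
    simp only [above, decide_eq_true_eq] at h ⊢
    omega
  | sto _ _, h => h
  | seq c c', h => by
    simp only [above, Bool.and_eq_true] at h ⊢
    exact ⟨above_mono hK h.1, above_mono hK h.2⟩
  | Cmd.ite e c c', h => by
    simp only [above, Bool.and_eq_true] at h ⊢
    exact ⟨above_mono hK h.1, above_mono hK h.2⟩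
  | for_ i e c, h => by
    simp only [above, Bool.and_eq_true, decide_eq_true_eq] at h ⊢
    exact ⟨by omega, above_mono hK h.2⟩

variable {u : Tab → ℕ → ℕ → ℕ → Tab} {Inv : Tab → Prop} {B : Cmd} {s₀ : State} {K : ℕ}

/-- Updates take effect at once, so later entries of the sweep see earlier changes. If nothing has
changed by the end, then every update was tried on one and the same table, which is therefore
stable. -/
theorem Carries.sweep (hc : Carries ρ m nP nΓ N Inv u B s₀ K) (hB : B.above 43 = true)
    (H : Static ρ m rules F N comp rc pos)
    (hu : ∀ t γ T p, γ ≤ nΓ → T < 2 ^ N → p < nP →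
      u t γ T p = t ∨ t.count (2 * nΓ + 2) N < (u t γ T p).count (2 * nΓ + 2) N)
    (hr : ∀ r < 39, s.reg r = s₀.reg r) (h : Good nΓ ρ m N t s) (hI : Inv t) :
    (∃ t', Good nΓ ρ m N t' ((sweep B).den s) ∧ Inv t' ∧
      ((t' = t ∧ ∀ γ T p, γ ≤ nΓ → T < 2 ^ N → p < nP → u t γ T p = t) ∨
        t.count (2 * nΓ + 2) N < t'.count (2 * nΓ + 2) N ∧
        ¬ ∀ γ T p, γ ≤ nΓ → T < 2 ^ N → p < nP → u t γ T p = t)) ∧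
    (sweep B).cost s ≤ 5 + (nΓ + 1) * (8 + 2 ^ N * (8 + nP * (K + 5))) := by
  have hP : s.reg 1 = nP := (h.reg 1 (by norm_num)).trans H.rP
  have hG : s.reg 2 = nΓ := (h.reg 2 (by norm_num)).trans H.rG
  have hD : s.reg 6 = 2 ^ N := (h.reg 6 (by norm_num)).trans H.rD
  have hn : (reg 2 + 1 : Expr).eval s = nΓ + 1 := by simp [hG]
  -- `A` describes the triples already visited. The second alternative also records that the initial
  -- table was not stable; otherwise stability could not be carried through later sweeps.
  let Q (A : ℕ → ℕ → ℕ → Prop) (s' : State) : Prop := ∃ t', Good nΓ ρ m N t' s' ∧ Inv t' ∧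
    ((t' = t ∧ ∀ γ T p, γ ≤ nΓ → T < 2 ^ N → p < nP → A γ T p → u t γ T p = t) ∨
        t.count (2 * nΓ + 2) N < t'.count (2 * nΓ + 2) N ∧
        ¬ ∀ γ T p, γ ≤ nΓ → T < 2 ^ N → p < nP → u t γ T p = t)
  have hQ : ∀ {A A' : ℕ → ℕ → ℕ → Prop} {s'}, (∀ γ T p, γ ≤ nΓ → T < 2 ^ N → p < nP → A' γ T p →
      A γ T p) → Q A s' → Q A' s' := by
    rintro A A' s' hA ⟨t', h1, h2, h3⟩
    refine ⟨t', h1, h2, h3.imp_left fun h3 => ⟨h3.1, fun γ T p hγ hT hp hA' =>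
      h3.2 γ T p hγ hT hp (hA γ T p hγ hT hp hA')⟩⟩
  have key := loop_rule' (s := s) (i := 40) (e := reg 2 + 1)
    (c := for_ 41 (reg 6) (for_ 42 (reg 1) B)) 39
    (by simp [above, above_mono (by norm_num : 39 ≤ 43) hB])
    (fun k s' => Q (fun γ _ _ => k ≤ γ) s') (3 + 2 ^ N * (8 + nP * (K + 5)))
    ⟨t, h, hI, .inl ⟨rfl, fun γ T p hγ _ _ hA => by rw [hn] at hA; omega⟩⟩ (by
      intro γ s₁ hγ hr₁ hQ₁
      rw [hn] at hγ
      have hD₁ : (reg 6).eval (s₁.set 40 γ) = 2 ^ N := by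
        rw [eval_reg, State.set_reg, if_neg (by norm_num), hr₁ 6 (by norm_num), hD]
      have key₁ := loop_rule' (s := s₁.set 40 γ) (i := 41) (e := reg 6)
        (c := for_ 42 (reg 1) B) 41
        (by simp [above, above_mono (by norm_num : 41 ≤ 43) hB])
        (fun k s' => Q (fun γ' T _ => γ + 1 ≤ γ' ∨ γ' = γ ∧ k ≤ T) s') (3 + nP * (K + 5))
        (by
          obtain ⟨t', h1, h2, h3⟩ := hQ₁
          refine hQ (A := fun γ' _ _ => γ + 1 ≤ γ') (fun γ' T p _ hT _ => ?_)
            ⟨t', h1.of_eq (fun r hr' => ?_) rfl, h2, h3⟩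
          · rw [hD₁]
            omega
          · rw [State.set_reg, if_neg (by omega)]) (by
          intro T s₂ hT hr₂ hQ₂
          rw [hD₁] at hT
          have hP₂ : (reg 1).eval (s₂.set 41 T) = nP := by
            rw [eval_reg, State.set_reg, if_neg (by norm_num), hr₂ 1 (by norm_num), State.set_reg,
              if_neg (by norm_num), hr₁ 1 (by norm_num), hP]
          have key₂ := loop_rule' (s := s₂.set 41 T) (i := 42) (e := reg 1) (c := B) 42
            (by simp [above, above_mono (by norm_num : 42 ≤ 43) hB])
            (fun k s' => Q (fun γ' T' p => (γ + 1 ≤ γ' ∨ γ' = γ ∧ T + 1 ≤ T') ∨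
              (γ' = γ ∧ T' = T ∧ k ≤ p)) s') K
            (by
              obtain ⟨t', h1, h2, h3⟩ := hQ₂
              refine hQ (A := fun γ' T' _ => γ + 1 ≤ γ' ∨ γ' = γ ∧ T + 1 ≤ T')
                (fun γ' T p _ hT hp => ?_) ⟨t', h1.of_eq (fun r hr' => ?_) rfl, h2, h3⟩
              · rw [hP₂]
                omega
              · rw [State.set_reg, if_neg (by omega)]) (by
              rintro p s₃ hp hr₃ ⟨t', h1, h2, h3⟩
              rw [hP₂] at hp
              have e1 : (s₃.set 42 p).reg 40 = γ := by
                rw [State.set_reg, if_neg (by norm_num), hr₃ 40 (by norm_num), State.set_reg,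
                  if_neg (by norm_num), hr₂ 40 (by norm_num), State.set_reg, if_pos rfl]
              have e2 : (s₃.set 42 p).reg 41 = T := by
                rw [State.set_reg, if_neg (by norm_num), hr₃ 41 (by norm_num), State.set_reg,
                  if_pos rfl]
              have e3 : (s₃.set 42 p).reg 42 = p := by rw [State.set_reg, if_pos rfl]
              have e4 : ∀ r < 39, (s₃.set 42 p).reg r = s₀.reg r := by
                intro r hr'
                rw [State.set_reg, if_neg (by omega), hr₃ r (by omega), State.set_reg,
                  if_neg (by omega), hr₂ r (by omega), State.set_reg, if_neg (by omega),
                  hr₁ r (by omega), hr r hr']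
              obtain ⟨g1, g2, g3⟩ := hc t' (s₃.set 42 p) e4
                (h1.of_eq (fun r hr' => by rw [State.set_reg, if_neg (by omega)]) rfl) h2
                (by rw [e1]; omega) (by rw [e2]; exact hT) (by rw [e3]; exact hp)
              rw [e1, e2, e3] at g1 g2
              refine ⟨⟨_, g1, g2, ?_⟩, g3⟩
              have hu' := hu t' γ T p (by omega) hT hp
              rcases h3 with ⟨rfl, h3⟩ | ⟨h3, h4⟩
              · rcases hu' with hu' | hu'
                · left
                  refine ⟨hu', fun γ' T' p' hγ' hT' hp' hA => ?_⟩
                  by_cases hx : γ' = γ ∧ T' = T ∧ p' = p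
                  · obtain ⟨rfl, rfl, rfl⟩ := hx
                    exact hu'
                  · exact h3 γ' T' p' hγ' hT' hp' (by omega)
                · right
                  refine ⟨hu', fun hall => ?_⟩
                  rw [hall γ T p (by omega) hT hp] at hu'
                  exact lt_irrefl _ hu'
              · right
                refine ⟨?_, h4⟩
                rcases hu' with hu' | hu'
                · rwa [hu']
                · exact h3.trans hu')
          refine ⟨hQ (fun γ' T' p _ _ _ hA => ?_) key₂.1, ?_⟩
          · omega
          · have := key₂.2
            rw [hP₂] at this
            exact this)
      refine ⟨hQ (fun γ' T' p _ _ _ hA => ?_) key₁.1, ?_⟩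
      · omega
      · have := key₁.2
        rw [hD₁] at this
        have e : 3 + nP * (K + 5) + 5 = 8 + nP * (K + 5) := by omega
        rw [e] at this
        exact this)
  refine ⟨?_, ?_⟩
  · obtain ⟨t', h1, h2, h3⟩ := key.1
    exact ⟨t', h1, h2, h3.imp_left fun h3 => ⟨h3.1, fun γ T p hγ hT hp =>
      h3.2 γ T p hγ hT hp (Nat.zero_le _)⟩⟩
  · have := key.2
    rw [hn] at this
    have e : 3 + 2 ^ N * (8 + nP * (K + 5)) + 5 = 8 + 2 ^ N * (8 + nP * (K + 5)) := by omega
    rw [e] at this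
    exact this

/-- The number of sweeps is one more than the number of digits of the table. Either a stable table
has been met, and it stays as it is, or each sweep has set a digit; the latter cannot go on to the
end. -/
theorem Carries.fix (hc : Carries ρ m nP nΓ N Inv u B s₀ K) (hB : B.above 43 = true)
    (H : Static ρ m rules F N comp rc pos)
    (hu : ∀ t γ T p, γ ≤ nΓ → T < 2 ^ N → p < nP →
      u t γ T p = t ∨ t.count (2 * nΓ + 2) N < (u t γ T p).count (2 * nΓ + 2) N)
    (h : Good nΓ ρ m N t s₀) (hI : Inv t) (hP : 0 < nP) :
    (∃ t', Good nΓ ρ m N t' ((fix B).den s₀) ∧ Inv t' ∧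
      ∀ γ T p, γ ≤ nΓ → T < 2 ^ N → p < nP → u t' γ T p = t') ∧
    (fix B).cost s₀ ≤ ((2 * nΓ + 2) * N * 2 ^ N + 1) * (nΓ + 1) * 2 ^ N * nP * (K + 40) := by
  have hn : (reg 7).eval s₀ = (2 * nΓ + 2) * N * 2 ^ N + 1 :=
    (h.reg 7 (by norm_num)).trans H.rM
  set M := (2 * nΓ + 2) * N * 2 ^ N with hM
  have key := loop_rule' (s := s₀) (i := 39) (e := reg 7) (c := BCARET.sweep B) 39
    (by simp [BCARET.sweep, above, above_mono (by norm_num : 39 ≤ 43) hB])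
    (fun k s' => ∃ t', Good nΓ ρ m N t' s' ∧ Inv t' ∧
      ((∀ γ T p, γ ≤ nΓ → T < 2 ^ N → p < nP → u t' γ T p = t') ∨
        M + 1 ≤ k + t'.count (2 * nΓ + 2) N))
    (5 + (nΓ + 1) * (8 + 2 ^ N * (8 + nP * (K + 5))))
    ⟨t, h, hI, .inr (by rw [hn]; omega)⟩ (by
      rintro k s' hk hr ⟨t', h1, h2, h3⟩
      obtain ⟨⟨t'', g1, g2, g3⟩, g4⟩ := hc.sweep hB H hu (s := s'.set 39 k) (t := t')
        (fun r hr' => by rw [State.set_reg, if_neg (by omega), hr r hr'])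
        (h1.of_eq (fun r hr' => by rw [State.set_reg, if_neg (by omega)]) rfl) h2
      refine ⟨⟨t'', g1, g2, ?_⟩, g4⟩
      rcases g3 with ⟨rfl, g3⟩ | ⟨g3, g5⟩
      · exact .inl g3
      · rcases h3 with h3 | h3
        · exact absurd h3 g5
        · right
          omega)
  refine ⟨?_, ?_⟩
  · obtain ⟨t', h1, h2, h3⟩ := key.1
    refine ⟨t', h1, h2, h3.resolve_right fun h4 => ?_⟩
    have := t'.count_le (2 * nΓ + 2) N
    omega
  · have h1 := key.2
    rw [hn] at h1
    refine h1.trans ?_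
    have hD : 1 ≤ 2 ^ N := Nat.one_le_two_pow
    generalize 2 ^ N = D at hD ⊢
    have a5 : 1 ≤ M + 1 := by omega
    generalize M + 1 = M' at *
    have a1 : 8 + nP * (K + 5) ≤ nP * (K + 13) := by nlinarith
    have a2 : 8 + D * (8 + nP * (K + 5)) ≤ D * nP * (K + 21) := by
      have := Nat.mul_le_mul_left D a1
      have h3 : 1 ≤ D * nP := Nat.mul_pos hD hP
      nlinarith
    have a3 : 5 + (nΓ + 1) * (8 + D * (8 + nP * (K + 5))) ≤ (nΓ + 1) * (D * nP) * (K + 26) := by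
      have := Nat.mul_le_mul_left (nΓ + 1) a2
      have h3 : 1 ≤ (nΓ + 1) * (D * nP) := Nat.mul_pos (by omega) (Nat.mul_pos hD hP)
      nlinarith
    have a4 : 0 < (nΓ + 1) * (D * nP) := Nat.mul_pos (by omega) (Nat.mul_pos hD hP)
    have a6 : (reg 7).cost = 2 := rfl
    rw [a6, Nat.mul_assoc M', Nat.mul_assoc M', Nat.mul_assoc (nΓ + 1), Nat.mul_assoc M']
    generalize (nΓ + 1) * (D * nP) = X at *
    have a7 := Nat.mul_le_mul_left M' a3
    have a8 : M' ≤ M' * X := Nat.le_mul_of_pos_right _ a4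
    nlinarith

end Loops

/-! ### Saturation of the popping relation -/

section PopStage

variable {nP nΓ nA : ℕ} {ρ m : ℕ → ℕ} {rules : List (Rule (Fin nP) (Fin nΓ))} {F N : ℕ}
  {comp : ℕ → Option (Formula (Fin nA))} {rc : ℕ → ℕ} {pos : ℕ → ℕ → ℕ} {t : Tab} {s : State}

/-- Check whether the rule that has been read leads to the empty stack. -/
def popRule : Cmd :=
  ite (eqE (reg 47) (reg 42)) (ite (eqE (reg 48) (reg 40))
    (asg 54 (reg 41) ;; evalWord 18 ;; asg 60 (reg 49) ;;
      ite (eqE (reg 46) 1) (asg 60 (reg 1 + reg 49)) skip ;;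
      ite (bitE (reg 60) (reg 54)) (asg 52 1) skip) skip) skip

/-- The elementary step of the computation of the popping relation. -/
def popBody : Cmd :=
  asg 52 0 ;; rulesLoop popRule ;;
    ite (reg 52) (setCmd 18 (reg 42) ;; setCmd 18 (reg 1 + reg 42)) skip

theorem Rule.word_length_le {P Γ : Type} (r : Rule P Γ) : r.word.length + 1 ≤ r.size := by
  cases r <;> simp [Rule.word, Rule.size, Nat.add_comm]

theorem popRule_spec (h : Good nΓ ρ m N t s) (H : Static ρ m rules F N comp rc pos)
    (hB : t.Bdd (2 * nΓ + 2) N) (hN : 2 * nP ≤ N) {r : Rule (Fin nP) (Fin nΓ)}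
    (hr : ReadOut r s) (hT : s.reg 41 < 2 ^ N) :
    (((popRule).den s).reg 52 ≠ 0 ↔ s.reg 52 ≠ 0 ∨ ((r.srcP : ℕ) = s.reg 42 ∧
      (r.srcΓ : ℕ) = s.reg 40 ∧
      (ev (t.low nΓ) r.word (s.reg 41)).testBit (lastBit nP r.act r.tgt) = true)) ∧
      popRule.cost s ≤ 150 * r.size := by
  have h1 := eval_eqE (s := s) (reg 47) (reg 42)
  have h2 := eval_eqE (s := s) (reg 48) (reg 40)
  simp only [eval_reg, hr.srcP, hr.srcΓ] at h1 h2
  have hsz := r.word_length_le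
  have c1 : (eqE (reg 47) (reg 42)).cost = 13 := rfl
  have c2 : (eqE (reg 48) (reg 40)).cost = 13 := rfl
  have c0 : ∀ s, skip.cost s = 1 := fun _ => rfl
  rw [popRule, den, Cmd.cost, c1]
  by_cases hp : (r.srcP : ℕ) = s.reg 42
  swap
  · rw [if_neg (h1.not.2 hp), if_neg (h1.not.2 hp), c0]
    exact ⟨by simp [den, hp], by omega⟩
  rw [if_pos (h1.2 hp), if_pos (h1.2 hp), den, Cmd.cost, c2]
  by_cases hγ : (r.srcΓ : ℕ) = s.reg 40
  swap
  · rw [if_neg (h2.not.2 hγ), if_neg (h2.not.2 hγ), c0]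
    exact ⟨by simp [den, hγ], by omega⟩
  rw [if_pos (h2.2 hγ), if_pos (h2.2 hγ)]
  set s₁ := s.set 54 (s.reg 41) with hs₁
  have hg₁ : Good nΓ ρ m N t s₁ :=
    h.of_eq (fun i hi => by rw [hs₁, State.set_reg, if_neg (by omega)]) rfl
  have hT₁ : s₁.reg 54 = s.reg 41 := by rw [hs₁, State.set_reg, if_pos rfl]
  obtain ⟨e1, e2, e3⟩ := hg₁.evalWord H hB (tp := 18) (.inr rfl) (w := r.word)
    (by
      have := hr.word
      rwa [hs₁, State.set_mem, State.set_reg, if_neg (by norm_num)])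
    (by rw [hs₁, State.set_reg, if_neg (by norm_num), hr.len]) (by rw [hT₁]; exact hT)
  set s₂ := (evalWord 18).den s₁ with hs₂
  have r₂ : ∀ i < 54, s₂.reg i = s.reg i := by
    intro i hi
    rw [hs₂, reg_den (K := 54) rfl _ hi, hs₁, State.set_reg, if_neg (by omega)]
  have m₂ : s₂.mem = s.mem := (mem_den (c := evalWord 18) rfl _).trans rfl
  have hrow : (fun γ => t (rowOf nΓ 18 γ)) = t.low nΓ := by
    funext γ
    simp [rowOf, Tab.low]
  rw [hT₁, hrow] at e1 e2
  set s₃ := (asg 60 (reg 49) ;; ite (eqE (reg 46) 1) (asg 60 (reg 1 + reg 49)) skip).den s₂ with hs₃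
  have r₃ : ∀ i < 60, s₃.reg i = s₂.reg i := fun i hi => reg_den (K := 60) rfl _ hi
  have m₃ : s₃.mem = s.mem := (mem_den (by rfl) _).trans m₂
  have hg₃ : Good nΓ ρ m N t s₃ := h.of_eq (fun i hi => by
    rw [r₃ i (by omega), r₂ i (by omega)]) m₃
  have h60 : s₃.reg 60 = lastBit nP r.act r.tgt := by
    have k1 := hr.kind
    have k2 := hr.tgt
    have k3 : s.reg 1 = nP := (h.reg 1 (by norm_num)).trans H.rP
    rw [← r₂ _ (by norm_num)] at k1 k2 k3
    have h3 := eval_eqE (s := s₂.set 60 (s₂.reg 49)) (reg 46) 1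
    simp only [eval_reg, eval_one, State.set_reg] at h3
    rw [if_neg (by norm_num), k1] at h3
    rw [hs₃, den, den, den, eval_reg]
    cases ha : r.act
    · rw [if_neg (by rw [h3, ha]; simp [actNum])]
      simp [den, State.set_reg, lastBit, k2]
    · rw [if_pos (by rw [h3, ha]; rfl)]
      simp [den, State.set_reg, lastBit, k2, k3]
    · rw [if_neg (by rw [h3, ha]; simp [actNum])]
      simp [den, State.set_reg, lastBit, k2]
  have hlast : lastBit nP r.act r.tgt < N := by
    have := r.tgt.2
    unfold lastBit
    split <;> omega
  have h54 : s₃.reg 54 = ev (t.low nΓ) r.word (s.reg 41) := (r₃ _ (by norm_num)).trans e1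
  have hb := hg₃.eval_bit H (b := reg 60) (T := reg 54) (by rw [eval_reg, h60]; exact hlast)
    (by rw [eval_reg, h54]; exact e2)
  rw [eval_reg, eval_reg, h60, h54] at hb
  constructor
  · change ((ite (bitE (reg 60) (reg 54)) (asg 52 1) skip).den s₃).reg 52 ≠ 0 ↔ _
    rw [den, hb]
    cases hbit : (ev (t.low nΓ) r.word (s.reg 41)).testBit (lastBit nP r.act r.tgt)
    · simp [den, r₃, r₂]
    · simp [den, State.set_reg, hp, hγ]
  · have hc := cost_le_worst (c := asg 60 (reg 49) ;;
      ite (eqE (reg 46) 1) (asg 60 (reg 1 + reg 49)) skip ;;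
      ite (bitE (reg 60) (reg 54)) (asg 52 1) skip) rfl s₂
    have hw : (asg 60 (reg 49) ;; ite (eqE (reg 46) 1) (asg 60 (reg 1 + reg 49)) skip ;;
      ite (bitE (reg 60) (reg 54)) (asg 52 1) skip).worst ≤ 60 := by decide
    change 13 + (13 + (4 + ((evalWord 18).cost s₁ + (asg 60 (reg 49) ;;
      ite (eqE (reg 46) 1) (asg 60 (reg 1 + reg 49)) skip ;;
      ite (bitE (reg 60) (reg 54)) (asg 52 1) skip).cost s₂) + 1) + 1) ≤ _
    omega

theorem popBody_carries {S : PDS (Fin nP) (Fin nΓ)} (H : Static ρ m rules F N comp rc pos)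
    (hN : 2 * nP ≤ N) (hR : ∀ r, r ∈ rules ↔ r ∈ S.Δ) (s₀ : State) :
    Carries ρ m nP nΓ N (fun t => t.Bdd (2 * nΓ + 2) N ∧ PopSound S N t) (popUpd S) popBody s₀
      (200 + 230 * (rules.map Rule.size).sum) := by
  rintro t s - h ⟨hB, hS⟩ hγ hT hp
  set s₁ := s.set 52 0 with hs₁
  have r₁ : ∀ i < 52, s₁.reg i = s.reg i := fun i hi => by
    rw [hs₁, State.set_reg, if_neg (by omega)]
  have hg₁ : Good nΓ ρ m N t s₁ := h.of_eq (fun i hi => r₁ i (by omega)) rfl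
  have hlow := H.rules_lt
  obtain ⟨hJ, hc, -⟩ := rulesLoop_spec (body := popRule) (s := s₁) (rules := rules) rfl rfl
    (H.rules_at.congr fun b _ hb => hg₁.mem b (by omega))
    ((hg₁.reg 3 (by norm_num)).trans H.rR)
    (fun l a _ => a ≠ 0 ↔ ∃ r ∈ l, (r.srcP : ℕ) = s.reg 42 ∧ (r.srcΓ : ℕ) = s.reg 40 ∧
      (ev (t.low nΓ) r.word (s.reg 41)).testBit (lastBit nP r.act r.tgt) = true) 150
    (by simp [hs₁, State.set_reg]) (by
      intro l r s' hr hr' hm' hro hJ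
      have hg' : Good nΓ ρ m N t s' := hg₁.of_eq (fun i hi => hr' i (by omega)) hm'
      have e41 : s'.reg 41 = s.reg 41 := (hr' _ (by norm_num)).trans (r₁ _ (by norm_num))
      have e42 : s'.reg 42 = s.reg 42 := (hr' _ (by norm_num)).trans (r₁ _ (by norm_num))
      have e40 : s'.reg 40 = s.reg 40 := (hr' _ (by norm_num)).trans (r₁ _ (by norm_num))
      obtain ⟨g1, g2⟩ := popRule_spec hg' H hB hN hro (by rw [e41]; exact hT)
      rw [e40, e41, e42, hJ] at g1
      refine ⟨?_, g2⟩
      rw [g1]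
      simp [or_and_right, exists_or])
  set s₂ := (rulesLoop popRule).den s₁ with hs₂
  have r₂ : ∀ i < 44, s₂.reg i = s.reg i := fun i hi => by
    rw [hs₂, reg_den (K := 44) rfl _ hi, r₁ i (by omega)]
  have m₂ : s₂.mem = s.mem := (mem_den (c := rulesLoop popRule) rfl _).trans rfl
  have hg₂ : Good nΓ ρ m N t s₂ := h.of_eq (fun i hi => r₂ i (by omega)) m₂
  have hcond : s₂.reg 52 ≠ 0 ↔ popCond S t (s.reg 40) (s.reg 41) (s.reg 42) := by
    rw [hJ, popCond]
    simp only [hR]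
  have hden : popBody.den s = if s₂.reg 52 ≠ 0 then
      (setCmd 18 (reg 1 + reg 42)).den ((setCmd 18 (reg 42)).den s₂) else s₂ := rfl
  have hcost : popBody.cost s = 3 + ((rulesLoop popRule).cost s₁ +
      (ite (reg 52) (setCmd 18 (reg 42) ;; setCmd 18 (reg 1 + reg 42)) skip).cost s₂) := rfl
  have hw := cost_le_worst (c := ite (reg 52) (setCmd 18 (reg 42) ;; setCmd 18 (reg 1 + reg 42)) skip)
    rfl s₂
  have hw' : (ite (reg 52) (setCmd 18 (reg 42) ;; setCmd 18 (reg 1 + reg 42)) skip).worst ≤ 180 := by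
    decide
  have hP : s₂.reg 1 = nP := (hg₂.reg 1 (by norm_num)).trans H.rP
  have hI : (popUpd S t (s.reg 40) (s.reg 41) (s.reg 42)).Bdd (2 * nΓ + 2) N := by
    unfold popUpd
    split_ifs
    · exact (hB.setBit (by omega)).setBit (by omega)
    · exact hB
  refine ⟨?_, ⟨hI, hS.upd hB hT hp⟩, by omega⟩
  rw [hden, popUpd]
  by_cases hc : popCond S t (s.reg 40) (s.reg 41) (s.reg 42)
  · rw [if_pos hc, if_pos (hcond.2 hc)]
    have g1 := hg₂.setCmd H hB (tp := 18) (.inr rfl) (b := reg 42)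
      (by rw [r₂ _ (by norm_num)]; exact hγ) (by rw [r₂ _ (by norm_num)]; exact hT)
      (by rw [eval_reg, r₂ _ (by norm_num)]; omega)
    have r₃ : ∀ i, ((setCmd 18 (reg 42)).den s₂).reg i = s₂.reg i :=
      fun i => reg_den (K := i + 1) rfl _ (by omega)
    have hB' := hB.setBit (γ := rowOf nΓ 18 (s₂.reg 40)) (T := s₂.reg 41)
      (b := (reg 42).eval s₂) (by rw [eval_reg, r₂ _ (by norm_num)]; omega)
    have g2 := g1.setCmd H hB' (tp := 18) (.inr rfl) (b := reg 1 + reg 42)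
      (by rw [r₃, r₂ _ (by norm_num)]; exact hγ) (by rw [r₃, r₂ _ (by norm_num)]; exact hT)
      (by rw [eval_add, eval_reg, eval_reg, r₃, r₃, hP, r₂ _ (by norm_num)]; omega)
    simp only [eval_reg, eval_add, r₃, hP, r₂ 40 (by norm_num), r₂ 41 (by norm_num),
      r₂ 42 (by norm_num), rowOf] at g2
    exact g2
  · rw [if_neg hc, if_neg (hcond.not.2 hc)]
    exact hg₂

/-- Two digits are set at a time; the count grows if either of them is new. -/
theorem popUpd_count {S : PDS (Fin nP) (Fin nΓ)} (hN : 2 * nP ≤ N) (t : Tab) (γ T p : ℕ)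
    (hγ : γ ≤ nΓ) (hT : T < 2 ^ N) (hp : p < nP) : popUpd S t γ T p = t ∨
      t.count (2 * nΓ + 2) N < (popUpd S t γ T p).count (2 * nΓ + 2) N := by
  unfold popUpd
  split_ifs with hc
  · rcases t.count_setBit (g := 2 * nΓ + 2) (N := N) (γ := nΓ + 1 + γ) (T := T) (b := p)
      (by omega) hT (by omega) with h | h
    · rw [h]
      exact t.count_setBit (by omega) hT (by omega)
    · exact .inr (h.trans_le (Tab.count_setBit_le _))
  · exact .inl rfl

/-- The computation of the popping relation. -/
theorem popStage {S : PDS (Fin nP) (Fin nΓ)} (H : Static ρ m rules F N comp rc pos)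
    (hN : 2 * nP ≤ N) (hR : ∀ r, r ∈ rules ↔ r ∈ S.Δ) (hP : 0 < nP)
    (h : Good nΓ ρ m N t s) (hB : t.Bdd (2 * nΓ + 2) N) (hS : PopSound S N t) :
    (∃ t', Good nΓ ρ m N t' ((fix popBody).den s) ∧ t'.Bdd (2 * nΓ + 2) N ∧
      (∀ γ T, γ ≤ nΓ → t' γ T = t γ T) ∧
      ∀ (q q' : Fin nP) (γ : Fin nΓ) (b : Act),
        (t' (nΓ + 1 + γ) (2 ^ lastBit nP b q')).testBit q = true ↔ S.Pop (b = .ret) q γ q') ∧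
    (fix popBody).cost s ≤ ((2 * nΓ + 2) * N * 2 ^ N + 1) * (nΓ + 1) * 2 ^ N * nP *
      (240 + 230 * (rules.map Rule.size).sum) := by
  have hC := popBody_carries H hN hR s
  -- The invariant is enlarged by the fact that the first half of the table, which holds the digits
  -- of the automata, is not touched: all updates go to rows beyond `nΓ`.
  have hC' : Carries ρ m nP nΓ N (fun t' => (t'.Bdd (2 * nΓ + 2) N ∧ PopSound S N t') ∧
      ∀ γ T, γ ≤ nΓ → t' γ T = t γ T) (popUpd S) popBody s
      (200 + 230 * (rules.map Rule.size).sum) := by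
    rintro t' s' hr hg ⟨hI, hlow⟩ hγ hT hp
    obtain ⟨h1, h2, h3⟩ := hC t' s' hr hg hI hγ hT hp
    refine ⟨h1, ⟨h2, fun γ T hγ' => ?_⟩, h3⟩
    rw [← hlow γ T hγ', popUpd]
    split_ifs
    · rw [Tab.setBit, if_neg (by omega), Tab.setBit, if_neg (by omega)]
    · rfl
  obtain ⟨⟨t', h1, ⟨⟨h2, h3⟩, h4⟩, h5⟩, h6⟩ := hC'.fix rfl H (popUpd_count hN) h
    ⟨⟨hB, hS⟩, fun _ _ _ => rfl⟩ hP
  refine ⟨⟨t', h1, h2, h4, fun q q' γ b => h3.pop_iff h2 h5 q q' γ b ?_⟩, ?_⟩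
  · have := q'.2
    unfold lastBit
    split <;> omega
  · convert h6 using 2
    omega

end PopStage

/-! ### Successors, rule by rule -/

section Successors

variable {nP nΓ nA : ℕ} {S : PDS (Fin nP) (Fin nΓ)}

/-- The successors to which the rule `r` leads. -/
def Yields (S : PDS (Fin nP) (Fin nΓ)) (J : Fin nP × List (Fin nΓ) → Prop) (b : Mode)
    (r : Rule (Fin nP) (Fin nΓ)) (o : Option (Fin nP × List (Fin nΓ))) : Prop :=
  match b, r with
  | .g, r => J (r.tgt, r.word) ∧ o = some (r.tgt, r.word)
  | .a, .int _ _ q u => J (q, u) ∧ o = some (q, u)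
  | .a, .ret _ _ q => J (q, []) ∧ o = none
  | .a, .call _ _ q γ₁ γ₂ =>
    (∃ q', J (q', [γ₂]) ∧ ((S.Pop True q γ₁ q' ∧ o = some (q', [γ₂])) ∨
      (S.Pop False q γ₁ q' ∧ o = none))) ∨ (S.Inf (q, [γ₁]) ∧ o = none)

/-- A regrouping of the successors by the rule that produces them, so that a single pass over the
rules meets them all. -/
theorem lsucc_iff_yields {J : Fin nP × List (Fin nΓ) → Prop} {b : Mode} {p : Fin nP} {γ : Fin nΓ}
    {o : Option (Fin nP × List (Fin nΓ))} : S.LSucc J p γ b o ↔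
      ∃ r ∈ S.Δ, r.srcP = p ∧ r.srcΓ = γ ∧ Yields S J b r o := by
  constructor
  · intro h
    cases h with
    | glob hr hp hγ h => exact ⟨_, hr, hp, hγ, h, rfl⟩
    | int hr h => exact ⟨_, hr, rfl, rfl, h, rfl⟩
    | ret hr h => exact ⟨_, hr, rfl, rfl, h, rfl⟩
    | callRet hr hp h => exact ⟨_, hr, rfl, rfl, .inl ⟨_, h, .inl ⟨hp, rfl⟩⟩⟩
    | callInt hr hp h => exact ⟨_, hr, rfl, rfl, .inl ⟨_, h, .inr ⟨hp, rfl⟩⟩⟩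
    | callNever hr h => exact ⟨_, hr, rfl, rfl, .inr ⟨h, rfl⟩⟩
  · rintro ⟨r, hr, rfl, rfl, h⟩
    cases b with
    | g =>
      obtain ⟨h, rfl⟩ := h
      exact .glob hr rfl rfl h
    | a =>
      cases r with
      | int p γ q u =>
        obtain ⟨h, rfl⟩ := h
        exact .int hr h
      | ret p γ q =>
        obtain ⟨h, rfl⟩ := h
        exact .ret hr h
      | call p γ q γ₁ γ₂ =>
        rcases h with ⟨q', h, ⟨hp, rfl⟩ | ⟨hp, rfl⟩⟩ | ⟨h, rfl⟩
        · exact .callRet hr hp h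
        · exact .callInt hr hp h
        · exact .callNever hr h

/-- From the state `s` to the state `s'`, the successors in `Y` are taken into account: register
`52` tells whether some successor satisfies `A`, register `53` whether all successors do. -/
structure Acc {α : Type} (A : α → Prop) (s s' : State) (Y : Option α → Prop) : Prop where
  ex : s'.reg 52 ≠ 0 ↔ s.reg 52 ≠ 0 ∨ ∃ o, Y o ∧ HoldsAt A o
  all : s'.reg 53 ≠ 0 ↔ s.reg 53 ≠ 0 ∧ ∀ o, Y o → HoldsAt A o

section Algebra

variable {α : Type} {A : α → Prop} {s s' s'' : State} {Y Y' : Option α → Prop}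

theorem Acc.refl (h52 : s'.reg 52 = s.reg 52) (h53 : s'.reg 53 = s.reg 53) (hY : ∀ o, ¬ Y o) :
    Acc A s s' Y := by
  constructor
  · simp [h52, hY]
  · simp [h53, hY]

theorem Acc.congr (h : Acc A s s' Y) (hY : ∀ o, Y' o ↔ Y o) : Acc A s s' Y' := by
  constructor
  · simpa only [hY] using h.ex
  · simpa only [hY] using h.all

theorem Acc.trans (h : Acc A s s' Y) (h' : Acc A s' s'' Y') (hY : ∀ o, Y o ∨ Y' o ↔ Y'' o) :
    Acc A s s'' Y'' := by
  constructor
  · rw [h'.ex, h.ex, or_assoc]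
    simp only [← hY, or_and_right, exists_or]
  · rw [h'.all, h.all, and_assoc]
    simp only [← hY, or_imp, forall_and]

theorem Acc.left (h : Acc A s s' Y) {s₀ : State} (h52 : s.reg 52 = s₀.reg 52)
    (h53 : s.reg 53 = s₀.reg 53) : Acc A s₀ s' Y :=
  ⟨by rw [h.ex, h52], by rw [h.all, h53]⟩

/-- Take the successor `⊥` into account. -/
theorem Acc.bot (e : Expr) {C : Prop} (he : e.eval s ≠ 0 ↔ C) :
    Acc A s ((ite e (asg 53 0) skip).den s) (fun o => C ∧ o = none) := by
  rw [den]
  by_cases hC : C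
  · rw [if_pos (he.2 hC)]
    constructor <;> simp [den, State.set_reg, hC, HoldsAt]
  · rw [if_neg (he.not.2 hC)]
    exact .refl rfl rfl (by simp [hC])

/-- Take a successor other than `⊥` into account. -/
theorem Acc.some (e e' : Expr) {C : Prop} {x : α} (he : e.eval s ≠ 0 ↔ C)
    (he' : C → (e'.eval s ≠ 0 ↔ A x)) :
    Acc A s ((ite e (ite e' (asg 52 1) (asg 53 0)) skip).den s) (fun o => C ∧ o = some x) := by
  rw [den]
  by_cases hC : C
  · rw [if_pos (he.2 hC), den]
    by_cases hA : A x
    · rw [if_pos ((he' hC).2 hA)]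
      constructor <;> simp [den, State.set_reg, hC, HoldsAt, hA]
    · rw [if_neg ((he' hC).not.2 hA)]
      constructor <;> simp [den, State.set_reg, hC, HoldsAt, hA]
  · rw [if_neg (he.not.2 hC)]
    exact .refl rfl rfl (by simp [hC])

end Algebra

end Successors

/-! ### Accounting for the successors that one rule yields -/

section Rule

variable {nP nΓ nA : ℕ} {ρ m : ℕ → ℕ} {rules : List (Rule (Fin nP) (Fin nΓ))} {F N : ℕ}
  {comp : ℕ → Option (Formula (Fin nA))} {rc : ℕ → ℕ} {pos : ℕ → ℕ → ℕ} {t : Tab} {s : State}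
  {S : PDS (Fin nP) (Fin nΓ)}

/-- Take into account the configuration to which the rule that has been read leads. -/
def accWord : Cmd :=
  asg 54 (reg 41) ;; evalWord 17 ;; ite (truthE (reg 4) (reg 49) (reg 54))
    (ite (truthE (reg 35) (reg 49) (reg 54)) (asg 52 1) (asg 53 0)) skip

/-- Whether the topmost symbol in register `58` can be popped, beginning at the location in
register `49`, with last digit `b`. -/
def popE (b : Expr) : Expr := bitE (reg 49) (lkE 18 (reg 58) (mem (reg 15 + b)))

/-- Take into account the abstract-successors for a call rule with return location in register
`57`. -/
def accReturn : Cmd :=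
  ite (truthE (reg 4) (reg 57) (reg 54))
    (ite (popE (reg 1 + reg 57)) (ite (truthE (reg 35) (reg 57) (reg 54)) (asg 52 1) (asg 53 0)) skip ;;
      ite (popE (reg 57)) (asg 53 0) skip) skip

/-- Take into account the abstract-successors for a call rule. -/
def accCall : Cmd :=
  asg 58 (mem (reg 50)) ;; asg 54 (lkE 17 (mem (reg 50 + 1)) (reg 41)) ;;
    for_ 57 (reg 1) accReturn ;;
    ite (truthE (reg 4) (reg 49) (lkE 17 (reg 58) (lkE 17 (reg 2) 0))) (asg 53 0) skip

/-- Take into account the successors for the rule that has been read. -/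
def succRule : Cmd :=
  ite (eqE (reg 47) (reg 42)) (ite (eqE (reg 48) (reg 40))
    (ite (reg 34) (ite (eqE (reg 46) 2) accWord (ite (eqE (reg 46) 1)
      (ite (truthE (reg 4) (reg 49) (reg 41)) (asg 53 0) skip) accCall)) accWord) skip) skip

/-- The second half of the table holds the popping relation. -/
def PopOK (S : PDS (Fin nP) (Fin nΓ)) (t : Tab) : Prop :=
  ∀ (q q' : Fin nP) (γ : Fin nΓ) (b : Act),
    (t (nΓ + 1 + γ) (2 ^ lastBit nP b q')).testBit q = true ↔ S.Pop (b = .ret) q γ q'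

variable {c T : ℕ}

theorem accWord_spec (h : Good nΓ ρ m N t s) (H : Static ρ m rules F N comp rc pos)
    (hB : t.Bdd (2 * nΓ + 2) N) (hpos : ∀ i ≤ F, ∀ p < nP, pos i p < N)
    {r : Rule (Fin nP) (Fin nΓ)} (hr : ReadOut r s) (hT : s.reg 41 < 2 ^ N)
    (hc : s.reg 35 = c) (hcF : c ≤ F) :
    Acc (fun x : Fin nP × List (Fin nΓ) => Truth comp pos c x.1 (ev t x.2 (s.reg 41))) s
      (accWord.den s) (fun o => Truth comp pos F r.tgt (ev t r.word (s.reg 41)) ∧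
        o = some (r.tgt, r.word)) ∧ accWord.cost s ≤ 200 + 21 * r.word.length := by
  set s₁ := s.set 54 (s.reg 41) with hs₁
  have hg₁ : Good nΓ ρ m N t s₁ :=
    h.of_eq (fun i hi => by rw [hs₁, State.set_reg, if_neg (by omega)]) rfl
  have hT₁ : s₁.reg 54 = s.reg 41 := by rw [hs₁, State.set_reg, if_pos rfl]
  obtain ⟨e1, e2, e3⟩ := hg₁.evalWord H hB (tp := 17) (.inl rfl) (w := r.word)
    (by
      have := hr.word
      rwa [hs₁, State.set_mem, State.set_reg, if_neg (by norm_num)])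
    (by rw [hs₁, State.set_reg, if_neg (by norm_num), hr.len]) (by rw [hT₁]; exact hT)
  set s₂ := (evalWord 17).den s₁ with hs₂
  have r₂ : ∀ i < 54, s₂.reg i = s.reg i := by
    intro i hi
    rw [hs₂, reg_den (K := 54) rfl _ hi, hs₁, State.set_reg, if_neg (by omega)]
  have m₂ : s₂.mem = s.mem := (mem_den (c := evalWord 17) rfl _).trans rfl
  rw [hT₁] at e1 e2
  have e1 : s₂.reg 54 = ev t r.word (s.reg 41) := e1
  have e2 : ev t r.word (s.reg 41) < 2 ^ N := e2
  have hg₂ : Good nΓ ρ m N t s₂ := h.of_eq (fun i hi => r₂ i (by omega)) m₂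
  have e4 : s₂.reg 4 = F := (hg₂.reg 4 (by norm_num)).trans H.rF
  have e35 : s₂.reg 35 = c := (r₂ _ (by norm_num)).trans hc
  have e49 : s₂.reg 49 = r.tgt := (r₂ _ (by norm_num)).trans hr.tgt
  have k1 := hg₂.eval_truth H (i := reg 4) (p := reg 49) (T := reg 54)
    (by rw [eval_reg, e4]) (by rw [eval_reg, e49]; exact r.tgt.2) (by rw [eval_reg, e1]; exact e2)
    (by rw [eval_reg, eval_reg, e4, e49]; exact hpos F le_rfl _ r.tgt.2)
  have k2 := hg₂.eval_truth H (i := reg 35) (p := reg 49) (T := reg 54)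
    (by rw [eval_reg, e35]; exact hcF) (by rw [eval_reg, e49]; exact r.tgt.2)
    (by rw [eval_reg, e1]; exact e2)
    (by rw [eval_reg, eval_reg, e35, e49]; exact hpos c hcF _ r.tgt.2)
  simp only [eval_reg, e4, e35, e49, e1] at k1 k2
  refine ⟨(Acc.some (A := fun x : Fin nP × List (Fin nΓ) => Truth comp pos c x.1
    (ev t x.2 (s.reg 41))) (x := (r.tgt, r.word)) _ _ k1 fun _ => k2).left (r₂ _ (by norm_num)) (r₂ _ (by norm_num)), ?_⟩
  have hc := cost_le_worst (c := ite (truthE (reg 4) (reg 49) (reg 54))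
    (ite (truthE (reg 35) (reg 49) (reg 54)) (asg 52 1) (asg 53 0)) skip) rfl s₂
  have hw : (ite (truthE (reg 4) (reg 49) (reg 54))
    (ite (truthE (reg 35) (reg 49) (reg 54)) (asg 52 1) (asg 53 0)) skip).worst ≤ 190 := by decide
  change 4 + ((evalWord 17).cost s₁ + (ite (truthE (reg 4) (reg 49) (reg 54))
    (ite (truthE (reg 35) (reg 49) (reg 54)) (asg 52 1) (asg 53 0)) skip).cost s₂) ≤ _
  omega

/-- The column is the one whose number is the power of two for the wanted last digit; it is looked
up in the array of powers, and the digit of the start location is then read from the entry. -/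
theorem eval_popE (h : Good nΓ ρ m N t s) (H : Static ρ m rules F N comp rc pos)
    (hB : t.Bdd (2 * nΓ + 2) N) (hN : 2 * nP ≤ N) (hpop : PopOK S t) {q q' : Fin nP}
    {γ : Fin nΓ} (hq : s.reg 49 = q) (hγ : s.reg 58 = γ) {b : Expr} (a : Act)
    (hb : b.eval s = lastBit nP a q') : (popE b).eval s ≠ 0 ↔ S.Pop (a = .ret) q γ q' := by
  have hlast : lastBit nP a q' < N := by
    have := q'.2
    unfold lastBit
    split <;> omega
  have hT : 2 ^ lastBit nP a q' < 2 ^ N := Nat.pow_lt_pow_right (by norm_num) hlast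
  have h1 : (mem (reg 15 + b)).eval s = 2 ^ lastBit nP a q' := by
    have := H.pow_lt
    rw [eval_mem, eval_add, hb, eval_reg, h.reg 15 (by norm_num), h.mem _ (by omega),
      H.pow _ hlast]
  have h2 := h.eval_lk_low H (γ := reg 58) (T := mem (reg 15 + b))
    (by rw [eval_reg, hγ]; exact γ.2.le) (by rw [h1]; exact hT)
  rw [eval_reg, hγ, h1] at h2
  have h3 := h.eval_bit H (b := reg 49) (T := lkE 18 (reg 58) (mem (reg 15 + b)))
    (by rw [eval_reg, hq]; omega) (by rw [h2]; exact hB _ (by omega) _ hT)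
  rw [h2, eval_reg, hq] at h3
  rw [popE, h3, ← hpop]
  cases (t (nΓ + 1 + γ) (2 ^ lastBit nP a q')).testBit q <;> simp

theorem accReturn_spec (h : Good nΓ ρ m N t s) (H : Static ρ m rules F N comp rc pos)
    (hB : t.Bdd (2 * nΓ + 2) N) (hN : 2 * nP ≤ N) (hpos : ∀ i ≤ F, ∀ p < nP, pos i p < N)
    (hpop : PopOK S t) {q q' : Fin nP} {γ₁ γ₂ : Fin nΓ} (hq : s.reg 49 = q) (hγ : s.reg 58 = γ₁)
    (hq' : s.reg 57 = q') (hU : s.reg 54 = t γ₂ T) (hT : T < 2 ^ N) (hc : s.reg 35 = c)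
    (hcF : c ≤ F) :
    Acc (fun x : Fin nP × List (Fin nΓ) => Truth comp pos c x.1 (ev t x.2 T)) s
      (accReturn.den s) (fun o => Truth comp pos F q' (ev t [γ₂] T) ∧
        ((S.Pop True q γ₁ q' ∧ o = some (q', [γ₂])) ∨ (S.Pop False q γ₁ q' ∧ o = none))) := by
  have e4 : s.reg 4 = F := (h.reg 4 (by norm_num)).trans H.rF
  have hU' : t γ₂ T < 2 ^ N := hB _ (by omega) _ hT
  have k1 := h.eval_truth H (i := reg 4) (p := reg 57) (T := reg 54)
    (by rw [eval_reg, e4]) (by rw [eval_reg, hq']; exact q'.2) (by rw [eval_reg, hU]; exact hU')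
    (by rw [eval_reg, eval_reg, e4, hq']; exact hpos F le_rfl _ q'.2)
  have k2 := h.eval_truth H (i := reg 35) (p := reg 57) (T := reg 54)
    (by rw [eval_reg, hc]; exact hcF) (by rw [eval_reg, hq']; exact q'.2)
    (by rw [eval_reg, hU]; exact hU')
    (by rw [eval_reg, eval_reg, hc, hq']; exact hpos c hcF _ q'.2)
  simp only [eval_reg, e4, hc, hq', hU] at k1 k2
  have k3 := eval_popE h H hB hN hpop (q' := q') hq hγ (b := reg 1 + reg 57) .ret (by
    rw [eval_add, eval_reg, eval_reg, hq', h.reg 1 (by norm_num), H.rP]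
    rfl)
  simp only at k3
  rw [accReturn, den]
  by_cases hJ : Truth comp pos F q' (t γ₂ T)
  swap
  · rw [if_neg (k1.not.2 hJ)]
    exact .refl rfl rfl fun o ho => hJ ho.1
  rw [if_pos (k1.2 hJ), den]
  have a1 := Acc.some (A := fun x : Fin nP × List (Fin nΓ) => Truth comp pos c x.1 (ev t x.2 T))
    (x := (q', [γ₂])) _ _ k3 fun _ => k2
  set s₁ := (ite (popE (reg 1 + reg 57)) (ite (truthE (reg 35) (reg 57) (reg 54)) (asg 52 1)
    (asg 53 0)) skip).den s with hs₁
  have hg₁ : Good nΓ ρ m N t s₁ := h.of_eq (fun i hi => reg_den (K := 52) rfl _ (by omega))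
    (mem_den rfl _)
  have k4 := eval_popE hg₁ H hB hN hpop (q := q) (q' := q') (γ := γ₁)
    ((reg_den (K := 52) rfl _ (by norm_num)).trans hq)
    ((reg_den_of_keeps rfl _).trans hγ) (b := reg 57) .int
    ((reg_den_of_keeps rfl _).trans hq')
  simp only [reduceCtorEq] at k4
  exact a1.trans (Acc.bot _ k4) fun o => by simp [hJ]

/-- A call is followed for each possible return location, which accounts for the factor `nP` in the
time. A call that never comes down is a run from the called symbol over the empty stack, so it is
read off from the column of the type of the empty stack. -/
theorem accCall_spec (h : Good nΓ ρ m N t s) (H : Static ρ m rules F N comp rc pos)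
    (hB : t.Bdd (2 * nΓ + 2) N) (hN : 2 * nP ≤ N) (hpos : ∀ i ≤ F, ∀ p < nP, pos i p < N)
    (hpop : PopOK S t)
    (hinf : ∀ (q : Fin nP) (γ : Fin nΓ), Truth comp pos F q (t γ (t nΓ 0)) ↔ S.Inf (q, [γ]))
    {q : Fin nP} {γ₁ γ₂ : Fin nΓ} (hq : s.reg 49 = q)
    (hw : MemAt s.mem (s.reg 50) [(γ₁ : ℕ), (γ₂ : ℕ)]) (hT : s.reg 41 < 2 ^ N)
    (hc : s.reg 35 = c) (hcF : c ≤ F) :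
    Acc (fun x : Fin nP × List (Fin nΓ) => Truth comp pos c x.1 (ev t x.2 (s.reg 41))) s
      (accCall.den s) (fun o =>
        (∃ q' : Fin nP, Truth comp pos F q' (ev t [γ₂] (s.reg 41)) ∧
          ((S.Pop True q γ₁ q' ∧ o = some (q', [γ₂])) ∨ (S.Pop False q γ₁ q' ∧ o = none))) ∨
        (S.Inf (q, [γ₁]) ∧ o = none)) ∧ accCall.cost s ≤ 200 + 250 * nP := by
  obtain ⟨w1, w2, -⟩ := hw
  set s₁ := (asg 58 (mem (reg 50)) ;; asg 54 (lkE 17 (mem (reg 50 + 1)) (reg 41))).den s with hs₁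
  have r₁ : ∀ i < 54, s₁.reg i = s.reg i := fun i hi => reg_den (K := 54) rfl _ hi
  have m₁ : s₁.mem = s.mem := mem_den (by rfl) s
  have hg₁ : Good nΓ ρ m N t s₁ := h.of_eq (fun i hi => r₁ i (by omega)) m₁
  have h58 : s₁.reg 58 = γ₁ := by
    rw [hs₁, den, den, den, State.set_reg, if_neg (by norm_num), State.set_reg, if_pos rfl]
    exact w1
  have h54 : s₁.reg 54 = t γ₂ (s.reg 41) := by
    rw [hs₁, den, den, den, State.set_reg, if_pos rfl]
    have hg : Good nΓ ρ m N t (s.set 58 ((mem (reg 50)).eval s)) :=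
      h.of_eq (fun i hi => by rw [State.set_reg, if_neg (by omega)]) rfl
    have e1 : (mem (reg 50 + 1)).eval (s.set 58 ((mem (reg 50)).eval s)) = γ₂ := by
      simpa [State.set_reg] using w2
    have e2 : (reg 41).eval (s.set 58 ((mem (reg 50)).eval s)) = s.reg 41 := by
      simp [State.set_reg]
    rw [hg.eval_lk H (by rw [e1]; exact γ₂.2.le) (by rw [e2]; exact hT), e1, e2]
  have hP : (reg 1).eval s₁ = nP := (hg₁.reg 1 (by norm_num)).trans H.rP
  have hwr : accReturn.worst ≤ 240 := by decide
  obtain ⟨⟨i1, i2, i3, i4⟩, i5⟩ := loop_rule' (s := s₁) (i := 57) (e := reg 1) (c := accReturn) 52 rfl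
    -- The return locations from `k` on have been accounted for.
    (fun k s' => s'.mem = s.mem ∧ s'.reg 58 = γ₁ ∧ s'.reg 54 = t γ₂ (s.reg 41) ∧
      Acc (fun x : Fin nP × List (Fin nΓ) => Truth comp pos c x.1 (ev t x.2 (s.reg 41))) s s'
        (fun o => ∃ q' : Fin nP, k ≤ q' ∧ Truth comp pos F q' (ev t [γ₂] (s.reg 41)) ∧
          ((S.Pop True q γ₁ q' ∧ o = some (q', [γ₂])) ∨ (S.Pop False q γ₁ q' ∧ o = none)))) 240
    ⟨m₁, h58, h54, .refl (r₁ _ (by norm_num)) (r₁ _ (by norm_num)) (by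
      rintro o ⟨q', hq', -⟩
      rw [hP] at hq'
      omega)⟩ (by
      rintro k s' hk hr ⟨j1, j2, j3, j4⟩
      rw [hP] at hk
      have hk57 : (s'.set 57 k).reg 57 = k := by rw [State.set_reg, if_pos rfl]
      have hkr : ∀ i < 57, (s'.set 57 k).reg i = s'.reg i := fun i hi => by
        rw [State.set_reg, if_neg (by omega)]
      have hk58 : (s'.set 57 k).reg 58 = s'.reg 58 := by rw [State.set_reg, if_neg (by omega)]
      have hg' : Good nΓ ρ m N t (s'.set 57 k) := h.of_eq (fun i hi => by
        rw [hkr i (by omega), hr i (by omega), r₁ i (by omega)]) j1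
      have := accReturn_spec hg' H hB hN hpos hpop (q := q) (q' := ⟨k, hk⟩) (γ₁ := γ₁) (γ₂ := γ₂)
        (by rw [hkr _ (by norm_num), hr _ (by norm_num), r₁ _ (by norm_num), hq])
        (by rw [hk58, j2]) hk57 (by rw [hkr _ (by norm_num), j3]) hT
        (c := c) (by rw [hkr _ (by norm_num), hr _ (by norm_num), r₁ _ (by norm_num), hc]) hcF
      refine ⟨⟨(mem_den rfl _).trans j1, (reg_den_of_keeps rfl _).trans (hk58.trans j2),
        (reg_den_of_keeps rfl _).trans ((hkr _ (by norm_num)).trans j3), ?_⟩,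
        (cost_le_worst rfl _).trans hwr⟩
      refine j4.trans (this.left (hkr _ (by norm_num)) (hkr _ (by norm_num))) fun o => ?_
      constructor
      · rintro (⟨q', hq', h⟩ | h)
        · exact ⟨q', by omega, h⟩
        · exact ⟨⟨k, hk⟩, le_rfl, h⟩
      · rintro ⟨q', hq', h⟩
        rcases hq'.lt_or_eq with hq' | rfl
        · exact .inl ⟨q', hq', h⟩
        · exact .inr h)
  set s₂ := (for_ 57 (reg 1) accReturn).den s₁ with hs₂
  have r₂ : ∀ i < 52, s₂.reg i = s.reg i := fun i hi => by
    rw [hs₂, reg_den (K := 52) rfl _ hi, r₁ i (by omega)]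
  have hg₂ : Good nΓ ρ m N t s₂ := h.of_eq (fun i hi => r₂ i (by omega)) i1
  have e4 : s₂.reg 4 = F := (hg₂.reg 4 (by norm_num)).trans H.rF
  have e2 : s₂.reg 2 = nΓ := (hg₂.reg 2 (by norm_num)).trans H.rG
  have e49 : s₂.reg 49 = q := (r₂ _ (by norm_num)).trans hq
  have l0 : t nΓ 0 < 2 ^ N := hB _ (by omega) _ (by positivity)
  have l1 := hg₂.eval_lk H (γ := reg 2) (T := 0) (by rw [eval_reg, e2]) (by simp)
  rw [eval_reg, e2, eval_zero] at l1
  have l2 := hg₂.eval_lk H (γ := reg 58) (T := lkE 17 (reg 2) 0)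
    (by rw [eval_reg, i2]; exact γ₁.2.le) (by rw [l1]; exact l0)
  rw [l1, eval_reg, i2] at l2
  have l3 := hg₂.eval_truth H (i := reg 4) (p := reg 49) (T := lkE 17 (reg 58) (lkE 17 (reg 2) 0))
    (by rw [eval_reg, e4]) (by rw [eval_reg, e49]; exact q.2)
    (by rw [l2]; exact hB _ (by omega) _ l0)
    (by rw [eval_reg, eval_reg, e4, e49]; exact hpos F le_rfl _ q.2)
  rw [l2, eval_reg, eval_reg, e4, e49, hinf] at l3
  refine ⟨i4.trans (Acc.bot _ l3) fun o => by simp, ?_⟩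
  have hc1 := cost_le_worst (c := asg 58 (mem (reg 50)) ;;
    asg 54 (lkE 17 (mem (reg 50 + 1)) (reg 41))) rfl s
  have hc2 := cost_le_worst (c := ite (truthE (reg 4) (reg 49) (lkE 17 (reg 58) (lkE 17 (reg 2) 0)))
    (asg 53 0) skip) rfl s₂
  have hw1 : (asg 58 (mem (reg 50)) ;; asg 54 (lkE 17 (mem (reg 50 + 1)) (reg 41))).worst ≤ 50 := by
    decide
  have hw2 : (ite (truthE (reg 4) (reg 49) (lkE 17 (reg 58) (lkE 17 (reg 2) 0)))
    (asg 53 0) skip).worst ≤ 140 := by decide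
  rw [hP] at i5
  have c1 : (reg 1).cost = 2 := rfl
  change _ + (_ + ((for_ 57 (reg 1) accReturn).cost s₁ + (ite (truthE (reg 4) (reg 49)
    (lkE 17 (reg 58) (lkE 17 (reg 2) 0))) (asg 53 0) skip).cost s₂)) ≤ _
  change _ + _ ≤ _ at hc1
  omega

/-- That the table decides the existence of runs is needed in abstract mode only. While this
property itself is being evaluated, its digits are not yet reliable; but its mode is global. -/
theorem succRule_spec (h : Good nΓ ρ m N t s) (H : Static ρ m rules F N comp rc pos)
    (hB : t.Bdd (2 * nΓ + 2) N) (hN : 2 * nP ≤ N) (hpos : ∀ i ≤ F, ∀ p < nP, pos i p < N)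
    (hpop : PopOK S t) {b : Mode} (hb : s.reg 34 = 0 ↔ b = .g)
    (hinf : b = .a → ∀ (q : Fin nP) (γ : Fin nΓ),
      Truth comp pos F q (t γ (t nΓ 0)) ↔ S.Inf (q, [γ]))
    {r : Rule (Fin nP) (Fin nΓ)} (hr : ReadOut r s) (hT : s.reg 41 < 2 ^ N)
    (hc : s.reg 35 = c) (hcF : c ≤ F) (hP : 0 < nP) :
    Acc (fun x : Fin nP × List (Fin nΓ) => Truth comp pos c x.1 (ev t x.2 (s.reg 41))) s
      (succRule.den s) (fun o => (r.srcP : ℕ) = s.reg 42 ∧ (r.srcΓ : ℕ) = s.reg 40 ∧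
        Yields S (fun x => Truth comp pos F x.1 (ev t x.2 (s.reg 41))) b r o) ∧
      succRule.cost s ≤ 600 * nP * r.size := by
  have h1 := eval_eqE (s := s) (reg 47) (reg 42)
  have h2 := eval_eqE (s := s) (reg 48) (reg 40)
  have h3 := eval_eqE (s := s) (reg 46) 2
  have h4 := eval_eqE (s := s) (reg 46) 1
  simp only [eval_reg, eval_ofNat, hr.srcP, hr.srcΓ, hr.kind] at h1 h2 h3 h4
  have hsz := r.word_length_le
  have hsz' : 500 * nP + 50 * r.size ≤ 600 * nP * r.size := by
    have : 1 ≤ r.size := by omega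
    nlinarith
  have c1 : (eqE (reg 47) (reg 42)).cost = 13 := rfl
  have c2 : (eqE (reg 48) (reg 40)).cost = 13 := rfl
  have c3 : (eqE (reg 46) 2).cost = 11 := rfl
  have c4 : (eqE (reg 46) 1).cost = 11 := rfl
  have c5 : (reg 34).cost = 2 := rfl
  have c0 : ∀ s, skip.cost s = 1 := fun _ => rfl
  have aw := accWord_spec h H hB hpos hr hT hc hcF
  rw [succRule, den, Cmd.cost, c1]
  by_cases hp : (r.srcP : ℕ) = s.reg 42
  swap
  · rw [if_neg (h1.not.2 hp), if_neg (h1.not.2 hp), c0]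
    exact ⟨.refl rfl rfl (by simp [hp]), by omega⟩
  rw [if_pos (h1.2 hp), if_pos (h1.2 hp), den, Cmd.cost, c2]
  by_cases hγ : (r.srcΓ : ℕ) = s.reg 40
  swap
  · rw [if_neg (h2.not.2 hγ), if_neg (h2.not.2 hγ), c0]
    exact ⟨.refl rfl rfl (by simp [hγ]), by omega⟩
  rw [if_pos (h2.2 hγ), if_pos (h2.2 hγ), den, Cmd.cost, c5]
  cases b with
  | g =>
    have h0 : ¬ (reg 34).eval s ≠ 0 := not_not.2 (hb.2 rfl)
    rw [if_neg h0, if_neg h0]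
    exact ⟨aw.1.congr fun o => by simp [hp, hγ, Yields], by omega⟩
  | a =>
    have h0 : (reg 34).eval s ≠ 0 := fun h => by simpa using hb.1 h
    rw [if_pos h0, if_pos h0, den, Cmd.cost, c3]
    cases r with
    | int p γ q u =>
      rw [if_pos (h3.2 rfl), if_pos (h3.2 rfl)]
      exact ⟨aw.1.congr fun o => by
        simp only [Yields, Rule.tgt, Rule.word, hp, hγ, true_and], by omega⟩
    | ret p γ q =>
      rw [if_neg (h3.not.2 (by simp [Rule.act, actNum])),
        if_neg (h3.not.2 (by simp [Rule.act, actNum])), den, Cmd.cost, c4, if_pos (h4.2 rfl),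
        if_pos (h4.2 rfl)]
      have e4 : s.reg 4 = F := (h.reg 4 (by norm_num)).trans H.rF
      have e49 : s.reg 49 = q := hr.tgt
      have k1 := h.eval_truth H (i := reg 4) (p := reg 49) (T := reg 41)
        (by rw [eval_reg, e4]) (by rw [eval_reg, e49]; exact q.2) hT
        (by rw [eval_reg, eval_reg, e4, e49]; exact hpos F le_rfl _ q.2)
      rw [eval_reg, eval_reg, eval_reg, e4, e49] at k1
      refine ⟨(Acc.bot _ k1).congr fun o => by
        simp only [Yields, hp, hγ, true_and, ev_nil], ?_⟩
      have hc2 := cost_le_worst (c := ite (truthE (reg 4) (reg 49) (reg 41)) (asg 53 0) skip) rfl s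
      have hw2 : (ite (truthE (reg 4) (reg 49) (reg 41)) (asg 53 0) skip).worst ≤ 140 := by decide
      omega
    | call p γ q γ₁ γ₂ =>
      rw [if_neg (h3.not.2 (by simp [Rule.act, actNum])),
        if_neg (h3.not.2 (by simp [Rule.act, actNum])), den, Cmd.cost, c4,
        if_neg (h4.not.2 (by simp [Rule.act, actNum])),
        if_neg (h4.not.2 (by simp [Rule.act, actNum]))]
      have ac := accCall_spec h H hB hN hpos hpop (hinf rfl) hr.tgt hr.word hT hc hcF
      exact ⟨ac.1.congr fun o => by simp only [Yields, hp, hγ, true_and]; rfl, by omega⟩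

end Rule

/-! ### Boolean combinations on the machine -/

section Cond

variable {s : State}

/-- Disjunction. -/
def orE (a b : Expr) : Expr := a + b

/-- Conjunction. -/
def andE (a b : Expr) : Expr := 1 - ((1 - a) + (1 - b))

theorem eval_orE (a b : Expr) : (orE a b).eval s ≠ 0 ↔ a.eval s ≠ 0 ∨ b.eval s ≠ 0 := by
  simp only [orE, eval_add]
  omega

theorem eval_andE (a b : Expr) : (andE a b).eval s ≠ 0 ↔ a.eval s ≠ 0 ∧ b.eval s ≠ 0 := by
  simp only [andE, eval_add, eval_sub, eval_one]
  omega

theorem eval_notE (a : Expr) : (1 - a).eval s ≠ 0 ↔ ¬ a.eval s ≠ 0 := by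
  simp only [eval_sub, eval_one]
  omega

/-- If register `33` holds `k`, put `e` into register `59`. -/
def pick (k : ℕ) (e : Expr) (c : Cmd) : Cmd := ite (eqE (reg 33) (num k)) (asg 59 e) c

theorem pick_reg {k : ℕ} {e : Expr} {c : Cmd} :
    ((pick k e c).den s).reg 59 = if s.reg 33 = k then e.eval s else (c.den s).reg 59 := by
  have h := eval_eqE (s := s) (reg 33) (num k)
  rw [eval_reg, eval_num] at h
  rw [pick, den]
  by_cases hk : s.reg 33 = k
  · rw [if_pos (h.2 hk), if_pos hk, den, State.set_reg, if_pos rfl]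
  · rw [if_neg (h.not.2 hk), if_neg hk]

/-- Put the value of the operator whose number is in register `33` into register `59`. -/
def condCmd (x₁ x₂ inf : Expr) : Cmd :=
  pick 0 1 <| pick 4 (orE x₁ x₂) <| pick 5 (andE x₁ x₂) <| pick 6 (reg 52) <| pick 7 (reg 53) <|
  pick 8 (andE inf (orE x₂ (andE x₁ (reg 52)))) <|
  pick 9 (orE (1 - inf) (orE x₂ (andE x₁ (reg 53)))) <|
  pick 10 (andE inf (andE x₂ (orE x₁ (reg 52)))) <|
  pick 11 (orE (1 - inf) (andE x₂ (orE x₁ (reg 53)))) <| pick 12 (reg 52) <| asg 59 0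

theorem condCmd_spec {x₁ x₂ inf : Expr} {tag : ℕ} (htag : s.reg 33 = tag) :
    ((condCmd x₁ x₂ inf).den s).reg 59 ≠ 0 ↔ cond tag (x₁.eval s ≠ 0) (x₂.eval s ≠ 0)
      (inf.eval s ≠ 0) (s.reg 52 ≠ 0) (s.reg 53 ≠ 0) := by
  have h0 : ((asg 59 0).den s).reg 59 = 0 := by simp [den, State.set_reg]
  simp only [condCmd, pick_reg, htag, h0]
  clear htag
  by_cases h : tag ≤ 12
  · interval_cases tag <;>
      simp [cond, eval_orE, eval_andE, eval_notE, -eval_sub, -ne_eq]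
    exact one_ne_zero
  · repeat rw [if_neg (by omega)]
    unfold cond
    split <;> first | omega | simp

end Cond

/-! ### One evaluation step on the machine -/

section Body

variable {nP nΓ nA : ℕ} {ρ m : ℕ → ℕ} {rules : List (Rule (Fin nP) (Fin nΓ))} {F N i : ℕ}
  {comp : ℕ → Option (Formula (Fin nA))} {rc : ℕ → ℕ} {pos : ℕ → ℕ → ℕ} {t : Tab} {s : State}
  {S : PDS (Fin nP) (Fin nΓ)} {lab : Fin nA → Set (Conf (Fin nP) (Fin nΓ))}
  {acc : ℕ → List (Fin nΓ) → Prop}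

/-- Set the digit of property number `i` for the location in register `42`. -/
def setTruth : Cmd := setCmd 17 (posE (reg 32) (reg 42))

/-- The elementary step of the evaluation of a property. -/
def stageBody : Cmd :=
  asg 52 0 ;; asg 53 1 ;; rulesLoop succRule ;; asg 54 (lkE 17 (reg 40) (reg 41)) ;;
    condCmd (truthE (reg 32 + 1) (reg 42) (reg 54)) (truthE (reg 36) (reg 42) (reg 54))
      (truthE (reg 4) (reg 42) (reg 54)) ;;
    ite (reg 59) (ite (reg 37) skip setTruth) (ite (reg 37) setTruth skip)

/-- The registers that describe property number `i`. -/
structure StageRegs (comp : ℕ → Option (Formula (Fin nA))) (rc : ℕ → ℕ) (i : ℕ) (s : State) :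
    Prop where
  idx : s.reg 32 = i
  tag : s.reg 33 = ctag (comp i)
  mode : 6 ≤ ctag (comp i) → s.reg 34 = encodeMode (cmode (comp i))
  cnt : s.reg 35 = cnt comp i
  rc : 4 ≤ ctag (comp i) → ctag (comp i) ≤ 11 → ctag (comp i) ≠ 6 → ctag (comp i) ≠ 7 →
    s.reg 36 = rc i
  pol : s.reg 37 ≠ 0 ↔ 10 ≤ ctag (comp i)

theorem StageRegs.of_eq {s' : State} (h : StageRegs comp rc i s)
    (hr : ∀ r < 39, s'.reg r = s.reg r) : StageRegs comp rc i s' := by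
  constructor
  · rw [hr _ (by norm_num), h.idx]
  · rw [hr _ (by norm_num), h.tag]
  · rw [hr _ (by norm_num)]; exact h.mode
  · rw [hr _ (by norm_num), h.cnt]
  · rw [hr _ (by norm_num)]; exact h.rc
  · rw [hr _ (by norm_num)]; exact h.pol

theorem tsucc_iff {T : ℕ} {γ p : ℕ} (hR : ∀ r, r ∈ rules ↔ r ∈ S.Δ)
    {o : Option (Fin nP × List (Fin nΓ))} : TSucc S comp pos F i t γ T p o ↔
      ∃ r ∈ rules, (r.srcP : ℕ) = p ∧ (r.srcΓ : ℕ) = γ ∧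
        Yields S (fun x => Truth comp pos F x.1 (ev t x.2 T)) (cmode (comp i)) r o := by
  simp only [TSucc, lsucc_iff_yields, hR]
  constructor
  · rintro ⟨p', γ', rfl, rfl, r, hr, rfl, rfl, h⟩
    exact ⟨r, hr, rfl, rfl, h⟩
  · rintro ⟨r, hr, rfl, rfl, h⟩
    exact ⟨_, _, rfl, rfl, r, hr, rfl, rfl, h⟩

theorem lt_of_ctag (L : Layout S lab F N comp rc pos acc) (hi : i ≤ F) (h : ctag (comp i) ≤ 11) :
    i < F := by
  rcases hi.lt_or_eq with h' | rfl
  · exact h'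
  · rw [L.last] at h
    simp [ctag] at h

theorem stageBody_spec (L : Layout S lab F N comp rc pos acc) (hi : i ≤ F) (hF : 1 ≤ F)
    (h : Good nΓ ρ m N t s) (H : Static ρ m rules F N comp rc pos)
    (hR : ∀ r, r ∈ rules ↔ r ∈ S.Δ) (hP : 0 < nP)
    (hB : t.Bdd (2 * nΓ + 2) N) (hpop : PopOK S t)
    (hinf : i < F → ∀ (q : Fin nP) (γ : Fin nΓ),
      Truth comp pos F q (t γ (t nΓ 0)) ↔ S.Inf (q, [γ]))
    (hs : StageRegs comp rc i s) (hγ : s.reg 40 ≤ nΓ) (hT : s.reg 41 < 2 ^ N)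
    (hp : s.reg 42 < nP) :
    Good nΓ ρ m N (upd S comp rc pos F i t (s.reg 40) (s.reg 41) (s.reg 42)) (stageBody.den s) ∧
      stageBody.cost s ≤ 2000 + 700 * nP * (rules.map Rule.size).sum := by
  have hN : 2 * nP ≤ N := (Nat.mul_le_mul_right _ (by omega)).trans L.le
  have hpos : ∀ i ≤ F, ∀ p < nP, pos i p < N := fun i hi p hp => L.pos_lt hi hp
  have hcF : cnt comp i ≤ F := by
    unfold cnt
    split_ifs with h8
    · exact hi
    · exact lt_of_ctag L hi (by omega)
  -- Operators below number 6 have no mode and register 34 may then hold any number. The mode is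
  -- taken from the register as it is; for these operators it does not influence the value.
  set b : Mode := if s.reg 34 = 0 then .g else .a with hb
  have hb0 : s.reg 34 = 0 ↔ b = .g := by
    rw [hb]
    split_ifs with h0 <;> simp [h0]
  have hbm : 6 ≤ ctag (comp i) → b = cmode (comp i) := by
    intro h6
    rw [hb, hs.mode h6]
    cases cmode (comp i) <;> rfl
  -- The last property has the global mode stored with it, so an abstract mode means that the
  -- existence of runs is already settled.
  have hba : b = .a → i < F := by
    intro hba
    by_contra hiF
    obtain rfl : i = F := by omega
    have := hbm (by rw [L.last]; simp [ctag])
    rw [L.last, hba] at this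
    simp [cmode] at this
  let Y (l : List (Rule (Fin nP) (Fin nΓ))) (o : Option (Fin nP × List (Fin nΓ))) : Prop :=
    ∃ r ∈ l, (r.srcP : ℕ) = s.reg 42 ∧ (r.srcΓ : ℕ) = s.reg 40 ∧
      Yields S (fun x => Truth comp pos F x.1 (ev t x.2 (s.reg 41))) b r o
  let A (x : Fin nP × List (Fin nΓ)) : Prop := Truth comp pos (cnt comp i) x.1 (ev t x.2 (s.reg 41))
  set s₁ := (asg 52 0 ;; asg 53 1).den s with hs₁
  have r₁ : ∀ i < 52, s₁.reg i = s.reg i := fun i hi => reg_den (K := 52) rfl _ hi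
  have hg₁ : Good nΓ ρ m N t s₁ := h.of_eq (fun i hi => r₁ i (by omega)) rfl
  have hlow := H.rules_lt
  obtain ⟨⟨hJ, hJ'⟩, hc, -⟩ := rulesLoop_spec (body := succRule) (s := s₁) (rules := rules) rfl rfl
    (H.rules_at.congr fun b _ hb => hg₁.mem b (by omega))
    ((hg₁.reg 3 (by norm_num)).trans H.rR)
    (fun l a a' => (a ≠ 0 ↔ ∃ o, Y l o ∧ HoldsAt A o) ∧ (a' ≠ 0 ↔ ∀ o, Y l o → HoldsAt A o))
    (600 * nP) (by simp [hs₁, den, State.set_reg, Y]) (by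
      intro l r s' hr hr' hm' hro hJ
      have hg' : Good nΓ ρ m N t s' := hg₁.of_eq (fun i hi => hr' i (by omega)) hm'
      have e : ∀ j < 44, s'.reg j = s.reg j := fun j hj => (hr' _ hj).trans (r₁ _ (by omega))
      obtain ⟨g1, g2⟩ := succRule_spec (S := S) (c := cnt comp i) hg' H hB hN hpos hpop
        (by rw [e _ (by norm_num)]; exact hb0) (fun hb => hinf (hba hb)) hro
        (by rw [e _ (by norm_num)]; exact hT) (by rw [e _ (by norm_num), hs.cnt]) hcF hP
      rw [e 40 (by norm_num), e 41 (by norm_num), e 42 (by norm_num)] at g1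
      have hY : ∀ o, Y (l ++ [r]) o ↔ Y l o ∨ ((r.srcP : ℕ) = s.reg 42 ∧
          (r.srcΓ : ℕ) = s.reg 40 ∧
          Yields S (fun x => Truth comp pos F x.1 (ev t x.2 (s.reg 41))) b r o) := by
        intro o
        simp [Y, or_and_right, exists_or]
      refine ⟨⟨?_, ?_⟩, g2⟩
      · rw [g1.ex, hJ.1]
        simp only [hY, or_and_right, exists_or, A]
      · rw [g1.all, hJ.2]
        simp only [hY, or_imp, forall_and, A])
  set s₂ := (rulesLoop succRule).den s₁ with hs₂
  have r₂ : ∀ i < 44, s₂.reg i = s.reg i := fun i hi => by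
    rw [hs₂, reg_den (K := 44) rfl _ hi, r₁ i (by omega)]
  have m₂ : s₂.mem = s.mem := (mem_den (c := rulesLoop succRule) rfl _).trans rfl
  set s₃ := s₂.set 54 ((lkE 17 (reg 40) (reg 41)).eval s₂) with hs₃
  have r₃ : ∀ i < 54, s₃.reg i = s₂.reg i := fun i hi => by
    rw [hs₃, State.set_reg, if_neg (by omega)]
  have r₃' : ∀ i < 44, s₃.reg i = s.reg i := fun i hi => (r₃ i (by omega)).trans (r₂ i hi)
  have hg₂ : Good nΓ ρ m N t s₂ := h.of_eq (fun i hi => r₂ i (by omega)) m₂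
  have hg₃ : Good nΓ ρ m N t s₃ := h.of_eq (fun i hi => r₃' i (by omega)) m₂
  have hst := hs.of_eq (s' := s₃) fun r hr => r₃' r (by omega)
  have h54 : s₃.reg 54 = t (s.reg 40) (s.reg 41) := by
    rw [hs₃, State.set_reg, if_pos rfl, hg₂.eval_lk H (by rw [eval_reg, r₂ _ (by norm_num)]; exact hγ)
      (by rw [eval_reg, r₂ _ (by norm_num)]; exact hT), eval_reg, eval_reg, r₂ _ (by norm_num),
      r₂ _ (by norm_num)]
  have hV : t (s.reg 40) (s.reg 41) < 2 ^ N := hB _ (by omega) _ hT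
  have htr : ∀ (e : Expr) (j : ℕ), e.eval s₃ = j → j ≤ F →
      ((truthE e (reg 42) (reg 54)).eval s₃ ≠ 0 ↔
        Truth comp pos j (s.reg 42) (t (s.reg 40) (s.reg 41))) := by
    intro e j he hj
    have := hg₃.eval_truth H (i := e) (p := reg 42) (T := reg 54) (by rw [he]; exact hj)
      (by rw [eval_reg, r₃' _ (by norm_num)]; exact hp) (by rw [eval_reg, h54]; exact hV)
      (by rw [he, eval_reg, r₃' _ (by norm_num)]; exact hpos j hj _ hp)
    rwa [he, eval_reg, eval_reg, r₃' _ (by norm_num), h54] at this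
  have hcond := condCmd_spec (x₁ := truthE (reg 32 + 1) (reg 42) (reg 54))
    (x₂ := truthE (reg 36) (reg 42) (reg 54)) (inf := truthE (reg 4) (reg 42) (reg 54)) hst.tag
  have hval : ((condCmd (truthE (reg 32 + 1) (reg 42) (reg 54)) (truthE (reg 36) (reg 42) (reg 54))
      (truthE (reg 4) (reg 42) (reg 54))).den s₃).reg 59 ≠ 0 ↔
      tval S comp rc pos F i t (s.reg 40) (s.reg 41) (s.reg 42) := by
    rw [hcond, tval]
    have hTS : 6 ≤ ctag (comp i) → ∀ o, TSucc S comp pos F i t (s.reg 40) (s.reg 41) (s.reg 42) o ↔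
        Y rules o := by
      intro h6 o
      rw [tsucc_iff hR, ← hbm h6]
    refine cond_congr ?_ ?_ ?_ ?_ ?_
    · intro h4 h11
      obtain ⟨φ, hφ⟩ := L.before i (lt_of_ctag L hi h11)
      rw [hφ] at h4
      exact htr _ _ (by rw [eval_add, eval_reg, eval_one, hst.idx])
        (L.left i (lt_of_ctag L hi h11) φ hφ h4).1.le
    · intro h4 h11 h6 h7
      have hr := hst.rc h4 h11 h6 h7
      obtain ⟨φ, hφ⟩ := L.before i (lt_of_ctag L hi h11)
      rw [hφ] at h4 h6 h7
      exact htr _ _ hr (L.right i (lt_of_ctag L hi h11) φ hφ h4 h6 h7).2.1.le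
    · intro _
      exact htr _ _ ((hg₃.reg 4 (by norm_num)).trans H.rF) le_rfl
    · intro h6 _
      rw [r₃ _ (by norm_num), hJ]
      simp only [hTS h6, A]
    · intro h6 _
      rw [r₃ _ (by norm_num), hJ']
      simp only [hTS h6, A]
  set s₄ := (condCmd (truthE (reg 32 + 1) (reg 42) (reg 54)) (truthE (reg 36) (reg 42) (reg 54))
    (truthE (reg 4) (reg 42) (reg 54))).den s₃ with hs₄
  have r₄ : ∀ i < 44, s₄.reg i = s.reg i := fun i hi => by
    rw [hs₄, reg_den (K := 44) rfl _ hi, r₃' i hi]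
  have hg₄ : Good nΓ ρ m N t s₄ := h.of_eq (fun i hi => r₄ i (by omega))
    ((mem_den rfl _).trans m₂)
  have hst₄ := hs.of_eq (s' := s₄) fun r hr => r₄ r (by omega)
  have hden : stageBody.den s =
      (ite (reg 59) (ite (reg 37) skip setTruth) (ite (reg 37) setTruth skip)).den s₄ := rfl
  have hposE := hg₄.eval_pos H (i := reg 32) (p := reg 42) (by rw [eval_reg, hst₄.idx]; exact hi)
    (by rw [eval_reg, r₄ _ (by norm_num)]; exact hp)
  rw [eval_reg, hst₄.idx, eval_reg, r₄ _ (by norm_num)] at hposE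
  have hset := hg₄.setCmd H hB (tp := 17) (.inl rfl) (b := posE (reg 32) (reg 42))
    (by rw [r₄ _ (by norm_num)]; exact hγ) (by rw [r₄ _ (by norm_num)]; exact hT)
    (by rw [hposE]; exact hpos i hi _ hp)
  rw [hposE, r₄ _ (by norm_num), r₄ _ (by norm_num)] at hset
  have hset : Good nΓ ρ m N (t.setBit (s.reg 40) (s.reg 41) (pos i (s.reg 42)))
    (setTruth.den s₄) := hset
  constructor
  · rw [hden, upd, den, eval_reg]
    have hpol := hst₄.pol
    by_cases hv : tval S comp rc pos F i t (s.reg 40) (s.reg 41) (s.reg 42)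
    · rw [if_pos (hval.2 hv), den, eval_reg]
      by_cases h10 : 10 ≤ ctag (comp i)
      · rw [if_pos (hpol.2 h10), if_neg (by simp [hv, h10])]
        exact hg₄
      · rw [if_neg (hpol.not.2 h10), if_pos (by simp [hv, h10])]
        exact hset
    · rw [if_neg (hval.not.2 hv), den, eval_reg]
      by_cases h10 : 10 ≤ ctag (comp i)
      · rw [if_pos (hpol.2 h10), if_pos (by simp [hv, h10])]
        exact hset
      · rw [if_neg (hpol.not.2 h10), if_neg (by simp [hv, h10])]
        exact hg₄
  · have hc1 := cost_le_worst (c := condCmd (truthE (reg 32 + 1) (reg 42) (reg 54))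
      (truthE (reg 36) (reg 42) (reg 54)) (truthE (reg 4) (reg 42) (reg 54))) rfl s₃
    have hw1 : (condCmd (truthE (reg 32 + 1) (reg 42) (reg 54))
      (truthE (reg 36) (reg 42) (reg 54)) (truthE (reg 4) (reg 42) (reg 54))).worst ≤ 1000 := by decide
    have hc2 := cost_le_worst (c := ite (reg 59) (ite (reg 37) skip setTruth)
      (ite (reg 37) setTruth skip)) rfl s₄
    have hw2 : (ite (reg 59) (ite (reg 37) skip setTruth) (ite (reg 37) setTruth skip)).worst ≤ 300 := by
      decide
    have hw3 : (lkE 17 (reg 40) (reg 41)).cost ≤ 20 := by decide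
    have hcost : stageBody.cost s = 3 + (3 + ((rulesLoop succRule).cost s₁ +
      (((lkE 17 (reg 40) (reg 41)).cost + 2) + ((condCmd (truthE (reg 32 + 1) (reg 42) (reg 54))
      (truthE (reg 36) (reg 42) (reg 54)) (truthE (reg 4) (reg 42) (reg 54))).cost s₃ +
      (ite (reg 59) (ite (reg 37) skip setTruth) (ite (reg 37) setTruth skip)).cost s₄)))) := rfl
    have hm : (600 * nP + 80) * (rules.map Rule.size).sum ≤ 700 * nP * (rules.map Rule.size).sum :=
      Nat.mul_le_mul_right _ (by omega)
    omega

end Body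

/-! ### The stages of the evaluation, and the answer -/

section Stages

variable {nP nΓ nA : ℕ} {ρ m : ℕ → ℕ} {rules : List (Rule (Fin nP) (Fin nΓ))} {F N i : ℕ}
  {comp : ℕ → Option (Formula (Fin nA))} {rc : ℕ → ℕ} {pos : ℕ → ℕ → ℕ} {t : Tab} {s : State}
  {S : PDS (Fin nP) (Fin nΓ)} {lab : Fin nA → Set (Conf (Fin nP) (Fin nΓ))}
  {acc : ℕ → List (Fin nΓ) → Prop}

/-- The digits of the properties with numbers below `k` are not set. -/
def Unset (nP nΓ N : ℕ) (comp : ℕ → Option (Formula (Fin nA))) (pos : ℕ → ℕ → ℕ) (k : ℕ)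
    (t : Tab) : Prop :=
  ∀ j < k, ctag (comp j) ≠ 2 ∧ ctag (comp j) ≠ 3 → ∀ p < nP, ∀ γ ≤ nΓ, ∀ T < 2 ^ N,
    (t γ T).testBit (pos j p) = false

/-- With no digit set, a least fixed point is approximated by falsehood and a greatest one by truth,
and either is on the correct side. Atoms are correct from the beginning, since their digits are
those of automaton states. -/
theorem StageInv.start (L : Layout S lab F N comp rc pos acc) (hi : i ≤ F)
    (h : TabOK S lab F N comp pos acc (i + 1) t) (hu : Unset nP nΓ N comp pos (i + 1) t) :
    StageInv S lab F N comp pos acc i t := by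
  by_cases hC : ctag (comp i) ≠ 2 ∧ ctag (comp i) ≠ 3
  · have key : ∀ (p : Fin nP) (γ T : ℕ), γ ≤ nΓ → T < 2 ^ N → ∀ a,
        Imp (10 ≤ ctag (comp i)) (Truth comp pos i p (t γ T)) a := by
      intro p γ T hγ hT a
      rw [Truth, hu i (by omega) hC p p.2 γ hγ T hT]
      exact ⟨fun hp _ => by simp [hp], fun hp h => absurd hp (by simpa using h)⟩
    exact ⟨h, fun γ T w hT _ _ p => key p γ T (by omega) hT _,
      fun p => key p nΓ 0 le_rfl (by positivity) _⟩
  · have hpol : ¬ 10 ≤ ctag (comp i) := by omega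
    have key : ∀ (p : Fin nP) T w, (∀ b, (F + 1) * nP ≤ b → b < N →
        (T.testBit b = true ↔ acc b w)) → (Truth comp pos i p T ↔ S.Sem lab (comp i) (p, w)) := by
      intro p T w ha
      obtain ⟨h1, h2, h3⟩ := L.atom i hi hC p
      rw [Truth, ha _ h1 h2, h3, iff_true_right hpol]
    exact ⟨h, fun γ T w hT hr _ p => .of_iff (key p _ _ (h.cons γ T w hT hr).acc),
      fun p => .of_iff (key p _ _ h.nil.acc)⟩

theorem Unset.upd (L : Layout S lab F N comp rc pos acc) (hi : i ≤ F)
    (hu : Unset nP nΓ N comp pos i t) {γ T p : ℕ} (hp : p < nP) :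
    Unset nP nΓ N comp pos i (upd S comp rc pos F i t γ T p) := by
  intro j hj hC q hq γ' hγ' T' hT'
  rw [BCARET.upd]
  split_ifs
  · rw [Tab.testBit_setBit, hu j hj hC q hq γ' hγ' T' hT', Bool.or_false, decide_eq_false_iff_not]
    rintro ⟨-, -, h⟩
    exact L.pos_ne (by omega) hC hq hi hp (.inl (by omega)) h.symm
  · exact hu j hj hC q hq γ' hγ' T' hT'

/-- The evaluation of the property whose number is in register `32`. -/
def stageCmd : Cmd :=
  asg 33 (mem (reg 9 + reg 32)) ;; asg 34 (mem (reg 10 + reg 32)) ;;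
    -- The left operand has the number `i + 1`. Its entry tells where it ends in prefix order, and
    -- this is where the right operand begins.
    asg 36 (mem (reg 11 + (reg 32 + 1))) ;;
    -- The truncated difference is 0 for recursive operators, numbered from 8 on, and 1 for nexttime
    -- operators, which ask their operand.
    asg 35 (reg 32 + (1 - (reg 33 - 7))) ;;
    asg 37 (1 - (10 - reg 33)) ;; fix stageBody

/-- The evaluation of all properties. -/
def stagesCmd : Cmd := for_ 32 (reg 4 + 1) stageCmd

theorem upd_count (L : Layout S lab F N comp rc pos acc) (hi : i ≤ F) (t : Tab) (γ T p : ℕ)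
    (hγ : γ ≤ nΓ) (hT : T < 2 ^ N) (hp : p < nP) : upd S comp rc pos F i t γ T p = t ∨
      t.count (2 * nΓ + 2) N < (upd S comp rc pos F i t γ T p).count (2 * nΓ + 2) N := by
  unfold upd
  split_ifs
  · exact t.count_setBit (by omega) hT (L.pos_lt hi hp)
  · exact .inl rfl

theorem stageCmd_spec (L : Layout S lab F N comp rc pos acc) (hi : i ≤ F) (hF : 1 ≤ F)
    (h : Good nΓ ρ m N t s) (H : Static ρ m rules F N comp rc pos)
    (hR : ∀ r, r ∈ rules ↔ r ∈ S.Δ) (hP : 0 < nP)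
    (hB : t.Bdd (2 * nΓ + 2) N) (hpop : PopOK S t) (h32 : s.reg 32 = i)
    (hok : TabOK S lab F N comp pos acc (i + 1) t) (hu : Unset nP nΓ N comp pos (i + 1) t) :
    (∃ t', Good nΓ ρ m N t' (stageCmd.den s) ∧ t'.Bdd (2 * nΓ + 2) N ∧ PopOK S t' ∧
      TabOK S lab F N comp pos acc i t' ∧ Unset nP nΓ N comp pos i t') ∧
    stageCmd.cost s ≤ 100 + ((2 * nΓ + 2) * N * 2 ^ N + 1) * (nΓ + 1) * 2 ^ N * nP *
      (2040 + 700 * nP * (rules.map Rule.size).sum) := by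
  set pre : Cmd := asg 33 (mem (reg 9 + reg 32)) ;; asg 34 (mem (reg 10 + reg 32)) ;;
    asg 36 (mem (reg 11 + (reg 32 + 1))) ;;
    asg 35 (reg 32 + (1 - (reg 33 - 7))) ;;
    asg 37 (1 - (10 - reg 33)) with hpre
  set s₁ := pre.den s with hs₁
  have r₁ : ∀ j < 33, s₁.reg j = s.reg j := fun j hj => reg_den (K := 33) rfl _ hj
  have hg₁ : Good nΓ ρ m N t s₁ := h.of_eq (fun j hj => r₁ j (by omega)) (mem_den (c := pre) rfl _)
  have e33 : s.mem (s.reg 9 + i) = ctag (comp i) := by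
    have := H.tag_lt
    rw [h.reg 9 (by norm_num), h.mem _ (by omega), H.tag i hi]
  have hst : StageRegs comp rc i s₁ := by
    have c33 : s₁.reg 33 = ctag (comp i) := by
      rw [← e33, ← h32, hs₁, hpre]
      simp [den, State.set_reg]
    constructor
    · rw [r₁ _ (by norm_num), h32]
    · exact c33
    · intro h6
      have := H.mode_lt
      rw [← H.mode i hi h6, ← h.mem _ (by omega), ← h.reg 10 (by norm_num), ← h32, hs₁, hpre]
      simp [den, State.set_reg]
    · rw [hs₁, hpre]
      simp only [den, eval_sub, eval_ofNat, eval_reg, eval_mem, eval_add, State.set_reg,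
        State.set_mem, cnt]
      norm_num
      rw [h32, e33]
      split_ifs <;> omega
    · intro h4 h11 h6 h7
      have := H.rc_lt
      have hiF := lt_of_ctag L hi h11
      rw [← H.rc i hiF h4 h6 h7, ← h.mem _ (by omega), ← h.reg 11 (by norm_num), ← h32, hs₁, hpre]
      simp [den, State.set_reg]
    · have : s₁.reg 37 = 1 - (10 - s₁.reg 33) := by
        rw [hs₁, hpre]
        simp [den, State.set_reg]
      rw [this, c33]
      omega
  have hC : Carries ρ m nP nΓ N (fun t => t.Bdd (2 * nΓ + 2) N ∧ PopOK S t ∧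
      StageInv S lab F N comp pos acc i t ∧ Unset nP nΓ N comp pos i t) (upd S comp rc pos F i)
      stageBody s₁ (2000 + 700 * nP * (rules.map Rule.size).sum) := by
    rintro t s hr hg ⟨hB, hpop, hS, hu⟩ hγ hT hp
    -- Entry row `nΓ`, column `0` is the type of the empty stack; one more letter on top gives the
    -- type of a one-letter stack, and the run property is settled for it.
    have hinf : i < F → ∀ (q : Fin nP) (γ : Fin nΓ),
        Truth comp pos F q (t γ (t nΓ 0)) ↔ S.Inf (q, [γ]) := by
      intro hiF q γ
      have := (hS.ok.cons γ _ [] (hB _ (by omega) _ (by positivity)) hS.ok.nil).truth F hiF le_rfl q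
      rw [this, L.last]
      rfl
    obtain ⟨g1, g2⟩ := stageBody_spec L hi hF hg H hR hP hB hpop hinf (hst.of_eq hr) hγ hT hp
    refine ⟨g1, ⟨?_, fun q q' γ b => ?_, hS.upd L hi hB hT hp, hu.upd L hi hp⟩, g2⟩
    · unfold upd
      split_ifs
      · exact hB.setBit (L.pos_lt hi hp)
      · exact hB
    · rw [← hpop q q' γ b, upd]
      split_ifs
      · rw [Tab.setBit, if_neg (by omega)]
      · rfl
  obtain ⟨⟨t', h1, ⟨h2, h3, h4, h5⟩, h6⟩, h7⟩ := hC.fix rfl H (upd_count L hi) hg₁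
    ⟨hB, hpop, .start L hi hok hu, fun j hj => hu j (by omega)⟩ hP
  refine ⟨⟨t', h1, h2, h3, h4.done L hi h2 h6, h5⟩, ?_⟩
  have hc := cost_le_worst (c := pre) rfl s
  have hw : pre.worst ≤ 100 := by decide
  have hcost : stageCmd.cost s = pre.cost s + (fix stageBody).cost s₁ := by
    rw [stageCmd, hs₁, hpre]
    simp only [Cmd.cost, den, Nat.add_assoc]
  rw [hcost]
  refine Nat.add_le_add (hc.trans hw) (h7.trans (Nat.mul_le_mul_left _ (by omega)))

/-- Properties are numbered in prefix order and the loop counts down. So the existence of runs, with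
the last number, comes first, and every operand is evaluated before its operator. -/
theorem stagesCmd_spec (L : Layout S lab F N comp rc pos acc) (hF : 1 ≤ F)
    (h : Good nΓ ρ m N t s) (H : Static ρ m rules F N comp rc pos)
    (hR : ∀ r, r ∈ rules ↔ r ∈ S.Δ) (hP : 0 < nP)
    (hB : t.Bdd (2 * nΓ + 2) N) (hpop : PopOK S t)
    (hok : TabOK S lab F N comp pos acc (F + 1) t) (hu : Unset nP nΓ N comp pos (F + 1) t) :
    (∃ t', Good nΓ ρ m N t' (stagesCmd.den s) ∧ t'.Bdd (2 * nΓ + 2) N ∧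
      TabOK S lab F N comp pos acc 0 t') ∧
    stagesCmd.cost s ≤ 10 + (F + 1) * (110 + ((2 * nΓ + 2) * N * 2 ^ N + 1) * (nΓ + 1) * 2 ^ N *
      nP * (2040 + 700 * nP * (rules.map Rule.size).sum)) := by
  have hn : (reg 4 + 1 : Expr).eval s = F + 1 := by
    rw [eval_add, eval_reg, h.reg 4 (by norm_num), H.rF, eval_one]
  obtain ⟨⟨t', h1, h2, -, h3, -⟩, h4⟩ := loop_rule' (s := s) (i := 32) (e := reg 4 + 1)
    (c := stageCmd) 32 rfl
    (fun k s' => ∃ t', Good nΓ ρ m N t' s' ∧ t'.Bdd (2 * nΓ + 2) N ∧ PopOK S t' ∧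
      TabOK S lab F N comp pos acc k t' ∧ Unset nP nΓ N comp pos k t')
    (100 + ((2 * nΓ + 2) * N * 2 ^ N + 1) * (nΓ + 1) * 2 ^ N * nP *
      (2040 + 700 * nP * (rules.map Rule.size).sum)) (by rw [hn]; exact ⟨t, h, hB, hpop, hok, hu⟩) (by
      rintro k s' hk hr ⟨t', h1, h2, h3, h4, h5⟩
      rw [hn] at hk
      exact stageCmd_spec L (by omega) hF (h1.of_eq (fun r hr' => by
        rw [State.set_reg, if_neg (by omega)]) rfl) H hR hP h2 h3
        (by rw [State.set_reg, if_pos rfl]) h4 h5)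
  refine ⟨⟨t', h1, h2, h3⟩, h4.trans ?_⟩
  rw [hn]
  have : (reg 4 + 1 : Expr).cost = 4 := rfl
  rw [this]
  refine Nat.add_le_add (by norm_num) (Nat.mul_le_mul_left _ (by omega))

/-- The answer for the configuration at the address in register `8`. -/
def answerCmd : Cmd :=
  asg 54 (lkE 17 (reg 2) 0) ;; asg 50 (reg 8 + 2) ;; asg 51 (mem (reg 8 + 1)) ;; evalWord 17 ;;
    ite (truthE 0 (mem (reg 8)) (reg 54)) (asg 0 1) (asg 0 0)

/-- The type of the whole stack arises by folding the table over it, beginning with the type of the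
empty stack. Property number `0` is the formula itself. -/
theorem answerCmd_spec (h : Good nΓ ρ m N t s) (H : Static ρ m rules F N comp rc pos)
    (L : Layout S lab F N comp rc pos acc)
    (hB : t.Bdd (2 * nΓ + 2) N) (hok : TabOK S lab F N comp pos acc 0 t)
    {c : Conf (Fin nP) (Fin nΓ)} (hc : MemAt s.mem (s.reg 8) ((c.1 : ℕ) :: encodeWord c.2)) :
    (S.Sem lab (comp 0) c → (answerCmd.den s).reg 0 = 1) ∧
    (¬ S.Sem lab (comp 0) c → (answerCmd.den s).reg 0 = 0) ∧
    answerCmd.cost s ≤ 300 + 21 * c.2.length := by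
  obtain ⟨c1, c2, c3⟩ := hc
  set pre : Cmd := asg 54 (lkE 17 (reg 2) 0) ;; asg 50 (reg 8 + 2) ;; asg 51 (mem (reg 8 + 1))
    with hpre
  set s₁ := pre.den s with hs₁
  have r₁ : ∀ j < 50, s₁.reg j = s.reg j := fun j hj => reg_den (K := 50) rfl _ hj
  have m₁ : s₁.mem = s.mem := mem_den (c := pre) rfl _
  have hg₁ : Good nΓ ρ m N t s₁ := h.of_eq (fun j hj => r₁ j (by omega)) m₁
  have e50 : s₁.reg 50 = s.reg 8 + 2 := by simp [hs₁, hpre, den, State.set_reg]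
  have e51 : s₁.reg 51 = c.2.length := by simp [hs₁, hpre, den, State.set_reg, c2]
  have e54 : s₁.reg 54 = t nΓ 0 := by
    have := h.eval_lk H (γ := reg 2) (T := 0)
      (by rw [eval_reg, h.reg 2 (by norm_num), H.rG]) (by simp)
    rw [eval_reg, h.reg 2 (by norm_num), H.rG, eval_zero] at this
    simp [hs₁, hpre, den, State.set_reg, this]
  have l0 : t nΓ 0 < 2 ^ N := hB _ (by omega) _ (by positivity)
  obtain ⟨e1, e2, e3⟩ := hg₁.evalWord H hB (tp := 17) (.inl rfl) (w := c.2)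
    (by rw [m₁, e50]; exact c3) e51 (by rw [e54]; exact l0)
  set s₂ := (evalWord 17).den s₁ with hs₂
  rw [e54] at e1 e2
  have e1 : s₂.reg 54 = ev t c.2 (t nΓ 0) := e1
  have e2 : ev t c.2 (t nΓ 0) < 2 ^ N := e2
  have r₂ : ∀ i < 50, s₂.reg i = s.reg i := by
    intro i hi
    rw [hs₂, reg_den (K := 54) rfl _ (by omega), r₁ i hi]
  have m₂ : s₂.mem = s.mem := (mem_den (c := evalWord 17) rfl _).trans m₁
  have hg₂ : Good nΓ ρ m N t s₂ := h.of_eq (fun i hi => r₂ i (by omega)) m₂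
  have e8 : (mem (reg 8)).eval s₂ = c.1 := by
    rw [eval_mem, eval_reg, r₂ _ (by norm_num), m₂, c1]
  have k1 := hg₂.eval_truth H (i := 0) (p := mem (reg 8)) (T := reg 54)
    (by rw [eval_zero]; omega) (by rw [e8]; exact c.1.2) (by rw [eval_reg, e1]; exact e2)
    (by rw [eval_zero, e8]; exact L.pos_lt (by omega) c.1.2)
  have hR := (hok.ev hB l0 hok.nil c.2).truth 0 le_rfl (by omega) c.1
  rw [List.append_nil] at hR
  rw [eval_zero, e8, eval_reg, e1, hR] at k1
  have hden : answerCmd.den s = (ite (truthE 0 (mem (reg 8)) (reg 54)) (asg 0 1) (asg 0 0)).den s₂ :=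
    rfl
  refine ⟨fun hA => ?_, fun hA => ?_, ?_⟩
  · rw [hden, den, if_pos (k1.2 hA)]
    simp [den, State.set_reg]
  · rw [hden, den, if_neg (k1.not.2 hA)]
    simp [den, State.set_reg]
  · have hc := cost_le_worst (c := pre) rfl s
    have hw : pre.worst ≤ 100 := by decide
    have hc' := cost_le_worst (c := ite (truthE 0 (mem (reg 8)) (reg 54)) (asg 0 1) (asg 0 0)) rfl s₂
    have hw' : (ite (truthE 0 (mem (reg 8)) (reg 54)) (asg 0 1) (asg 0 0)).worst ≤ 100 := by decide
    have hcost : answerCmd.cost s = pre.cost s + ((evalWord 17).cost s₁ +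
        (ite (truthE 0 (mem (reg 8)) (reg 54)) (asg 0 1) (asg 0 0)).cost s₂) := by
      rw [answerCmd, hs₂, hs₁, hpre]
      simp only [Cmd.cost, den, Nat.add_assoc]
      rfl
    omega

end Stages

/-! ### Formulas in prefix notation -/

namespace Formula

variable {nA : ℕ}

/-- The operands. -/
def children {AP : Type} : Formula AP → List (Formula AP)
  | EX _ φ | AX _ φ => [φ]
  | or φ ψ | and φ ψ | EU _ φ ψ | AU _ φ ψ | ER _ φ ψ | AR _ φ ψ => [φ, ψ]
  | _ => []

/-- The subformulas in prefix order. -/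
def pre {AP : Type} : Formula AP → List (Formula AP)
  | EX b φ => EX b φ :: φ.pre
  | AX b φ => AX b φ :: φ.pre
  | or φ ψ => or φ ψ :: (φ.pre ++ ψ.pre)
  | and φ ψ => and φ ψ :: (φ.pre ++ ψ.pre)
  | EU b φ ψ => EU b φ ψ :: (φ.pre ++ ψ.pre)
  | AU b φ ψ => AU b φ ψ :: (φ.pre ++ ψ.pre)
  | ER b φ ψ => ER b φ ψ :: (φ.pre ++ ψ.pre)
  | AR b φ ψ => AR b φ ψ :: (φ.pre ++ ψ.pre)
  | φ => [φ]

theorem pre_eq {AP : Type} (φ : Formula AP) : φ.pre = φ :: φ.children.flatMap pre := by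
  cases φ <;> simp [pre, children]

theorem length_pre {AP : Type} (φ : Formula AP) : φ.pre.length = φ.size := by
  induction φ <;> simp_all [pre, size]

theorem size_pos {AP : Type} (φ : Formula AP) : 1 ≤ φ.size := by
  cases φ <;> simp [size]

/-- The atom or the mode of a formula. -/
def arg : Formula (Fin nA) → ℕ
  | atom e | natom e => e
  | EX b _ | AX b _ | EU b _ _ | AU b _ _ | ER b _ _ | AR b _ _ => encodeMode b
  | _ => 0

/-- The numbers that stand for the outermost operator. -/
def hd (φ : Formula (Fin nA)) : List ℕ :=
  if φ.tag ≤ 1 ∨ φ.tag = 4 ∨ φ.tag = 5 then [φ.tag] else [φ.tag, φ.arg]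

theorem encodeFormula_eq (φ : Formula (Fin nA)) :
    encodeFormula φ = φ.hd ++ φ.children.flatMap encodeFormula := by
  cases φ <;> simp [encodeFormula, hd, tag, arg, children]

theorem size_le_length (φ : Formula (Fin nA)) : φ.size ≤ (encodeFormula φ).length := by
  induction φ <;> simp [encodeFormula, size] <;> omega

theorem length_le_size (φ : Formula (Fin nA)) : (encodeFormula φ).length ≤ 2 * φ.size := by
  induction φ <;> simp [encodeFormula, size] <;> omega

/-- In prefix order a subformula is immediately followed by its own subformulas. All address
arithmetic for operands follows from this. -/
theorem drop_pre {AP : Type} (φ : Formula AP) : ∀ i ψ, φ.pre[i]? = some ψ →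
    ∃ r, φ.pre.drop i = ψ.pre ++ r := by
  have two : ∀ (χ φ ψ : Formula AP), χ.pre = χ :: (φ.pre ++ ψ.pre) →
      (∀ i θ, φ.pre[i]? = some θ → ∃ r, φ.pre.drop i = θ.pre ++ r) →
      (∀ i θ, ψ.pre[i]? = some θ → ∃ r, ψ.pre.drop i = θ.pre ++ r) →
      ∀ i θ, χ.pre[i]? = some θ → ∃ r, χ.pre.drop i = θ.pre ++ r := by
    intro χ φ ψ hχ h h' i θ hi
    cases i with
    | zero =>
      rw [hχ, List.getElem?_cons_zero, Option.some_inj] at hi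
      exact ⟨[], by rw [← hi, List.drop_zero, List.append_nil]⟩
    | succ i =>
      rw [hχ, List.getElem?_cons_succ, List.getElem?_append] at hi
      rw [hχ, List.drop_succ_cons, List.drop_append]
      split_ifs at hi with hl
      · obtain ⟨r, hr⟩ := h i θ hi
        exact ⟨_, by rw [hr, List.append_assoc]⟩
      · obtain ⟨r, hr⟩ := h' _ θ hi
        exact ⟨r, by rw [hr, List.drop_eq_nil_of_le (by omega), List.nil_append]⟩
  have one : ∀ (χ φ : Formula AP), χ.pre = χ :: φ.pre →
      (∀ i θ, φ.pre[i]? = some θ → ∃ r, φ.pre.drop i = θ.pre ++ r) →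
      ∀ i θ, χ.pre[i]? = some θ → ∃ r, χ.pre.drop i = θ.pre ++ r := by
    intro χ φ hχ h i θ hi
    cases i with
    | zero =>
      rw [hχ, List.getElem?_cons_zero, Option.some_inj] at hi
      exact ⟨[], by rw [← hi, List.drop_zero, List.append_nil]⟩
    | succ i =>
      rw [hχ, List.getElem?_cons_succ] at hi
      rw [hχ, List.drop_succ_cons]
      exact h i θ hi
  have zero : ∀ (χ : Formula AP), χ.pre = [χ] →
      ∀ i θ, χ.pre[i]? = some θ → ∃ r, χ.pre.drop i = θ.pre ++ r := by
    intro χ hχ i θ hi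
    cases i with
    | zero =>
      rw [hχ, List.getElem?_cons_zero, Option.some_inj] at hi
      exact ⟨[], by rw [← hi, List.drop_zero, List.append_nil]⟩
    | succ i => simp [hχ] at hi
  induction φ with
  | tt => exact zero _ rfl
  | ff => exact zero _ rfl
  | atom e => exact zero _ rfl
  | natom e => exact zero _ rfl
  | or φ ψ h h' => exact two _ _ _ rfl h h'
  | and φ ψ h h' => exact two _ _ _ rfl h h'
  | EX b φ h => exact one _ _ rfl h
  | AX b φ h => exact one _ _ rfl h
  | EU b φ ψ h h' => exact two _ _ _ rfl h h'
  | AU b φ ψ h h' => exact two _ _ _ rfl h h'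
  | ER b φ ψ h h' => exact two _ _ _ rfl h h'
  | AR b φ ψ h h' => exact two _ _ _ rfl h h'

theorem children_unary {AP : Type} {φ : Formula AP} (h : φ.tag = 6 ∨ φ.tag = 7) :
    φ.children = [φ.left] ∧ φ.size = φ.left.size + 1 := by
  cases φ <;> simp [tag] at h <;> simp [children, left, size]

theorem children_binary {AP : Type} {φ : Formula AP} (h : 4 ≤ φ.tag) (h6 : φ.tag ≠ 6)
    (h7 : φ.tag ≠ 7) : φ.children = [φ.left, φ.right] ∧ φ.size = φ.left.size + φ.right.size + 1 := by
  cases φ <;> simp [tag] at h h6 h7 <;> simp [children, left, right, size]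

theorem size_leaf {AP : Type} {φ : Formula AP} (h : φ.tag < 4) : φ.size = 1 := by
  cases φ <;> simp [tag] at h <;> simp [size]

theorem pre_left {AP : Type} {φ ψ : Formula AP} {i : ℕ} (h : φ.pre[i]? = some ψ) (h4 : 4 ≤ ψ.tag) :
    φ.pre[i + 1]? = some ψ.left := by
  obtain ⟨r, hr⟩ := φ.drop_pre i ψ h
  have : φ.pre[i + 1]? = (φ.pre.drop i)[1]? := by rw [List.getElem?_drop]
  rw [this, hr, pre_eq]
  by_cases h6 : ψ.tag = 6 ∨ ψ.tag = 7
  · rw [(children_unary h6).1, List.flatMap_cons, pre_eq]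
    simp
  · rw [(children_binary h4 (by omega) (by omega)).1, List.flatMap_cons, pre_eq]
    simp

/-- The left operand occupies as many places as its size, directly after the operator. -/
theorem pre_right {AP : Type} {φ ψ : Formula AP} {i : ℕ} (h : φ.pre[i]? = some ψ) (h4 : 4 ≤ ψ.tag)
    (h6 : ψ.tag ≠ 6) (h7 : ψ.tag ≠ 7) : φ.pre[i + 1 + ψ.left.size]? = some ψ.right := by
  obtain ⟨r, hr⟩ := φ.drop_pre i ψ h
  have : φ.pre[i + 1 + ψ.left.size]? = (φ.pre.drop i)[1 + ψ.left.size]? := by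
    rw [List.getElem?_drop, Nat.add_assoc]
  rw [this, hr, pre_eq, (children_binary h4 h6 h7).1, Nat.add_comm 1, List.cons_append,
    List.getElem?_cons_succ, List.flatMap_cons, List.append_assoc,
    List.getElem?_append_right (by rw [length_pre]), length_pre, Nat.sub_self, List.flatMap_cons,
    pre_eq ψ.right]
  simp

end Formula

/-! ### Parsing the formula -/

section Tokens

variable {nA : ℕ} {s : State}

/-- Read the operator at the address in register `61`. -/
def readToken : Cmd :=
  asg 65 (mem (reg 61)) ;; sto (reg 9 + reg 62) (reg 65) ;;
    -- An operator without atom or mode gets the next number of the input here; such an entry is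
    -- never consulted.
    sto (reg 10 + reg 62) (mem (reg 61 + 1)) ;; asg 62 (reg 62 + 1) ;;
    ite (reg 65 - 1) (ite (reg 65 - 3) (ite (reg 65 - 5)
      (asg 61 (reg 61 + 2) ;; ite (reg 65 - 7) (asg 63 (reg 63 + 1)) skip)
      (asg 61 (reg 61 + 1) ;; asg 63 (reg 63 + 1)))
      (asg 61 (reg 61 + 2) ;; asg 63 (reg 63 - 1)))
      (asg 61 (reg 61 + 1) ;; asg 63 (reg 63 - 1))

/-- Register 63 counts the formulas still expected: reading an operator settles one of them and adds
its operands. In prefix notation this count is all that a parser has to remember. -/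
theorem readToken_reg {ψ : Formula (Fin nA)} (hm : MemAt s.mem (s.reg 61) ψ.hd) :
    (readToken.den s).reg 61 = s.reg 61 + ψ.hd.length ∧
    (readToken.den s).reg 62 = s.reg 62 + 1 ∧
    (readToken.den s).reg 63 = s.reg 63 + ψ.children.length - 1 := by
  have h0 : s.mem (s.reg 61) = ψ.tag := by
    unfold Formula.hd at hm
    split_ifs at hm <;> exact hm.1
  cases ψ <;> simp [readToken, den, State.set_reg, h0, Formula.tag, Formula.hd, Formula.children]

theorem readToken_mem {ψ : Formula (Fin nA)} (hm : MemAt s.mem (s.reg 61) ψ.hd)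
    (h : s.reg 61 + 1 < s.reg 9 + s.reg 62) (h' : s.reg 9 < s.reg 10) :
    (readToken.den s).mem (s.reg 9 + s.reg 62) = ψ.tag ∧
    (ψ.hd.length = 2 → (readToken.den s).mem (s.reg 10 + s.reg 62) = ψ.arg) ∧
    ∀ a, a ≠ s.reg 9 + s.reg 62 → a ≠ s.reg 10 + s.reg 62 →
      (readToken.den s).mem a = s.mem a := by
  have h0 : s.mem (s.reg 61) = ψ.tag := by
    unfold Formula.hd at hm
    split_ifs at hm <;> exact hm.1
  have hden : (readToken.den s).mem = Function.update (Function.update s.mem (s.reg 9 + s.reg 62)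
      (s.mem (s.reg 61))) (s.reg 10 + s.reg 62) (s.mem (s.reg 61 + 1)) := by
    refine (mem_den (c := asg 62 (reg 62 + 1) ;;
      ite (reg 65 - 1) (ite (reg 65 - 3) (ite (reg 65 - 5)
      (asg 61 (reg 61 + 2) ;; ite (reg 65 - 7) (asg 63 (reg 63 + 1)) skip)
      (asg 61 (reg 61 + 1) ;; asg 63 (reg 63 + 1)))
      (asg 61 (reg 61 + 2) ;; asg 63 (reg 63 - 1)))
      (asg 61 (reg 61 + 1) ;; asg 63 (reg 63 - 1))) rfl _).trans ?_
    simp [den, State.set_reg, Function.update_apply]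
    rw [if_neg (by omega)]
  rw [hden]
  refine ⟨?_, fun hl => ?_, fun a ha ha' => ?_⟩
  · rw [Function.update_of_ne (by omega), Function.update_self, h0]
  · rw [Function.update_self]
    unfold Formula.hd at hm hl
    split_ifs at hm hl
    · simp at hl
    · exact hm.2.1
  · rw [Function.update_of_ne ha', Function.update_of_ne ha]

/-- Read the formula at the address in register `44`. -/
def readFormula : Cmd :=
  asg 61 (reg 44) ;; asg 62 0 ;; asg 63 1 ;; for_ 64 (reg 0) (ite (reg 63) readToken skip)

/-- The end of the formula is not marked in the input. The loop therefore runs once for each number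
of the whole input and idles as soon as no formula is expected any more. The list `td` in the
invariant consists of the subformulas still to be read. -/
theorem readFormula_spec {φ : Formula (Fin nA)}
    (hm : MemAt s.mem (s.reg 44) (encodeFormula φ))
    (h0 : s.reg 44 + (encodeFormula φ).length < s.reg 9) (h00 : φ.size ≤ s.reg 0)
    (h10 : s.reg 9 + φ.size ≤ s.reg 10) :
    (readFormula.den s).reg 61 = s.reg 44 + (encodeFormula φ).length ∧
    (readFormula.den s).reg 62 = φ.size ∧
    (∀ i ψ, φ.pre[i]? = some ψ → (readFormula.den s).mem (s.reg 9 + i) = ψ.tag ∧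
      (ψ.hd.length = 2 → (readFormula.den s).mem (s.reg 10 + i) = ψ.arg)) ∧
    (∀ a, a < s.reg 9 ∨ s.reg 10 + φ.size ≤ a → (readFormula.den s).mem a = s.mem a) ∧
    readFormula.cost s ≤ 20 + 150 * s.reg 0 := by
  have hsz := φ.size_pos
  have hw : (ite (reg 63) readToken skip).worst ≤ 140 := by decide
  set s₁ := (asg 61 (reg 44) ;; asg 62 0 ;; asg 63 1).den s with hs₁
  have r₁ : ∀ i < 61, s₁.reg i = s.reg i := fun i hi => reg_den (K := 61) rfl _ hi
  have e0 : (reg 0).eval s₁ = s.reg 0 := r₁ 0 (by norm_num)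
  obtain ⟨⟨l, td, h1, h2, h3, h4, h5, h6, h7, h8⟩, h9⟩ := loop_rule' (s := s₁) (i := 64) (e := reg 0)
    (c := ite (reg 63) readToken skip) 61 rfl
    (fun k s' => ∃ l td : List (Formula (Fin nA)), φ.pre = l ++ td.flatMap Formula.pre ∧
      s'.reg 62 = l.length ∧ s'.reg 63 = td.length ∧
      s'.reg 61 + (td.flatMap encodeFormula).length = s.reg 44 + (encodeFormula φ).length ∧
      MemAt s'.mem (s'.reg 61) (td.flatMap encodeFormula) ∧
      (∀ i ψ, l[i]? = some ψ → s'.mem (s.reg 9 + i) = ψ.tag ∧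
        (ψ.hd.length = 2 → s'.mem (s.reg 10 + i) = ψ.arg)) ∧
      (∀ a, a < s.reg 9 ∨ s.reg 10 + φ.size ≤ a → s'.mem a = s.mem a) ∧
      -- As long as something is expected, every iteration reads an operator; after the last
      -- iteration at least as many would have been read as the formula has.
      (td = [] ∨ s.reg 0 ≤ l.length + k)) 140
    (by
      refine ⟨[], [φ], by simp, ?_, ?_, ?_, ?_, by simp, fun a _ => rfl, ?_⟩
      · simp [hs₁, den, State.set_reg]
      · simp [hs₁, den, State.set_reg]
      · simp [hs₁, den, State.set_reg]
      · simpa [hs₁, den, State.set_reg] using hm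
      · rw [e0]
        simp)
    (by
      rintro k s' - hr ⟨l, td, h1, h2, h3, h4, h5, h6, h7, h8⟩
      refine ⟨?_, (cost_le_worst rfl _).trans hw⟩
      cases td with
      | nil =>
        have : (reg 63).eval (s'.set 64 k) = 0 := by simp [State.set_reg, h3]
        rw [den, if_neg (not_not.2 this), den]
        exact ⟨l, [], h1, h2, h3, h4, h5, h6, h7, .inl rfl⟩
      | cons ψ td =>
        have : (reg 63).eval (s'.set 64 k) ≠ 0 := by simp [State.set_reg, h3]
        rw [den, if_pos this]
        have hm' : MemAt (s'.set 64 k).mem ((s'.set 64 k).reg 61)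
            (ψ.hd ++ (ψ.children.flatMap encodeFormula ++ td.flatMap encodeFormula)) := by
          rw [List.flatMap_cons, Formula.encodeFormula_eq, List.append_assoc] at h5
          exact h5
        rw [List.flatMap_cons, Formula.encodeFormula_eq, List.append_assoc] at h4
        rw [memAt_append] at hm'
        obtain ⟨g1, g2, g3⟩ := readToken_reg hm'.1
        have hlen : l.length + 1 ≤ φ.size := by
          have := congrArg List.length h1
          rw [φ.length_pre, List.flatMap_cons, List.length_append, List.length_append,
            ψ.length_pre] at this
          have := ψ.size_pos
          omega
        have e61 : (s'.set 64 k).reg 61 = s'.reg 61 := rfl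
        have e62 : (s'.set 64 k).reg 62 = l.length := h2
        have e63 : (s'.set 64 k).reg 63 = td.length + 1 := h3
        have e9 : (s'.set 64 k).reg 9 = s.reg 9 := by
          rw [State.set_reg, if_neg (by norm_num), hr 9 (by norm_num), r₁ 9 (by norm_num)]
        have e10 : (s'.set 64 k).reg 10 = s.reg 10 := by
          rw [State.set_reg, if_neg (by norm_num), hr 10 (by norm_num), r₁ 10 (by norm_num)]
        have hhd : 1 ≤ ψ.hd.length := by
          unfold Formula.hd
          split_ifs <;> simp
        simp only [List.length_append] at h4
        obtain ⟨g4, g5, g6⟩ := readToken_mem hm'.1 (by omega) (by omega)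
        rw [e9, e62] at g4 g6
        rw [e10] at g5 g6
        rw [e62] at g5
        rw [e61] at g1
        rw [e62] at g2
        rw [e63] at g3
        refine ⟨l ++ [ψ], ψ.children ++ td, ?_, ?_, ?_, ?_, ?_, ?_, ?_, ?_⟩
        · rw [h1, List.flatMap_cons, Formula.pre_eq]
          simp
        · rw [g2, List.length_append, List.length_singleton]
        · rw [g3, List.length_append]
          omega
        · rw [g1, List.flatMap_append, List.length_append]
          omega
        · rw [g1, List.flatMap_append]
          refine hm'.2.congr fun a ha ha' => g6 a ?_ ?_
          · rw [List.length_append, e61] at ha'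
            omega
          · rw [List.length_append, e61] at ha'
            omega
        · intro i θ hi
          rw [List.getElem?_append] at hi
          split_ifs at hi with hl
          · rw [g6 _ (by omega) (by omega), State.set_mem]
            refine ⟨(h6 i θ hi).1, fun h => ?_⟩
            rw [g6 _ (by omega) (by omega), State.set_mem]
            exact (h6 i θ hi).2 h
          · have hi' : i = l.length := by
              by_contra hne
              rw [List.getElem?_eq_none (by simp; omega)] at hi
              cases hi
            subst hi'
            rw [Nat.sub_self, List.getElem?_cons_zero, Option.some_inj] at hi
            rw [← hi]
            exact ⟨g4, g5⟩
        · intro a ha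
          rw [g6 a (by omega) (by omega), State.set_mem]
          exact h7 a ha
        · right
          rw [List.length_append, List.length_singleton]
          rcases h8 with h8 | h8
          · cases h8
          · omega)
  have htd : td = [] := by
    rcases h8 with h8 | h8
    · exact h8
    · have := congrArg List.length h1
      rw [φ.length_pre, List.length_append] at this
      cases td with
      | nil => rfl
      | cons ψ td =>
        rw [List.flatMap_cons, List.length_append, ψ.length_pre] at this
        have := ψ.size_pos
        omega
  subst htd
  have h1 : φ.pre = l := by simpa using h1
  refine ⟨h4, ?_, ?_, h7, ?_⟩
  · rw [← φ.length_pre, h1]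
    exact h2
  · rw [h1]
    exact h6
  · have : readFormula.cost s = 4 + (3 + (3 +
      (for_ 64 (reg 0) (ite (reg 63) readToken skip)).cost s₁)) := rfl
    rw [e0] at h9
    have e : (reg 0).cost = 2 := rfl
    omega

end Tokens

/-! ### Filling of arrays -/

section Arrays

variable {s : State}

/-- The operators that the subformulas end with. -/
def nextCmd : Cmd :=
  for_ 40 (reg 4) (ite (mem (reg 9 + reg 40) - 3)
    (ite (eqE (mem (reg 9 + reg 40)) 6) (sto (reg 11 + reg 40) (mem (reg 11 + (reg 40 + 1))))
      (ite (eqE (mem (reg 9 + reg 40)) 7) (sto (reg 11 + reg 40) (mem (reg 11 + (reg 40 + 1))))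
        (sto (reg 11 + reg 40) (mem (reg 11 + mem (reg 11 + (reg 40 + 1)))))))
    (sto (reg 11 + reg 40) (reg 40 + 1)))

/-- The array is filled from the last subformula to the first, so the ends of the operands are
known: a unary operator ends where its operand ends, and a binary one where the operand that starts
at the end of the left one ends. -/
theorem nextCmd_spec {nA : ℕ} {φ : Formula (Fin nA)} (h4 : s.reg 4 = φ.size)
    (ht : ∀ i ψ, φ.pre[i]? = some ψ → s.mem (s.reg 9 + i) = ψ.tag)
    (h9 : s.reg 9 + φ.size ≤ s.reg 11) :
    (∀ i ψ, φ.pre[i]? = some ψ → (nextCmd.den s).mem (s.reg 11 + i) = i + ψ.size) ∧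
    (∀ a, a < s.reg 11 ∨ s.reg 11 + φ.size ≤ a → (nextCmd.den s).mem a = s.mem a) ∧
    nextCmd.cost s ≤ 3 + 105 * φ.size := by
  obtain ⟨⟨h1, h2⟩, h3⟩ := loop_rule' (s := s) (i := 40) (e := reg 4)
    (c := (ite (mem (reg 9 + reg 40) - 3)
    (ite (eqE (mem (reg 9 + reg 40)) 6) (sto (reg 11 + reg 40) (mem (reg 11 + (reg 40 + 1))))
      (ite (eqE (mem (reg 9 + reg 40)) 7) (sto (reg 11 + reg 40) (mem (reg 11 + (reg 40 + 1))))
        (sto (reg 11 + reg 40) (mem (reg 11 + mem (reg 11 + (reg 40 + 1)))))))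
    (sto (reg 11 + reg 40) (reg 40 + 1)))) 40 rfl
    (fun k s' => (∀ i ψ, k ≤ i → φ.pre[i]? = some ψ → s'.mem (s.reg 11 + i) = i + ψ.size) ∧
      (∀ a, a < s.reg 11 ∨ s.reg 11 + φ.size ≤ a → s'.mem a = s.mem a)) 100
    (by
      refine ⟨fun i ψ hi hψ => ?_, fun a _ => rfl⟩
      have := (List.getElem?_eq_some_iff.1 hψ).1
      rw [φ.length_pre] at this
      rw [eval_reg] at hi
      omega)
    (by
      rintro k s' hk hr ⟨h1, h2⟩
      rw [eval_reg, h4] at hk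
      refine ⟨?_, (cost_le_worst rfl _).trans (by decide)⟩
      obtain ⟨ψ, hψ⟩ : ∃ ψ, φ.pre[k]? = some ψ :=
        ⟨_, List.getElem?_eq_getElem (by rwa [φ.length_pre])⟩
      have e40 : (s'.set 40 k).reg 40 = k := by simp [State.set_reg]
      have e9 : (s'.set 40 k).reg 9 = s.reg 9 := by
        rw [State.set_reg, if_neg (by norm_num), hr 9 (by norm_num)]
      have e11 : (s'.set 40 k).reg 11 = s.reg 11 := by
        rw [State.set_reg, if_neg (by norm_num), hr 11 (by norm_num)]
      have et : s'.mem (s.reg 9 + k) = ψ.tag := by rw [h2 _ (by omega), ht k ψ hψ]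
      have key : ∀ v, v = k + ψ.size →
          (∀ i θ, k ≤ i → φ.pre[i]? = some θ →
            Function.update s'.mem (s.reg 11 + k) v (s.reg 11 + i) = i + θ.size) ∧
          (∀ a, a < s.reg 11 ∨ s.reg 11 + φ.size ≤ a →
            Function.update s'.mem (s.reg 11 + k) v a = s.mem a) := by
        rintro v rfl
        refine ⟨fun i θ hi hθ => ?_, fun a ha => ?_⟩
        · rcases eq_or_ne i k with rfl | hne
          · rw [hψ, Option.some_inj] at hθ
            rw [Function.update_self, hθ]
          · rw [Function.update_of_ne (by omega)]
            exact h1 i θ (by omega) hθ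
        · rw [Function.update_of_ne (by omega), h2 a ha]
      have ec : (mem (reg 9 + reg 40) : Expr).eval (s'.set 40 k) = ψ.tag := by
        rw [eval_mem, eval_add, eval_reg, eval_reg, e9, e40, State.set_mem, et]
      have ea : (reg 11 + reg 40 : Expr).eval (s'.set 40 k) = s.reg 11 + k := by
        rw [eval_add, eval_reg, eval_reg, e11, e40]
      have en : (mem (reg 11 + (reg 40 + 1)) : Expr).eval (s'.set 40 k) =
          s'.mem (s.reg 11 + (k + 1)) := by
        rw [eval_mem, eval_add, eval_add, eval_reg, eval_reg, e11, e40, State.set_mem, eval_one]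
      by_cases h4' : 4 ≤ ψ.tag
      · have hl := h1 (k + 1) _ (by omega) (Formula.pre_left hψ h4')
        rw [den, if_pos (by rw [eval_sub, ec, eval_ofNat, OfNat.ofNat]; simp [instOfNatNat]; omega)]
        by_cases h67 : ψ.tag = 6 ∨ ψ.tag = 7
        · have hs := (Formula.children_unary h67).2
          rw [den]
          split_ifs with h6
          · rw [den, ea, en]
            exact key _ (by omega)
          · rw [eval_eqE, ec] at h6
            rw [den, if_pos (by
              rw [eval_eqE, ec]
              exact h67.resolve_left h6), den, ea, en]
            exact key _ (by omega)
        · have hs := (Formula.children_binary h4' (by omega) (by omega)).2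
          have hr := h1 _ _ (by omega) (Formula.pre_right hψ h4' (by omega) (by omega))
          rw [den, if_neg (by
              rw [eval_eqE, ec]
              exact fun h => h67 (.inl h)), den, if_neg (by
              rw [eval_eqE, ec]
              exact fun h => h67 (.inr h)), den, ea, eval_mem, eval_add, eval_reg, e11, en, hl,
              State.set_mem, hr]
          exact key _ (by omega)
      · have hs := Formula.size_leaf (φ := ψ) (by omega)
        rw [den, if_neg (by rw [eval_sub, ec, eval_ofNat, OfNat.ofNat]; simp [instOfNatNat]; omega),
          den, ea, eval_add, eval_reg, e40, eval_one]
        exact key _ (by omega))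
  refine ⟨fun i ψ => h1 i ψ (Nat.zero_le _), h2, ?_⟩
  rw [eval_reg, h4] at h3
  have e : (reg 4).cost = 2 := rfl
  have : nextCmd.cost s ≤ (reg 4).cost + 1 + φ.size * (100 + 5) := h3
  omega

/-- Write `n` values, given by `val`, from the address in register `41` on; `upd` modifies the
register `42` after each of them. -/
def fill (n val : Expr) (upd : Cmd) : Cmd :=
  for_ 40 n (sto (reg 41) val ;; asg 41 (reg 41 + 1) ;; upd)

/-- `f j` is the value written at position `j`, and `g j` is the content of register 42 at that
moment. The write pointer ascends although the loop counter descends, so the proof follows the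
number of writes already made. -/
theorem fill_spec {n val : Expr} {upd : Cmd} (hu : upd.above 42 = true) (hq : upd.quiet = true)
    (f g : ℕ → ℕ) (T : ℕ) (h0 : s.reg 42 = g 0)
    (step : ∀ j s', j < n.eval s → (∀ r < 40, s'.reg r = s.reg r) → s'.reg 42 = g j →
      val.eval s' = f j ∧ (upd.den s').reg 42 = g (j + 1) ∧ upd.cost s' ≤ T) :
    (∀ j < n.eval s, ((fill n val upd).den s).mem (s.reg 41 + j) = f j) ∧
    (∀ a, a < s.reg 41 ∨ s.reg 41 + n.eval s ≤ a → ((fill n val upd).den s).mem a = s.mem a) ∧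
    ((fill n val upd).den s).reg 41 = s.reg 41 + n.eval s ∧
    ((fill n val upd).den s).reg 42 = g (n.eval s) ∧
    (fill n val upd).cost s ≤ n.cost + 1 + n.eval s * (val.cost + T + 14) := by
  have hab : (for_ 40 n (sto (reg 41) val ;; asg 41 (reg 41 + 1) ;; upd)).above 40 = true := by
    simp [above, above_mono (K := 40) (by norm_num) hu]
  obtain ⟨⟨j, h1, h2, h3, h4, h5⟩, h6⟩ := loop_rule' (s := s) (i := 40) (e := n)
    (c := sto (reg 41) val ;; asg 41 (reg 41 + 1) ;; upd) 40 hab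
    (fun k s' => ∃ j, j + k = n.eval s ∧ s'.reg 41 = s.reg 41 + j ∧ s'.reg 42 = g j ∧
      (∀ i < j, s'.mem (s.reg 41 + i) = f i) ∧
      ∀ a, a < s.reg 41 ∨ s.reg 41 + n.eval s ≤ a → s'.mem a = s.mem a)
    (val.cost + T + 9) ⟨0, by simp, rfl, h0, by simp, fun _ _ => rfl⟩ (by
      rintro k s' hk hr ⟨j, h1, h2, h3, h4, h5⟩
      have r1 : ∀ r < 40, (s'.set 40 k).reg r = s.reg r := fun r hr' => by
        rw [State.set_reg, if_neg (by omega), hr r hr']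
      have v1 := (step j (s'.set 40 k) (by omega) r1 h3).1
      set s₂ := (sto (reg 41) val ;; asg 41 (reg 41 + 1)).den (s'.set 40 k) with hs₂
      have r2 : ∀ r < 40, s₂.reg r = s.reg r := fun r hr' => by
        rw [reg_den (K := 40) rfl _ hr', r1 r hr']
      have e42 : s₂.reg 42 = g j := h3
      have e41 : s₂.reg 41 = s.reg 41 + (j + 1) := by
        simp [hs₂, den, State.set_reg, h2, Nat.add_assoc]
      have em : s₂.mem = Function.update s'.mem (s.reg 41 + j) (f j) := by
        have : s₂.mem = Function.update s'.mem (s'.reg 41) (val.eval (s'.set 40 k)) := rfl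
        rw [this, h2, v1]
      obtain ⟨-, v2, v3⟩ := step j s₂ (by omega) r2 e42
      refine ⟨⟨j + 1, by omega, ?_, v2, fun i hi => ?_, fun a ha => ?_⟩, ?_⟩
      · exact (reg_den hu s₂ (by norm_num)).trans e41
      · change (upd.den s₂).mem _ = _
        rw [mem_den hq, em]
        rcases eq_or_ne i j with rfl | hne
        · rw [Function.update_self]
        · rw [Function.update_of_ne (by omega)]
          exact h4 i (by omega)
      · change (upd.den s₂).mem _ = _
        rw [mem_den hq, em, Function.update_of_ne (by omega)]
        exact h5 a ha
      · have : (sto (reg 41) val ;; asg 41 (reg 41 + 1) ;; upd).cost (s'.set 40 k) =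
            (2 + (val.cost + 1)) + (6 + upd.cost s₂) := rfl
        omega)
  have hj : j = n.eval s := by omega
  subst hj
  refine ⟨h4, h5, h2, h3, h6.trans ?_⟩
  exact Nat.add_le_add_left (Nat.mul_le_mul_left _ (by omega)) _

/-- The product of two numbers, in register `42`. -/
def mul (a b : Expr) : Cmd := asg 42 0 ;; for_ 40 a (asg 42 (reg 42 + b))

theorem mul_spec {a b : Expr} {A B : ℕ} (ha : a.eval (s.set 42 0) = A)
    (hb : ∀ s', (∀ r < 40, s'.reg r = s.reg r) → s'.mem = s.mem → b.eval s' = B) :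
    ((mul a b).den s).reg 42 = A * B ∧
    (mul a b).cost s ≤ a.cost + 4 + A * (b.cost + 10) := by
  obtain ⟨⟨h1, -⟩, h2⟩ := loop_rule' (s := s.set 42 0) (i := 40) (e := a)
    (c := asg 42 (reg 42 + b)) 40 rfl
    (fun k s' => s'.reg 42 + k * B = A * B ∧ s'.mem = s.mem) (b.cost + 5)
    ⟨by rw [ha]; simp [State.set_reg], rfl⟩ (by
      rintro k s' hk hr ⟨h1, h2⟩
      have := hb (s'.set 40 k) (fun r hr' => by
        rw [State.set_reg, if_neg (by omega), hr r hr', State.set_reg, if_neg (by omega)]) h2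
      refine ⟨⟨?_, h2⟩, ?_⟩
      · rw [den, State.set_reg, if_pos rfl, eval_add, this, ← h1, eval_reg, State.set_reg,
          if_neg (by norm_num), Nat.add_mul]
        omega
      · have : (asg 42 (reg 42 + b)).cost (s'.set 40 k) = 2 + (b.cost + 1) + 2 := rfl
        omega)
  rw [ha] at h2
  refine ⟨by rw [Nat.zero_mul, Nat.add_zero] at h1; exact h1, ?_⟩
  have : (mul a b).cost s = 3 + (for_ 40 a (asg 42 (reg 42 + b))).cost (s.set 42 0) := rfl
  have e : A * (b.cost + 5 + 5) = A * (b.cost + 10) := rfl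
  omega

end Arrays

/-! ### Reading the rules and the formula -/

section Prepare

variable {nP nΓ nA : ℕ} {rules : List (Rule (Fin nP) (Fin nΓ))} {φ : Formula (Fin nA)} {x : List ℕ}

/-- The arrays that depend on the formula only. -/
structure Prepared (rules : List (Rule (Fin nP) (Fin nΓ))) (φ : Formula (Fin nA)) (x : List ℕ)
    (s : State) : Prop where
  lt : φ.size < x.length
  r1 : s.reg 1 = nP
  r2 : s.reg 2 = nΓ
  r3 : s.reg 3 = rules.length
  r4 : s.reg 4 = φ.size
  r9 : s.reg 9 = x.length
  r10 : s.reg 10 = 2 * x.length + 1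
  r11 : s.reg 11 = 3 * x.length + 2
  r12 : s.reg 12 = 4 * x.length + 3
  r13 : s.reg 13 = 5 * x.length + 4
  r19 : s.reg 19 = (φ.size + 1) * nP
  r20 : s.reg 20 = 3 + (rules.flatMap encodeRule).length + (encodeFormula φ).length
  r63 : s.reg 63 = 5 * x.length + 4 + (φ.size + 1) * nP
  input : ∀ a < x.length, s.mem a = x.getD a 0
  free : ∀ a, 5 * x.length + 4 + (φ.size + 1) * nP ≤ a → s.mem a = 0
  tag : ∀ i ψ, φ.pre[i]? = some ψ → s.mem (x.length + i) = ψ.tag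
  tag_last : s.mem (x.length + φ.size) = 12
  arg : ∀ i ψ, φ.pre[i]? = some ψ → ψ.hd.length = 2 → s.mem (2 * x.length + 1 + i) = ψ.arg
  arg_last : s.mem (2 * x.length + 1 + φ.size) = 0
  next : ∀ i ψ, φ.pre[i]? = some ψ → s.mem (3 * x.length + 2 + i) = i + ψ.size
  row : ∀ i ≤ φ.size, s.mem (4 * x.length + 3 + i) = 5 * x.length + 4 + i * nP
  ident : ∀ j < (φ.size + 1) * nP, s.mem (5 * x.length + 4 + j) = j

/-- Read the numbers in front, pass over the rules and choose the places of the arrays. -/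
def headCmd : Cmd :=
  (asg 1 (mem 0) ;; asg 2 (mem 1) ;; asg 3 (mem 2)) ;; rulesLoop skip ;;
    (asg 9 (reg 0) ;; asg 10 (reg 9 + reg 0 + 1) ;; asg 11 (reg 10 + reg 0 + 1) ;;
      asg 12 (reg 11 + reg 0 + 1) ;; asg 13 (reg 12 + reg 0 + 1))

/-- The rules are passed over with an idle body merely to find where they end, since their encodings
differ in length. The arrays are laid out above the input at distances of one more than the length
of the input. -/
theorem headCmd_spec {y : List ℕ}
    (hx : x = nP :: nΓ :: rules.length :: (rules.flatMap encodeRule ++ y)) :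
    ((headCmd.den (State.start x)).reg 0 = x.length ∧ (headCmd.den (State.start x)).reg 1 = nP ∧
      (headCmd.den (State.start x)).reg 2 = nΓ ∧
      (headCmd.den (State.start x)).reg 3 = rules.length ∧
      (headCmd.den (State.start x)).reg 9 = x.length ∧
      (headCmd.den (State.start x)).reg 10 = 2 * x.length + 1 ∧
      (headCmd.den (State.start x)).reg 11 = 3 * x.length + 2 ∧
      (headCmd.den (State.start x)).reg 12 = 4 * x.length + 3 ∧
      (headCmd.den (State.start x)).reg 13 = 5 * x.length + 4 ∧
      (headCmd.den (State.start x)).reg 44 = 3 + (rules.flatMap encodeRule).length) ∧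
    (headCmd.den (State.start x)).mem = (State.start x).mem ∧
    headCmd.cost (State.start x) ≤ 100 + 81 * (rules.map Rule.size).sum := by
  set s := State.start x with hs
  set s₁ := (asg 1 (mem 0) ;; asg 2 (mem 1) ;; asg 3 (mem 2)).den s with hs₁
  have hm : MemAt s.mem 0 x := memAt_getD x
  have hm' : MemAt s.mem 0 (nP :: nΓ :: rules.length :: (rules.flatMap encodeRule ++ y)) := hx ▸ hm
  obtain ⟨m0, m1, m2, m3⟩ := hm'
  rw [memAt_append] at m3
  have e1 : s₁.reg 1 = nP := by
    rw [← m0]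
    simp [hs₁, den, State.set_reg]
  have e2 : s₁.reg 2 = nΓ := by
    rw [← m1]
    simp [hs₁, den, State.set_reg]
  have e3 : s₁.reg 3 = rules.length := by
    rw [← m2]
    simp [hs₁, den, State.set_reg]
  have e0 : s₁.reg 0 = x.length := by
    simp [hs₁, den, State.set_reg, hs, State.start]
  obtain ⟨-, h2, h3⟩ := rulesLoop_spec (body := skip) rfl rfl (s := s₁) m3.1 e3
    (fun _ _ _ => True) 1 trivial (fun _ r _ _ _ _ _ _ => ⟨trivial, by
      have : 1 ≤ r.size := by cases r <;> simp [Rule.size]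
      rw [Cmd.cost]
      omega⟩)
  set s₂ := (rulesLoop skip).den s₁ with hs₂
  have r₂ : ∀ r < 44, s₂.reg r = s₁.reg r := fun r hr => reg_den (K := 44) rfl _ hr
  have em₂ : s₂.mem = s₁.mem := mem_den (c := rulesLoop skip) rfl _
  have hd : headCmd.den s = (asg 9 (reg 0) ;; asg 10 (reg 9 + reg 0 + 1) ;;
      asg 11 (reg 10 + reg 0 + 1) ;; asg 12 (reg 11 + reg 0 + 1) ;;
      asg 13 (reg 12 + reg 0 + 1)).den s₂ := rfl
  refine ⟨?_, ?_, ?_⟩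
  · have f0 := (r₂ 0 (by norm_num)).trans e0
    have f1 := (r₂ 1 (by norm_num)).trans e1
    have f2 := (r₂ 2 (by norm_num)).trans e2
    have f3 := (r₂ 3 (by norm_num)).trans e3
    rw [hd]
    clear_value s₂
    refine ⟨?_, ?_, ?_, ?_, ?_, ?_, ?_, ?_, ?_, ?_⟩ <;>
      simp only [den, State.set_reg, eval_add, eval_reg, eval_one, f0, f1, f2, f3, h3] <;> norm_num <;> ring
  · rw [hd, mem_den rfl, em₂]
    rfl
  · have hc := cost_le_worst (c := asg 1 (mem 0) ;; asg 2 (mem 1) ;; asg 3 (mem 2)) rfl s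
    have hw : (asg 1 (mem 0) ;; asg 2 (mem 1) ;; asg 3 (mem 2)).worst ≤ 20 := by decide
    have hc' := cost_le_worst (c := asg 9 (reg 0) ;; asg 10 (reg 9 + reg 0 + 1) ;;
      asg 11 (reg 10 + reg 0 + 1) ;; asg 12 (reg 11 + reg 0 + 1) ;;
      asg 13 (reg 12 + reg 0 + 1)) rfl s₂
    have hw' : (asg 9 (reg 0) ;; asg 10 (reg 9 + reg 0 + 1) ;;
      asg 11 (reg 10 + reg 0 + 1) ;; asg 12 (reg 11 + reg 0 + 1) ;;
      asg 13 (reg 12 + reg 0 + 1)).worst ≤ 60 := by decide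
    have : headCmd.cost s = (asg 1 (mem 0) ;; asg 2 (mem 1) ;; asg 3 (mem 2)).cost s +
      ((rulesLoop skip).cost s₁ + (asg 9 (reg 0) ;; asg 10 (reg 9 + reg 0 + 1) ;;
      asg 11 (reg 10 + reg 0 + 1) ;; asg 12 (reg 11 + reg 0 + 1) ;;
      asg 13 (reg 12 + reg 0 + 1)).cost s₂) := rfl
    omega

/-- Read the formula. -/
def formulaCmd : Cmd :=
  readFormula ;; (asg 4 (reg 62) ;; asg 20 (reg 61) ;; sto (reg 9 + reg 4) 12) ;; nextCmd

/-- Default places of the properties. -/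
def placesCmd : Cmd :=
  mul (reg 4 + 1) (reg 1) ;; (asg 19 (reg 42) ;; asg 41 (reg 13) ;; asg 42 0) ;;
    fill (reg 19) (reg 42) (asg 42 (reg 42 + 1)) ;;
    (asg 63 (reg 41) ;; asg 41 (reg 12) ;; asg 42 (reg 13)) ;;
    fill (reg 4 + 1) (reg 42) (asg 42 (reg 42 + reg 1))

/-- The preparations before the automata are read. -/
def prepareCmd : Cmd := headCmd ;; formulaCmd ;; placesCmd

-- The formula is shorter than the input, so each array has room for all subformulas and the
-- additional run property. Every phase writes to its own array only, and everything above the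
-- arrays still holds `0`.
set_option maxHeartbeats 1000000 in
theorem prepareCmd_spec {y : List ℕ} (hy : y ≠ [])
    (hx : x = nP :: nΓ :: rules.length :: (rules.flatMap encodeRule ++ (encodeFormula φ ++ y))) :
    Prepared rules φ x (prepareCmd.den (State.start x)) ∧
    prepareCmd.cost (State.start x) ≤ 400 + 81 * (rules.map Rule.size).sum + 150 * x.length +
      105 * φ.size + (φ.size + 1) * (50 + 30 * nP) := by
  set s := State.start x with hs
  obtain ⟨a1, a2, a3⟩ := headCmd_spec (rules := rules) (nP := nP) (nΓ := nΓ) hx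
  rw [← hs] at a1 a2 a3
  set s₁ := headCmd.den s with hs₁
  have hlen : x.length = 3 + (rules.flatMap encodeRule).length + (encodeFormula φ).length +
      y.length := by
    rw [hx]
    simp only [List.length_cons, List.length_append]
    omega
  have hy' := List.length_pos_of_ne_nil hy
  have hsz := φ.size_le_length
  obtain ⟨b0, b1, b2, b3, b9, b10, b11, b12, b13, b44⟩ := a1
  have bm : ∀ a, s₁.mem a = x.getD a 0 := fun a => congrFun a2 a
  have hm : MemAt s₁.mem (s₁.reg 44) (encodeFormula φ) := by
    rw [a2, b44]
    have : MemAt s.mem 0 x := memAt_getD x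
    rw [hx] at this
    obtain ⟨-, -, -, m3⟩ := this
    rw [memAt_append, memAt_append] at m3
    exact m3.2.1
  obtain ⟨c1, c2, c3, c4, c5⟩ := readFormula_spec hm (by omega) (by omega) (by omega)
  set s₂ := readFormula.den s₁ with hs₂
  have r₂ : ∀ r < 61, s₂.reg r = s₁.reg r := fun r hr => reg_den (K := 61) rfl _ hr
  set s₃ := (asg 4 (reg 62) ;; asg 20 (reg 61) ;; sto (reg 9 + reg 4) 12).den s₂ with hs₃
  have r₃ : ∀ r, s₃.reg r = if r = 20 then s₂.reg 61 else if r = 4 then s₂.reg 62 else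
      s₂.reg r := by
    intro r
    simp [hs₃, den, State.set_reg]
  have m₃ : s₃.mem = Function.update s₂.mem (x.length + φ.size) 12 := by
    have : s₃.mem = Function.update s₂.mem (s₂.reg 9 + s₂.reg 62) 12 := rfl
    rw [this, r₂ 9 (by norm_num), b9, c2]
  have d4 : s₃.reg 4 = φ.size := (r₃ 4).trans c2
  have d9 : s₃.reg 9 = x.length := ((r₃ 9).trans (r₂ 9 (by norm_num))).trans b9
  have d11 : s₃.reg 11 = 3 * x.length + 2 := ((r₃ 11).trans (r₂ 11 (by norm_num))).trans b11
  rw [b9, b10] at c3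
  rw [b9, b10] at c4
  have hpre : ∀ {i : ℕ} {ψ : Formula (Fin nA)}, φ.pre[i]? = some ψ → i < φ.size := by
    intro i ψ h
    rw [← φ.length_pre]
    exact (List.getElem?_eq_some_iff.1 h).1
  obtain ⟨e1, e2, e3⟩ := nextCmd_spec (s := s₃) d4 (fun i ψ h => by
    have := hpre h
    rw [d9, m₃, Function.update_of_ne (by omega)]
    exact (c3 i ψ h).1) (by omega)
  rw [d11] at e1
  rw [d11] at e2
  set s₄ := nextCmd.den s₃ with hs₄
  have r₄ : ∀ r < 40, s₄.reg r = s₃.reg r := fun r hr => reg_den (K := 40) rfl _ hr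
  obtain ⟨f1, f2⟩ := mul_spec (s := s₄) (a := reg 4 + 1) (b := reg 1) (A := φ.size + 1) (B := nP)
    (by
      simp only [eval_add, eval_reg, State.set_reg, eval_one]
      rw [if_neg (by norm_num), r₄ 4 (by norm_num), d4])
    (fun s' hr _ => by
      rw [eval_reg, hr 1 (by norm_num), r₄ 1 (by norm_num), r₃, if_neg (by norm_num),
        if_neg (by norm_num), r₂ 1 (by norm_num), b1])
  set s₅ := (mul (reg 4 + 1) (reg 1)).den s₄ with hs₅
  have r₅ : ∀ r < 40, s₅.reg r = s₄.reg r := fun r hr => reg_den (K := 40) rfl _ hr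
  have m₅ : s₅.mem = s₄.mem := mem_den (c := mul (reg 4 + 1) (reg 1)) rfl _
  set s₆ := (asg 19 (reg 42) ;; asg 41 (reg 13) ;; asg 42 0).den s₅ with hs₆
  have r₆ : ∀ r, s₆.reg r = if r = 42 then 0 else if r = 41 then s₅.reg 13 else
      if r = 19 then s₅.reg 42 else s₅.reg r := by
    intro r
    simp [hs₆, den, State.set_reg]
  have g13 : s₅.reg 13 = 5 * x.length + 4 := by
    rw [r₅ 13 (by norm_num), r₄ 13 (by norm_num), r₃, if_neg (by norm_num), if_neg (by norm_num),
      r₂ 13 (by norm_num), b13]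
  have g19 : (reg 19).eval s₆ = (φ.size + 1) * nP := by
    rw [eval_reg, r₆, if_neg (by norm_num), if_neg (by norm_num), if_pos rfl, f1]
  have g41 : s₆.reg 41 = 5 * x.length + 4 := by rw [r₆, if_neg (by norm_num), if_pos rfl, g13]
  obtain ⟨h1, h2, h3, -, h5⟩ := fill_spec (s := s₆) (n := reg 19) (val := reg 42)
    (upd := asg 42 (reg 42 + 1)) rfl rfl (fun j => j) (fun j => j) 6 (by rw [r₆, if_pos rfl])
    (fun j s' _ _ h42 => ⟨h42, by simp [den, State.set_reg, h42], le_rfl⟩)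
  rw [g19, g41] at h1
  rw [g19, g41] at h2
  rw [g19, g41] at h3
  rw [g19] at h5
  set s₇ := (fill (reg 19) (reg 42) (asg 42 (reg 42 + 1))).den s₆ with hs₇
  have r₇ : ∀ r < 40, s₇.reg r = s₆.reg r := fun r hr => reg_den (K := 40) rfl _ hr
  set s₈ := (asg 63 (reg 41) ;; asg 41 (reg 12) ;; asg 42 (reg 13)).den s₇ with hs₈
  have r₈ : ∀ r, s₈.reg r = if r = 42 then s₇.reg 13 else if r = 41 then s₇.reg 12 else
      if r = 63 then s₇.reg 41 else s₇.reg r := by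
    intro r
    simp [hs₈, den, State.set_reg]
  have low : ∀ r < 40, r ≠ 19 → r ≠ 20 → r ≠ 4 → s₈.reg r = s₁.reg r := by
    intro r hr h19 h20 h4
    rw [r₈, if_neg (by omega), if_neg (by omega), if_neg (by omega), r₇ r hr, r₆,
      if_neg (by omega), if_neg (by omega), if_neg h19, r₅ r hr, r₄ r hr, r₃, if_neg h20,
      if_neg h4, r₂ r (by omega)]
  have k4 : s₈.reg 4 = φ.size := by
    rw [r₈, if_neg (by omega), if_neg (by omega), if_neg (by omega), r₇ 4 (by norm_num), r₆,
      if_neg (by omega), if_neg (by omega), if_neg (by norm_num), r₅ 4 (by norm_num),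
      r₄ 4 (by norm_num), d4]
  have k41 : s₈.reg 41 = 4 * x.length + 3 := by
    rw [r₈, if_neg (by norm_num), if_pos rfl, r₇ 12 (by norm_num), r₆, if_neg (by norm_num),
      if_neg (by norm_num), if_neg (by norm_num), r₅ 12 (by norm_num), r₄ 12 (by norm_num), r₃,
      if_neg (by norm_num), if_neg (by norm_num), r₂ 12 (by norm_num), b12]
  have kn : (reg 4 + 1 : Expr).eval s₈ = φ.size + 1 := by rw [eval_add, eval_reg, k4, eval_one]
  obtain ⟨i1, i2, -, -, i5⟩ := fill_spec (s := s₈) (n := reg 4 + 1) (val := reg 42)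
    (upd := asg 42 (reg 42 + reg 1)) rfl rfl (fun j => 5 * x.length + 4 + j * nP)
    (fun j => 5 * x.length + 4 + j * nP) 7
    (by
      rw [r₈, if_pos rfl, r₇ 13 (by norm_num), r₆, if_neg (by norm_num), if_neg (by norm_num),
        if_neg (by norm_num), g13]
      simp)
    (fun j s' _ hr h42 => ⟨h42, by
      have : s'.reg 1 = nP := by rw [hr 1 (by norm_num), low 1 (by norm_num) (by norm_num)
        (by norm_num) (by norm_num), b1]
      simp only [den, State.set_reg, eval_add, eval_reg, h42, this, if_true]
      ring, le_rfl⟩)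
  rw [kn, k41] at i1
  rw [kn, k41] at i2
  rw [kn] at i5
  set s₉ := (fill (reg 4 + 1) (reg 42) (asg 42 (reg 42 + reg 1))).den s₈ with hs₉
  have r₉ : ∀ r < 40, s₉.reg r = s₈.reg r := fun r hr => reg_den (K := 40) rfl _ hr
  have hden : prepareCmd.den s = s₉ := rfl
  have m₈ : s₈.mem = s₇.mem := rfl
  have m₆ : s₆.mem = s₄.mem := m₅
  have mA : ∀ a, (a < 4 * x.length + 3 ∨ 5 * x.length + 4 + (φ.size + 1) * nP ≤ a) →
      s₉.mem a = s₄.mem a := by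
    intro a ha
    rw [i2 a (by omega), m₈, h2 a (by omega), m₆]
  have mB : ∀ a, a ≠ x.length + φ.size → (a < 3 * x.length + 2 ∨ 4 * x.length + 3 ≤ a) →
      s₄.mem a = s₂.mem a := by
    intro a ha ha'
    rw [e2 a (by omega), m₃, Function.update_of_ne ha]
  rw [hden]
  constructor
  · have reg9 : ∀ r < 40, r ≠ 19 → r ≠ 20 → r ≠ 4 → s₉.reg r = s₁.reg r :=
      fun r h h' h'' h''' => (r₉ r h).trans (low r h h' h'' h''')
    constructor
    · omega
    · rw [reg9 1 (by norm_num) (by norm_num) (by norm_num) (by norm_num), b1]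
    · rw [reg9 2 (by norm_num) (by norm_num) (by norm_num) (by norm_num), b2]
    · rw [reg9 3 (by norm_num) (by norm_num) (by norm_num) (by norm_num), b3]
    · rw [r₉ 4 (by norm_num), k4]
    · rw [reg9 9 (by norm_num) (by norm_num) (by norm_num) (by norm_num), b9]
    · rw [reg9 10 (by norm_num) (by norm_num) (by norm_num) (by norm_num), b10]
    · rw [reg9 11 (by norm_num) (by norm_num) (by norm_num) (by norm_num), b11]
    · rw [reg9 12 (by norm_num) (by norm_num) (by norm_num) (by norm_num), b12]
    · rw [reg9 13 (by norm_num) (by norm_num) (by norm_num) (by norm_num), b13]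
    · rw [r₉ 19 (by norm_num), r₈, if_neg (by norm_num), if_neg (by norm_num),
        if_neg (by norm_num), r₇ 19 (by norm_num)]
      exact g19
    · rw [r₉ 20 (by norm_num), r₈, if_neg (by norm_num), if_neg (by norm_num),
        if_neg (by norm_num), r₇ 20 (by norm_num), r₆, if_neg (by norm_num), if_neg (by norm_num),
        if_neg (by norm_num), r₅ 20 (by norm_num), r₄ 20 (by norm_num), r₃, if_pos rfl, c1, b44]
    · have : s₉.reg 63 = s₈.reg 63 :=
        reg_den_of_keeps (c := fill (reg 4 + 1) (reg 42) (asg 42 (reg 42 + reg 1))) rfl _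
      rw [this, r₈, if_neg (by norm_num), if_neg (by norm_num), if_pos rfl, h3]
    · intro a ha
      rw [mA a (by omega), mB a (by omega) (by omega), c4 a (by omega), bm]
    · intro a ha
      rw [mA a (by omega), mB a (by omega) (by omega), c4 a (by omega), bm,
        List.getD_eq_default _ _ (by omega)]
    · intro i ψ h
      have := hpre h
      rw [mA _ (by omega), mB _ (by omega) (by omega)]
      exact (c3 i ψ h).1
    · rw [mA _ (by omega), e2 _ (by omega), m₃, Function.update_self]
    · intro i ψ h h'
      have := hpre h
      rw [mA _ (by omega), mB _ (by omega) (by omega)]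
      exact (c3 i ψ h).2 h'
    -- This cell is never written and lies beyond the input. Its content `0` is the code of the
    -- global mode, as the run property needs.
    · rw [mA _ (by omega), mB _ (by omega) (by omega), c4 _ (by omega), bm,
        List.getD_eq_default _ _ (by omega)]
    · intro i ψ h
      have := hpre h
      rw [mA _ (by omega)]
      exact e1 i ψ h
    · exact fun i hi => i1 i (by omega)
    · intro j hj
      rw [i2 _ (by omega), m₈]
      exact h1 j hj
  · have hcost : prepareCmd.cost s = headCmd.cost s + ((readFormula.cost s₁ +
      ((asg 4 (reg 62) ;; asg 20 (reg 61) ;; sto (reg 9 + reg 4) 12).cost s₂ + nextCmd.cost s₃)) +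
      ((mul (reg 4 + 1) (reg 1)).cost s₄ + (11 +
      ((fill (reg 19) (reg 42) (asg 42 (reg 42 + 1))).cost s₆ + (12 +
      (fill (reg 4 + 1) (reg 42) (asg 42 (reg 42 + reg 1))).cost s₈))))) := rfl
    have hw := cost_le_worst (c := asg 4 (reg 62) ;; asg 20 (reg 61) ;; sto (reg 9 + reg 4) 12)
      rfl s₂
    have hw' : (asg 4 (reg 62) ;; asg 20 (reg 61) ;; sto (reg 9 + reg 4) 12).worst ≤ 20 := by decide
    rw [b0] at c5
    have k1 : (reg 4 + 1 : Expr).cost = 4 := rfl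
    have k2 : (reg 1).cost = 2 := rfl
    have k3 : (reg 19).cost = 2 := rfl
    have k5 : (reg 42).cost = 2 := rfl
    rw [k1, k2] at f2
    rw [k3, k5] at h5
    rw [k1, k5] at i5
    have : (φ.size + 1) * (50 + 30 * nP) = (φ.size + 1) * 50 + (φ.size + 1) * nP * 30 := by ring
    omega

end Prepare

/-! ### Reading the automata -/

/-- An automaton together with the atomic proposition that it belongs to and a list of its
transitions. -/
structure Entry (nP nΓ nA : ℕ) where
  atom : Fin nA
  aut : MultiAutomaton (Fin nP) (Fin nΓ)
  trans : List (Fin aut.states × Fin nΓ × Fin aut.states)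

section Walk

variable {nP nΓ nA : ℕ}

/-- The numbers that stand for an entry. -/
def Entry.code (E : Entry nP nΓ nA) : List ℕ := [E.atom.val] ++ encodeAutomaton E.aut E.trans

theorem Entry.length_code (E : Entry nP nΓ nA) :
    E.code.length = 3 + nP + E.aut.states + 3 * E.trans.length := by
  have : ∀ l : List (Fin E.aut.states × Fin nΓ × Fin E.aut.states),
      (l.flatMap (fun τ => [(τ.1 : ℕ), (τ.2.1 : ℕ), (τ.2.2 : ℕ)])).length = 3 * l.length := by
    intro l
    induction l with
    | nil => rfl
    | cons a l ih =>
      rw [List.flatMap_cons, List.length_append, ih]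
      simp
      omega
  simp only [code, encodeAutomaton, List.length_append, this, List.length_ofFn, List.length_singleton]
  omega

theorem MemAt.ofFn {m : ℕ → ℕ} {a n : ℕ} {f : Fin n → ℕ} (h : MemAt m a (List.ofFn f)) (i : Fin n) :
    m (a + i) = f i := by
  rw [h.get (by simp)]
  simp

theorem MemAt.flatMap_three {α : Type} {m : ℕ → ℕ} {f g h : α → ℕ} {l : List α} :
    ∀ {a : ℕ}, MemAt m a (l.flatMap fun τ => [f τ, g τ, h τ]) → ∀ {i : ℕ} {τ : α}, l[i]? = some τ →
      m (a + 3 * i) = f τ ∧ m (a + 3 * i + 1) = g τ ∧ m (a + 3 * i + 2) = h τ := by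
  induction l with
  | nil => intro a _ i τ h; simp at h
  | cons x l ih =>
    intro a hm i τ hi
    rw [List.flatMap_cons, memAt_append] at hm
    cases i with
    | zero =>
      rw [List.getElem?_cons_zero, Option.some_inj] at hi
      subst hi
      exact ⟨hm.1.1, hm.1.2.1, hm.1.2.2.1⟩
    | succ i =>
      rw [List.getElem?_cons_succ] at hi
      have := ih hm.2 hi
      simp only [List.length_cons, List.length_nil, Nat.zero_add] at this
      rwa [show a + 3 * (i + 1) = a + 3 + 3 * i by ring]

/-- What the registers say about the entry that is read. -/
structure EntryOut (E : Entry nP nΓ nA) (o X : ℕ) (s : State) : Prop where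
  r66 : s.reg 66 = s.reg 60 + nP
  r68 : s.reg 68 = s.reg 66 + E.aut.states + 1
  le : s.reg 68 + 3 * E.trans.length ≤ X
  r62 : s.reg 62 = o
  r64 : s.reg 64 = E.atom
  r65 : s.reg 65 = E.aut.states
  r67 : s.reg 67 = E.trans.length
  init : ∀ p : Fin nP, s.mem (s.reg 60 + p) = E.aut.init p
  final : ∀ q : Fin E.aut.states, s.mem (s.reg 66 + q) = if q ∈ E.aut.final then 1 else 0
  trans : ∀ i τ, E.trans[i]? = some τ → s.mem (s.reg 68 + 3 * i) = τ.1 ∧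
    s.mem (s.reg 68 + 3 * i + 1) = τ.2.1 ∧ s.mem (s.reg 68 + 3 * i + 2) = τ.2.2

/-- Read the entry at the address in register `61`. -/
def readEntry : Cmd :=
  asg 64 (mem (reg 61)) ;; asg 65 (mem (reg 61 + 1)) ;; asg 60 (reg 61 + 2) ;;
    asg 66 (reg 60 + reg 1) ;; asg 67 (mem (reg 66 + reg 65)) ;; asg 68 (reg 66 + reg 65 + 1)

theorem readEntry_spec {s : State} {E : Entry nP nΓ nA} {X : ℕ} (h1 : s.reg 1 = nP)
    (hm : MemAt s.mem (s.reg 61) E.code)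
    (hX : s.reg 61 + E.code.length ≤ X) : EntryOut E (s.reg 62) X (readEntry.den s) ∧
      (readEntry.den s).reg 68 + 3 * E.trans.length = s.reg 61 + E.code.length := by
  have hl := E.length_code
  rw [Entry.code, memAt_append, encodeAutomaton] at hm
  obtain ⟨⟨m1, -⟩, m2⟩ := hm
  rw [List.length_singleton, memAt_append, memAt_append, memAt_append, memAt_append] at m2
  obtain ⟨⟨⟨⟨⟨m2, -⟩, m3⟩, m4⟩, ⟨m5, -⟩⟩, m6⟩ := m2
  simp only [List.length_append, List.length_ofFn, List.length_singleton] at m2 m3 m4 m5 m6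
  have e60 : (readEntry.den s).reg 60 = s.reg 61 + 2 := by
    simp [readEntry, den, State.set_reg]
  have e66 : (readEntry.den s).reg 66 = s.reg 61 + 2 + nP := by
    simp [readEntry, den, State.set_reg, h1]
  have e68 : (readEntry.den s).reg 68 = s.reg 61 + 2 + nP + E.aut.states + 1 := by
    simp [readEntry, den, State.set_reg, h1, m2]
  have em : (readEntry.den s).mem = s.mem := rfl
  refine ⟨⟨?_, ?_, ?_, ?_, ?_, ?_, ?_, ?_, ?_, ?_⟩, ?_⟩
  · rw [e66, e60]
  · rw [e68, e66]
  · rw [e68]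
    omega
  · simp [readEntry, den, State.set_reg]
  · simp [readEntry, den, State.set_reg, m1]
  · simp [readEntry, den, State.set_reg, m2]
  · rw [show s.reg 61 + 1 + (1 + nP + E.aut.states) = s.reg 61 + 2 + nP + E.aut.states by ring] at m5
    simp [readEntry, den, State.set_reg, m2, m5, h1]
  · intro p
    rw [em, e60]
    exact m3.ofFn p
  · intro q
    rw [em, e66, show s.reg 61 + 2 + nP = s.reg 61 + 1 + (1 + nP) by ring]
    exact m4.ofFn q
  · intro i τ hi
    rw [em, e68, show s.reg 61 + 2 + nP + E.aut.states + 1 =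
      s.reg 61 + 1 + (1 + nP + E.aut.states + 1) by ring]
    exact m6.flatMap_three hi
  · rw [e68, hl]
    omega

/-- Run `body` for every entry of the list at the address in register `61`; the numbers of the
states are shifted by register `62`. -/
def walk (k : Expr) (body : Cmd) : Cmd :=
  asg 69 k ;; asg 70 (mem (reg 61)) ;; asg 61 (reg 61 + 1) ;;
    for_ 71 (reg 70) (readEntry ;; body ;; (asg 61 (reg 68 + (reg 67 + (reg 67 + reg 67))) ;;
      asg 62 (reg 62 + reg 65)))

/-- The total number of states. -/
def statesOf (es : List (Entry nP nΓ nA)) : ℕ := (es.map fun E => E.aut.states).sum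

/-- The list of automata is traversed twice, once to place the atoms and once to write digits.
Memory below `X`, which contains the input, is preserved; register 63 is left to the body as a
pointer that survives from entry to entry. -/
theorem walk_spec {body : Cmd} (hb : body.above 32 = true)
    (hk : ∀ r ∈ List.range' 60 12, r ≠ 63 → body.keeps r = true) {s : State} {kind X : ℕ}
    {es : List (Entry nP nΓ nA)} (h1 : s.reg 1 = nP)
    (hm : MemAt s.mem (s.reg 61) (es.length :: es.flatMap Entry.code))
    (hX : s.reg 61 + 1 + (es.flatMap Entry.code).length ≤ X)
    (J : List (Entry nP nΓ nA) → (ℕ → ℕ) → ℕ → Prop) (K : ℕ) (h0 : J [] s.mem (s.reg 63))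
    (step : ∀ l E s', l ++ [E] <+: es → (∀ r < 32, s'.reg r = s.reg r) →
      (∀ a < X, s'.mem a = s.mem a) → s'.reg 69 = kind → EntryOut E (s.reg 62 + statesOf l) X s' →
      J l s'.mem (s'.reg 63) →
      J (l ++ [E]) (body.den s').mem ((body.den s').reg 63) ∧
        (∀ a < X, (body.den s').mem a = s'.mem a) ∧ body.cost s' ≤ K) :
    J es ((walk (num kind) body).den s).mem (((walk (num kind) body).den s).reg 63) ∧
    (∀ a < X, ((walk (num kind) body).den s).mem a = s.mem a) ∧
    ((walk (num kind) body).den s).reg 61 = s.reg 61 + 1 + (es.flatMap Entry.code).length ∧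
    ((walk (num kind) body).den s).reg 62 = s.reg 62 + statesOf es ∧
    (walk (num kind) body).cost s ≤ 20 + es.length * (K + 70) := by
  have keep : ∀ r ∈ [60, 61, 62, 64, 65, 66, 67, 68, 69], ∀ s, (body.den s).reg r = s.reg r := by
    intro r hr s
    refine reg_den_of_keeps (hk r ?_ ?_) s <;> revert r <;> decide
  set s₁ := (asg 69 (num kind) ;; asg 70 (mem (reg 61)) ;; asg 61 (reg 61 + 1)).den s with hs₁
  have e1 : ∀ r < 60, s₁.reg r = s.reg r := fun r hr => reg_den (K := 60) rfl _ hr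
  have e61 : s₁.reg 61 = s.reg 61 + 1 := by simp [hs₁, den, State.set_reg]
  have e62 : s₁.reg 62 = s.reg 62 := by simp [hs₁, den, State.set_reg]
  have e63 : s₁.reg 63 = s.reg 63 := by simp [hs₁, den, State.set_reg]
  have e69 : s₁.reg 69 = kind := by simp [hs₁, den, State.set_reg]
  have e70 : (reg 70).eval s₁ = es.length := by simp [hs₁, den, State.set_reg, hm.1]
  have hab : (for_ 71 (reg 70) (readEntry ;; body ;;
      (asg 61 (reg 68 + (reg 67 + (reg 67 + reg 67))) ;; asg 62 (reg 62 + reg 65)))).above 32 =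
      true := by
    simp [above, hb, readEntry]
  obtain ⟨⟨l, td, g1, g2, g3, g4, g5, g6, g7⟩, g8⟩ := loop_rule' (s := s₁) 32 hab
    (fun k s' => ∃ l td, es = l ++ td ∧ td.length = k ∧
      s'.reg 61 = s.reg 61 + 1 + (l.flatMap Entry.code).length ∧
      s'.reg 62 = s.reg 62 + statesOf l ∧ (∀ a < X, s'.mem a = s.mem a) ∧ s'.reg 69 = kind ∧
      J l s'.mem (s'.reg 63)) (K + 65)
    ⟨[], es, rfl, e70.symm, by rw [e61]; rfl, by rw [e62]; rfl, fun _ _ => rfl, e69,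
      by rw [e63]; exact h0⟩ (by
      rintro k s' - hr ⟨l, td, g1, g2, g3, g4, g5, g6, g7⟩
      obtain ⟨E, td, rfl⟩ := List.exists_cons_of_length_eq_add_one g2
      have g2 : td.length = k := by simpa using g2
      have hes : es = (l ++ [E]) ++ td := by simp [g1]
      have hlen : (es.flatMap Entry.code).length =
          (l.flatMap Entry.code).length + (E.code.length + (td.flatMap Entry.code).length) := by
        rw [hes]
        simp [List.flatMap_append]
      have hcode : MemAt (s'.set 71 k).mem ((s'.set 71 k).reg 61) E.code := by
        have h2 := hm.2
        rw [hes, List.append_assoc, List.flatMap_append, memAt_append, List.flatMap_append,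
          memAt_append, List.flatMap_singleton] at h2
        have : (s'.set 71 k).reg 61 = s.reg 61 + 1 + (l.flatMap Entry.code).length := g3
        rw [this]
        exact h2.2.1.congr fun b hb hb' => g5 b (by omega)
      have r1 : ∀ r < 32, (readEntry.den (s'.set 71 k)).reg r = s.reg r := fun r hr' => by
        rw [reg_den (K := 60) rfl _ (by omega), State.set_reg, if_neg (by omega), hr r hr',
          e1 r (by omega)]
      obtain ⟨k1, k2⟩ := readEntry_spec (s := s'.set 71 k) (by
        rw [State.set_reg, if_neg (by norm_num), hr 1 (by norm_num), e1 1 (by norm_num), h1]) hcode (X := X) (by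
        have : (s'.set 71 k).reg 61 = s.reg 61 + 1 + (l.flatMap Entry.code).length := g3
        omega)
      have h62 : (s'.set 71 k).reg 62 = s.reg 62 + statesOf l := g4
      rw [h62] at k1
      have h61 : (s'.set 71 k).reg 61 = s.reg 61 + 1 + (l.flatMap Entry.code).length := g3
      rw [h61] at k2
      set s₂ := readEntry.den (s'.set 71 k) with hs₂
      have m2 : s₂.mem = s'.mem := rfl
      obtain ⟨f1, f2, f3⟩ := step l E s₂ ⟨td, hes.symm⟩ r1 g5 g6 k1 g7
      set s₃ := body.den s₂ with hs₃
      have hd : (readEntry ;; body ;; (asg 61 (reg 68 + (reg 67 + (reg 67 + reg 67))) ;;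
        asg 62 (reg 62 + reg 65))).den (s'.set 71 k) =
        (asg 61 (reg 68 + (reg 67 + (reg 67 + reg 67))) ;; asg 62 (reg 62 + reg 65)).den s₃ := rfl
      rw [hd]
      refine ⟨⟨l ++ [E], td, hes, g2, ?_, ?_, fun a ha => (f2 a ha).trans (g5 a ha), ?_, ?_⟩, ?_⟩
      · have : s₃.reg 67 = s₂.reg 67 := keep 67 (by decide) s₂
        have : s₃.reg 68 = s₂.reg 68 := keep 68 (by decide) s₂
        have := k1.r67
        simp only [den, State.set_reg, eval_add, eval_reg]
        rw [List.flatMap_append, List.length_append, List.flatMap_singleton]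
        simp only [if_true, Nat.reduceEqDiff, if_false]
        omega
      · have : s₃.reg 62 = s₂.reg 62 := keep 62 (by decide) s₂
        have : s₃.reg 65 = s₂.reg 65 := keep 65 (by decide) s₂
        have := k1.r65
        have := k1.r62
        simp only [den, State.set_reg, eval_add, eval_reg]
        simp only [if_true, Nat.reduceEqDiff, if_false, statesOf,
          List.map_append, List.sum_append, List.map_singleton, List.sum_singleton]
        rw [statesOf] at *
        omega
      · have h3 := keep 69 (by decide) s₂
        have h4 : s₂.reg 69 = kind := g6
        have : ((asg 61 (reg 68 + (reg 67 + (reg 67 + reg 67))) ;;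
          asg 62 (reg 62 + reg 65)).den s₃).reg 69 = s₃.reg 69 := reg_den_of_keeps rfl _
        rw [this, h3, h4]
      · have : ((asg 61 (reg 68 + (reg 67 + (reg 67 + reg 67))) ;;
          asg 62 (reg 62 + reg 65)).den s₃).reg 63 = s₃.reg 63 := reg_den_of_keeps rfl _
        rw [this]
        exact f1
      · have hc := cost_le_worst (c := readEntry) rfl (s'.set 71 k)
        have hw : readEntry.worst ≤ 42 := by decide
        have : (readEntry ;; body ;; (asg 61 (reg 68 + (reg 67 + (reg 67 + reg 67))) ;;
          asg 62 (reg 62 + reg 65))).cost (s'.set 71 k) =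
          readEntry.cost (s'.set 71 k) + (body.cost s₂ + (13 + 7)) := rfl
        omega)
  obtain rfl := List.length_eq_zero_iff.1 g2
  rw [List.append_nil] at g1
  subst g1
  refine ⟨g7, g5, g3, g4, ?_⟩
  rw [e70] at g8
  have : (walk (num kind) body).cost s = 3 + (5 + (6 +
    (for_ 71 (reg 70) (readEntry ;; body ;; (asg 61 (reg 68 + (reg 67 + (reg 67 + reg 67))) ;;
      asg 62 (reg 62 + reg 65)))).cost s₁)) := rfl
  have e : (reg 70).cost = 2 := rfl
  have : es.length * (K + 65 + 5) = es.length * (K + 70) := by ring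
  omega

end Walk

section Places

variable {nP nΓ nA : ℕ}

/-- Note the initial states of an automaton and the operators that refer to it. -/
def placeBody : Cmd :=
  for_ 72 (reg 1) (sto (reg 63 + reg 72) (reg 62 + mem (reg 60 + reg 72))) ;;
    for_ 72 (reg 4) (ite (eqE (mem (reg 9 + reg 72)) (reg 69))
      (ite (eqE (mem (reg 10 + reg 72)) (reg 64)) (sto (reg 12 + reg 72) (reg 63)) skip) skip) ;;
    asg 63 (reg 63 + reg 1)

/-- The initial states of an automaton may be numbered arbitrarily. Hence each automaton gets an
array with the digit of the initial state of every location, and the occurrences of its literal in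
the formula are redirected to this array. -/
theorem placeBody_spec {s : State} {E : Entry nP nΓ nA} {o X F : ℕ} (h : EntryOut E o X s)
    (h1 : s.reg 1 = nP) (h4 : s.reg 4 = F) (h9 : s.reg 9 + F ≤ s.reg 12)
    (h10 : s.reg 10 + F ≤ s.reg 12) (hX : X ≤ s.reg 12) (h12 : s.reg 12 + F ≤ s.reg 63) :
    (∀ p : Fin nP, (placeBody.den s).mem (s.reg 63 + p) = o + E.aut.init p) ∧
    (∀ i < F, (placeBody.den s).mem (s.reg 12 + i) =
      if s.mem (s.reg 9 + i) = s.reg 69 ∧ s.mem (s.reg 10 + i) = E.atom then s.reg 63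
      else s.mem (s.reg 12 + i)) ∧
    (∀ a, (a < s.reg 12 ∨ s.reg 12 + F ≤ a) → (a < s.reg 63 ∨ s.reg 63 + nP ≤ a) →
      (placeBody.den s).mem a = s.mem a) ∧
    (placeBody.den s).reg 63 = s.reg 63 + nP ∧
    placeBody.cost s ≤ 20 + 20 * nP + 60 * F := by
  have r66 := h.r66
  have r68 := h.r68
  have hle := h.le
  set c₁ : Cmd := for_ 72 (reg 1) (sto (reg 63 + reg 72) (reg 62 + mem (reg 60 + reg 72))) with hc₁
  set c₂ : Cmd := for_ 72 (reg 4) (ite (eqE (mem (reg 9 + reg 72)) (reg 69))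
      (ite (eqE (mem (reg 10 + reg 72)) (reg 64)) (sto (reg 12 + reg 72) (reg 63)) skip) skip)
    with hc₂
  obtain ⟨⟨a1, a2⟩, a3⟩ := loop_rule' (s := s) (i := 72) (e := reg 1)
    (c := sto (reg 63 + reg 72) (reg 62 + mem (reg 60 + reg 72))) 72 rfl
    (fun k s' => (∀ p : Fin nP, k ≤ p → s'.mem (s.reg 63 + p) = o + E.aut.init p) ∧
      ∀ a, (a < s.reg 63 ∨ s.reg 63 + nP ≤ a) → s'.mem a = s.mem a) 15
    ⟨fun p hp => by
      rw [eval_reg, h1] at hp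
      omega, fun _ _ => rfl⟩ (by
      rintro k s' hk hr ⟨a1, a2⟩
      rw [eval_reg, h1] at hk
      have e63 : (reg 63 + reg 72 : Expr).eval (s'.set 72 k) = s.reg 63 + k := by
        rw [eval_add, eval_reg, eval_reg, State.set_reg, State.set_reg, if_neg (by norm_num),
          if_pos rfl, hr 63 (by norm_num)]
      have ev : (reg 62 + mem (reg 60 + reg 72) : Expr).eval (s'.set 72 k) =
          o + E.aut.init ⟨k, hk⟩ := by
        have := h.init ⟨k, hk⟩
        simp only at this
        rw [eval_add, eval_reg, eval_mem, eval_add, eval_reg, eval_reg, State.set_reg,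
          State.set_reg, State.set_reg, if_neg (by norm_num), if_neg (by norm_num), if_pos rfl,
          hr 62 (by norm_num), hr 60 (by norm_num), State.set_mem, a2 _ (by omega), this, h.r62]
      refine ⟨⟨fun p hp => ?_, fun a ha => ?_⟩, le_refl _⟩
      · simp only [den, e63, ev]
        rcases eq_or_ne (p : ℕ) k with hpk | hpk
        · rw [hpk, Function.update_self]
          congr 3
          exact Fin.ext hpk.symm
        · rw [Function.update_of_ne (by omega)]
          exact a1 p (by omega)
      · simp only [den, e63, ev]
        rw [Function.update_of_ne (by omega)]
        exact a2 a ha)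
  rw [← hc₁] at a1 a2 a3
  set s₁ := c₁.den s with hs₁
  have r₁ : ∀ r < 72, s₁.reg r = s.reg r := fun r hr => reg_den (K := 72) rfl _ hr
  rw [eval_reg, h1] at a3
  obtain ⟨⟨b1, b2⟩, b3⟩ := loop_rule' (s := s₁) (i := 72) (e := reg 4)
    (c := ite (eqE (mem (reg 9 + reg 72)) (reg 69))
      (ite (eqE (mem (reg 10 + reg 72)) (reg 64)) (sto (reg 12 + reg 72) (reg 63)) skip) skip) 72 rfl
    (fun k s' => (∀ i < F, s'.mem (s.reg 12 + i) =
        if k ≤ i ∧ s.mem (s.reg 9 + i) = s.reg 69 ∧ s.mem (s.reg 10 + i) = E.atom then s.reg 63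
        else s.mem (s.reg 12 + i)) ∧
      ∀ a, (a < s.reg 12 ∨ s.reg 12 + F ≤ a) → s'.mem a = s₁.mem a) 55
    ⟨fun i hi => by
      rw [eval_reg, r₁ 4 (by norm_num), h4, if_neg (by omega), a2 _ (by omega)], fun _ _ => rfl⟩ (by
      rintro k s' hk hr ⟨g1, g2⟩
      rw [eval_reg, r₁ 4 (by norm_num), h4] at hk
      have hr' : ∀ r < 72, (s'.set 72 k).reg r = s.reg r := fun r hr' => by
        rw [State.set_reg, if_neg (by omega), hr r hr', r₁ r hr']
      have e72 : (s'.set 72 k).reg 72 = k := by rw [State.set_reg, if_pos rfl]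
      have e9 : (mem (reg 9 + reg 72) : Expr).eval (s'.set 72 k) = s.mem (s.reg 9 + k) := by
        rw [eval_mem, eval_add, eval_reg, eval_reg, hr' 9 (by norm_num), e72, State.set_mem,
          g2 _ (by omega), a2 _ (by omega)]
      have e10 : (mem (reg 10 + reg 72) : Expr).eval (s'.set 72 k) = s.mem (s.reg 10 + k) := by
        rw [eval_mem, eval_add, eval_reg, eval_reg, hr' 10 (by norm_num), e72, State.set_mem,
          g2 _ (by omega), a2 _ (by omega)]
      have e69 : (reg 69).eval (s'.set 72 k) = s.reg 69 := hr' 69 (by norm_num)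
      have e64 : (reg 64).eval (s'.set 72 k) = E.atom := (hr' 64 (by norm_num)).trans h.r64
      have e12 : (reg 12 + reg 72 : Expr).eval (s'.set 72 k) = s.reg 12 + k := by
        rw [eval_add, eval_reg, eval_reg, hr' 12 (by norm_num), e72]
      refine ⟨?_, (cost_le_worst rfl _).trans (by decide)⟩
      have no : ¬ (s.mem (s.reg 9 + k) = s.reg 69 ∧ s.mem (s.reg 10 + k) = E.atom) →
          (∀ i < F, (s'.set 72 k).mem (s.reg 12 + i) =
        if k ≤ i ∧ s.mem (s.reg 9 + i) = s.reg 69 ∧ s.mem (s.reg 10 + i) = E.atom then s.reg 63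
        else s.mem (s.reg 12 + i)) ∧
          ∀ a, (a < s.reg 12 ∨ s.reg 12 + F ≤ a) → (s'.set 72 k).mem a = s₁.mem a := by
        refine fun hn => ⟨fun i hi => ?_, g2⟩
        rw [State.set_mem, g1 i hi]
        refine if_congr ?_ rfl rfl
        refine ⟨fun h => ⟨by omega, h.2⟩, fun h => ⟨?_, h.2⟩⟩
        rcases eq_or_ne i k with rfl | hne
        · exact absurd h.2 hn
        · omega
      rw [den]
      split_ifs with hA
      · rw [eval_eqE, e9, e69] at hA
        rw [den]
        split_ifs with hB
        · rw [eval_eqE, e10, e64] at hB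
          rw [den, e12, eval_reg, hr' 63 (by norm_num), State.set_mem]
          refine ⟨fun i hi => ?_, fun a ha => ?_⟩
          · simp only
            rcases eq_or_ne i k with rfl | hne
            · rw [Function.update_self, if_pos ⟨le_rfl, hA, hB⟩]
            · rw [Function.update_of_ne (by omega), g1 i hi]
              refine if_congr ?_ rfl rfl
              exact ⟨fun h => ⟨by omega, h.2⟩, fun h => ⟨by omega, h.2⟩⟩
          · simp only
            rw [Function.update_of_ne (by omega)]
            exact g2 a ha
        · rw [eval_eqE, e10, e64] at hB
          exact no fun h => hB h.2
      · rw [eval_eqE, e9, e69] at hA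
        exact no fun h => hA h.1)
  rw [← hc₂] at b1 b2 b3
  set s₂ := c₂.den s₁ with hs₂
  rw [eval_reg, r₁ 4 (by norm_num), h4] at b3
  have r₂ : ∀ r < 72, s₂.reg r = s₁.reg r := fun r hr => reg_den (K := 72) rfl _ hr
  have hd : placeBody.den s = s₂.set 63 ((reg 63 + reg 1).eval s₂) := rfl
  rw [hd, State.set_mem]
  refine ⟨fun p => ?_, fun i hi => ?_, fun a ha ha' => ?_, ?_, ?_⟩
  · rw [b2 _ (by omega)]
    exact a1 p (Nat.zero_le _)
  · rw [b1 i hi]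
    simp
  · rw [b2 a ha, a2 a ha']
  · rw [State.set_reg, if_pos rfl, eval_add, eval_reg, eval_reg, r₂ 63 (by norm_num),
      r₂ 1 (by norm_num), r₁ 63 (by norm_num), r₁ 1 (by norm_num), h1]
  · have : placeBody.cost s = c₁.cost s + (c₂.cost s₁ + 7) := rfl
    have e : (reg 1).cost = 2 := rfl
    have e' : (reg 4).cost = 2 := rfl
    omega

/-- The entries of a list refer to the operator number `i`, and the last of them gives its
places. -/
def Placed (m : ℕ → ℕ) (IP F o lo hi : ℕ) (refers : ℕ → Entry nP nΓ nA → Prop)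
    (l : List (Entry nP nΓ nA)) (m' : ℕ → ℕ) : Prop :=
  ∀ i < F, (m' (IP + i) = m (IP + i) ∧ ∀ E ∈ l, ¬ refers i E) ∨
    ∃ l₁ E l₂, l = l₁ ++ E :: l₂ ∧ refers i E ∧ lo ≤ m' (IP + i) ∧ m' (IP + i) + nP ≤ hi ∧
      ∀ p : Fin nP, m' (m' (IP + i) + p) = o + statesOf l₁ + E.aut.init p

/-- Each entry uses a fresh block of `nP` cells. A later entry for the same literal may redirect an
occurrence once more, but earlier blocks are not overwritten, so what an occurrence points to
remains valid. -/
theorem walk_placeBody {s : State} {F kind X : ℕ} {es : List (Entry nP nΓ nA)} (h1 : s.reg 1 = nP)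
    (hm : MemAt s.mem (s.reg 61) (es.length :: es.flatMap Entry.code))
    (hX : s.reg 61 + 1 + (es.flatMap Entry.code).length ≤ X)
    (h4 : s.reg 4 = F) (hX9 : X ≤ s.reg 9) (h9 : s.reg 9 + F ≤ s.reg 12)
    (h10 : s.reg 10 + F ≤ s.reg 12) (h12 : s.reg 12 + F ≤ s.reg 63) :
    let s' := (walk (num kind) placeBody).den s
    Placed s.mem (s.reg 12) F (s.reg 62) (s.reg 63) (s.reg 63 + es.length * nP)
      (fun i E => s.mem (s.reg 9 + i) = kind ∧ s.mem (s.reg 10 + i) = E.atom) es s'.mem ∧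
    (∀ a, (a < s.reg 12 ∨ s.reg 12 + F ≤ a) → (a < s.reg 63 ∨ s.reg 63 + es.length * nP ≤ a) →
      s'.mem a = s.mem a) ∧
    s'.reg 61 = s.reg 61 + 1 + (es.flatMap Entry.code).length ∧
    s'.reg 62 = s.reg 62 + statesOf es ∧ s'.reg 63 = s.reg 63 + es.length * nP ∧
    (walk (num kind) placeBody).cost s ≤ 20 + es.length * (90 + 20 * nP + 60 * F) := by
  intro s'
  obtain ⟨⟨h2, h3, h5⟩, -, h6, h7, h8⟩ := walk_spec (body := placeBody) rfl (by decide)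
    (kind := kind) h1 hm hX
    (fun l m' pp => pp = s.reg 63 + l.length * nP ∧
      Placed s.mem (s.reg 12) F (s.reg 62) (s.reg 63) pp
        (fun i E => s.mem (s.reg 9 + i) = kind ∧ s.mem (s.reg 10 + i) = E.atom) l m' ∧
      ∀ a, (a < s.reg 12 ∨ s.reg 12 + F ≤ a) → (a < s.reg 63 ∨ pp ≤ a) → m' a = s.mem a)
    (20 + 20 * nP + 60 * F)
    ⟨by simp, fun i _ => .inl ⟨rfl, by simp⟩, fun _ _ _ => rfl⟩ (by
      rintro l E s₁ hl hr hlow h69 hE ⟨g1, g2, g3⟩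
      have e1 := hr 1 (by norm_num)
      have e4 := hr 4 (by norm_num)
      have e9 := hr 9 (by norm_num)
      have e10 := hr 10 (by norm_num)
      have e12 := hr 12 (by norm_num)
      obtain ⟨k1, k2, k3, k4, k5⟩ := placeBody_spec (F := F) hE (by omega) (by omega) (by omega)
        (by omega) (by omega) (by omega)
      rw [e9, e10, e12, h69] at k2
      rw [e12] at k3
      have hlen : (l ++ [E]).length * nP = l.length * nP + nP := by
        rw [List.length_append, List.length_singleton]
        ring
      refine ⟨⟨by omega, fun i hi => ?_, fun a ha ha' => ?_⟩, fun a ha => k3 a (by omega) (by omega),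
        k5⟩
      · have k := k2 i hi
        rw [g3 (s.reg 9 + i) (by omega) (by omega), g3 (s.reg 10 + i) (by omega) (by omega)] at k
        simp only
        rw [k4]
        split_ifs at k with hmatch
        · refine .inr ⟨l, E, [], rfl, hmatch, ?_, ?_, fun p => ?_⟩
          · rw [k, g1]
            omega
          · rw [k]
          · rw [k, k1]
        · rw [k]
          rcases g2 i hi with ⟨f1, f2⟩ | ⟨l₁, E', l₂, f1, f2, f3, f4, f5⟩
          · refine .inl ⟨f1, fun E' hE' => ?_⟩
            rcases List.mem_append.1 hE' with hE' | hE'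
            · exact f2 E' hE'
            · rw [List.mem_singleton.1 hE']
              exact hmatch
          · refine .inr ⟨l₁, E', l₂ ++ [E], by simp [f1], f2, f3, by omega, fun p => ?_⟩
            rw [k3 _ (by omega) (by omega)]
            exact f5 p
      · rw [k3 a ha (by omega), g3 a ha (by omega)])
  exact ⟨h2 ▸ h3, fun a ha ha' => h5 a ha (h2 ▸ ha'), h6, h7, h2, h8.trans (le_of_eq (by ring))⟩

end Places

/-! ### Powers of two, digits and the rows of the table -/

section Tables

variable {s : State}

/-- Without division a digit is found by truncated subtraction from the residue modulo `2 ^ (j +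
1)`, and this residue can be counted along as `T` increases. -/
theorem testBit_eq_sub (T j : ℕ) : (T.testBit j).toNat = 1 - (2 ^ j - T % 2 ^ (j + 1)) := by
  have h1 := Nat.mod_lt T (Nat.two_pow_pos (j + 1))
  have h2 : T.testBit j = (T % 2 ^ (j + 1)).testBit j := by
    rw [Nat.testBit_mod_two_pow]
    simp
  rw [h2]
  rw [pow_succ] at h1 ⊢
  by_cases h : 2 ^ j ≤ T % (2 ^ j * 2)
  · rw [Nat.testBit_eq_decide_div_mod_eq, Nat.div_eq_of_lt_le (k := 1) (by omega) (by omega),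
      Nat.sub_eq_zero_of_le h]
    rfl
  · rw [Nat.testBit_lt_two_pow (by omega)]
    have := Nat.two_pow_pos j
    simp
    omega

theorem succ_mod (T n : ℕ) (hn : 1 < n) :
    (T + 1) % n = if n - (T % n + 1) ≠ 0 then T % n + 1 else 0 := by
  have h1 := Nat.mod_lt T (show 0 < n by omega)
  rw [Nat.add_mod, Nat.mod_eq_of_lt hn]
  split_ifs with h
  · exact Nat.mod_eq_of_lt (by omega)
  · rw [show T % n + 1 = n by omega, Nat.mod_self]

/-- Write the digits of the numbers below `2 ^ N`. -/
def digitsCmd : Cmd :=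
  for_ 38 (reg 5) ((asg 41 (mem (reg 14 + reg 38)) ;; asg 37 (mem (reg 15 + reg 38)) ;; asg 42 0) ;;
    fill (reg 6) (1 - (reg 37 - reg 42))
      (asg 42 (reg 42 + 1) ;; ite (reg 37 + reg 37 - reg 42) skip (asg 42 0)))

theorem digitsCmd_spec {N B : ℕ} (h5 : s.reg 5 = N) (h6 : s.reg 6 = 2 ^ N)
    (h14 : ∀ j < N, s.mem (s.reg 14 + j) = B + j * 2 ^ N)
    (h15 : ∀ j < N, s.mem (s.reg 15 + j) = 2 ^ j) (hB : s.reg 14 + N ≤ B) (hB' : s.reg 15 + N ≤ B) :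
    (∀ j < N, ∀ T < 2 ^ N, (digitsCmd.den s).mem (B + j * 2 ^ N + T) = (T.testBit j).toNat) ∧
    (∀ a, a < B ∨ B + N * 2 ^ N ≤ a → (digitsCmd.den s).mem a = s.mem a) ∧
    digitsCmd.cost s ≤ 3 + N * (40 + 2 ^ N * 40) := by
  obtain ⟨⟨a1, a2⟩, a3⟩ := loop_rule' (s := s) (i := 38) (e := reg 5)
    (c := (asg 41 (mem (reg 14 + reg 38)) ;; asg 37 (mem (reg 15 + reg 38)) ;; asg 42 0) ;;
    fill (reg 6) (1 - (reg 37 - reg 42))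
      (asg 42 (reg 42 + 1) ;; ite (reg 37 + reg 37 - reg 42) skip (asg 42 0))) 37 rfl
    (fun k s' => (∀ j < N, k ≤ j → ∀ T < 2 ^ N, s'.mem (B + j * 2 ^ N + T) = (T.testBit j).toNat) ∧
      ∀ a, a < B ∨ B + N * 2 ^ N ≤ a → s'.mem a = s.mem a) (30 + 2 ^ N * 40)
    ⟨fun j hj hj' => by
      rw [eval_reg, h5] at hj'
      omega, fun _ _ => rfl⟩ (by
      rintro k s' hk hr ⟨a1, a2⟩
      rw [eval_reg, h5] at hk
      set c : Cmd := asg 41 (mem (reg 14 + reg 38)) ;; asg 37 (mem (reg 15 + reg 38)) ;; asg 42 0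
        with hc
      have hr' : ∀ r < 37, (s'.set 38 k).reg r = s.reg r := fun r hr' => by
        rw [State.set_reg, if_neg (by omega), hr r hr']
      have e38 : (s'.set 38 k).reg 38 = k := by rw [State.set_reg, if_pos rfl]
      have m14 : s'.mem (s.reg 14 + k) = B + k * 2 ^ N := by rw [a2 _ (by omega), h14 k hk]
      have m15 : s'.mem (s.reg 15 + k) = 2 ^ k := by rw [a2 _ (by omega), h15 k hk]
      set s₁ := c.den (s'.set 38 k) with hs₁
      have e41 : s₁.reg 41 = B + k * 2 ^ N := by
        rw [← m14, ← hr' 14 (by norm_num)]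
        simp [hs₁, hc, den, State.set_reg]
      have e37 : s₁.reg 37 = 2 ^ k := by
        rw [← m15, ← hr' 15 (by norm_num)]
        simp [hs₁, hc, den, State.set_reg]
      have e42 : s₁.reg 42 = 0 := by simp [hs₁, hc, den, State.set_reg]
      have e6 : (reg 6).eval s₁ = 2 ^ N := by
        rw [eval_reg, hs₁, reg_den (K := 37) rfl _ (by norm_num), hr' 6 (by norm_num), h6]
      have em : s₁.mem = s'.mem := rfl
      obtain ⟨f1, f2, -, -, f5⟩ := fill_spec (s := s₁) (n := reg 6) (val := 1 - (reg 37 - reg 42))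
        (upd := asg 42 (reg 42 + 1) ;; ite (reg 37 + reg 37 - reg 42) skip (asg 42 0)) rfl rfl
        -- Register 42 holds the residue of the current column; it is reset to zero when it reaches
        -- the modulus.
        (fun T => (T.testBit k).toNat) (fun T => T % 2 ^ (k + 1)) 18 (by rw [e42, Nat.zero_mod])
        (fun T s₂ _ hr₂ h42 => by
          have h37 : s₂.reg 37 = 2 ^ k := (hr₂ 37 (by norm_num)).trans e37
          refine ⟨?_, ?_, (cost_le_worst rfl _).trans (by decide)⟩
          · rw [eval_sub, eval_sub, eval_one, eval_reg, eval_reg, h37, h42, testBit_eq_sub]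
          · have hp := Nat.two_pow_pos k
            have h2 : 2 ^ k + 2 ^ k = 2 ^ (k + 1) := by
              rw [pow_succ]
              ring
            rw [succ_mod T _ (by omega), ← h2]
            rw [← h2] at h42
            simp only [den, State.set_reg, eval_add, eval_sub, eval_reg, eval_one, if_true, h42,
              Nat.reduceEqDiff, if_false, h37]
            split_ifs <;> simp [State.set_reg])
      rw [e41, e6] at f1
      rw [e41, e6] at f2
      rw [e6] at f5
      have hd : ∀ c' : Cmd, (c ;; c').den (s'.set 38 k) = c'.den s₁ := fun _ => rfl
      rw [hd]
      have hmul : k * 2 ^ N + 2 ^ N ≤ N * 2 ^ N := by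
        rw [← Nat.succ_mul]
        exact Nat.mul_le_mul_right _ hk
      refine ⟨⟨fun j hj hkj T hT => ?_, fun a ha => ?_⟩, ?_⟩
      · rcases eq_or_ne j k with rfl | hne
        · exact f1 T hT
        · have : k * 2 ^ N + 2 ^ N ≤ j * 2 ^ N := by
            rw [← Nat.succ_mul]
            exact Nat.mul_le_mul_right _ (by omega)
          rw [f2 _ (by omega), em]
          exact a1 j hj (by omega) T hT
      · rw [f2 _ (by omega), em, a2 a ha]
      · have hw := cost_le_worst (c := c) rfl (s'.set 38 k)
        have hw' : c.worst ≤ 20 := by decide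
        have k1 : (reg 6).cost = 2 := rfl
        have k2 : (1 - (reg 37 - reg 42) : Expr).cost = 7 := rfl
        rw [k1, k2] at f5
        have hcost : ∀ c' : Cmd, (c ;; c').cost (s'.set 38 k) = c.cost (s'.set 38 k) + c'.cost s₁ :=
          fun _ => rfl
        rw [hcost]
        omega)
  refine ⟨fun j hj T hT => a1 j hj (Nat.zero_le _) T hT, a2, a3.trans ?_⟩
  rw [eval_reg, h5]
  have k1 : (reg 5).cost = 2 := rfl
  rw [k1]
  exact Nat.add_le_add_left (Nat.mul_le_mul_left _ (by omega)) _

/-- Build the tables that depend on the number of digits only. -/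
def tablesCmd : Cmd :=
  (asg 8 (reg 61) ;; asg 5 (reg 62) ;; asg 15 (reg 63) ;; asg 14 (reg 15 + reg 5) ;;
    asg 17 (reg 14 + reg 5) ;; asg 18 (reg 17 + (reg 2 + 1)) ;; asg 16 (reg 18 + (reg 2 + 1)) ;;
    asg 41 (reg 15) ;; asg 42 1) ;;
  fill (reg 5) (reg 42) (asg 42 (reg 42 + reg 42)) ;;
  (asg 6 (reg 42) ;; asg 41 (reg 14) ;; asg 42 (reg 16)) ;;
  fill (reg 5 + (reg 2 + reg 2 + 2)) (reg 42) (asg 42 (reg 42 + reg 6)) ;;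
  digitsCmd ;; mul (reg 2 + reg 2 + 2) (reg 5) ;; asg 38 (reg 42) ;; mul (reg 38) (reg 6) ;;
  asg 7 (reg 42 + 1)

/-- What the tables are. -/
structure Tables (G N : ℕ) (s s' : State) : Prop where
  low : ∀ r < 32, r ∉ [5, 6, 7, 8, 14, 15, 16, 17, 18] → s'.reg r = s.reg r
  r5 : s'.reg 5 = N
  r6 : s'.reg 6 = 2 ^ N
  r7 : s'.reg 7 = (2 * G + 2) * N * 2 ^ N + 1
  r8 : s'.reg 8 = s.reg 61
  r14 : s'.reg 14 = s.reg 63 + N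
  r15 : s'.reg 15 = s.reg 63
  r16 : s'.reg 16 = s.reg 63 + N + (N + (2 * G + 2))
  r17 : s'.reg 17 = s.reg 63 + N + N
  r18 : s'.reg 18 = s.reg 63 + N + N + (G + 1)
  pow : ∀ j < N, s'.mem (s.reg 63 + j) = 2 ^ j
  row : ∀ r < N + (2 * G + 2), s'.mem (s.reg 63 + N + r) = s'.reg 16 + r * 2 ^ N
  digit : ∀ j < N, ∀ T < 2 ^ N, s'.mem (s'.reg 16 + j * 2 ^ N + T) = (T.testBit j).toNat
  mem : ∀ a, a < s.reg 63 ∨ s'.reg 16 + N * 2 ^ N ≤ a → s'.mem a = s.mem a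

-- Powers of two arise by doubling and row addresses by repeated addition of `2 ^ N`. True products
-- are needed only for the number of sweeps; they are computed by repeated addition, with the large
-- factor `2 ^ N` as the summand and not as the number of iterations.
set_option maxHeartbeats 1000000 in
theorem tablesCmd_spec {G N : ℕ} (h2 : s.reg 2 = G) (h62 : s.reg 62 = N) :
    Tables G N s (tablesCmd.den s) ∧
    tablesCmd.cost s ≤ 400 + 100 * G + N * (100 + 2 ^ N * 40) + 15 * ((2 * G + 2) * N) := by
  set c₁ : Cmd := asg 8 (reg 61) ;; asg 5 (reg 62) ;; asg 15 (reg 63) ;; asg 14 (reg 15 + reg 5) ;;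
    asg 17 (reg 14 + reg 5) ;; asg 18 (reg 17 + (reg 2 + 1)) ;; asg 16 (reg 18 + (reg 2 + 1)) ;;
    asg 41 (reg 15) ;; asg 42 1 with hc₁
  set s₁ := c₁.den s with hs₁
  have a5 : s₁.reg 5 = N := by simp [hs₁, hc₁, den, State.set_reg, h62]
  have a2 : s₁.reg 2 = G := by simp [hs₁, hc₁, den, State.set_reg, h2]
  have a8 : s₁.reg 8 = s.reg 61 := by simp [hs₁, hc₁, den, State.set_reg]
  have a15 : s₁.reg 15 = s.reg 63 := by simp [hs₁, hc₁, den, State.set_reg]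
  have a14 : s₁.reg 14 = s.reg 63 + N := by simp [hs₁, hc₁, den, State.set_reg, h62]
  have a17 : s₁.reg 17 = s.reg 63 + N + N := by simp [hs₁, hc₁, den, State.set_reg, h62]
  have a18 : s₁.reg 18 = s.reg 63 + N + N + (G + 1) := by
    simp [hs₁, hc₁, den, State.set_reg, h62, h2]
  have a16 : s₁.reg 16 = s.reg 63 + N + (N + (2 * G + 2)) := by
    simp [hs₁, hc₁, den, State.set_reg, h62, h2]
    ring
  have a41 : s₁.reg 41 = s.reg 63 := by simp [hs₁, hc₁, den, State.set_reg]
  have a42 : s₁.reg 42 = 1 := by simp [hs₁, hc₁, den, State.set_reg]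
  have am : s₁.mem = s.mem := rfl
  have alow : ∀ r < 32, r ∉ [5, 6, 7, 8, 14, 15, 16, 17, 18] → s₁.reg r = s.reg r := by
    intro r hr hl
    simp only [List.mem_cons, not_or] at hl
    simp only [hs₁, hc₁, den, State.set_reg]
    rw [if_neg (by omega), if_neg (by omega), if_neg (by omega), if_neg (by omega),
      if_neg (by omega), if_neg (by omega), if_neg (by omega), if_neg (by omega), if_neg (by omega)]
  have hd₁ : ∀ c : Cmd, (c₁ ;; c).den s = c.den s₁ := fun _ => rfl
  have hc₁' : ∀ c : Cmd, (c₁ ;; c).cost s = c₁.cost s + c.cost s₁ := fun _ => rfl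
  have hw₁ := cost_le_worst (c := c₁) rfl s
  have hw₁' : c₁.worst ≤ 70 := by decide
  rw [tablesCmd, hd₁, hc₁']
  clear_value s₁
  set c₂ : Cmd := fill (reg 5) (reg 42) (asg 42 (reg 42 + reg 42)) with hc₂
  obtain ⟨b1, b2, -, b4, b5⟩ := fill_spec (s := s₁) (n := reg 5) (val := reg 42)
    (upd := asg 42 (reg 42 + reg 42)) rfl rfl (fun j => 2 ^ j) (fun j => 2 ^ j) 7 a42
    (fun j s' _ _ h => ⟨h, by
      simp only [den, State.set_reg, if_true, eval_add, eval_reg, h, pow_succ]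
      ring, le_refl _⟩)
  rw [← hc₂] at b1 b2 b4 b5
  rw [eval_reg, a5] at b1 b2 b4 b5
  rw [a41] at b1 b2
  set s₂ := c₂.den s₁ with hs₂
  have r₂ : ∀ r < 40, s₂.reg r = s₁.reg r := fun r hr => reg_den (K := 40) rfl _ hr
  have hd₂ : ∀ c : Cmd, (c₂ ;; c).den s₁ = c.den s₂ := fun _ => rfl
  have hc₂' : ∀ c : Cmd, (c₂ ;; c).cost s₁ = c₂.cost s₁ + c.cost s₂ := fun _ => rfl
  rw [hd₂, hc₂']
  clear_value s₂
  set c₃ : Cmd := asg 6 (reg 42) ;; asg 41 (reg 14) ;; asg 42 (reg 16) with hc₃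
  set s₃ := c₃.den s₂ with hs₃
  have r₃ : ∀ r < 40, s₃.reg r = if r = 6 then 2 ^ N else s₁.reg r := by
    intro r hr
    have : s₃.reg r = if r = 42 then s₂.reg 16 else if r = 41 then s₂.reg 14 else if r = 6 then
        s₂.reg 42 else s₂.reg r := by
      simp [hs₃, hc₃, den, State.set_reg]
    rw [this, if_neg (by omega), if_neg (by omega), b4, r₂ r hr]
  have c41 : s₃.reg 41 = s.reg 63 + N := by
    rw [← a14, ← r₂ 14 (by norm_num)]
    simp [hs₃, hc₃, den, State.set_reg]
  have c42 : s₃.reg 42 = s.reg 63 + N + (N + (2 * G + 2)) := by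
    rw [← a16, ← r₂ 16 (by norm_num)]
    simp [hs₃, hc₃, den, State.set_reg]
  have m₃ : s₃.mem = s₂.mem := rfl
  have hd₃ : ∀ c : Cmd, (c₃ ;; c).den s₂ = c.den s₃ := fun _ => rfl
  have hc₃' : ∀ c : Cmd, (c₃ ;; c).cost s₂ = 12 + c.cost s₃ := fun _ => rfl
  rw [hd₃, hc₃']
  clear_value s₃
  set c₄ : Cmd := fill (reg 5 + (reg 2 + reg 2 + 2)) (reg 42) (asg 42 (reg 42 + reg 6)) with hc₄
  have en : (reg 5 + (reg 2 + reg 2 + 2) : Expr).eval s₃ = N + (2 * G + 2) := by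
    simp only [eval_add, eval_reg, eval_ofNat]
    rw [r₃ 5 (by norm_num), r₃ 2 (by norm_num), if_neg (by norm_num), if_neg (by norm_num), a5, a2]
    ring
  obtain ⟨d1, d2, -, -, d5⟩ := fill_spec (s := s₃) (n := reg 5 + (reg 2 + reg 2 + 2)) (val := reg 42)
    (upd := asg 42 (reg 42 + reg 6)) rfl rfl
    (fun j => s.reg 63 + N + (N + (2 * G + 2)) + j * 2 ^ N)
    (fun j => s.reg 63 + N + (N + (2 * G + 2)) + j * 2 ^ N) 7 (by rw [c42]; ring)
    (fun j s' _ hr h => ⟨h, by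
      have : s'.reg 6 = 2 ^ N := by rw [hr 6 (by norm_num), r₃ 6 (by norm_num), if_pos rfl]
      simp only [den, State.set_reg, if_true, eval_add, eval_reg, h, this]
      ring, le_refl _⟩)
  rw [← hc₄] at d1 d2 d5
  rw [en] at d1 d2 d5
  rw [c41] at d1 d2
  set s₄ := c₄.den s₃ with hs₄
  have r₄ : ∀ r < 40, s₄.reg r = s₃.reg r := fun r hr => reg_den (K := 40) rfl _ hr
  have hd₄ : ∀ c : Cmd, (c₄ ;; c).den s₃ = c.den s₄ := fun _ => rfl
  have hc₄' : ∀ c : Cmd, (c₄ ;; c).cost s₃ = c₄.cost s₃ + c.cost s₄ := fun _ => rfl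
  rw [hd₄, hc₄']
  clear_value s₄
  have f14 : s₄.reg 14 = s.reg 63 + N := by
    rw [r₄ 14 (by norm_num), r₃ 14 (by norm_num), if_neg (by norm_num), a14]
  have f15 : s₄.reg 15 = s.reg 63 := by
    rw [r₄ 15 (by norm_num), r₃ 15 (by norm_num), if_neg (by norm_num), a15]
  have f5 : s₄.reg 5 = N := by
    rw [r₄ 5 (by norm_num), r₃ 5 (by norm_num), if_neg (by norm_num), a5]
  have f6 : s₄.reg 6 = 2 ^ N := by rw [r₄ 6 (by norm_num), r₃ 6 (by norm_num), if_pos rfl]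
  have fpow : ∀ j < N, s₄.mem (s.reg 63 + j) = 2 ^ j := fun j hj => by
    rw [d2 _ (by omega), m₃, b1 j hj]
  obtain ⟨g1, g2, g3⟩ := digitsCmd_spec (s := s₄) (N := N)
    (B := s.reg 63 + N + (N + (2 * G + 2))) f5 f6 (fun j hj => by rw [f14, d1 j (by omega)])
    (fun j hj => by rw [f15, fpow j hj]) (by omega) (by omega)
  set s₅ := digitsCmd.den s₄ with hs₅
  have r₅ : ∀ r < 37, s₅.reg r = s₄.reg r := fun r hr => reg_den (K := 37) rfl _ hr
  have hd₅ : ∀ c : Cmd, (digitsCmd ;; c).den s₄ = c.den s₅ := fun _ => rfl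
  have hc₅' : ∀ c : Cmd, (digitsCmd ;; c).cost s₄ = digitsCmd.cost s₄ + c.cost s₅ := fun _ => rfl
  rw [hd₅, hc₅']
  clear_value s₅
  obtain ⟨h1, h2'⟩ := mul_spec (s := s₅) (a := reg 2 + reg 2 + 2) (b := reg 5) (A := 2 * G + 2)
    (B := N) (by
      simp only [eval_add, eval_reg, eval_ofNat, State.set_reg]
      rw [if_neg (by norm_num), r₅ 2 (by norm_num), r₄ 2 (by norm_num), r₃ 2 (by norm_num),
        if_neg (by norm_num), a2]
      ring) (fun s' hr _ => by rw [eval_reg, hr 5 (by norm_num), r₅ 5 (by norm_num), f5])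
  set s₆ := (mul (reg 2 + reg 2 + 2) (reg 5)).den s₅ with hs₆
  have r₆ : ∀ r < 40, s₆.reg r = s₅.reg r := fun r hr => reg_den (K := 40) rfl _ hr
  have m₆ : s₆.mem = s₅.mem := mem_den (c := mul (reg 2 + reg 2 + 2) (reg 5)) rfl _
  set s₇ := s₆.set 38 (s₆.reg 42) with hs₇
  have hd₆ : ∀ c : Cmd, (mul (reg 2 + reg 2 + 2) (reg 5) ;; asg 38 (reg 42) ;; c).den s₅ = c.den s₇ :=
    fun _ => rfl
  have hc₆' : ∀ c : Cmd, (mul (reg 2 + reg 2 + 2) (reg 5) ;; asg 38 (reg 42) ;; c).cost s₅ =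
    (mul (reg 2 + reg 2 + 2) (reg 5)).cost s₅ + (4 + c.cost s₇) := fun _ => rfl
  rw [hd₆, hc₆']
  clear_value s₆
  have i38 : s₇.reg 38 = (2 * G + 2) * N := by rw [hs₇, State.set_reg, if_pos rfl, h1]
  have r₇ : ∀ r < 37, s₇.reg r = s₅.reg r := fun r hr => by
    rw [hs₇, State.set_reg, if_neg (by omega), r₆ r (by omega)]
  have m₇ : s₇.mem = s₆.mem := rfl
  clear_value s₇
  obtain ⟨j1, j2⟩ := mul_spec (s := s₇) (a := reg 38) (b := reg 6) (A := (2 * G + 2) * N)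
    (B := 2 ^ N) (by rw [eval_reg, State.set_reg, if_neg (by norm_num), i38])
    (fun s' hr _ => by
      rw [eval_reg, hr 6 (by norm_num), r₇ 6 (by norm_num), r₅ 6 (by norm_num), f6])
  set s₈ := (mul (reg 38) (reg 6)).den s₇ with hs₈
  have r₈ : ∀ r < 40, s₈.reg r = s₇.reg r := fun r hr => reg_den (K := 40) rfl _ hr
  have m₈ : s₈.mem = s₇.mem := mem_den (c := mul (reg 38) (reg 6)) rfl _
  have hd₈ : (mul (reg 38) (reg 6) ;; asg 7 (reg 42 + 1)).den s₇ = s₈.set 7 (s₈.reg 42 + 1) := rfl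
  have hc₈ : (mul (reg 38) (reg 6) ;; asg 7 (reg 42 + 1)).cost s₇ =
    (mul (reg 38) (reg 6)).cost s₇ + 6 := rfl
  rw [hd₈, hc₈]
  clear_value s₈
  have hr : ∀ r < 32, r ≠ 7 → (s₈.set 7 (s₈.reg 42 + 1)).reg r = if r = 6 then 2 ^ N else s₁.reg r :=
    fun r hr hr7 => by
      rw [State.set_reg, if_neg hr7, r₈ r (by omega), r₇ r (by omega), r₅ r (by omega),
        r₄ r (by omega), r₃ r (by omega)]
  have hm : (s₈.set 7 (s₈.reg 42 + 1)).mem = s₅.mem := by rw [State.set_mem, m₈, m₇, m₆]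
  have e16 : (s₈.set 7 (s₈.reg 42 + 1)).reg 16 = s.reg 63 + N + (N + (2 * G + 2)) := by
    rw [hr 16 (by norm_num) (by norm_num), if_neg (by norm_num), a16]
  refine ⟨⟨fun r hr' hl => ?_, ?_, ?_, ?_, ?_, ?_, ?_, e16, ?_, ?_, fun j hj => ?_, fun r hr' => ?_,
    ?_, fun a ha => ?_⟩, ?_⟩
  · rw [← alow r hr' hl]
    simp only [List.mem_cons, not_or] at hl
    rw [hr r hr' (by omega), if_neg (by omega)]
  · rw [hr 5 (by norm_num) (by norm_num), if_neg (by norm_num), a5]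
  · rw [hr 6 (by norm_num) (by norm_num), if_pos rfl]
  · rw [State.set_reg, if_pos rfl, j1]
  · rw [hr 8 (by norm_num) (by norm_num), if_neg (by norm_num), a8]
  · rw [hr 14 (by norm_num) (by norm_num), if_neg (by norm_num), a14]
  · rw [hr 15 (by norm_num) (by norm_num), if_neg (by norm_num), a15]
  · rw [hr 17 (by norm_num) (by norm_num), if_neg (by norm_num), a17]
  · rw [hr 18 (by norm_num) (by norm_num), if_neg (by norm_num), a18]
  · rw [hm, g2 _ (by omega), fpow j hj]
  · rw [hm, g2 _ (by omega), d1 r hr', e16]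
  · rw [hm, e16]
    exact g1
  · rw [e16] at ha
    rw [hm, g2 _ (by omega), d2 _ (by omega), m₃, b2 _ (by omega), am]
  · have k5 : (reg 5).cost = 2 := rfl
    have k42 : (reg 42).cost = 2 := rfl
    have k6 : (reg 6).cost = 2 := rfl
    have k38 : (reg 38).cost = 2 := rfl
    have kn : (reg 5 + (reg 2 + reg 2 + 2) : Expr).cost = 10 := rfl
    have ka : (reg 2 + reg 2 + 2 : Expr).cost = 7 := rfl
    rw [k5, k42] at b5
    rw [kn, k42] at d5
    rw [ka, k5] at h2'
    rw [k38, k6] at j2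
    have e1 : N * (40 + 2 ^ N * 40) = N * 40 + N * (2 ^ N * 40) := by ring
    have e2 : N * (100 + 2 ^ N * 40) = N * 100 + N * (2 ^ N * 40) := by ring
    omega

end Tables

/-! ### The digits of the automata -/

section Digits

variable {nP nΓ nA : ℕ} {ρ m : ℕ → ℕ} {rules : List (Rule (Fin nP) (Fin nΓ))} {F N : ℕ}
  {comp : ℕ → Option (Formula (Fin nA))} {rc : ℕ → ℕ} {pos : ℕ → ℕ → ℕ} {t : Tab} {s : State}
  {Q Q' : ℕ → ℕ → ℕ → Prop}

/-- The state holds the table `t` with the additional digits `Q`. -/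
def Adds (nΓ : ℕ) (ρ m : ℕ → ℕ) (N : ℕ) (t : Tab) (Q : ℕ → ℕ → ℕ → Prop) (s : State) : Prop :=
  ∃ t', Good nΓ ρ m N t' s ∧ t'.Bdd (2 * nΓ + 2) N ∧
    ∀ γ T b, (t' γ T).testBit b = true ↔ (t γ T).testBit b = true ∨ Q γ T b

theorem Adds.congr (h : Adds nΓ ρ m N t Q s) (hQ : ∀ γ T b, Q γ T b ↔ Q' γ T b) :
    Adds nΓ ρ m N t Q' s := by
  have : Q = Q' := by
    funext γ T b
    exact propext (hQ γ T b)
  rwa [← this]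

theorem Adds.of_eq {s' : State} (h : Adds nΓ ρ m N t Q s) (hr : ∀ r < 32, s'.reg r = s.reg r)
    (hm : s'.mem = s.mem) : Adds nΓ ρ m N t Q s' := by
  obtain ⟨t', h1, h2, h3⟩ := h
  exact ⟨t', h1.of_eq hr hm, h2, h3⟩

theorem Adds.mem (h : Adds nΓ ρ m N t Q s) {a : ℕ} (ha : a < ρ 16) : s.mem a = m a := by
  obtain ⟨t', h1, -⟩ := h
  exact h1.mem a (by omega)

theorem Adds.setCmd (h : Adds nΓ ρ m N t Q s) (H : Static ρ m rules F N comp rc pos) {b : Expr}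
    (hγ : s.reg 40 ≤ nΓ) (hT : s.reg 41 < 2 ^ N) (hb : b.eval s < N) :
    Adds nΓ ρ m N t (fun γ T b' => Q γ T b' ∨ γ = s.reg 40 ∧ T = s.reg 41 ∧ b' = b.eval s)
      ((setCmd 17 b).den s) := by
  obtain ⟨t', h1, h2, h3⟩ := h
  refine ⟨_, h1.setCmd H h2 (.inl rfl) hγ hT hb, h2.setBit hb, fun γ T b' => ?_⟩
  rw [Tab.testBit_setBit, Bool.or_eq_true, h3, decide_eq_true_eq, rowOf, if_pos rfl]
  tauto

/-- Write the digits of one automaton into the table. -/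
def tabBody : Cmd :=
  (asg 40 (reg 2) ;; asg 41 0) ;;
    for_ 72 (reg 65) (ite (mem (reg 66 + reg 72)) (setCmd 17 (reg 62 + reg 72)) skip) ;;
    asg 73 (reg 68) ;;
    for_ 72 (reg 67) (asg 40 (mem (reg 73 + 1)) ;;
      for_ 41 (reg 6) (ite (bitE (reg 62 + mem (reg 73 + 2)) (reg 41))
        (setCmd 17 (reg 62 + mem (reg 73))) skip) ;; asg 73 (reg 73 + 3))

/-- The digit of a transition. -/
def edge (nΓ N o : ℕ) {n : ℕ} (τ : Fin n × Fin nΓ × Fin n) (γ T b : ℕ) : Prop :=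
  T < 2 ^ N ∧ γ = τ.2.1 ∧ b = o + τ.1 ∧ T.testBit (o + τ.2.2) = true

/-- Automata are run backwards along the stack: a transition makes its source a member of the type
of γw whenever its target belongs to the type of w. So it contributes to every column that contains
the target. -/
theorem edgeLoop_spec (h : Adds nΓ ρ m N t Q s) (H : Static ρ m rules F N comp rc pos) {o n : ℕ}
    {τ : Fin n × Fin nΓ × Fin n} (hn : o + n ≤ N) (h62 : s.reg 62 = o) (h40 : s.reg 40 = τ.2.1)
    (h73 : s.reg 73 + 2 < ρ 16)
    (hτ : s.mem (s.reg 73) = τ.1 ∧ s.mem (s.reg 73 + 2) = τ.2.2) :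
    Adds nΓ ρ m N t (fun γ T b => Q γ T b ∨ edge nΓ N o τ γ T b)
      ((for_ 41 (reg 6) (ite (bitE (reg 62 + mem (reg 73 + 2)) (reg 41))
        (setCmd 17 (reg 62 + mem (reg 73))) skip)).den s) ∧
    (for_ 41 (reg 6) (ite (bitE (reg 62 + mem (reg 73 + 2)) (reg 41))
        (setCmd 17 (reg 62 + mem (reg 73))) skip)).cost s ≤ 3 + 2 ^ N * 125 := by
  have h6 : (reg 6).eval s = 2 ^ N := by
    obtain ⟨t', h1, -⟩ := h
    rw [eval_reg, h1.reg 6 (by norm_num), H.rD]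
  have hm1 : m (s.reg 73) = τ.1 := by rw [← h.mem (by omega), hτ.1]
  have hm2 : m (s.reg 73 + 2) = τ.2.2 := by rw [← h.mem (by omega), hτ.2]
  obtain ⟨⟨h1, -⟩, h2⟩ := loop_rule' (s := s) (i := 41) (e := reg 6)
    (c := ite (bitE (reg 62 + Expr.mem (reg 73 + 2)) (reg 41))
        (BCARET.setCmd 17 (reg 62 + Expr.mem (reg 73))) skip) 41 rfl
    (fun k s' => Adds nΓ ρ m N t (fun γ T b => Q γ T b ∨ k ≤ T ∧ edge nΓ N o τ γ T b) s' ∧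
      ∀ r, r ≠ 41 → s'.reg r = s.reg r) 120
    ⟨h.congr fun γ T b => ⟨.inl, fun h => h.resolve_right fun h => by
      rw [h6] at h
      exact absurd h.2.1 (by omega)⟩, fun _ _ => rfl⟩ (by
      rintro k s' hk - ⟨g1, g2⟩
      rw [h6] at hk
      refine ⟨?_, (cost_le_worst rfl _).trans (by decide)⟩
      have g1' := g1.of_eq (s' := s'.set 41 k) (fun r hr => by
        rw [State.set_reg, if_neg (by omega)]) rfl
      have hr : ∀ r, r ≠ 41 → (s'.set 41 k).reg r = s.reg r := fun r hr => by
        rw [State.set_reg, if_neg hr, g2 r hr]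
      have e41 : (s'.set 41 k).reg 41 = k := by rw [State.set_reg, if_pos rfl]
      have e1 : (reg 62 + mem (reg 73) : Expr).eval (s'.set 41 k) = o + τ.1 := by
        rw [eval_add, eval_mem, eval_reg, eval_reg, hr 62 (by norm_num), hr 73 (by norm_num), h62,
          g1'.mem (by omega), hm1]
      have e2 : (reg 62 + mem (reg 73 + 2) : Expr).eval (s'.set 41 k) = o + τ.2.2 := by
        rw [eval_add, eval_mem, eval_add, eval_reg, eval_reg, eval_ofNat, hr 62 (by norm_num),
          hr 73 (by norm_num), h62, g1'.mem (by exact h73)]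
        exact congrArg _ hm2
      have l1 : o + (τ.1 : ℕ) < N := by omega
      have l2 : o + (τ.2.2 : ℕ) < N := by omega
      have e3 : (bitE (reg 62 + mem (reg 73 + 2)) (reg 41)).eval (s'.set 41 k) =
          (k.testBit (o + τ.2.2)).toNat := by
        obtain ⟨t', f1, -⟩ := g1'
        have := f1.eval_bit H (b := reg 62 + mem (reg 73 + 2)) (T := reg 41) (by rw [e2]; exact l2)
          (by rw [eval_reg, e41]; exact hk)
        rw [this, e2, eval_reg, e41]
      rw [den, e3]
      by_cases hb : k.testBit (o + τ.2.2) = true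
      · rw [if_pos (by simp [hb])]
        refine ⟨?_, fun r hr' => (reg_den (K := r + 1) rfl _ (Nat.lt_succ_self r)).trans (hr r hr')⟩
        refine (g1'.setCmd H (b := reg 62 + mem (reg 73)) ?_ ?_ ?_).congr fun γ T b => ?_
        · rw [hr 40 (by norm_num), h40]
          omega
        · rw [e41]
          exact hk
        · rw [e1]
          exact l1
        · rw [e41, e1, hr 40 (by norm_num), h40]
          constructor
          · rintro ((h | h) | ⟨rfl, rfl, rfl⟩)
            · exact .inl h
            · exact .inr ⟨by omega, h.2⟩
            · exact .inr ⟨le_rfl, hk, rfl, rfl, hb⟩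
          · rintro (h | ⟨h, h'⟩)
            · exact .inl (.inl h)
            · rcases eq_or_ne T k with rfl | hne
              · exact .inr ⟨h'.2.1, rfl, h'.2.2.1⟩
              · exact .inl (.inr ⟨by omega, h'⟩)
      · rw [if_neg (by simp [hb])]
        refine ⟨g1'.congr fun γ T b => or_congr_right ?_, hr⟩
        refine ⟨fun h => ⟨by omega, h.2⟩, fun h => ⟨?_, h.2⟩⟩
        rcases eq_or_ne T k with rfl | hne
        · exact absurd h.2.2.2.2 hb
        · omega)
  refine ⟨h1.congr fun γ T b => by simp, ?_⟩
  rw [h6] at h2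
  have e : (reg 6).cost = 2 := rfl
  omega

/-- The digits of an automaton whose states are shifted by `o`. -/
def Digit (N : ℕ) (E : Entry nP nΓ nA) (o γ T b : ℕ) : Prop :=
  (γ = nΓ ∧ T = 0 ∧ ∃ q ∈ E.aut.final, b = o + q) ∨ ∃ τ ∈ E.trans, edge nΓ N o τ γ T b

theorem tabBody_spec (h : Adds nΓ ρ m N t Q s) (H : Static ρ m rules F N comp rc pos)
    {E : Entry nP nΓ nA} {o X : ℕ} (hE : EntryOut E o X s) (hX : X ≤ ρ 16)
    (hN : o + E.aut.states ≤ N) :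
    Adds nΓ ρ m N t (fun γ T b => Q γ T b ∨ Digit N E o γ T b) (tabBody.den s) ∧
    tabBody.cost s ≤ 30 + 130 * E.aut.states + E.trans.length * (40 + 2 ^ N * 125) := by
  have r68 := hE.r68
  have hle := hE.le
  set c₁ : Cmd := asg 40 (reg 2) ;; asg 41 0 with hc₁
  set s₁ := c₁.den s with hs₁
  have a2 : s.reg 2 = nΓ := by
    obtain ⟨t', h1, -⟩ := h
    rw [h1.reg 2 (by norm_num), H.rG]
  have a40 : s₁.reg 40 = nΓ := by simp [hs₁, hc₁, den, State.set_reg, a2]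
  have a41 : s₁.reg 41 = 0 := by simp [hs₁, hc₁, den, State.set_reg]
  have ar : ∀ r, 42 ≤ r → s₁.reg r = s.reg r := fun r hr => by
    simp only [hs₁, hc₁, den, State.set_reg]
    rw [if_neg (by omega), if_neg (by omega)]
  have ah : Adds nΓ ρ m N t Q s₁ := h.of_eq (fun r hr => reg_den (K := 40) rfl _ (by omega)) rfl
  have am : s₁.mem = s.mem := rfl
  have a65 : (reg 65).eval s₁ = E.aut.states := by rw [eval_reg, ar 65 (by norm_num), hE.r65]
  set c₂ : Cmd := for_ 72 (reg 65) (ite (Expr.mem (reg 66 + reg 72)) (setCmd 17 (reg 62 + reg 72)) skip)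
    with hc₂
  obtain ⟨b1, b2⟩ := loop_rule' (s := s₁) (i := 72) (e := reg 65)
    (c := ite (Expr.mem (reg 66 + reg 72)) (setCmd 17 (reg 62 + reg 72)) skip) 72 rfl
    (fun k s' => Adds nΓ ρ m N t (fun γ T b => Q γ T b ∨
      γ = nΓ ∧ T = 0 ∧ ∃ q ∈ E.aut.final, k ≤ q ∧ b = o + q) s') 120
    (ah.congr fun γ T b => ⟨.inl, fun h => h.resolve_right fun ⟨_, _, q, _, h, _⟩ => by
      rw [a65] at h
      exact absurd q.2 (by omega)⟩) (by
      rintro k s' hk hr g1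
      rw [a65] at hk
      refine ⟨?_, (cost_le_worst rfl _).trans (by decide)⟩
      have g1' := g1.of_eq (s' := s'.set 72 k) (fun r hr => by
        rw [State.set_reg, if_neg (by omega)]) rfl
      have hr' : ∀ r < 72, (s'.set 72 k).reg r = s₁.reg r := fun r hr' => by
        rw [State.set_reg, if_neg (by omega), hr r hr']
      have e72 : (s'.set 72 k).reg 72 = k := by rw [State.set_reg, if_pos rfl]
      have e1 : (reg 62 + reg 72 : Expr).eval (s'.set 72 k) = o + k := by
        rw [eval_add, eval_reg, eval_reg, hr' 62 (by norm_num), e72, ar 62 (by norm_num), hE.r62]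
      have e2 : (Expr.mem (reg 66 + reg 72)).eval (s'.set 72 k) =
          if (⟨k, hk⟩ : Fin E.aut.states) ∈ E.aut.final then 1 else 0 := by
        rw [← hE.final ⟨k, hk⟩, eval_mem, eval_add, eval_reg, eval_reg, hr' 66 (by norm_num), e72,
          ar 66 (by norm_num), g1'.mem (by omega), h.mem (by simp only; omega)]
      rw [den, e2]
      by_cases hf : (⟨k, hk⟩ : Fin E.aut.states) ∈ E.aut.final
      · rw [if_pos hf, if_pos one_ne_zero]
        refine (g1'.setCmd H (b := reg 62 + reg 72) ?_ ?_ ?_).congr fun γ T b => ?_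
        · rw [hr' 40 (by norm_num), a40]
        · rw [hr' 41 (by norm_num), a41]
          positivity
        · rw [e1]
          omega
        · rw [e1, hr' 40 (by norm_num), hr' 41 (by norm_num), a40, a41]
          constructor
          · rintro ((h | ⟨h, h', q, hq, hq', hb⟩) | ⟨rfl, rfl, rfl⟩)
            · exact .inl h
            · exact .inr ⟨h, h', q, hq, by omega, hb⟩
            · exact .inr ⟨rfl, rfl, ⟨k, hk⟩, hf, le_rfl, rfl⟩
          · rintro (h | ⟨h, h', q, hq, hq', hb⟩)
            · exact .inl (.inl h)
            · rcases eq_or_ne (q : ℕ) k with hqk | hne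
              · exact .inr ⟨h, h', by rw [hb, hqk]⟩
              · exact .inl (.inr ⟨h, h', q, hq, by omega, hb⟩)
      · rw [if_neg hf, if_neg (by simp)]
        refine g1'.congr fun γ T b => or_congr_right ?_
        refine and_congr_right fun _ => and_congr_right fun _ => exists_congr fun q =>
          and_congr_right fun hq => ?_
        refine ⟨fun h => ⟨by omega, h.2⟩, fun h => ⟨?_, h.2⟩⟩
        rcases eq_or_ne (q : ℕ) k with hqk | hne
        · exact absurd (show (⟨k, hk⟩ : Fin E.aut.states) ∈ E.aut.final by
            rwa [show (⟨k, hk⟩ : Fin E.aut.states) = q from Fin.ext hqk.symm]) hf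
        · omega)
  rw [← hc₂] at b1 b2
  rw [a65] at b2
  set s₂ := c₂.den s₁ with hs₂
  have r₂ : ∀ r < 72, s₂.reg r = s₁.reg r := fun r hr => reg_den (K := 72) rfl _ hr
  set s₃ := s₂.set 73 (s₂.reg 68) with hs₃
  have c67 : (reg 67).eval s₃ = E.trans.length := by
    rw [eval_reg, hs₃, State.set_reg, if_neg (by norm_num), r₂ 67 (by norm_num),
      ar 67 (by norm_num), hE.r67]
  have c62 : s₃.reg 62 = o := by
    rw [hs₃, State.set_reg, if_neg (by norm_num), r₂ 62 (by norm_num), ar 62 (by norm_num), hE.r62]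
  have c73 : s₃.reg 73 = s.reg 68 := by
    rw [hs₃, State.set_reg, if_pos rfl, r₂ 68 (by norm_num), ar 68 (by norm_num)]
  have ch := b1.of_eq (s' := s₃) (fun r hr => by
    rw [hs₃, State.set_reg, if_neg (by omega)]) rfl
  set c₃ : Cmd := for_ 41 (reg 6) (ite (bitE (reg 62 + Expr.mem (reg 73 + 2)) (reg 41))
        (setCmd 17 (reg 62 + Expr.mem (reg 73))) skip) with hc₃
  obtain ⟨⟨j, d1, -, -, d4⟩, d5⟩ := loop_rule' (s := s₃) (i := 72) (e := reg 67)
    (c := asg 40 (Expr.mem (reg 73 + 1)) ;; c₃ ;; asg 73 (reg 73 + 3)) 40 rfl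
    (fun k s' => ∃ j, j + k = E.trans.length ∧ s'.reg 62 = o ∧ s'.reg 73 = s.reg 68 + 3 * j ∧
      Adds nΓ ρ m N t (fun γ T b => (Q γ T b ∨
        γ = nΓ ∧ T = 0 ∧ ∃ q ∈ E.aut.final, 0 ≤ (q : ℕ) ∧ b = o + q) ∨
        ∃ τ ∈ E.trans.take j, edge nΓ N o τ γ T b) s') (20 + 2 ^ N * 125)
    ⟨0, by rw [c67, Nat.zero_add], c62, c73, ch.congr fun γ T b => by simp⟩ (by
      rintro k s' hk hr ⟨j, f1, f2, f3, f4⟩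
      rw [c67] at hk
      have hj : j < E.trans.length := by omega
      obtain ⟨t1, t2, t3⟩ := hE.trans j _ (List.getElem?_eq_getElem hj)
      have ht : ∀ a, a ≤ s.reg 68 + 3 * j + 2 → (s'.set 72 k).mem a = s.mem a := fun a ha => by
        rw [State.set_mem, f4.mem (by omega), h.mem (by omega)]
      set s₄ := (s'.set 72 k).set 40 ((Expr.mem (reg 73 + 1)).eval (s'.set 72 k)) with hs₄
      have g40 : s₄.reg 40 = E.trans[j].2.1 := by
        rw [← t2, ← ht _ (by omega), ← f3]
        simp [hs₄, State.set_reg]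
      have g62 : s₄.reg 62 = o := f2
      have g73 : s₄.reg 73 = s.reg 68 + 3 * j := f3
      obtain ⟨k1, k2⟩ := edgeLoop_spec (s := s₄) (o := o) (n := E.aut.states) (τ := E.trans[j])
        (f4.of_eq (fun r hr => by
          rw [hs₄, State.set_reg, State.set_reg, if_neg (by omega), if_neg (by omega)]) rfl) H hN
        g62 g40 (by omega) (by
          have : s₄.mem = (s'.set 72 k).mem := rfl
          rw [g73, this, ht _ (by omega), ht _ (by omega)]
          exact ⟨t1, t3⟩)
      rw [← hc₃] at k1 k2
      set s₅ := c₃.den s₄ with hs₅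
      have g62' : s₅.reg 62 = s₄.reg 62 := reg_den_of_keeps rfl _
      have g73' : s₅.reg 73 = s₄.reg 73 := reg_den_of_keeps rfl _
      have hd : (asg 40 (Expr.mem (reg 73 + 1)) ;; c₃ ;; asg 73 (reg 73 + 3)).den (s'.set 72 k) =
        s₅.set 73 (s₅.reg 73 + 3) := rfl
      rw [hd]
      refine ⟨⟨j + 1, by omega, ?_, ?_, ?_⟩, ?_⟩
      · rw [State.set_reg, if_neg (by norm_num), g62', g62]
      · rw [State.set_reg, if_pos rfl, g73', g73]
        ring
      · refine (k1.of_eq (s' := s₅.set 73 (s₅.reg 73 + 3)) (fun r hr => by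
          rw [State.set_reg, if_neg (by omega)]) rfl).congr
          fun γ T b => ?_
        rw [List.take_add_one, List.getElem?_eq_getElem hj, or_assoc]
        refine or_congr_right ?_
        simp only [List.mem_append, Option.toList_some, List.mem_singleton, or_and_right, exists_or,
          exists_eq_left]
      · have : (asg 40 (Expr.mem (reg 73 + 1)) ;; c₃ ;; asg 73 (reg 73 + 3)).cost (s'.set 72 k) =
          7 + (c₃.cost s₄ + 6) := rfl
        omega)
  obtain rfl : j = E.trans.length := by omega
  refine ⟨d4.congr fun γ T b => ?_, ?_⟩
  · rw [List.take_length, or_assoc]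
    refine or_congr_right ?_
    simp [Digit]
  · have : tabBody.cost s = 7 + (c₂.cost s₁ + (4 + (for_ 72 (reg 67)
      (asg 40 (Expr.mem (reg 73 + 1)) ;; c₃ ;; asg 73 (reg 73 + 3))).cost s₃)) := rfl
    rw [c67] at d5
    have e1 : (reg 65).cost = 2 := rfl
    have e2 : (reg 67).cost = 2 := rfl
    have e3 : E.trans.length * (20 + 2 ^ N * 125 + 5) + E.trans.length * 15 =
      E.trans.length * (40 + 2 ^ N * 125) := by ring
    omega

end Digits

/-! ### The types of the automata -/

section Located

variable {nP nΓ nA : ℕ}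

/-- The entries with the numbers by which their states are shifted. -/
def located : ℕ → List (Entry nP nΓ nA) → List (Entry nP nΓ nA × ℕ)
  | _, [] => []
  | o, E :: es => (E, o) :: located (o + E.aut.states) es

theorem statesOf_cons (E : Entry nP nΓ nA) (es : List (Entry nP nΓ nA)) :
    statesOf (E :: es) = E.aut.states + statesOf es := by
  simp [statesOf]

theorem statesOf_append (es es' : List (Entry nP nΓ nA)) :
    statesOf (es ++ es') = statesOf es + statesOf es' := by
  simp [statesOf]

theorem located_append (es es' : List (Entry nP nΓ nA)) : ∀ o,
    located o (es ++ es') = located o es ++ located (o + statesOf es) es' := by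
  induction es with
  | nil => intro o; simp [located, statesOf]
  | cons E es ih =>
    intro o
    rw [List.cons_append, located, ih, located, statesOf_cons, List.cons_append, Nat.add_assoc]

theorem mem_located {es : List (Entry nP nΓ nA)} {x : Entry nP nΓ nA × ℕ} : ∀ {o},
    x ∈ located o es → x.1 ∈ es ∧ o ≤ x.2 ∧ x.2 + x.1.aut.states ≤ o + statesOf es := by
  induction es with
  | nil => intro o h; simp [located] at h
  | cons E es ih =>
    intro o h
    rw [statesOf_cons]
    rcases List.mem_cons.1 h with rfl | h
    · exact ⟨List.mem_cons_self, le_rfl, by simp only; omega⟩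
    · obtain ⟨h1, h2, h3⟩ := ih h
      exact ⟨List.mem_cons_of_mem _ h1, by omega, by omega⟩

/-- The shifted state sets occupy disjoint intervals, so a digit determines its automaton. -/
theorem located_unique {es : List (Entry nP nΓ nA)} {x y : Entry nP nΓ nA × ℕ} : ∀ {o},
    x ∈ located o es → y ∈ located o es → ∀ (q : Fin x.1.aut.states) (q' : Fin y.1.aut.states),
    x.2 + (q : ℕ) = y.2 + q' → x = y := by
  induction es with
  | nil => intro o h; simp [located] at h
  | cons E es ih =>
    intro o hx hy q q' he
    have := q.2
    have := q'.2
    rcases List.mem_cons.1 hx with rfl | hx <;> rcases List.mem_cons.1 hy with rfl | hy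
    · rfl
    · have := (mem_located hy).2.1
      simp only at *
      omega
    · have := (mem_located hx).2.1
      simp only at *
      omega
    · exact ih hx hy q q' he

/-- The words that are accepted from a shifted state. -/
def accepts (ls : List (Entry nP nΓ nA × ℕ)) : ℕ → List (Fin nΓ) → Prop
  | b, [] => ∃ x ∈ ls, ∃ q ∈ x.1.aut.final, b = x.2 + q
  | b, γ :: w => ∃ x ∈ ls, ∃ τ ∈ x.1.trans, γ = τ.2.1 ∧ b = x.2 + τ.1 ∧ accepts ls (x.2 + τ.2.2) w

/-- Transitions of all the automata are used together; by `located_unique` an accepting path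
nevertheless stays inside one automaton. -/
theorem accepts_iff {o : ℕ} {es : List (Entry nP nΓ nA)} {x : Entry nP nΓ nA × ℕ}
    (hx : x ∈ located o es) (hE : ∀ E ∈ es, ∀ τ, τ ∈ E.trans ↔ τ ∈ E.aut.δ) (w : List (Fin nΓ)) :
    ∀ q : Fin x.1.aut.states, accepts (located o es) (x.2 + q) w ↔
      ∃ f ∈ x.1.aut.final, x.1.aut.Reach q w f := by
  induction w with
  | nil =>
    intro q
    constructor
    · rintro ⟨y, hy, q', hq', he⟩
      obtain rfl := located_unique hx hy q q' he
      obtain rfl : q = q' := Fin.ext (by omega)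
      exact ⟨q, hq', .nil q⟩
    · rintro ⟨f, hf, hr⟩
      cases hr
      exact ⟨x, hx, q, hf, rfl⟩
  | cons γ w ih =>
    intro q
    constructor
    · rintro ⟨y, hy, ⟨q₁, γ', q₂⟩, hτ, hγ, he, ha⟩
      obtain rfl := located_unique hx hy q q₁ he
      obtain rfl : q = q₁ := Fin.ext (by simp only at he; omega)
      obtain rfl : γ = γ' := hγ
      obtain ⟨f, hf, hr⟩ := (ih q₂).1 ha
      exact ⟨f, hf, .cons ((hE _ (mem_located hx).1 _).1 hτ) hr⟩
    · rintro ⟨f, hf, hr⟩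
      cases hr with
      | cons h h' =>
        exact ⟨x, hx, _, (hE _ (mem_located hx).1 _).2 h, rfl, rfl, (ih _).2 ⟨f, hf, h'⟩⟩

variable {S : PDS (Fin nP) (Fin nΓ)} {lab : Fin nA → Set (Conf (Fin nP) (Fin nΓ))} {F N : ℕ}
  {comp : ℕ → Option (Formula (Fin nA))} {pos : ℕ → ℕ → ℕ} {t : Tab}

/-- From number `F + 1` on there is no property left, so only the automaton digits have to be right.
These are right by construction: final states over the empty stack, and one backward step for each
letter. -/
theorem tabOK_of_digits {es : List (Entry nP nΓ nA)} (hN : (F + 1) * nP + statesOf es = N)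
    (ht : ∀ γ T b, (t γ T).testBit b = true ↔ ∃ x ∈ located ((F + 1) * nP) es, Digit N x.1 x.2 γ T b) :
    TabOK S lab F N comp pos (accepts (located ((F + 1) * nP) es)) (F + 1) t := by
  refine ⟨fun γ T w hT h => ⟨fun j hj hj' => absurd hj' (by omega), fun b hb hb' => ?_⟩,
    ⟨fun j hj hj' => absurd hj' (by omega), fun b hb hb' => ?_⟩⟩
  · rw [ht, accepts]
    refine exists_congr fun x => and_congr_right fun hx => ?_
    have := (mem_located hx).2
    constructor
    · rintro (⟨h1, -⟩ | ⟨τ, hτ, h1, h2, h3, h4⟩)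
      · exact absurd h1 γ.2.ne
      · exact ⟨τ, hτ, Fin.ext h2, h3, (h.acc _ (by omega) (by omega)).1 h4⟩
    · rintro ⟨τ, hτ, h1, h2, h3⟩
      exact .inr ⟨τ, hτ, hT, congrArg Fin.val h1, h2, (h.acc _ (by omega) (by omega)).2 h3⟩
  · rw [ht, accepts]
    refine exists_congr fun x => and_congr_right fun hx => ?_
    constructor
    · rintro (⟨-, -, h⟩ | ⟨τ, hτ, h1, h2, h3, h4⟩)
      · exact h
      · exact absurd h2.symm τ.2.1.2.ne
    · exact fun h => .inl ⟨rfl, rfl, h⟩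

end Located

/-! ### The places of the properties -/

section Places

variable {nP nΓ nA : ℕ} {rules : List (Rule (Fin nP) (Fin nΓ))} {φ : Formula (Fin nA)} {x : List ℕ}
  {s : State}

/-- Determine the places of all properties. -/
def walksCmd : Cmd :=
  (asg 61 (reg 20) ;; asg 62 (reg 19)) ;; walk (num 2) placeBody ;; walk (num 3) placeBody

/-- Both lists are walked with shifts that continue from one to the other, beginning behind the
digits of the properties; the final shift is therefore the number of all digits. The first
alternative for an operator means that no automaton refers to it, and then its default place is
kept. -/
theorem walksCmd_spec (h : Prepared rules φ x s) {es es' : List (Entry nP nΓ nA)} {z : List ℕ}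
    (hz : z ≠ [])
    (hx : x = nP :: nΓ :: rules.length :: (rules.flatMap encodeRule ++ (encodeFormula φ ++
      (es.length :: es.flatMap Entry.code ++ (es'.length :: es'.flatMap Entry.code ++ z))))) :
    let s' := walksCmd.den s
    let PB := 5 * x.length + 4 + ((φ.size + 1) + (es.length + es'.length)) * nP
    (∀ r < 60, s'.reg r = s.reg r) ∧
    MemAt s'.mem (s'.reg 61) z ∧ s'.reg 61 + z.length = x.length ∧
    s'.reg 62 = (φ.size + 1) * nP + (statesOf es + statesOf es') ∧
    s'.reg 63 = PB ∧
    (∀ a, (a < 4 * x.length + 3 ∨ 4 * x.length + 3 + φ.size ≤ a) →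
      (a < 5 * x.length + 4 + (φ.size + 1) * nP ∨ PB ≤ a) → s'.mem a = s.mem a) ∧
    (∀ i ψ, φ.pre[i]? = some ψ → s'.mem (4 * x.length + 3 + i) = 5 * x.length + 4 + i * nP ∧
        (∀ E ∈ es, ¬ (ψ.tag = 2 ∧ ψ.arg = (E.atom : ℕ))) ∧
        (∀ E ∈ es', ¬ (ψ.tag = 3 ∧ ψ.arg = (E.atom : ℕ))) ∨
      ∃ y ∈ located ((φ.size + 1) * nP) (es ++ es'), s'.mem (4 * x.length + 3 + i) + nP ≤ PB ∧
        (y.1 ∈ es ∧ ψ.tag = 2 ∧ ψ.arg = (y.1.atom : ℕ) ∨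
          y.1 ∈ es' ∧ ψ.tag = 3 ∧ ψ.arg = (y.1.atom : ℕ)) ∧
        ∀ p : Fin nP, s'.mem (s'.mem (4 * x.length + 3 + i) + p) = y.2 + y.1.aut.init p) ∧
    walksCmd.cost s ≤ 60 + (es.length + es'.length) * (90 + 20 * nP + 60 * φ.size) := by
  intro s' PB
  have hm : MemAt s.mem 0 x := (memAt_getD x).congr fun b _ hb => h.input b (by omega)
  rw [hx] at hm
  obtain ⟨-, -, -, hm⟩ := hm
  rw [memAt_append, memAt_append, memAt_append, memAt_append] at hm
  obtain ⟨-, -, hm1, hm2, hm3⟩ := hm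
  have hz' := List.length_pos_of_ne_nil hz
  have hlen : x.length = 3 + (rules.flatMap encodeRule).length + (encodeFormula φ).length +
      (1 + (es.flatMap Entry.code).length) + (1 + (es'.flatMap Entry.code).length) + z.length := by
    conv_lhs => rw [hx]
    simp only [List.length_cons, List.length_append]
    omega
  have h20 := h.r20
  have hlt := h.lt
  set s₁ := (asg 61 (reg 20) ;; asg 62 (reg 19)).den s with hs₁
  have a61 : s₁.reg 61 = 3 + (rules.flatMap encodeRule).length + (encodeFormula φ).length := by
    simp [hs₁, den, State.set_reg, h20]
  have a62 : s₁.reg 62 = (φ.size + 1) * nP := by simp [hs₁, den, State.set_reg, h.r19]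
  have a63 : s₁.reg 63 = 5 * x.length + 4 + (φ.size + 1) * nP := by
    simp [hs₁, den, State.set_reg, h.r63]
  have ar : ∀ r < 60, s₁.reg r = s.reg r := fun r hr => reg_den (K := 60) rfl _ hr
  have am : s₁.mem = s.mem := rfl
  have a1 := (ar 1 (by norm_num)).trans h.r1
  have a4 := (ar 4 (by norm_num)).trans h.r4
  have a9 := (ar 9 (by norm_num)).trans h.r9
  have a10 := (ar 10 (by norm_num)).trans h.r10
  have a12 := (ar 12 (by norm_num)).trans h.r12
  obtain ⟨b1, b2, b3, b4, b5, b6⟩ := walk_placeBody (s := s₁) (F := φ.size) (kind := 2)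
    (X := x.length) (es := es) a1 (by rw [a61, am]; exact hm1) (by rw [a61]; omega) a4
    (by omega) (by omega) (by omega) (by omega)
  set s₂ := (walk (num 2) placeBody).den s₁ with hs₂
  have r₂ : ∀ r < 60, s₂.reg r = s₁.reg r := fun r hr => reg_den (K := 60) rfl _ hr
  rw [a9, a10, a12, a62, a63, am] at b1
  rw [a12, a63, am] at b2
  rw [a61] at b3
  rw [a62] at b4
  rw [a63] at b5
  have d1 := (r₂ 1 (by norm_num)).trans a1
  have d4 := (r₂ 4 (by norm_num)).trans a4
  have d9 := (r₂ 9 (by norm_num)).trans a9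
  have d10 := (r₂ 10 (by norm_num)).trans a10
  have d12 := (r₂ 12 (by norm_num)).trans a12
  have hl2 : (es'.length :: es'.flatMap Entry.code).length = 1 + (es'.flatMap Entry.code).length := by
    simp only [List.length_cons]
    omega
  have hm2' : MemAt s₂.mem (s₂.reg 61) (es'.length :: es'.flatMap Entry.code) := by
    rw [b3]
    have := hm2
    simp only [List.length_cons] at this
    convert this.congr (m' := s₂.mem) fun b hb hb' => b2 b (.inl ?_) (.inl ?_) using 1
    · omega
    · simp only [List.length_cons] at hb'
      omega
    · simp only [List.length_cons] at hb'
      omega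
  obtain ⟨c1, c2, c3, c4, c5, c6⟩ := walk_placeBody (s := s₂) (F := φ.size) (kind := 3)
    (X := x.length) (es := es') d1 hm2' (by rw [b3]; omega) d4 (by omega) (by omega) (by omega)
    (by omega)
  have hs' : s' = (walk (num 3) placeBody).den s₂ := rfl
  rw [← hs'] at c1 c2 c3 c4 c5
  have r₃ : ∀ r < 60, s'.reg r = s₂.reg r := fun r hr =>
    reg_den (c := walk (num 3) placeBody) (K := 60) rfl s₂ hr
  rw [d9, d10, d12, b4, b5] at c1
  rw [d12, b5] at c2
  rw [b3] at c3
  rw [b4] at c4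
  rw [b5] at c5
  have hPB : PB = 5 * x.length + 4 + (φ.size + 1) * nP + es.length * nP + es'.length * nP := by
    simp only [PB]
    ring
  have frame : ∀ a, (a < 4 * x.length + 3 ∨ 4 * x.length + 3 + φ.size ≤ a) →
      (a < 5 * x.length + 4 + (φ.size + 1) * nP ∨ PB ≤ a) → s'.mem a = s.mem a := by
    intro a ha ha'
    rw [c2 a ha (by omega), b2 a ha (by omega)]
  refine ⟨fun r hr => by rw [r₃ r hr, r₂ r hr, ar r hr], ?_, by rw [c3]; omega, by rw [c4]; ring,
    by rw [c5, hPB],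
    frame, fun i ψ hi => ?_, ?_⟩
  · rw [c3]
    have := hm3
    simp only [List.length_cons] at this
    convert this.congr (m' := s'.mem) fun b hb hb' => frame b (.inl ?_) (.inl ?_) using 1
    · omega
    · omega
    · omega
  · have hiF : i < φ.size := by
      rw [← φ.length_pre]
      exact (List.getElem?_eq_some_iff.1 hi).1
    -- The second number of an operator is compared only after the kind has been found to be a
    -- literal, where it is the atomic proposition.
    have key : ∀ k, k = 2 ∨ k = 3 → ∀ E : Entry nP nΓ nA,
        (s.mem (x.length + i) = k ∧ s.mem (2 * x.length + 1 + i) = E.atom) ↔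
          (ψ.tag = k ∧ ψ.arg = E.atom) := by
      intro k hk E
      rw [h.tag i ψ hi]
      refine and_congr_right fun ht => ?_
      rw [h.arg i ψ hi]
      rw [Formula.hd, if_neg (by omega)]
      rfl
    have key2 : ∀ k, k = 2 ∨ k = 3 → ∀ E : Entry nP nΓ nA,
        (s₂.mem (x.length + i) = k ∧ s₂.mem (2 * x.length + 1 + i) = E.atom) ↔
          (ψ.tag = k ∧ ψ.arg = E.atom) := by
      intro k hk E
      rw [b2 _ (by omega) (by omega), b2 _ (by omega) (by omega)]
      exact key k hk E
    rcases c1 i hiF with ⟨f1, f2⟩ | ⟨l₁, E, l₂, f1, f2, f3, f4, f5⟩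
    · rcases b1 i hiF with ⟨g1, g2⟩ | ⟨l₁, E, l₂, g1, g2, g3, g4, g5⟩
      · left
        refine ⟨?_, fun E hE hc => g2 E hE ((key 2 (.inl rfl) E).2 hc),
          fun E hE hc => f2 E hE ((key2 3 (.inr rfl) E).2 hc)⟩
        rw [f1, g1]
        exact h.row i hiF.le
      · right
        refine ⟨(E, (φ.size + 1) * nP + statesOf l₁), ?_, ?_, .inl ⟨?_, (key 2 (.inl rfl) E).1 g2⟩,
          fun p => ?_⟩
        · rw [g1, List.append_assoc, List.cons_append, located_append, List.mem_append, located]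
          exact .inr List.mem_cons_self
        · rw [f1]
          omega
        · rw [g1]
          simp
        · rw [f1, c2 _ (by omega) (by omega)]
          exact g5 p
    · right
      refine ⟨(E, (φ.size + 1) * nP + statesOf (es ++ l₁)), ?_, ?_,
        .inr ⟨?_, (key2 3 (.inr rfl) E).1 f2⟩, fun p => ?_⟩
      · rw [f1, ← List.append_assoc, located_append, List.mem_append, located]
        exact .inr List.mem_cons_self
      · omega
      · rw [f1]
        simp
      · rw [f5 p, statesOf_append]
        simp only
        omega
  · have : walksCmd.cost s = (4 + 4) + ((walk (num 2) placeBody).cost s₁ +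
      (walk (num 3) placeBody).cost s₂) := rfl
    rw [Nat.add_mul]
    omega

end Places

/-! ### The state after the input has been read -/

namespace Formula

theorem mem_cl_of_mem_pre {AP : Type} {φ ψ : Formula AP} (h : ψ ∈ φ.pre) : ψ ∈ φ.cl := by
  induction φ <;> simp only [pre, cl, List.mem_cons, List.mem_append, List.not_mem_nil, or_false,
    Set.mem_insert_iff, Set.mem_union, Set.mem_singleton_iff] at * <;> tauto

theorem eq_atom {nA : ℕ} {ψ : Formula (Fin nA)} (h : ψ.tag = 2) : ∃ e, ψ = atom e ∧ ψ.arg = e := by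
  cases ψ <;> simp [tag] at h
  exact ⟨_, rfl, rfl⟩

theorem eq_natom {nA : ℕ} {ψ : Formula (Fin nA)} (h : ψ.tag = 3) : ∃ e, ψ = natom e ∧ ψ.arg = e := by
  cases ψ <;> simp [tag] at h
  exact ⟨_, rfl, rfl⟩

theorem arg_eq_mode {nA : ℕ} {ψ : Formula (Fin nA)} (h : 6 ≤ ψ.tag) :
    ψ.hd.length = 2 ∧ ψ.arg = encodeMode ψ.mode := by
  cases ψ <;> simp [tag] at h <;> simp [hd, arg, tag, mode]

/-- The number of the second operand of the operator number `i`. -/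
def second {AP : Type} (φ : Formula AP) (i : ℕ) : ℕ :=
  i + 1 + match φ.pre[i]? with
    | some ψ => ψ.left.size
    | none => 0

theorem second_eq {AP : Type} {φ ψ : Formula AP} {i : ℕ} (h : φ.pre[i]? = some ψ) :
    φ.second i = i + 1 + ψ.left.size := by
  rw [second, h]

end Formula

section Setup

variable {nP nΓ nA : ℕ} {rules : List (Rule (Fin nP) (Fin nΓ))} {φ : Formula (Fin nA)} {x : List ℕ}
  {s : State} {S : PDS (Fin nP) (Fin nΓ)} {lab : Fin nA → Set (Conf (Fin nP) (Fin nΓ))}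

/-- The entries present the labelling. -/
structure Presents (φ : Formula (Fin nA)) (lab : Fin nA → Set (Conf (Fin nP) (Fin nΓ)))
    (es es' : List (Entry nP nΓ nA)) : Prop where
  pos : ∀ e, Formula.atom e ∈ φ.cl → ∃ E ∈ es, E.atom = e
  neg : ∀ e, Formula.natom e ∈ φ.cl → ∃ E ∈ es', E.atom = e
  language : ∀ E ∈ es, E.aut.language = lab E.atom
  language' : ∀ E ∈ es', E.aut.language = (lab E.atom)ᶜ
  trans : ∀ E ∈ es ++ es', ∀ τ, τ ∈ E.trans ↔ τ ∈ E.aut.δ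

/-- Read the input up to the table. -/
def setupCmd : Cmd := walksCmd ;; tablesCmd

/-- The layout of digits is read off from memory: `pos i q` is found through the pointer of operator
`i`. For literals it leads to an initial state, whose language is the labelling or its complement;
for all other properties it leads to the default block. -/
theorem setupCmd_spec (h : Prepared rules φ x s) {es es' : List (Entry nP nΓ nA)} {z : List ℕ}
    (hz : z ≠ []) (hE : Presents φ lab es es')
    (hx : x = nP :: nΓ :: rules.length :: (rules.flatMap encodeRule ++ (encodeFormula φ ++
      (es.length :: es.flatMap Entry.code ++ (es'.length :: es'.flatMap Entry.code ++ z))))) :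
    let s' := setupCmd.den s
    let N := (φ.size + 1) * nP + (statesOf es + statesOf es')
    (∃ pos, Static s'.reg s'.mem rules φ.size N (fun i => φ.pre[i]?) φ.second pos ∧
      Layout S lab φ.size N (fun i => φ.pre[i]?) φ.second pos
        (accepts (located ((φ.size + 1) * nP) (es ++ es')))) ∧
    Good nΓ s'.reg s'.mem N (fun _ _ => 0) s' ∧ x.length ≤ s'.reg 16 ∧ MemAt s'.mem 0 x ∧
    MemAt s'.mem (s'.reg 8) z ∧ s'.reg 8 + z.length ≤ s'.reg 16 ∧
    s'.reg 19 = (φ.size + 1) * nP ∧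
    s'.reg 20 = 3 + (rules.flatMap encodeRule).length + (encodeFormula φ).length ∧
    setupCmd.cost s ≤ 60 + (es.length + es'.length) * (90 + 20 * nP + 60 * φ.size) +
      (400 + 100 * nΓ + N * (100 + 2 ^ N * 40) + 15 * ((2 * nΓ + 2) * N)) := by
  intro s' N
  obtain ⟨a1, a2, a3, a4, a5, a6, a7, a8⟩ := walksCmd_spec h hz hx
  set s₁ := walksCmd.den s with hs₁
  set PB := 5 * x.length + 4 + ((φ.size + 1) + (es.length + es'.length)) * nP with hPB
  have b2 : s₁.reg 2 = nΓ := (a1 2 (by norm_num)).trans h.r2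
  obtain ⟨T, c2⟩ := tablesCmd_spec (s := s₁) (G := nΓ) (N := N) b2 a4
  have hs' : s' = tablesCmd.den s₁ := rfl
  rw [← hs'] at T
  have hcost : setupCmd.cost s = walksCmd.cost s + tablesCmd.cost s₁ := rfl
  clear_value s' s₁
  have hlow : ∀ r < 32, r ∉ [5, 6, 7, 8, 14, 15, 16, 17, 18] → s'.reg r = s.reg r :=
    fun r hr hl => (T.low r hr hl).trans (a1 r (by omega))
  have r16 := T.r16
  rw [a5] at r16
  have hmul : (φ.size + 1) * nP ≤ ((φ.size + 1) + (es.length + es'.length)) * nP :=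
    Nat.mul_le_mul_right _ (by omega)
  have m1 : ∀ a < PB, s'.mem a = s₁.mem a := fun a ha => T.mem a (.inl (by omega))
  have m2 : ∀ a, (a < 4 * x.length + 3 ∨ 4 * x.length + 3 + φ.size ≤ a) →
      a < 5 * x.length + 4 + (φ.size + 1) * nP → s'.mem a = s.mem a := fun a ha ha' => by
    rw [m1 a (by omega), a6 a ha (.inl ha')]
  have hlt := h.lt
  have hxm : MemAt s'.mem 0 x := (memAt_getD x).congr fun b _ hb => by
    rw [m2 b (by omega) (by omega), h.input b (by omega)]
  have r9 := (hlow 9 (by norm_num) (by decide)).trans h.r9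
  have r10 := (hlow 10 (by norm_num) (by decide)).trans h.r10
  have r11 := (hlow 11 (by norm_num) (by decide)).trans h.r11
  have r12 := (hlow 12 (by norm_num) (by decide)).trans h.r12
  have r14 := T.r14
  rw [a5] at r14
  have r15 := T.r15
  rw [a5] at r15
  have hpre : ∀ i < φ.size, ∃ ψ, φ.pre[i]? = some ψ := fun i hi =>
    ⟨_, List.getElem?_eq_getElem (by rwa [φ.length_pre])⟩
  have hlast : φ.pre[φ.size]? = none := List.getElem?_eq_none (by rw [φ.length_pre])
  have hnP : (φ.size + 1) * nP = φ.size * nP + nP := by ring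
  have hrow : ∀ i < φ.size, i * nP + nP ≤ φ.size * nP := fun i hi => by
    rw [← Nat.succ_mul]
    exact Nat.mul_le_mul_right _ hi
  -- A literal cannot be left at its default place, since an automaton is presented for each literal
  -- of the formula.
  have place : ∀ i, ∀ ψ, φ.pre[i]? = some ψ →
      s'.mem (4 * x.length + 3 + i) = 5 * x.length + 4 + i * nP ∧ ψ.tag ≠ 2 ∧ ψ.tag ≠ 3 ∨
      s'.mem (4 * x.length + 3 + i) + nP ≤ PB ∧ ∃ y ∈ located ((φ.size + 1) * nP) (es ++ es'),
        (y.1 ∈ es ∧ ψ.tag = 2 ∧ ψ.arg = (y.1.atom : ℕ) ∨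
          y.1 ∈ es' ∧ ψ.tag = 3 ∧ ψ.arg = (y.1.atom : ℕ)) ∧
        ∀ p : Fin nP, s'.mem (s'.mem (4 * x.length + 3 + i) + p) = y.2 + y.1.aut.init p := by
    intro i ψ hψ
    have hi : i < φ.size := by
      rw [← φ.length_pre]
      exact (List.getElem?_eq_some_iff.1 hψ).1
    have hcl := Formula.mem_cl_of_mem_pre (List.mem_of_getElem? hψ)
    rcases a7 i ψ hψ with ⟨g1, g2, g3⟩ | ⟨y, hy, g1, g2, g3⟩
    · refine .inl ⟨by rw [m1 _ (by omega), g1], fun ht => ?_, fun ht => ?_⟩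
      · obtain ⟨e, rfl, he⟩ := Formula.eq_atom ht
        obtain ⟨E, hE', rfl⟩ := hE.pos e hcl
        exact g2 E hE' ⟨ht, he⟩
      · obtain ⟨e, rfl, he⟩ := Formula.eq_natom ht
        obtain ⟨E, hE', rfl⟩ := hE.neg e hcl
        exact g3 E hE' ⟨ht, he⟩
    · rw [m1 (4 * x.length + 3 + i) (by omega)]
      refine .inr ⟨g1, y, hy, g2, fun p => ?_⟩
      rw [m1 _ (by omega)]
      exact g3 p
  refine ⟨⟨fun i q => s'.mem (s'.reg 12 + i) |> fun b => s'.mem (b + q), ?_, ?_⟩,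
    ⟨fun _ _ => rfl, fun _ _ => rfl, fun γ _ T' _ => ?_⟩, by omega, hxm, ?_, ?_, ?_, ?_, ?_⟩
  · constructor
    · exact (hlow 1 (by norm_num) (by decide)).trans h.r1
    · exact (hlow 2 (by norm_num) (by decide)).trans h.r2
    · exact (hlow 3 (by norm_num) (by decide)).trans h.r3
    · exact (hlow 4 (by norm_num) (by decide)).trans h.r4
    · exact T.r5
    · exact T.r6
    · exact T.r7
    · rw [T.r17, T.r14]
    · rw [T.r18, T.r14]
    · have := hxm
      rw [hx] at this
      obtain ⟨-, -, -, this⟩ := this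
      rw [memAt_append] at this
      exact this.1
    · have := congrArg List.length hx
      simp only [List.length_cons, List.length_append] at this
      omega
    · intro i hi
      rw [r9, m2 _ (by omega) (by omega)]
      rcases hi.lt_or_eq with hi | rfl
      · obtain ⟨ψ, hψ⟩ := hpre i hi
        simp only [hψ]
        exact h.tag i ψ hψ
      · simp only [hlast]
        exact h.tag_last
    · omega
    · intro i hi ht
      rw [r10, m2 _ (by omega) (by omega)]
      rcases hi.lt_or_eq with hi | rfl
      · obtain ⟨ψ, hψ⟩ := hpre i hi
        simp only [hψ] at ht ⊢
        obtain ⟨h1, h2⟩ := Formula.arg_eq_mode ht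
        rw [h.arg i ψ hψ h1, h2]
        rfl
      · simp only [hlast]
        exact h.arg_last
    · omega
    · intro i hi h4 h6 h7
      obtain ⟨ψ, hψ⟩ := hpre i hi
      simp only [hψ] at h4 h6 h7
      rw [r11, m2 _ (by omega) (by omega), h.next _ _ (Formula.pre_left hψ h4),
        Formula.second_eq hψ]
    · omega
    · omega
    · intro i hi q hq
      refine ⟨?_, rfl⟩
      rw [r12]
      rcases hi.lt_or_eq with hi' | rfl
      · obtain ⟨ψ, hψ⟩ := hpre i hi'
        have := hrow i hi'
        rcases place i ψ hψ with ⟨g1, -⟩ | ⟨g1, -⟩ <;> omega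
      · rw [m2 _ (by omega) (by omega), h.row _ le_rfl]
        omega
    · intro r hr
      rw [r14, ← a5]
      exact T.row r hr
    · omega
    · intro j hj
      rw [T.r15]
      exact T.pow j hj
    · omega
    · exact T.digit
  · refine ⟨hlast, hpre, fun i hi ψ hψ h4 => ?_, fun i hi ψ hψ h4 h6 h7 => ?_,
      fun i hi ht p hp => ?_, fun i hi ht p => ?_, ?_⟩
    · have := Formula.pre_left hψ h4
      refine ⟨?_, this⟩
      rw [← φ.length_pre]
      exact (List.getElem?_eq_some_iff.1 this).1
    · have := Formula.pre_right hψ h4 h6 h7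
      rw [Formula.second_eq hψ]
      refine ⟨by omega, ?_, this⟩
      rw [← φ.length_pre]
      exact (List.getElem?_eq_some_iff.1 this).1
    · simp only [r12]
      rcases hi.lt_or_eq with hi' | rfl
      · obtain ⟨ψ, hψ⟩ := hpre i hi'
        have := hrow i hi'
        simp only [hψ] at ht
        rcases place i ψ hψ with ⟨g1, -⟩ | ⟨-, y, -, g2, -⟩
        · rw [g1, Nat.add_assoc, m2 _ (by omega) (by omega), h.ident _ (by omega)]
        · rcases g2 with g2 | g2
          · exact absurd g2.2.1 ht.1
          · exact absurd g2.2.1 ht.2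
      · rw [m2 (4 * x.length + 3 + φ.size) (by omega) (by omega), h.row _ le_rfl, Nat.add_assoc,
          m2 _ (by omega) (by omega), h.ident _ (by omega)]
    · rcases hi.lt_or_eq with hi' | rfl
      · obtain ⟨ψ, hψ⟩ := hpre i hi'
        simp only [hψ] at ht ⊢
        rcases place i ψ hψ with ⟨-, g1⟩ | ⟨-, y, hy, g2, g3⟩
        · exact absurd g1 ht
        · have hy' := mem_located hy
          rw [statesOf_append] at hy'
          rw [r12, g3 p]
          refine ⟨by omega, by omega, fun w => ?_⟩
          rw [accepts_iff hy hE.trans]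
          have hl : (∃ f ∈ y.1.aut.final, y.1.aut.Reach (y.1.aut.init p) w f) ↔
            (p, w) ∈ y.1.aut.language := Iff.rfl
          rw [hl]
          rcases g2 with ⟨g2, g4, g5⟩ | ⟨g2, g4, g5⟩
          · obtain ⟨e, rfl, he⟩ := Formula.eq_atom g4
            obtain rfl : e = y.1.atom := Fin.ext (by rw [← he, g5])
            rw [hE.language _ g2]
            rfl
          · obtain ⟨e, rfl, he⟩ := Formula.eq_natom g4
            obtain rfl : e = y.1.atom := Fin.ext (by rw [← he, g5])
            rw [hE.language' _ g2]
            rfl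
      · simp only [hlast] at ht
        exact absurd (by simp [ctag]) ht
    · omega
  -- The region of the table has not been written so far, so it represents the zero table.
  · rw [T.mem _ (.inr (by omega)), a6 _ (.inr (by omega)) (.inr (by omega)), h.free _ (by omega)]
  · rw [T.r8]
    exact a2.congr fun b hb hb' => m1 b (by omega)
  · rw [T.r8]
    omega
  · exact (hlow 19 (by norm_num) (by decide)).trans h.r19
  · exact (hlow 20 (by norm_num) (by decide)).trans h.r20
  · omega

end Setup

/-! ### The initial table -/

section Load

variable {nP nΓ nA : ℕ} {ρ m : ℕ → ℕ} {rules : List (Rule (Fin nP) (Fin nΓ))} {F N : ℕ}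
  {comp : ℕ → Option (Formula (Fin nA))} {rc : ℕ → ℕ} {pos : ℕ → ℕ → ℕ} {t : Tab} {s : State}
  {Q : ℕ → ℕ → ℕ → Prop}

theorem walk_tabBody (h : Adds nΓ ρ m N t Q s) (H : Static ρ m rules F N comp rc pos) {kind X D : ℕ}
    {es : List (Entry nP nΓ nA)}
    (hm : MemAt s.mem (s.reg 61) (es.length :: es.flatMap Entry.code))
    (hX : s.reg 61 + 1 + (es.flatMap Entry.code).length ≤ X) (hX' : X ≤ ρ 16)
    (hN : s.reg 62 + statesOf es ≤ N) (hD : ∀ E ∈ es, E.trans.length ≤ D) :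
    let s' := (walk (num kind) tabBody).den s
    Adds nΓ ρ m N t (fun γ T b => Q γ T b ∨ ∃ x ∈ located (s.reg 62) es, Digit N x.1 x.2 γ T b) s' ∧
    s'.reg 61 = s.reg 61 + 1 + (es.flatMap Entry.code).length ∧
    s'.reg 62 = s.reg 62 + statesOf es ∧
    (walk (num kind) tabBody).cost s ≤
      20 + es.length * (100 + 130 * N + D * (40 + 2 ^ N * 125)) := by
  intro s'
  have hreg : ∀ r < 32, s.reg r = ρ r := by
    obtain ⟨t', h1, -⟩ := h
    exact h1.reg
  obtain ⟨h2, -, h3, h4, h5⟩ := walk_spec (body := tabBody) rfl (by decide) (kind := kind)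
    ((hreg 1 (by norm_num)).trans H.rP) hm hX
    -- The walk reports on the memory only. Since the table depends on registers below 32 alone, and
    -- these do not change, the registers of the start may be put in.
    (fun l m' _ => Adds nΓ ρ m N t
      (fun γ T b => Q γ T b ∨ ∃ x ∈ located (s.reg 62) l, Digit N x.1 x.2 γ T b) ⟨s.reg, m'⟩)
    (30 + 130 * N + D * (40 + 2 ^ N * 125))
    (h.congr fun γ T b => by simp [located]) (by
      rintro l E s₁ ⟨l', hl⟩ hr - - hE g1
      have hst : statesOf l + E.aut.states ≤ statesOf es := by
        rw [← hl, statesOf_append, statesOf_append, statesOf_cons]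
        omega
      have hmem : E ∈ es := by
        rw [← hl]
        simp
      have g1' : Adds nΓ ρ m N t _ s₁ := g1.of_eq (s' := s₁) hr rfl
      obtain ⟨k1, k2⟩ := tabBody_spec g1' H hE hX' (by omega)
      refine ⟨?_, fun a ha => ?_, k2.trans ?_⟩
      · refine (k1.of_eq (s' := ⟨s.reg, (tabBody.den s₁).mem⟩) (fun r hr' => ?_) rfl).congr
          fun γ T b => ?_
        · rw [reg_den (K := 32) (c := tabBody) rfl _ hr', hr r hr']
        · rw [located_append, or_assoc]
          simp [located, or_and_right, exists_or]
      · rw [k1.mem (by omega), g1'.mem (by omega)]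
      · have := Nat.mul_le_mul_right (40 + 2 ^ N * 125) (hD E hmem)
        omega)
  refine ⟨h2.of_eq (fun r hr => ?_) rfl, h3, h4, h5.trans (Nat.add_le_add_left
    (Nat.mul_le_mul_left _ (by omega)) _)⟩
  exact reg_den (c := walk (num kind) tabBody) (K := 32) rfl s hr

/-- Write the digits of all automata into the table. -/
def loadCmd : Cmd :=
  (asg 61 (reg 20) ;; asg 62 (reg 19)) ;; walk (num 2) tabBody ;; walk (num 3) tabBody

/-- The second passage through the automata starts from the same address and the same shift as the
one that placed the atoms, so the digits written here are those to which the atoms point. -/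
theorem loadCmd_spec (h : Good nΓ ρ m N (fun _ _ => 0) s) (H : Static ρ m rules F N comp rc pos)
    {φ : Formula (Fin nA)} {x z : List ℕ} {es es' : List (Entry nP nΓ nA)} {o D : ℕ}
    (hxm : MemAt m 0 x) (hxl : x.length ≤ ρ 16)
    (hx : x = nP :: nΓ :: rules.length :: (rules.flatMap encodeRule ++ (encodeFormula φ ++
      (es.length :: es.flatMap Entry.code ++ (es'.length :: es'.flatMap Entry.code ++ z)))))
    (h19 : ρ 19 = o)
    (h20 : ρ 20 = 3 + (rules.flatMap encodeRule).length + (encodeFormula φ).length)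
    (hN : o + (statesOf es + statesOf es') = N) (hD : ∀ E ∈ es ++ es', E.trans.length ≤ D) :
    (∃ t, Good nΓ ρ m N t (loadCmd.den s) ∧ t.Bdd (2 * nΓ + 2) N ∧
      ∀ γ T b, (t γ T).testBit b = true ↔ ∃ y ∈ located o (es ++ es'), Digit N y.1 y.2 γ T b) ∧
    loadCmd.cost s ≤ 60 + (es.length + es'.length) *
      (100 + 130 * N + D * (40 + 2 ^ N * 125)) := by
  have hm := hxm
  rw [hx] at hm
  obtain ⟨-, -, -, hm⟩ := hm
  rw [memAt_append, memAt_append, memAt_append, memAt_append] at hm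
  obtain ⟨-, -, hm1, hm2, hm3⟩ := hm
  have hlen : x.length = 3 + (rules.flatMap encodeRule).length + (encodeFormula φ).length +
      (1 + (es.flatMap Entry.code).length) + (1 + (es'.flatMap Entry.code).length) + z.length := by
    conv_lhs => rw [hx]
    simp only [List.length_cons, List.length_append]
    omega
  have l1 : (es.length :: es.flatMap Entry.code).length = 1 + (es.flatMap Entry.code).length := by
    rw [List.length_cons, Nat.add_comm]
  have l2 : (es'.length :: es'.flatMap Entry.code).length = 1 + (es'.flatMap Entry.code).length := by
    rw [List.length_cons, Nat.add_comm]
  set s₁ := (asg 61 (reg 20) ;; asg 62 (reg 19)).den s with hs₁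
  have a61 : s₁.reg 61 = 3 + (rules.flatMap encodeRule).length + (encodeFormula φ).length := by
    simp [hs₁, den, State.set_reg, h.reg 20 (by norm_num), h20]
  have a62 : s₁.reg 62 = o := by simp [hs₁, den, State.set_reg, h.reg 19 (by norm_num), h19]
  have ah : Adds nΓ ρ m N (fun _ _ => 0) (fun _ _ _ => False) s₁ := by
    refine ⟨fun _ _ => 0, h.of_eq (fun r hr => reg_den (K := 60) rfl _ (by omega)) rfl,
      fun _ _ _ _ => by positivity, fun γ T b => by simp⟩
  obtain ⟨b1, b2, b3, b4⟩ := walk_tabBody (kind := 2) (X := x.length) (es := es) (D := D) ah H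
    (by
      rw [a61]
      exact hm1.congr fun b _ hb => ah.mem (by omega)) (by omega) hxl (by omega)
    (fun E hE => hD E (List.mem_append_left _ hE))
  set s₂ := (walk (num 2) tabBody).den s₁ with hs₂
  obtain ⟨c1, c2, c3, c4⟩ := walk_tabBody (kind := 3) (X := x.length) (es := es') (D := D) b1 H
    (by
      rw [b2, a61, Nat.add_assoc _ 1, ← l1, ← Nat.zero_add (_ + _)]
      rw [show (0 : ℕ) + (3 + (rules.flatMap encodeRule).length + (encodeFormula φ).length +
        (es.length :: es.flatMap Entry.code).length) = 0 + 1 + 1 + 1 +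
        (rules.flatMap encodeRule).length + (encodeFormula φ).length +
        (es.length :: es.flatMap Entry.code).length by omega]
      exact hm2.congr fun b _ hb => b1.mem (by omega)) (by omega) hxl (by omega)
    (fun E hE => hD E (List.mem_append_right _ hE))
  refine ⟨?_, ?_⟩
  · obtain ⟨t', d1, d2, d3⟩ := c1
    refine ⟨t', d1, d2, fun γ T b => ?_⟩
    rw [d3, located_append, b3, a62]
    simp [or_and_right, exists_or]
  · have : loadCmd.cost s = 8 + ((walk (num 2) tabBody).cost s₁ + (walk (num 3) tabBody).cost s₂) :=
      rfl
    rw [Nat.add_mul]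
    omega

end Load

/-! ### The running time -/

/-- The sum of the running times of the parts of the program. -/
def totalCost (P G R F N E d w L : ℕ) : ℕ :=
  (400 + 81 * R + 150 * L + 105 * F + (F + 1) * (50 + 30 * P)) +
  (60 + E * (90 + 20 * P + 60 * F) +
      (400 + 100 * G + N * (100 + 2 ^ N * 40) + 15 * ((2 * G + 2) * N))) +
  (60 + E * (100 + 130 * N + d * (40 + 2 ^ N * 125))) +
  ((2 * G + 2) * N * 2 ^ N + 1) * (G + 1) * 2 ^ N * P * (240 + 230 * R) +
  (10 + (F + 1) * (110 + ((2 * G + 2) * N * 2 ^ N + 1) * (G + 1) * 2 ^ N *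
      P * (2040 + 700 * P * R))) +
  (300 + 21 * w)

/-- With n = PF + k and A = 2^n, the stages cost about g n 2^N sweeps of g 2^N P entries at P r
each, for F + 1 properties, that is g² n F P² r A⁴; everything else that is free of d and w is
bounded by the same monomial `U`. The automata contribute n A² d and the final query w. All three
are dominated by the corresponding terms of the bound, in which A occurs with exponent 5. -/
theorem totalCost_le {P G R F N E d w L k : ℕ} (hP : 0 < P) (hF : 0 < F)
    (hN : N = (F + 1) * P + k) (hE : E ≤ k) (hEP : E * P ≤ k)
    (hL : L ≤ 10 + 5 * R + 2 * F + 5 * k + 3 * d + w) :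
    totalCost P G R F N E d w L ≤ 200000 * timeBound P (max 1 G) (max 1 R) F k d w := by
  set g := max 1 G with hg
  set r := max 1 R with hr
  have hg0 : 0 < g := by omega
  have hr0 : 0 < r := by omega
  have hG : G ≤ g := by omega
  have hR : R ≤ r := by omega
  obtain ⟨n, hn⟩ : ∃ n, n = P * F + k := ⟨_, rfl⟩
  obtain ⟨A, hA⟩ : ∃ A, A = 2 ^ n := ⟨_, rfl⟩
  have hPF : P ≤ P * F := Nat.le_mul_of_pos_right _ hF
  have hn0 : 0 < n := by
    have := Nat.mul_pos hP hF
    omega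
  have hPn : P ≤ n := by omega
  have hA0 : 0 < A := by
    rw [hA]
    positivity
  -- The additional run property costs only `P` more digits, and `P ≤ n`; hence `2 ^ N ≤ A ^ 2`.
  have hNn : N ≤ 2 * n := by
    rw [hN, hn, Nat.add_mul, Nat.mul_comm F P]
    omega
  have hX : 2 ^ N ≤ A ^ 2 := by
    rw [hA, ← pow_mul]
    exact Nat.pow_le_pow_right (by norm_num) (by omega)
  obtain ⟨X, hXd⟩ : ∃ X, X = 2 ^ N := ⟨_, rfl⟩
  rw [← hXd] at hX
  obtain ⟨U, hU⟩ : ∃ U, U = n ^ 2 * g ^ 2 * F ^ 2 * P * r * A ^ 4 := ⟨_, rfl⟩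
  have hB : timeBound P g r F k d w =
      n ^ 2 * g ^ 2 * F ^ 2 * P * r * A ^ 5 + n ^ 2 * g * F * d * A ^ 5 + n ^ 2 * g * F * A * w := by
    rw [timeBound, ← hn, Nat.mul_comm 5 n, pow_mul, ← hA]
    ring
  have hUB : U ≤ n ^ 2 * g ^ 2 * F ^ 2 * P * r * A ^ 5 := by
    rw [hU]
    exact Nat.mul_le_mul_left _ (Nat.pow_le_pow_right hA0 (by norm_num))
  have hdB : n * A ^ 2 * d ≤ n ^ 2 * g * F * d * A ^ 5 :=
    (Nat.le_mul_of_pos_right _ (show 0 < n * g * F * A ^ 3 by positivity)).trans_eq (by ring)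
  have hd : d ≤ n * A ^ 2 * d := Nat.le_mul_of_pos_left _ (by positivity)
  have hw : w ≤ n ^ 2 * g * F * A * w := Nat.le_mul_of_pos_left _ (by positivity)
  have u1 : 1 ≤ U := by
    rw [hU]
    exact Nat.succ_le_of_lt (by positivity)
  have ur : r ≤ U := by
    rw [hU]
    exact (Nat.le_mul_of_pos_right r
      (show 0 < n ^ 2 * g ^ 2 * F ^ 2 * P * A ^ 4 by positivity)).trans_eq (by ring)
  have ug : g ≤ U := by
    rw [hU]
    exact (Nat.le_mul_of_pos_right g
      (show 0 < n ^ 2 * g * F ^ 2 * P * r * A ^ 4 by positivity)).trans_eq (by ring)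
  have uF : F ≤ U := by
    rw [hU]
    exact (Nat.le_mul_of_pos_right F
      (show 0 < n ^ 2 * g ^ 2 * F * P * r * A ^ 4 by positivity)).trans_eq (by ring)
  have uFP : F * P ≤ U := by
    rw [hU]
    exact (Nat.le_mul_of_pos_right (F * P)
      (show 0 < n ^ 2 * g ^ 2 * F * r * A ^ 4 by positivity)).trans_eq (by ring)
  have unF : n * F ≤ U := by
    rw [hU]
    exact (Nat.le_mul_of_pos_right (n * F)
      (show 0 < n * g ^ 2 * F * P * r * A ^ 4 by positivity)).trans_eq (by ring)
  have un : n ≤ n * F := Nat.le_mul_of_pos_right _ hF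
  have ugn : g * n ≤ U := by
    rw [hU]
    exact (Nat.le_mul_of_pos_right (g * n)
      (show 0 < n * g * F ^ 2 * P * r * A ^ 4 by positivity)).trans_eq (by ring)
  have unn : n * n ≤ U := by
    rw [hU]
    exact (Nat.le_mul_of_pos_right (n * n)
      (show 0 < g ^ 2 * F ^ 2 * P * r * A ^ 4 by positivity)).trans_eq (by ring)
  have unA : n * A ^ 2 ≤ U := by
    rw [hU]
    exact (Nat.le_mul_of_pos_right (n * A ^ 2)
      (show 0 < n * g ^ 2 * F ^ 2 * P * r * A ^ 2 by positivity)).trans_eq (by ring)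
  -- One factor `P` is traded for `n * F`.
  have uM : g ^ 2 * n * F * P ^ 2 * r * A ^ 4 ≤ U := by
    have : g ^ 2 * n * F * P ^ 2 * r * A ^ 4 ≤ g ^ 2 * n * F * (P * (n * F)) * r * A ^ 4 := by
      rw [pow_two P]
      gcongr
      omega
    rw [hU]
    exact this.trans_eq (by ring)
  have hEn : E ≤ n := by omega
  have hkn : k ≤ n := by omega
  -- the loops over the table
  have t1 : (2 * G + 2) * N * X + 1 ≤ 9 * (g * n * A ^ 2) := by
    have h1 : (2 * G + 2) * N * X ≤ (4 * g) * (2 * n) * A ^ 2 := by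
      gcongr
      omega
    have h2 : 0 < g * n * A ^ 2 := by positivity
    have h3 : (4 * g) * (2 * n) * A ^ 2 = 8 * (g * n * A ^ 2) := by ring
    omega
  have t2 : ((2 * G + 2) * N * X + 1) * (G + 1) * X * P ≤
      9 * (g * n * A ^ 2) * (2 * g) * A ^ 2 * P := by
    gcongr
    omega
  have t3 : ((2 * G + 2) * N * X + 1) * (G + 1) * X * P * (240 + 230 * R) ≤ 8460 * U := by
    calc _ ≤ 9 * (g * n * A ^ 2) * (2 * g) * A ^ 2 * P * (470 * r) :=
          Nat.mul_le_mul t2 (by omega)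
      _ = 8460 * (g ^ 2 * n * 1 * (P * 1) * r * A ^ 4) := by ring
      _ ≤ 8460 * (g ^ 2 * n * F * (P * P) * r * A ^ 4) := by gcongr <;> omega
      _ = 8460 * (g ^ 2 * n * F * P ^ 2 * r * A ^ 4) := by ring
      _ ≤ 8460 * U := Nat.mul_le_mul_left _ uM
  have t4 : (F + 1) * (110 + ((2 * G + 2) * N * X + 1) * (G + 1) * X * P *
      (2040 + 700 * P * R)) ≤ 98860 * U := by
    have h1 : 2040 + 700 * P * R ≤ 2740 * (P * r) := by
      have h2 : 700 * P * R ≤ 700 * (P * r) := by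
        rw [Nat.mul_assoc]
        gcongr
      have h3 : 0 < P * r := by positivity
      omega
    calc _ ≤ (2 * F) * (110 + 9 * (g * n * A ^ 2) * (2 * g) * A ^ 2 * P * (2740 * (P * r))) := by
          gcongr
          omega
      _ = 220 * F + 98640 * (g ^ 2 * n * F * P ^ 2 * r * A ^ 4) := by ring
      _ ≤ 220 * U + 98640 * U := by gcongr
      _ = 98860 * U := by ring
  -- the other parts
  have t5 : E * (100 + 130 * N + d * (40 + X * 125)) ≤ 360 * U + 165 * (n * A ^ 2 * d) := by
    calc _ ≤ n * (100 * n + 130 * (2 * n) + d * (40 * A ^ 2 + A ^ 2 * 125)) := by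
          gcongr
          · omega
          · exact Nat.le_mul_of_pos_right _ (by positivity)
      _ = 360 * (n * n) + 165 * (n * A ^ 2 * d) := by ring
      _ ≤ _ := by gcongr
  have t6 : E * (90 + 20 * P + 60 * F) ≤ 170 * U := by
    calc _ = 90 * E + 20 * (E * P) + 60 * (E * F) := by ring
      _ ≤ 170 * U := by
          have h1 : E * F ≤ n * F := Nat.mul_le_mul_right _ hEn
          omega
  have t7 : N * (100 + X * 40) ≤ 280 * U := by
    calc _ ≤ (2 * n) * (100 * A ^ 2 + A ^ 2 * 40) := by
          gcongr
          exact Nat.le_mul_of_pos_right _ (by positivity)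
      _ = 280 * (n * A ^ 2) := by ring
      _ ≤ 280 * U := by gcongr
  have t8 : 15 * ((2 * G + 2) * N) ≤ 120 * U := by
    calc _ ≤ 15 * ((4 * g) * (2 * n)) := by
          gcongr
          omega
      _ = 120 * (g * n) := by ring
      _ ≤ _ := by gcongr
  have t9 : (F + 1) * (50 + 30 * P) ≤ 160 * U := by
    calc _ ≤ (2 * F) * (50 * P + 30 * P) := by
          gcongr
          · omega
          · exact Nat.le_mul_of_pos_right _ hP
      _ = 160 * (F * P) := by ring
      _ ≤ _ := by gcongr
  rw [hB, totalCost, ← hXd]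
  clear_value g r
  clear hB hX hXd hU hA hn hN
  generalize n ^ 2 * g ^ 2 * F ^ 2 * P * r * A ^ 5 = B₁ at *
  generalize n ^ 2 * g * F * d * A ^ 5 = B₂ at *
  generalize n ^ 2 * g * F * A * w = B₃ at *
  omega

/-! ### The program -/

section Program

variable {nP nΓ nA : ℕ}

/-- The whole program. -/
def program : Cmd :=
  prepareCmd ;; setupCmd ;; loadCmd ;; fix popBody ;; stagesCmd ;; answerCmd

theorem program_den (s : State) : program.den s = answerCmd.den (stagesCmd.den
    ((fix popBody).den (loadCmd.den (setupCmd.den (prepareCmd.den s))))) := by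
  rw [program, Cmd.den, Cmd.den, Cmd.den, Cmd.den, Cmd.den]

theorem program_cost (s : State) : program.cost s = prepareCmd.cost s +
    (setupCmd.cost (prepareCmd.den s) + (loadCmd.cost (setupCmd.den (prepareCmd.den s)) +
      ((fix popBody).cost (loadCmd.den (setupCmd.den (prepareCmd.den s))) +
        (stagesCmd.cost ((fix popBody).den (loadCmd.den (setupCmd.den (prepareCmd.den s)))) +
          answerCmd.cost (stagesCmd.den ((fix popBody).den (loadCmd.den (setupCmd.den
            (prepareCmd.den s))))))))) := by
  rw [program, Cmd.cost, Cmd.cost, Cmd.cost, Cmd.cost, Cmd.cost]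

/-- The phases are chained through the table: automaton digits, then popping relation, then the
properties. Each phase leaves intact what the earlier ones have established. -/
theorem program_spec {S : PDS (Fin nP) (Fin nΓ)} {lab : Fin nA → Set (Conf (Fin nP) (Fin nΓ))}
    {φ : Formula (Fin nA)} {rules : List (Rule (Fin nP) (Fin nΓ))} {es es' : List (Entry nP nΓ nA)}
    {c : Conf (Fin nP) (Fin nΓ)} {x : List ℕ} {D : ℕ} (hR : ∀ r, r ∈ rules ↔ r ∈ S.Δ)
    (hE : Presents φ lab es es') (hD : ∀ E ∈ es ++ es', E.trans.length ≤ D)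
    (hx : x = nP :: nΓ :: rules.length :: (rules.flatMap encodeRule ++ (encodeFormula φ ++
      (es.length :: es.flatMap Entry.code ++ (es'.length :: es'.flatMap Entry.code ++
        (c.1 : ℕ) :: encodeWord c.2))))) :
    (program.compile 0).AnswersWithin x (S.Sat lab φ c)
      (totalCost nP nΓ (rules.map Rule.size).sum φ.size
        ((φ.size + 1) * nP + (statesOf es + statesOf es')) (es.length + es'.length) D c.2.length
        x.length) := by
  have hP : 0 < nP := c.1.pos
  have hF := φ.size_pos
  have hz : (c.1 : ℕ) :: encodeWord c.2 ≠ [] := by simp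
  obtain ⟨a1, a2⟩ := prepareCmd_spec (rules := rules) (φ := φ) (by simp) hx
  set s₁ := prepareCmd.den (State.start x) with hs₁
  obtain ⟨⟨pos, b1, b2⟩, b3, b4, b5, b6, b7, b8, b9, b10⟩ := setupCmd_spec (S := S) a1 hz hE hx
  set s₂ := setupCmd.den s₁ with hs₂
  set N := (φ.size + 1) * nP + (statesOf es + statesOf es') with hN
  obtain ⟨⟨t, d1, d2, d3⟩, d4⟩ := loadCmd_spec b3 b1 b5 b4 hx b8 b9 hN.symm hD
  set s₃ := loadCmd.den s₂ with hs₃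
  have hN2 : 2 * nP ≤ N := by
    have : 2 * nP ≤ (φ.size + 1) * nP := Nat.mul_le_mul_right _ (by omega)
    omega
  -- The automata write only to the rows of letters and of the empty stack, so the popping half
  -- starts empty, which is sound.
  have hlow : ∀ γ T b, nΓ < γ → (t γ T).testBit b = false := by
    intro γ T b hγ
    rw [← Bool.not_eq_true, d3]
    rintro ⟨y, -, ⟨h, -⟩ | ⟨τ, -, -, h, -⟩⟩
    · omega
    · have := τ.2.1.2
      omega
  have hsound : PopSound S N t := by
    refine ⟨fun γ T _ q h => ?_, fun γ T q => ?_⟩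
    · rw [Tab.low, hlow _ _ _ (by omega)] at h
      cases h
    · rw [Tab.low, hlow _ _ _ (by omega), hlow _ _ _ (by omega)]
  obtain ⟨⟨t₁, e1, e2, e3, e4⟩, e5⟩ := popStage b1 hN2 hR hP d1 d2 hsound
  set s₄ := (fix popBody).den s₃ with hs₄
  have hok : TabOK S lab φ.size N (fun i => φ.pre[i]?) pos
      (accepts (located ((φ.size + 1) * nP) (es ++ es'))) (φ.size + 1) t :=
    tabOK_of_digits (by rw [statesOf_append]) d3
  have hok₁ : TabOK S lab φ.size N (fun i => φ.pre[i]?) pos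
      (accepts (located ((φ.size + 1) * nP) (es ++ es'))) (φ.size + 1) t₁ := by
    refine ⟨fun γ T w hT h => ?_, ?_⟩
    · rw [e3 _ _ γ.2.le]
      exact hok.cons γ T w hT h
    · rw [e3 _ _ le_rfl]
      exact hok.nil
  -- Digits of automaton states begin at `(φ.size + 1) * nP`, above all digits of the properties
  -- that are still to be evaluated.
  have hun : Unset nP nΓ N (fun i => φ.pre[i]?) pos (φ.size + 1) t₁ := by
    intro j hj ht p hp γ hγ T _
    rw [e3 _ _ hγ, b2.pos_eq j (by omega) ht p hp, ← Bool.not_eq_true, d3]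
    have hj' : j * nP + p < (φ.size + 1) * nP := by
      have : (j + 1) * nP ≤ (φ.size + 1) * nP := Nat.mul_le_mul_right _ hj
      rw [Nat.succ_mul] at this
      omega
    rintro ⟨y, hy, ⟨-, -, q, -, h⟩ | ⟨τ, -, -, -, h, -⟩⟩ <;>
    · have := (mem_located hy).2.1
      omega
  obtain ⟨⟨t₂, f1, f2, f3⟩, f4⟩ := stagesCmd_spec b2 hF e1 b1 hR hP e2 e4 hok₁ hun
  set s₅ := stagesCmd.den s₄ with hs₅
  have hquery : MemAt s₅.mem (s₅.reg 8) ((c.1 : ℕ) :: encodeWord c.2) := by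
    rw [f1.reg 8 (by norm_num)]
    exact b6.congr fun b _ hb => f1.mem b (by omega)
  obtain ⟨g1, g2, g3⟩ := answerCmd_spec f1 b1 b2 f2 f3 hquery
  have h0 : φ.pre[0]? = some φ := by rw [Formula.pre_eq, List.getElem?_cons_zero]
  simp only [h0] at g1 g2
  have hd : program.den (State.start x) = answerCmd.den s₅ := by
    rw [program_den]
  have hcost := program_cost (State.start x)
  rw [← hs₁, ← hs₂, ← hs₃, ← hs₄, ← hs₅] at hcost
  clear_value s₅ s₄ s₃ s₂ s₁
  refine Cmd.answers ?_ (fun h => ?_) (fun h => ?_)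
  · rw [hcost, totalCost, ← Nat.add_assoc, ← Nat.add_assoc, ← Nat.add_assoc, ← Nat.add_assoc]
    exact Nat.add_le_add (Nat.add_le_add (Nat.add_le_add (Nat.add_le_add (Nat.add_le_add a2 b10) d4)
      e5) f4) g3
  · rw [hd]
    exact g1 h
  · rw [hd]
    exact g2 h

end Program

/-! ### Complements of regular sets -/

section Complement

variable {P Γ : Type}

theorem MultiAutomaton.reach_nil_iff {A : MultiAutomaton P Γ} {q q' : Fin A.states} :
    A.Reach q [] q' ↔ q = q' := by
  constructor
  · rintro ⟨⟩
    rfl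
  · rintro rfl
    exact .nil _

theorem MultiAutomaton.reach_cons_iff {A : MultiAutomaton P Γ} {q q' : Fin A.states} {γ : Γ}
    {w : List Γ} : A.Reach q (γ :: w) q' ↔ ∃ p, (q, γ, p) ∈ A.δ ∧ A.Reach p w q' := by
  constructor
  · rintro (_ | ⟨h, h'⟩)
    exact ⟨_, h, h'⟩
  · rintro ⟨p, h, h'⟩
    exact .cons h h'

variable [Fintype P] [Fintype Γ]

open Classical in
/-- A numbering of the states of the complement: the sets of states of `A`, and initial states that
are not entered again. -/
noncomputable def MultiAutomaton.setStates (A : MultiAutomaton P Γ) :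
    P ⊕ Finset (Fin A.states) ≃ Fin (Fintype.card (P ⊕ Finset (Fin A.states))) :=
  Fintype.equivFin _

/-- The set of states of `A` for which a state of the complement stands. -/
def MultiAutomaton.subset (A : MultiAutomaton P Γ) : P ⊕ Finset (Fin A.states) → Finset (Fin A.states)
  | .inl p => {A.init p}
  | .inr X => X

open Classical in
/-- The states that are entered from a set of states by reading a letter. -/
noncomputable def MultiAutomaton.image (A : MultiAutomaton P Γ) (X : Finset (Fin A.states)) (γ : Γ) :
    Finset (Fin A.states) :=
  Finset.univ.filter fun q => ∃ p ∈ X, (p, γ, q) ∈ A.δ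

open Classical in
/-- The subset construction, with the final states complemented. -/
noncomputable def MultiAutomaton.compl (A : MultiAutomaton P Γ) : MultiAutomaton P Γ where
  states := Fintype.card (P ⊕ Finset (Fin A.states))
  δ := Finset.univ.filter fun τ =>
    τ.2.2 = A.setStates (.inr (A.image (A.subset (A.setStates.symm τ.1)) τ.2.1))
  init := ⟨fun p => A.setStates (.inl p), fun p q h => by simpa using h⟩
  final := Finset.univ.filter fun q => ∀ s ∈ A.subset (A.setStates.symm q), s ∉ A.final

/-- The state of the complement with a given name. -/
noncomputable def MultiAutomaton.toCompl (A : MultiAutomaton P Γ)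
    (x : P ⊕ Finset (Fin A.states)) : Fin A.compl.states := A.setStates x

theorem MultiAutomaton.mem_compl_final {A : MultiAutomaton P Γ} {x : P ⊕ Finset (Fin A.states)} :
    A.toCompl x ∈ A.compl.final ↔ ∀ s ∈ A.subset x, s ∉ A.final := by
  refine Finset.mem_filter.trans ?_
  rw [toCompl, Equiv.symm_apply_apply]
  exact and_iff_right (Finset.mem_univ _)

theorem MultiAutomaton.mem_compl_δ {A : MultiAutomaton P Γ} {x : P ⊕ Finset (Fin A.states)} {γ : Γ}
    {q : Fin A.compl.states} :
    (A.toCompl x, γ, q) ∈ A.compl.δ ↔ q = A.toCompl (.inr (A.image (A.subset x) γ)) := by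
  refine Finset.mem_filter.trans ?_
  dsimp only
  rw [toCompl, Equiv.symm_apply_apply]
  exact and_iff_right (Finset.mem_univ _)

/-- The complement automaton is deterministic and total, so it accepts exactly when the set reached
at the end contains no final state. The induction on the word needs the claim for every state,
standing for a set of states of `A`. -/
theorem MultiAutomaton.exists_reach_compl (A : MultiAutomaton P Γ) (w : List Γ)
    (x : P ⊕ Finset (Fin A.states)) :
    (∃ q ∈ A.compl.final, A.compl.Reach (A.toCompl x) w q) ↔
      ∀ s ∈ A.subset x, ¬ ∃ q ∈ A.final, A.Reach s w q := by
  classical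
  induction w generalizing x with
  | nil =>
    simp only [reach_nil_iff, exists_eq_right', mem_compl_final]
  | cons γ w ih =>
    have key : (∃ q ∈ A.compl.final, A.compl.Reach (A.toCompl x) (γ :: w) q) ↔
        ∃ q ∈ A.compl.final, A.compl.Reach (A.toCompl (.inr (A.image (A.subset x) γ))) w q := by
      simp only [reach_cons_iff, mem_compl_δ, exists_eq_left]
    rw [key, ih]
    constructor
    · rintro h s hs ⟨q, hq, h'⟩
      obtain ⟨r, e, e'⟩ := reach_cons_iff.1 h'
      exact h r (Finset.mem_filter.2 ⟨Finset.mem_univ _, s, hs, e⟩) ⟨q, hq, e'⟩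
    · rintro h s hs ⟨q, hq, h'⟩
      obtain ⟨p, hp, e⟩ := (Finset.mem_filter.1 hs).2
      exact h p hp ⟨q, hq, .cons e h'⟩

theorem MultiAutomaton.language_compl (A : MultiAutomaton P Γ) :
    A.compl.language = A.languageᶜ := by
  ext ⟨p, w⟩
  refine (A.exists_reach_compl w (.inl p)).trans ?_
  simp [MultiAutomaton.subset, MultiAutomaton.language]

theorem exists_automata {ι : Type} {L : ι → Set (Conf P Γ)} (h : ∀ i, IsRegularSet (L i)) :
    ∃ M M' : ι → MultiAutomaton P Γ,
      (∀ i, (M i).language = L i) ∧ ∀ i, (M' i).language = (L i)ᶜ := by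
  choose M hM using h
  exact ⟨M, fun i => (M i).compl, hM, fun i => by rw [(M i).language_compl, hM]⟩

end Complement

/-! ### From the encoded input to the time bound -/

section Input

variable {nP nΓ nA : ℕ}

theorem Enumerates.sum_map {α : Type} {l : List α} {s : Finset α} (h : Enumerates l s) (f : α → ℕ) :
    (l.map f).sum = ∑ a ∈ s, f a := by
  classical
  have : s = l.toFinset := by
    ext a
    rw [List.mem_toFinset, h.2]
  rw [this, List.sum_toFinset _ h.1]

theorem Enumerates.length_eq {α : Type} {l : List α} {s : Finset α} (h : Enumerates l s) :
    l.length = s.card := by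
  simpa using h.sum_map fun _ => 1

theorem length_encodeRules_le (rules : List (Rule (Fin nP) (Fin nΓ))) :
    (rules.flatMap encodeRule).length ≤ 5 * (rules.map Rule.size).sum := by
  induction rules with
  | nil => simp
  | cons r rules ih =>
    have : (encodeRule r).length ≤ 5 * r.size := by
      cases r <;> simp [encodeRule, encodeWord, Rule.size]; omega
    rw [List.flatMap_cons, List.length_append, List.map_cons, List.sum_cons]
    omega

theorem length_codes (es : List (Entry nP nΓ nA)) : (es.flatMap Entry.code).length =
    (3 + nP) * es.length + statesOf es + 3 * (es.map fun E => E.trans.length).sum := by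
  induction es with
  | nil => simp [statesOf]
  | cons E es ih =>
    rw [List.flatMap_cons, List.length_append, ih, statesOf_cons, E.length_code, List.map_cons,
      List.sum_cons, List.length_cons]
    ring

/-- Every automaton has all control locations among its states. This absorbs the cost of one block
of `nP` cells per automaton, and it bounds the number of automata by `k`. -/
theorem length_mul_le_statesOf (es : List (Entry nP nΓ nA)) : es.length * nP ≤ statesOf es := by
  induction es with
  | nil => simp
  | cons E es ih =>
    have := Fintype.card_le_of_embedding E.aut.init
    rw [Fintype.card_fin, Fintype.card_fin] at this
    rw [statesOf_cons, List.length_cons, Nat.succ_mul]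
    omega

theorem Prog.AnswersWithin.mono {p : Prog} {x : List ℕ} {A : Prop} {T T' : ℕ}
    (h : p.AnswersWithin x A T) (hT : T ≤ T') : p.AnswersWithin x A T' := by
  obtain ⟨t, s, h1, h2, h3⟩ := h
  exact ⟨t, s, h1, h2.trans hT, h3⟩

/-- The lists of the input are turned into entries, and sums over enumerating lists into sums over
the finite sets. What remains is that the length of the input, too, is bounded by the quantities of
the time bound. -/
theorem program_answersWithin {S : PDS (Fin nP) (Fin nΓ)}
    {lab : Fin nA → Set (Conf (Fin nP) (Fin nΓ))} {φ : Formula (Fin nA)}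
    {M M' : Fin nA → MultiAutomaton (Fin nP) (Fin nΓ)}
    (hM : ∀ e ∈ φ.posAtoms, (M e).language = lab e)
    (hM' : ∀ e ∈ φ.negAtoms, (M' e).language = (lab e)ᶜ)
    {c : Conf (Fin nP) (Fin nΓ)} {x : List ℕ} (hx : IsInput S φ M M' c x) :
    (program.compile 0).AnswersWithin x (S.Sat lab φ c)
      (200000 * timeBound nP (max 1 nΓ) (max 1 S.size) φ.size
        (totalStates φ M M') (totalTransitions φ M M') c.2.length) := by
  classical
  obtain ⟨rules, pos, neg, l, l', hr, hp, hn, hl, hl', hx⟩ := hx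
  set es : List (Entry nP nΓ nA) := pos.map fun e => ⟨e, M e, l e⟩ with hes
  set es' : List (Entry nP nΓ nA) := neg.map fun e => ⟨e, M' e, l' e⟩ with hes'
  have hstates : statesOf es + statesOf es' = totalStates φ M M' := by
    rw [totalStates, ← hp.sum_map, ← hn.sum_map, statesOf, statesOf, hes, hes', List.map_map,
      List.map_map]
    rfl
  have htrans : (es.map fun E => E.trans.length).sum + (es'.map fun E => E.trans.length).sum =
      totalTransitions φ M M' := by
    rw [totalTransitions, ← hp.sum_map, ← hn.sum_map, hes, hes', List.map_map, List.map_map]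
    congr 3
    · exact funext fun e => (hl e).length_eq
    · exact funext fun e => (hl' e).length_eq
  -- The total number of transitions serves as a bound for each single automaton; the time bound has
  -- room for the factor that is lost.
  have hD : ∀ E ∈ es ++ es', E.trans.length ≤ totalTransitions φ M M' := by
    intro E hE
    rw [← htrans, ← List.sum_append, ← List.map_append]
    exact List.single_le_sum (fun _ _ => Nat.zero_le _) _ (List.mem_map_of_mem hE)
  have hE : Presents φ lab es es' := by
    refine ⟨fun e he => ?_, fun e he => ?_, fun E hE => ?_, fun E hE => ?_, fun E hE => ?_⟩
    · exact ⟨_, List.mem_map_of_mem ((hp.2 e).2 (Finset.mem_filter.2 ⟨Finset.mem_univ _, he⟩)), rfl⟩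
    · exact ⟨_, List.mem_map_of_mem ((hn.2 e).2 (Finset.mem_filter.2 ⟨Finset.mem_univ _, he⟩)), rfl⟩
    · obtain ⟨e, he, rfl⟩ := List.mem_map.1 hE
      exact hM e ((hp.2 e).1 he)
    · obtain ⟨e, he, rfl⟩ := List.mem_map.1 hE
      exact hM' e ((hn.2 e).1 he)
    · rcases List.mem_append.1 hE with hE | hE
      · obtain ⟨e, he, rfl⟩ := List.mem_map.1 hE
        exact (hl e).2
      · obtain ⟨e, he, rfl⟩ := List.mem_map.1 hE
        exact (hl' e).2
  have hx' : x = nP :: nΓ :: rules.length :: (rules.flatMap encodeRule ++ (encodeFormula φ ++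
      (es.length :: es.flatMap Entry.code ++ (es'.length :: es'.flatMap Entry.code ++
        (c.1 : ℕ) :: encodeWord c.2)))) := by
    rw [hx, hes, hes', List.length_map, List.length_map, List.flatMap_map, List.flatMap_map]
    simp only [List.append_assoc, List.cons_append, List.nil_append, Entry.code]
  have hsize : (rules.map Rule.size).sum = S.size := hr.sum_map _
  have hEP := length_mul_le_statesOf es
  have hEP' := length_mul_le_statesOf es'
  -- The queried configuration has a control location, so there is at least one.
  have hP : 0 < nP := c.1.pos
  have h1 : (es.length + es'.length) * nP ≤ totalStates φ M M' := by
    rw [Nat.add_mul]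
    omega
  have h2 : es.length + es'.length ≤ totalStates φ M M' :=
    (Nat.le_mul_of_pos_right _ hP).trans h1
  have hlen : x.length ≤ 10 + 5 * S.size + 2 * φ.size + 5 * totalStates φ M M' +
      3 * totalTransitions φ M M' + c.2.length := by
    have e1 := length_encodeRules_le rules
    have e2 := φ.length_le_size
    rw [hx']
    simp only [List.length_cons, List.length_append, length_codes, encodeWord, List.length_map]
    rw [Nat.add_mul] at h1
    rw [Nat.add_mul, Nat.add_mul, Nat.mul_comm nP, Nat.mul_comm nP]
    omega
  refine (program_spec (fun r => hr.2 r) hE hD hx').mono ?_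
  rw [hsize, hstates]
  exact totalCost_le hP φ.size_pos rfl h2 h1 hlen

end Input

end BCARET

/-- Every regular labelling function is given by multi-automata for the sets `lab e` and for their
complements; and there are one program and one constant such that, for all pushdown systems,
labelling functions given in this way, formulas and configurations, the program decides whether
the configuration satisfies the formula within the constant times the time bound. -/
theorem mainTheorem4 :
    (∀ (nP nΓ nA : ℕ) (lab : Fin nA → Set (Conf (Fin nP) (Fin nΓ))),
      (∀ e, IsRegularSet (lab e)) →
        ∃ M M' : Fin nA → MultiAutomaton (Fin nP) (Fin nΓ),
          (∀ e, (M e).language = lab e) ∧ (∀ e, (M' e).language = (lab e)ᶜ)) ∧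
    ∃ (prog : Prog) (C : ℕ),
      ∀ (nP nΓ nA : ℕ) (S : PDS (Fin nP) (Fin nΓ))
        (lab : Fin nA → Set (Conf (Fin nP) (Fin nΓ))) (φ : Formula (Fin nA))
        (M M' : Fin nA → MultiAutomaton (Fin nP) (Fin nΓ)),
        (∀ e ∈ φ.posAtoms, (M e).language = lab e) →
        (∀ e ∈ φ.negAtoms, (M' e).language = (lab e)ᶜ) →
        ∀ (c : Conf (Fin nP) (Fin nΓ)) (x : List ℕ), IsInput S φ M M' c x →
          prog.AnswersWithin x (S.Sat lab φ c)
            (C * timeBound nP (max 1 nΓ) (max 1 S.size) φ.size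
              (totalStates φ M M') (totalTransitions φ M M') c.2.length) :=
  ⟨fun _ _ _ _ h => exists_automata h, program.compile 0, 200000,
    fun _ _ _ _ _ _ _ _ hM hM' _ _ hx => program_answersWithin hM hM' hx⟩
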